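/- **Definitions.** Let $T^2\times I$ be the thickened torus with coordinates $x$ (course direction), $y$ (wale direction), both in $\mathbb{R}/\mathbb{Z}$, and $z\in I=[0,1]$. Everything is smooth; ambient isotopies have compact support in the interior of the region named. *Band surgery.* A band compatible with a link $L$ is an embedded rectangle $b$ that meets $L$ exactly in two opposite sides. Band surgery replaces these two sides of $b$ in $L$ by the other two (with corners rounded). *Swatches.* Let $n\ge 0$ and $k\ge 1$. An $n\times k$ swatch is a $k$-component link in $T^2\times I$ obtained as follows. Cut the annulus $0<y<1$ into strips. In the thickened lowest strip take an ordered $n$-component unlink $U_1,\dots,U_n$ whose components bound disjoint embedded disks, placed in consecutive cells along the $x$-direction. Then, for $j=1,\dots,k$, add a trivial row above all that was built before: a longitude $\ell_j$ (the circle $y=\mathrm{const}$, $z=\tfrac12$ in the next strip), and, in the strip above it, an ordered unlink $U_{j,1},\dots,U_{j,n_j}$ arranged in the same way ($n_j\ge 0$, $n_k=n$). Move $\ell_j$ by an ambient isotopy of the thickened annulus below the strip of the $U_{j,i}$ that fixes the $U_i$ and all previous rows, and then join each $U_{j,i}$ to the moved longitude by band surgery, along disjoint compatible bands in the thickened annulus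 built so far. This gives the row $R_j$. Finally, for each $i$, join $U_i$ by band surgery to the arc of $R_k$ that comes from $U_{k,i}$. These last $n$ bands are compatible with the whole link and in knitting position: their projections to $T^2$ are embedded, mutually disjoint and disjoint from the projection of the link away from the attaching arcs, and each of them passes exactly once through $\{y=0\}$. The components of the swatch are $R_1,\dots,R_{k-1}$ and $R_k$ joined to $U_1,\dots,U_n$. *Textiles.* A two-periodic weft-knitted textile $S$ is a collection of yarns in $\mathbb{R}^2\times I$, with the course and wale directions as axes and the unit square as translational unit, which is invariant under the translations in $\mathbb{Z}^2$ and whose textile link, the quotient $L^S\subset T^2\times I$, is ambient isotopic to an $n\times k$ swatch for some $n$ and $k$. *Dehn filling.* Let $f:T^2\times I\to S^3\subset\mathbb{C}^2$ be the embedding as the exterior of the Hopf link given by the Dehn filling with slope $1/0$ (longitude) on $T^2\times\{0\}$ and slope $0/1$ (meridian) on $T^2\times\{1\}$, that is, $f(x,y,z)=(\sin\theta\, e^{2\pi i x},\cos\theta\, e^{2\pi i y})$ with $\theta=\pi/8+z\pi/4$. *Ribbon links.* An $N$-component link in $S^3$ is ribbon if its components bound $N$ smoothly immersed disks all of whose mutual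 intersections and self-intersections are ribbon singularities: disjoint arcs of transverse double points, each with two preimage arcs, one in the interior of a disk and one properly embedded in a disk. **Theorem.** Let $S$ be a two-periodic weft-knitted textile and let $L^S\subset T^2\times I$ be its $N$-component textile link. Then $f(L^S)\subset S^3$ is an $N$-component ribbon link. -/

import Mathlib

open Set Metric
open scoped Manifold ContDiff

/-! ## The ambient manifolds -/

/-- The thickened torus `T² × I`.  The three coordinates are: the angle in the course (weft,
longitude) direction `x`, the angle in the wale (meridian) direction `y`, and the depth `z`. -/
abbrev ThickTorus : Type := Circle × Circle × unitInterval

/-- The model (with boundary) of the smooth structure of `T² × I`. -/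
noncomputable abbrev thickTorusModel :=
  (𝓡 1).prod ((𝓡 1).prod (𝓡∂ 1))

/-- The unit three-sphere in `ℝ⁴ = ℂ²`. -/
abbrev S3 : Type := sphere (0 : EuclideanSpace ℝ (Fin (3 + 1))) 1

/-- The universal covering `ℝ² × I → T² × I`, the quotient by the translations of `ℤ²`. -/
noncomputable def torusProj (p : ℝ × ℝ × unitInterval) : ThickTorus :=
  (Circle.exp (2 * Real.pi * p.1), Circle.exp (2 * Real.pi * p.2.1), p.2.2)

/-- The projection `T² × I → T²` that is used to draw planar diagrams. -/
def planarProj (p : ThickTorus) : Circle × Circle := (p.1, p.2.1)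

/-- The angle `π / 8 + z π / 4`, which grows from `π / 8` to `3 π / 8`. -/
noncomputable def hopfAngle (z : unitInterval) : ℝ :=
  Real.pi / 8 + (z : ℝ) * (Real.pi / 4)

/-- The embedding `f : T² × I → S³` given by the Dehn filling of the two boundary tori, in complex
coordinates `(x, y, z) ↦ (sin θ(z) · x, cos θ(z) · y)` with `θ(z) = π / 8 + z π / 4`.
Its image is the exterior of the Hopf link `{w₁ = 0} ∪ {w₂ = 0}`; the complement of the image
consists of the two open solid tori `{|w₁| < sin (π / 8)}` and `{|w₂| < sin (π / 8)}`.
The longitudes (slope `1/0`) of the torus `z = 0` bound meridian disks of the first one, and the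
meridians (slope `0/1`) of the torus `z = 1` bound meridian disks of the second one. -/
noncomputable def dehnFilling (p : ThickTorus) : S3 :=
  ⟨!₂[Real.sin (hopfAngle p.2.2) * (p.1 : ℂ).re, Real.sin (hopfAngle p.2.2) * (p.1 : ℂ).im,
      Real.cos (hopfAngle p.2.2) * (p.2.1 : ℂ).re, Real.cos (hopfAngle p.2.2) * (p.2.1 : ℂ).im], by
    have h (c : Circle) : (c : ℂ).re ^ 2 + (c : ℂ).im ^ 2 = 1 := by
      have := Circle.normSq_coe c
      rw [Complex.normSq_apply] at this
      linarith
    have h1 := h p.1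
    have h2 := h p.2.1
    have h3 := Real.sin_sq_add_cos_sq (hopfAngle p.2.2)
    rw [mem_sphere_zero_iff_norm, EuclideanSpace.norm_eq, Real.sqrt_eq_one]
    simp only [Real.norm_eq_abs, sq_abs, Fin.sum_univ_four]
    simp
    linear_combination Real.sin (hopfAngle p.2.2) ^ 2 * h1 +
      Real.cos (hopfAngle p.2.2) ^ 2 * h2 + h3⟩

/-! ## Smooth embeddings and ambient isotopies -/

section Generic

/-- `φ` is a smooth map which is an injective immersion along `s`.  For compact `s` (a closed disk,
a closed box) this says that `φ` restricts to a smooth embedding of a neighbourhood of `s`. -/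
def IsSmoothEmbeddingOn {F : Type*} [NormedAddCommGroup F] [NormedSpace ℝ F]
    {E H M : Type*} [NormedAddCommGroup E] [NormedSpace ℝ E] [TopologicalSpace H]
    (I : ModelWithCorners ℝ E H) [TopologicalSpace M] [ChartedSpace H M]
    (φ : F → M) (s : Set F) : Prop :=
  ContMDiff 𝓘(ℝ, F) I ∞ φ ∧ InjOn φ s ∧
    ∀ p ∈ s, Function.Injective (mfderiv 𝓘(ℝ, F) I φ p)

/-- A smooth ambient isotopy of `M` with compact support in `W`: a smooth family of diffeomorphisms
of `M`, starting at the identity, which all fix the complement of a compact subset of `W`.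
The isotopy runs over the time interval `[0, 1]`. -/
structure AmbientIsotopy {E H M : Type*} [NormedAddCommGroup E] [NormedSpace ℝ E]
    [TopologicalSpace H] (I : ModelWithCorners ℝ E H) [TopologicalSpace M] [ChartedSpace H M]
    (W : Set M) where
  toDiffeo : ℝ → Diffeomorph I I M M ∞
  smooth : ContMDiff (𝓘(ℝ, ℝ).prod I) I ∞ (fun q : ℝ × M => toDiffeo q.1 q.2)
  start : ∀ p, toDiffeo 0 p = p
  supp : ∃ C : Set M, IsCompact C ∧ C ⊆ W ∧ ∀ t, ∀ p ∉ C, toDiffeo t p = p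

end Generic

/-! ## Band surgery -/

/-- A box around a band, with coordinates `u` (across the band), `s` (along the band) and
`v` (normal to the band). -/
def bandBox : Set (ℝ × ℝ × ℝ) := Icc (-3) 3 ×ˢ Icc (-2) 2 ×ˢ Icc (-1) 1

/-- The band itself (together with the arcs along which it is attached) inside the box. -/
def bandFace : Set (ℝ × ℝ × ℝ) := Icc (-3) 3 ×ˢ Icc (-1) 1 ×ˢ {0}

/-- The arc of the link to which the beginning of the band is attached. -/
def startStrand : Set (ℝ × ℝ × ℝ) := Icc (-3) 3 ×ˢ {-1} ×ˢ {0}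

/-- The arc of the link to which the end of the band is attached. -/
def endStrand : Set (ℝ × ℝ × ℝ) := Icc (-3) 3 ×ˢ {1} ×ˢ {0}

/-- A smooth monotone function with value `-1` on `(-∞, -1]` and value `1` on `[1, ∞)`. -/
noncomputable def smoothStep (τ : ℝ) : ℝ := 2 * Real.smoothTransition ((τ + 1) / 2) - 1

/-- The two sides of the band, with the corners rounded: smooth arcs `u = ±(1 + τ · smoothStep τ)`,
`s = smoothStep τ`, which replace `startStrand` and `endStrand` in a band surgery.  For
`1 ≤ |τ| ≤ 2` they run along the old strands, where `2 ≤ |u| ≤ 3`. -/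
noncomputable def sideStrands : Set (ℝ × ℝ × ℝ) :=
  {p | ∃ τ ∈ Icc (-2 : ℝ) 2, ∃ ε : ℝ, (ε = 1 ∨ ε = -1) ∧
    p = (ε * (1 + τ * smoothStep τ), smoothStep τ, 0)}

/-- `Φ` is a finite family of pairwise disjoint smooth bands in `T² × I` (each one given with a
thickening to a box) that are compatible with the link `L`: a box meets `L` exactly in the two
opposite arcs to which the band is attached. The `i`-th band begins in the set `A i` and ends in
the set `B i`. -/
def AreBands {ι : Type} (L : Set ThickTorus) (A B : ι → Set ThickTorus)
    (Φ : ι → ℝ × ℝ × ℝ → ThickTorus) : Prop :=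
  (∀ i, IsSmoothEmbeddingOn thickTorusModel (Φ i) bandBox ∧
    bandBox ∩ Φ i ⁻¹' L = startStrand ∪ endStrand ∧
    Φ i '' startStrand ⊆ A i ∧ Φ i '' endStrand ⊆ B i) ∧
  Pairwise fun i j => Disjoint (Φ i '' bandBox) (Φ j '' bandBox)

/-- The result of band surgery on `X` along all the bands of the family `Φ`. -/
noncomputable def bandSurgery {ι : Type} (X : Set ThickTorus)
    (Φ : ι → ℝ × ℝ × ℝ → ThickTorus) : Set ThickTorus :=
  (X \ ⋃ i, Φ i '' bandBox) ∪ ⋃ i, Φ i '' sideStrands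

/-! ## Knits and swatches -/

/-- The open box `(a, b) × (c, d) × (0, 1)` of `T² × I`, in the coordinates `(x, y, z)`. -/
def torusCell (a b c d : ℝ) : Set ThickTorus :=
  torusProj '' (Ioo a b ×ˢ Ioo c d ×ˢ {z : unitInterval | (z : ℝ) ∈ Ioo (0 : ℝ) 1})

/-- The interior of the thickened annulus `S¹ × (c, d) × I` of `T² × I`. -/
def thickAnnulus (c d : ℝ) : Set ThickTorus :=
  torusProj '' (univ ×ˢ Ioo c d ×ˢ {z : unitInterval | (z : ℝ) ∈ Ioo (0 : ℝ) 1})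

/-- The standard essential curve of the annulus at height `y = c`, in the course direction. -/
noncomputable def courseCurve (c : ℝ) : Set ThickTorus :=
  {p | p.2.1 = Circle.exp (2 * Real.pi * c) ∧ (p.2.2 : ℝ) = 1 / 2}

/-- `U` is an ordered unlink in the thickened annulus between the heights `c` and `d`, arranged
horizontally: the components bound smoothly embedded disks that lie in consecutive cells. -/
def IsOrderedUnlink {n : ℕ} (c d : ℝ) (U : Fin n → Set ThickTorus) : Prop :=
  ∃ x : Fin (n + 1) → ℝ, StrictMono x ∧ 0 ≤ x 0 ∧ x (Fin.last n) ≤ 1 ∧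
    ∀ i : Fin n, ∃ D : ℂ → ThickTorus,
      IsSmoothEmbeddingOn thickTorusModel D (closedBall 0 1) ∧
      D '' closedBall 0 1 ⊆ torusCell (x i.castSucc) (x i.succ) c d ∧
      D '' sphere 0 1 = U i

/-- The data from which a swatch with `k + 1` rows is built.  The rows are numbered from the bottom
to the top by `Fin (k + 1)`. -/
structure SwatchData (k : ℕ) where
  /-- the number of stitches of each row -/
  stitches : Fin (k + 1) → ℕ
  /-- the unknit that is the base of the knit, with as many components as the last row -/
  base : Fin (stitches (Fin.last k)) → Set ThickTorus
  /-- the contractible components of the trivial rows -/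
  loops : ∀ j, Fin (stitches j) → Set ThickTorus
  /-- the heights of the longitudes of the trivial rows -/
  height : Fin (k + 1) → ℝ
  /-- heights that cut the annulus into strips: the base lies between `cut 0` and `cut 1`, the
  longitude of the row `j` between `cut (2 j + 1)` and `cut (2 j + 2)`, and its contractible
  components between `cut (2 j + 2)` and `cut (2 j + 3)` -/
  cut : ℕ → ℝ
  /-- the isotopies that act on the longitudes -/
  iso : ∀ j : Fin (k + 1),
    AmbientIsotopy thickTorusModel (thickAnnulus (cut 0) (cut (2 * (j : ℕ) + 2)))
  /-- the bands that connect the contractible components of a row to its longitude -/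
  rowBand : ∀ j, Fin (stitches j) → ℝ × ℝ × ℝ → ThickTorus
  /-- the bands that connect the base to the last row -/
  finalBand : Fin (stitches (Fin.last k)) → ℝ × ℝ × ℝ → ThickTorus

namespace SwatchData

variable {k : ℕ} (d : SwatchData k)

/-- The longitude of the row `j` after its isotopy. -/
noncomputable def yarn (j : Fin (k + 1)) : Set ThickTorus :=
  (d.iso j).toDiffeo 1 '' courseCurve (d.height j)

/-- The row `j` of the knit: the isotoped longitude joined to the contractible components. -/
noncomputable def row (j : Fin (k + 1)) : Set ThickTorus :=
  bandSurgery (d.yarn j ∪ ⋃ i, d.loops j i) (d.rowBand j)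

/-- The knit on which the row `j` is worked: the base and all the previous rows. -/
noncomputable def below (j : Fin (k + 1)) : Set ThickTorus :=
  (⋃ i, d.base i) ∪ ⋃ i, ⋃ (_ : i < j), d.row i

/-- The base together with all the rows. -/
noncomputable def allRows : Set ThickTorus := (⋃ i, d.base i) ∪ ⋃ j, d.row j

/-- The components of the final link.  In the last one the base has been joined to the last
row. -/
noncomputable def component (j : Fin (k + 1)) : Set ThickTorus :=
  if j = Fin.last k then bandSurgery (d.row j ∪ ⋃ i, d.base i) d.finalBand else d.row j

/-- The final bands are in knitting position: in the planar diagram, they are embedded, mutually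
disjoint and cross no part of the link, and they pass exactly once through the lower boundary
`y = 0` of the annulus. -/
def InKnittingPosition : Prop :=
  (∀ i, InjOn (planarProj ∘ d.finalBand i) bandFace) ∧
  (Pairwise fun i j => Disjoint (planarProj '' (d.finalBand i '' bandFace))
    (planarProj '' (d.finalBand j '' bandFace))) ∧
  (∀ i, Disjoint (planarProj '' (d.finalBand i '' bandFace))
    (planarProj '' (d.allRows \ d.finalBand i '' (startStrand ∪ endStrand)))) ∧
  (∀ i, ∀ u ∈ Icc (-3 : ℝ) 3, ∃! s : ℝ, s ∈ Icc (-1 : ℝ) 1 ∧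
    (d.finalBand i (u, s, 0)).2.1 = 1)

/-- The data describe the construction of a swatch. -/
structure IsValid : Prop where
  cut_strictMono : StrictMono d.cut
  cut_zero : d.cut 0 = 0
  cut_top : d.cut (2 * k + 3) ≤ 1
  base_unlink : IsOrderedUnlink (d.cut 0) (d.cut 1) d.base
  height_mem : ∀ j : Fin (k + 1), d.height j ∈ Ioo (d.cut (2 * (j : ℕ) + 1)) (d.cut (2 * (j : ℕ) + 2))
  loops_unlink : ∀ j : Fin (k + 1),
    IsOrderedUnlink (d.cut (2 * (j : ℕ) + 2)) (d.cut (2 * (j : ℕ) + 3)) (d.loops j)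
  /-- the isotopy of a longitude takes place in the complement of the knit below -/
  iso_fix : ∀ j, ∀ t, ∀ p ∈ d.below j, (d.iso j).toDiffeo t p = p
  /-- each contractible component is joined by a band to the longitude of its row -/
  rowBand_bands : ∀ j,
    AreBands (d.below j ∪ d.yarn j ∪ ⋃ i, d.loops j i) (d.loops j) (fun _ => d.yarn j)
      (d.rowBand j)
  rowBand_mem : ∀ j : Fin (k + 1), ∀ i,
    d.rowBand j i '' bandBox ⊆ thickAnnulus (d.cut 0) (d.cut (2 * (j : ℕ) + 3))
  /-- the `i`-th component of the base is joined by a band to the `i`-th loop of the last row -/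
  finalBand_bands : AreBands d.allRows d.base (d.loops (Fin.last k)) d.finalBand
  finalBand_knitting : d.InKnittingPosition

end SwatchData

/-- `L` is a swatch with `k + 1` rows and `n` stitches in its last row. -/
def IsSwatch (n : ℕ) {k : ℕ} (L : Fin (k + 1) → Set ThickTorus) : Prop :=
  ∃ d : SwatchData k, d.IsValid ∧ d.stitches (Fin.last k) = n ∧ L = d.component

/-! ## Textiles -/

/-- The textile link in `T² × I` of a two-periodic textile `S` in `ℝ² × I`. The set `S j` is the
union of all translates of the `j`-th yarn. -/
noncomputable def textileLink {N : ℕ} (S : Fin N → Set (ℝ × ℝ × unitInterval)) :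
    Fin N → Set ThickTorus :=
  fun j => torusProj '' S j

/-- `S` is a two-periodic weft-knitted textile, with the course and wale directions as the `x` and
`y` axes and the unit square as translational unit: it is invariant under the integral translations
of the plane, and the motif in its translational unit can be knit as a swatch, up to an ambient
isotopy of `T² × I` (with support in the interior). -/
def IsWeftKnittedTextile {k : ℕ} (S : Fin (k + 1) → Set (ℝ × ℝ × unitInterval)) : Prop :=
  (∀ j, ∀ p ∈ S j, ∀ a b : ℤ, (p.1 + a, p.2.1 + b, p.2.2) ∈ S j) ∧
  ∃ (n : ℕ) (L : Fin (k + 1) → Set ThickTorus), IsSwatch n L ∧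
    ∃ Ψ : AmbientIsotopy thickTorusModel {p : ThickTorus | (p.2.2 : ℝ) ∈ Ioo (0 : ℝ) 1},
      ∀ j, Ψ.toDiffeo 1 '' L j = textileLink S j

/-! ## Ribbon links -/

/-- The disks `D i` (maps on the closed unit disk of `ℂ`) have only ribbon singularities: their
double points form finitely many disjoint arcs, along which two sheets cross transversely. Each
arc has two preimages, an arc `α s` in the interior of a disk, and an arc `β s` which
is properly embedded in a disk, and all these preimages are disjoint embedded arcs. -/
def OnlyRibbonSingularities {N : ℕ} (D : Fin N → ℂ → S3) : Prop :=
  ∃ (r : ℕ) (a b : Fin r → Fin N) (α β : Fin r → unitInterval → ℂ),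
    (∀ s, Continuous (α s) ∧ Continuous (β s)) ∧
    (∀ s t, α s t ∈ ball (0 : ℂ) 1) ∧
    (∀ s t, β s t ∈ closedBall (0 : ℂ) 1 ∧ (β s t ∈ sphere (0 : ℂ) 1 ↔ t = 0 ∨ t = 1)) ∧
    (Function.Injective
      (Sum.elim (fun q : Fin r × unitInterval => (a q.1, α q.1 q.2))
        (fun q : Fin r × unitInterval => (b q.1, β q.1 q.2)))) ∧
    (∀ s t, D (a s) (α s t) = D (b s) (β s t) ∧
      (mfderiv 𝓘(ℝ, ℂ) (𝓡 3) (D (a s)) (α s t)).range ≠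
        (mfderiv 𝓘(ℝ, ℂ) (𝓡 3) (D (b s)) (β s t)).range) ∧
    (∀ i j, ∀ p ∈ closedBall (0 : ℂ) 1, ∀ q ∈ closedBall (0 : ℂ) 1,
      (i, p) ≠ (j, q) → D i p = D j q →
        ∃ s t, ((i, p) = (a s, α s t) ∧ (j, q) = (b s, β s t)) ∨
          ((j, q) = (a s, α s t) ∧ (i, p) = (b s, β s t)))

/-- The sets `K i` are the components of an `N`-component ribbon link in `S³`: they bound smoothly
immersed disks, all of whose intersections and self-intersections are ribbon singularities. (In
particular, the `K i` are pairwise disjoint smoothly embedded circles.) -/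
def IsRibbonLink {N : ℕ} (K : Fin N → Set S3) : Prop :=
  ∃ D : Fin N → ℂ → S3,
    (∀ i, ContMDiff 𝓘(ℝ, ℂ) (𝓡 3) ∞ (D i)) ∧
    (∀ i, ∀ p ∈ closedBall (0 : ℂ) 1,
      Function.Injective (mfderiv 𝓘(ℝ, ℂ) (𝓡 3) (D i) p)) ∧
    (∀ i, D i '' sphere (0 : ℂ) 1 = K i) ∧
    OnlyRibbonSingularities D

/-!
# Weft-knitted textiles are ribbon links after Dehn filling

A link which is obtained from a link with disjoint embedded disks by fusion, that is, by joining each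
of some components to another one by a band, is ribbon. The filling `dehnFilling` makes a swatch such
a link: the base and the contractible components of the trivial rows bound disks in the thickened
torus, and the longitude of each row bounds a meridian disk of one of the two solid tori that are glued
in. This disk lies over the same point of the wale direction as the longitude, so that it is disjoint
from the disks of all the components at other heights (`disjoint_sector`, `meridianDisk`).

The proof runs over the rows (`SwatchData.IsValid.boundsRibbon_firstRows`). Suppose that the knit below
a row bounds ribbon disks in a sector of Euclidean space, the complement of a point of the sphere. The
meridian disk of the longitude lies in the next sector. The isotopy of the longitude extends to the
whole space (`AmbientIsotopy.exists_extension`); its final diffeomorphism is applied to the disks of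
the knit below as well. Their images may look different, but they are still ribbon disks, and their
boundaries are unchanged because the isotopy fixes the knit below. Then the contractible components are
joined to the longitude. The final bands, and the isotopy between the textile link and the swatch, are
treated in the same way.

The substance is the fusion lemma `exists_isJoin`: if the boundaries of two disks of a ribbon family
are joined by a band, which may cross all the disks, then the resulting link bounds a ribbon family.
The new disk is the union of the two disks and a subband, and each arc in which a disk crosses the
subband is a ribbon singularity. To see this, all the disks are deformed inside the box of the band,
by diffeomorphisms of space that preserve the two attaching strands:
* a small shift moves the midpoints of the strands away from the double points
  (`exists_isSimplePoint`);
* near the midpoints, the two disks are brought into the plane of the band, on the side opposite to it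
  (`exists_endForm`, which rests on the extension of germs of diffeomorphisms that preserve a line,
  `germExt_of_fderiv`);
* by Sard's theorem, a small shift makes the core of the band transverse to the disks and disjoint from
  their double points (`exists_coreTransverse`);
* a compression towards the core makes the band so narrow that the disks cross it only in arcs from
  side to side (`exists_isJoin_of_coreTransverse`).

Finally the disks and the band are glued to one smoothly immersed disk (`isRibbonFamily_glued`), by
means of a diffeomorphism of the plane that maps the unit disk onto a dumbbell whose neck has the shape
of the rounded sides prescribed by `sideStrands` (`exists_dumbbell_param`).
-/

set_option linter.unusedSectionVars false

/-! ### Smooth injective immersions between spaces of equal dimension -/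

section Diffeos

variable {E : Type*} [NormedAddCommGroup E] [NormedSpace ℝ E] [FiniteDimensional ℝ E]

lemma surjective_of_injective_clm {A : E →L[ℝ] E} (h : Function.Injective A) :
    Function.Surjective A :=
  (LinearMap.injective_iff_surjective (f := (A : E →ₗ[ℝ] E))).1 h

/-- An injective continuous endomorphism of a finite-dimensional space, as an equivalence. -/
noncomputable def clmEquivOfInjective (A : E →L[ℝ] E) (h : Function.Injective A) : E ≃L[ℝ] E :=
  ContinuousLinearEquiv.ofBijective A (LinearMap.ker_eq_bot.2 h)
    (LinearMap.range_eq_top.2 (surjective_of_injective_clm h))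

lemma coe_clmEquivOfInjective (A : E →L[ℝ] E) (h : Function.Injective A) :
    (clmEquivOfInjective A h : E →L[ℝ] E) = A := by
  ext x; rfl

lemma map_nhds_eq_of_injective_fderiv {f : E → E} {x : E} (hf : ContDiffAt ℝ ∞ f x)
    (h : Function.Injective (fderiv ℝ f x)) : Filter.map f (nhds x) = nhds (f x) := by
  have : CompleteSpace E := FiniteDimensional.complete ℝ E
  have h1 := hf.hasStrictFDerivAt (by simp)
  rw [← coe_clmEquivOfInjective _ h] at h1
  exact h1.map_nhds_eq_of_equiv

/-- The inverse function theorem for an injective immersion of an open set into a space of the same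
dimension. -/
theorem exists_smooth_inverse {f : E → E} {U : Set E} (hU : IsOpen U)
    (hf : ContDiffOn ℝ ∞ f U) (hinj : InjOn f U)
    (himm : ∀ x ∈ U, Function.Injective (fderiv ℝ f x)) :
    IsOpen (f '' U) ∧ ∃ g : E → E, ContDiffOn ℝ ∞ g (f '' U) ∧ ∀ x ∈ U, g (f x) = x := by
  have : CompleteSpace E := FiniteDimensional.complete ℝ E
  have hat : ∀ x ∈ U, ContDiffAt ℝ ∞ f x := fun x hx => hf.contDiffAt (hU.mem_nhds hx)
  have hopen : ∀ V ⊆ U, IsOpen V → IsOpen (f '' V) := by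
    intro V hV hVo
    rw [isOpen_iff_mem_nhds]
    rintro _ ⟨x, hx, rfl⟩
    rw [← map_nhds_eq_of_injective_fderiv (hat x (hV hx)) (himm x (hV hx))]
    exact Filter.image_mem_map (hVo.mem_nhds hx)
  by_cases hne : Nonempty U
  swap
  · have : U = ∅ := by
      rw [← not_nonempty_iff_eq_empty]; rintro ⟨x, hx⟩; exact hne ⟨x, hx⟩
    subst this
    simp
  obtain ⟨x0, hx0⟩ := hne
  have : Nonempty E := ⟨x0⟩
  let e : OpenPartialHomeomorph E E :=
    OpenPartialHomeomorph.ofContinuousOpenRestrict (hinj.toPartialEquiv f U) hf.continuousOn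
      (by
        intro V hV
        have : (U.domRestrict f) '' V = f '' (Subtype.val '' V) := by
          ext y
          constructor
          · rintro ⟨v, hv, rfl⟩; exact ⟨v, ⟨v, hv, rfl⟩, rfl⟩
          · rintro ⟨_, ⟨v, hv, rfl⟩, rfl⟩; exact ⟨v, hv, rfl⟩
        change IsOpen ((U.domRestrict f) '' V)
        rw [this]
        exact hopen _ (by rintro _ ⟨v, -, rfl⟩; exact v.2) (hU.isOpenMap_subtype_val V hV)) hU
  have he : ∀ x ∈ U, e.symm (f x) = x := fun x hx => e.left_inv hx
  refine ⟨hopen U le_rfl hU, e.symm, ?_, he⟩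
  rintro _ ⟨x, hx, rfl⟩
  have h1 : e.symm (f x) = x := he x hx
  refine (e.contDiffAt_symm (f₀' := clmEquivOfInjective _ (himm x hx)) ?_ ?_ ?_).contDiffWithinAt
  · exact ⟨x, hx, rfl⟩
  · rw [coe_clmEquivOfInjective, h1]
    exact ((hat x hx).differentiableAt (by simp)).hasFDerivAt
  · rw [h1]; exact hat x hx

/-- `F` is a smooth diffeomorphism of `E` with compact support inside `C`. -/
def DiffeoIn (C : Set E) (F : Equiv.Perm E) : Prop :=
  ContDiff ℝ ∞ F ∧ ContDiff ℝ ∞ F.symm ∧ ∃ K, IsCompact K ∧ K ⊆ C ∧ ∀ x ∉ K, F x = x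

namespace DiffeoIn

variable {C C' : Set E} {F G : Equiv.Perm E}

lemma mono (h : DiffeoIn C F) (hC : C ⊆ C') : DiffeoIn C' F :=
  let ⟨h1, h2, K, h3, h4, h5⟩ := h
  ⟨h1, h2, K, h3, h4.trans hC, h5⟩

lemma eq_self (h : DiffeoIn C F) {x : E} (hx : x ∉ C) : F x = x :=
  let ⟨_, _, _, _, h4, h5⟩ := h
  h5 x fun hk => hx (h4 hk)

lemma inv (h : DiffeoIn C F) : DiffeoIn C F⁻¹ := by
  obtain ⟨h1, h2, K, h3, h4, h5⟩ := h
  refine ⟨h2, h1, K, h3, h4, fun x hx => ?_⟩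
  rw [Equiv.Perm.inv_eq_iff_eq, h5 x hx]

lemma mul (h : DiffeoIn C F) (h' : DiffeoIn C G) : DiffeoIn C (F * G) := by
  obtain ⟨h1, h2, K, h3, h4, h5⟩ := h
  obtain ⟨h1', h2', K', h3', h4', h5'⟩ := h'
  refine ⟨h1.comp h1', h2'.comp h2, K ∪ K', h3.union h3', union_subset h4 h4', fun x hx => ?_⟩
  rw [mem_union, not_or] at hx
  rw [Equiv.Perm.mul_apply, h5' x hx.2, h5 x hx.1]

lemma map_mem (h : DiffeoIn C F) {x : E} : F x ∈ C ↔ x ∈ C := by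
  constructor
  · intro hx
    by_contra hx'
    rw [h.eq_self hx'] at hx
    exact hx' hx
  · intro hx
    by_contra hx'
    have := h.eq_self hx'
    rw [F.injective this] at hx'
    exact hx' hx

lemma fderiv_injective (h : DiffeoIn C F) (x : E) : Function.Injective (fderiv ℝ F x) := by
  have h1 : HasFDerivAt F (fderiv ℝ F x) x :=
    ((h.1.differentiable (by simp)) x).hasFDerivAt
  have h2 : HasFDerivAt F.symm (fderiv ℝ F.symm (F x)) (F x) :=
    ((h.2.1.differentiable (by simp)) (F x)).hasFDerivAt
  have h3 := h2.comp x h1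
  have h4 : (F.symm ∘ F) = id := by ext; simp
  rw [h4] at h3
  have h5 := h3.unique (hasFDerivAt_id x)
  intro v w hvw
  have := congrArg (fderiv ℝ F.symm (F x)) hvw
  have e (v : E) : fderiv ℝ F.symm (F x) (fderiv ℝ F x v) = v := by
    have := DFunLike.congr_fun h5 v
    simpa using this
  rwa [e, e] at this

end DiffeoIn

/-- An injective immersion which is the identity outside a compact set is a diffeomorphism. -/
theorem exists_diffeoIn {f : E → E} (hf : ContDiff ℝ ∞ f) (hinj : Function.Injective f)
    (himm : ∀ x, Function.Injective (fderiv ℝ f x)) {K C : Set E} (hK : IsCompact K) (hKC : K ⊆ C)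
    (hid : ∀ x ∉ K, f x = x) : ∃ F : Equiv.Perm E, DiffeoIn C F ∧ ⇑F = f := by
  obtain ⟨hopen, g, hg, hgf⟩ := exists_smooth_inverse isOpen_univ hf.contDiffOn hinj.injOn
    (fun x _ => himm x)
  have hclosed : IsClosed (f '' univ) := by
    rw [← isSeqClosed_iff_isClosed]
    intro u y hu huy
    by_cases hy : y ∈ K
    · choose v hv using fun n => hu n
      by_cases hfr : ∃ᶠ n in Filter.atTop, v n ∈ K
      · obtain ⟨φ, hφ, hφK⟩ := Filter.extraction_of_frequently_atTop hfr
        obtain ⟨z, hz, ψ, hψ, hlim⟩ := hK.tendsto_subseq hφK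
        refine ⟨z, trivial, ?_⟩
        have h1 := (hf.continuous.tendsto z).comp hlim
        have h2 : Filter.Tendsto (u ∘ φ ∘ ψ) Filter.atTop (nhds y) :=
          huy.comp (hφ.tendsto_atTop.comp hψ.tendsto_atTop)
        have h3 : f ∘ (fun n => v (φ n)) ∘ ψ = u ∘ φ ∘ ψ := by
          ext n; exact (hv _).2
        rw [h3] at h1
        exact tendsto_nhds_unique h1 h2
      · rw [Filter.not_frequently] at hfr
        have h1 : Filter.Tendsto v Filter.atTop (nhds y) := by
          refine huy.congr' ?_
          filter_upwards [hfr] with n hn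
          rw [← (hv n).2, hid _ hn]
        have h2 := (hf.continuous.tendsto y).comp h1
        have h3 : f ∘ v = u := by ext n; exact (hv n).2
        rw [h3] at h2
        exact ⟨y, trivial, tendsto_nhds_unique h2 huy⟩
    · exact ⟨y, trivial, hid y hy⟩
  have hsurj : Function.Surjective f := by
    rw [← range_eq_univ, ← image_univ]
    exact IsClopen.eq_univ ⟨hclosed, hopen⟩ ⟨f 0, 0, trivial, rfl⟩
  let F : Equiv.Perm E := Equiv.ofBijective f ⟨hinj, hsurj⟩
  refine ⟨F, ⟨hf, ?_, K, hK, hKC, hid⟩, rfl⟩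
  have : (F.symm : E → E) = g := by
    ext y
    obtain ⟨x, rfl⟩ := hsurj y
    rw [hgf x trivial]
    exact F.symm_apply_apply x
  rw [this]
  rw [image_univ, hsurj.range_eq] at hg
  exact contDiffOn_univ.1 hg

/-- A smooth perturbation of the identity with compact support and small derivative is a
diffeomorphism. -/
theorem exists_diffeoIn_add {k : E → E} (hk : ContDiff ℝ ∞ k)
    (hk' : ∀ x, ‖fderiv ℝ k x‖ ≤ 1 / 2) {K C : Set E} (hK : IsCompact K) (hKC : K ⊆ C)
    (hid : ∀ x ∉ K, k x = 0) :
    ∃ F : Equiv.Perm E, DiffeoIn C F ∧ ∀ x, F x = x + k x := by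
  have hlip : ∀ x y, ‖k y - k x‖ ≤ 1 / 2 * ‖y - x‖ := fun x y =>
    convex_univ.norm_image_sub_le_of_norm_fderiv_le (𝕜 := ℝ)
      (fun x _ => (hk.differentiable (by simp)) x) (fun x _ => hk' x) trivial trivial
  have hinj : Function.Injective fun x => x + k x := by
    intro x y hxy
    have h1 := hlip x y
    have h2 : k y - k x = x - y := by
      have : x + k x = y + k y := hxy
      rw [sub_eq_sub_iff_add_eq_add, this, add_comm]
    rw [h2, norm_sub_rev] at h1
    have : ‖y - x‖ = 0 := le_antisymm (by linarith) (norm_nonneg _)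
    rw [norm_eq_zero, sub_eq_zero] at this
    exact this.symm
  have himm : ∀ x, Function.Injective (fderiv ℝ (fun x => x + k x) x) := by
    intro x
    have hd : HasFDerivAt (fun x => x + k x) (ContinuousLinearMap.id ℝ E + fderiv ℝ k x) x :=
      (hasFDerivAt_id x).add ((hk.differentiable (by simp)) x).hasFDerivAt
    rw [hd.fderiv]
    rw [injective_iff_map_eq_zero]
    intro v hv
    have h1 : v = - fderiv ℝ k x v := by
      rw [← add_eq_zero_iff_eq_neg]; simpa using hv
    have h2 : ‖v‖ ≤ 1 / 2 * ‖v‖ := by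
      calc ‖v‖ = ‖fderiv ℝ k x v‖ := by conv_lhs => rw [h1, norm_neg]
        _ ≤ ‖fderiv ℝ k x‖ * ‖v‖ := ContinuousLinearMap.le_opNorm _ _
        _ ≤ _ := by gcongr; exact hk' x
    have : ‖v‖ = 0 := le_antisymm (by linarith) (norm_nonneg _)
    simpa using this
  obtain ⟨F, hF, hFf⟩ := exists_diffeoIn (contDiff_id.add hk) hinj himm hK hKC
    (fun x hx => by simp [hid x hx])
  exact ⟨F, hF, fun x => by rw [hFf]; rfl⟩

/-! ### Transplanting a diffeomorphism along an embedding -/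

/-- The conjugate of `H` by the embedding `Φ` of `U`, extended by the identity. -/
noncomputable def transplant (Φ : E → E) (U : Set E) (H : E → E) (y : E) : E :=
  open Classical in if h : ∃ x ∈ U, Φ x = y then Φ (H h.choose) else y

lemma transplant_apply {Φ : E → E} {U : Set E} (hinj : InjOn Φ U) (H : E → E) {x : E}
    (hx : x ∈ U) : transplant Φ U H (Φ x) = Φ (H x) := by
  have h : ∃ x' ∈ U, Φ x' = Φ x := ⟨x, hx, rfl⟩
  rw [transplant, dif_pos h, hinj h.choose_spec.1 hx h.choose_spec.2]

lemma transplant_of_notMem {Φ : E → E} {U : Set E} (H : E → E) {y : E}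
    (hy : y ∉ Φ '' U) : transplant Φ U H y = y := by
  rw [transplant, dif_neg]
  exact hy

lemma contDiff_transplant {Φ : E → E} {U : Set E} (hU : IsOpen U) (hΦ : ContDiff ℝ ∞ Φ)
    (hinj : InjOn Φ U) (himm : ∀ x ∈ U, Function.Injective (fderiv ℝ Φ x))
    {H : E → E} (hH : ContDiff ℝ ∞ H) {K : Set E} (hK : IsCompact K) (hKU : K ⊆ U)
    (hid : ∀ x ∉ K, H x = x) : ContDiff ℝ ∞ (transplant Φ U H) := by
  obtain ⟨hopen, g, hg, hgf⟩ := exists_smooth_inverse hU hΦ.contDiffOn hinj himm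
  rw [contDiff_iff_contDiffAt]
  intro y
  by_cases hy : y ∈ Φ '' K
  · have hyU : y ∈ Φ '' U := image_mono hKU hy
    have h1 : ContDiffAt ℝ ∞ (fun y => Φ (H (g y))) y :=
      hΦ.contDiffAt.comp y (hH.contDiffAt.comp y (hg.contDiffAt (hopen.mem_nhds hyU)))
    refine h1.congr_of_eventuallyEq ?_
    filter_upwards [hopen.mem_nhds hyU]
    rintro _ ⟨x, hx, rfl⟩
    rw [transplant_apply hinj H hx, hgf x hx]
  · have hcl : IsClosed (Φ '' K) := (hK.image hΦ.continuous).isClosed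
    refine contDiffAt_id.congr_of_eventuallyEq ?_
    filter_upwards [hcl.isOpen_compl.mem_nhds hy] with z hz
    by_cases hzU : z ∈ Φ '' U
    · obtain ⟨x, hx, rfl⟩ := hzU
      rw [transplant_apply hinj H hx, hid x fun hxK => hz ⟨x, hxK, rfl⟩]
      rfl
    · rw [transplant_of_notMem H hzU]; rfl

/-- A diffeomorphism with compact support in `U` is carried by an embedding `Φ` of `U` to a
diffeomorphism with compact support in `Φ '' U`. -/
theorem exists_transplant {Φ : E → E} {U : Set E} (hU : IsOpen U) (hΦ : ContDiff ℝ ∞ Φ)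
    (hinj : InjOn Φ U) (himm : ∀ x ∈ U, Function.Injective (fderiv ℝ Φ x))
    {H : Equiv.Perm E} (hH : DiffeoIn U H) :
    ∃ G : Equiv.Perm E, DiffeoIn (Φ '' U) G ∧ ∀ x ∈ U, G (Φ x) = Φ (H x) := by
  have hH0 := hH
  obtain ⟨h1, h2, K, hK, hKU, hid⟩ := hH
  have hid' : ∀ x ∉ K, H.symm x = x := fun x hx => by
    rw [Equiv.symm_apply_eq, hid x hx]
  have key : ∀ (A B : Equiv.Perm E), DiffeoIn U B → (∀ x, A (B x) = x) → ∀ y,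
      transplant Φ U A (transplant Φ U B y) = y := by
    intro A B hB hAB y
    by_cases hy : y ∈ Φ '' U
    · obtain ⟨x, hx, rfl⟩ := hy
      rw [transplant_apply hinj _ hx, transplant_apply hinj _ (hB.map_mem.2 hx), hAB]
    · rw [transplant_of_notMem _ hy, transplant_of_notMem _ hy]
  refine ⟨⟨transplant Φ U H, transplant Φ U H.symm, ?_, ?_⟩, ⟨?_, ?_, Φ '' K, ?_, ?_, ?_⟩, ?_⟩
  · exact key H.symm H hH0 (fun x => by simp)
  · exact key H H.symm hH0.inv (fun x => by simp)
  · exact contDiff_transplant hU hΦ hinj himm h1 hK hKU hid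
  · exact contDiff_transplant hU hΦ hinj himm h2 hK hKU hid'
  · exact hK.image hΦ.continuous
  · exact image_mono hKU
  · intro y hy
    change transplant Φ U H y = y
    by_cases hyU : y ∈ Φ '' U
    · obtain ⟨x, hx, rfl⟩ := hyU
      rw [transplant_apply hinj _ hx, hid x fun hxK => hy ⟨x, hxK, rfl⟩]
    · exact transplant_of_notMem _ hyU
  · intro x hx
    exact transplant_apply hinj _ hx

end Diffeos

/-! ### Extending germs that preserve a line -/

/-- The three-dimensional space that contains the disks. -/
abbrev E3 : Type := ℝ × ℝ × ℝ

/-- The first coordinate axis. -/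
def axis : Set E3 := {x | x.2 = 0}

/-- The germ of `g` at the origin extends to diffeomorphisms of `E3` with arbitrarily small support
which preserve the first axis. -/
def GermExt (g : E3 → E3) : Prop :=
  ∀ ε > 0, ∃ F : Equiv.Perm E3, DiffeoIn (ball 0 ε) F ∧ (∀ᶠ x in nhds 0, F x = g x) ∧
    ∀ x, F x ∈ axis ↔ x ∈ axis

lemma GermExt.comp {g h : E3 → E3} (hg : GermExt g) (hh : GermExt h) (hc : ContinuousAt h 0)
    (h0 : h 0 = 0) : GermExt (g ∘ h) := by
  intro ε hε
  obtain ⟨F, hF, hFg, hFa⟩ := hg ε hε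
  obtain ⟨G, hG, hGh, hGa⟩ := hh ε hε
  refine ⟨F * G, hF.mul hG, ?_, fun x => by rw [Equiv.Perm.mul_apply, hFa, hGa]⟩
  have h1 : Filter.Tendsto h (nhds 0) (nhds 0) := by
    have := hc.tendsto; rwa [h0] at this
  filter_upwards [h1.eventually hFg, hGh] with x hx hx'
  rw [Equiv.Perm.mul_apply, hx', hx]; rfl

/-- If a diffeomorphism with compact support maps the axis into itself, it preserves it. -/
lemma mem_axis_iff_of_mapsTo {F : Equiv.Perm E3} {C : Set E3} (hF : DiffeoIn C F)
    (h : ∀ x ∈ axis, F x ∈ axis) (x : E3) : F x ∈ axis ↔ x ∈ axis := by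
  refine ⟨fun hx => ?_, h x⟩
  obtain ⟨K, hK, -, hid⟩ := hF.2.2
  obtain ⟨R, hR⟩ := hK.isBounded.subset_closedBall 0
  have hid' : ∀ t : ℝ, R < |t| → F (t, 0, 0) = (t, 0, 0) := by
    intro t ht
    refine hid _ fun hk => ?_
    have := hR hk
    rw [mem_closedBall_zero_iff, Prod.norm_def] at this
    simp at this
    linarith
  let f : ℝ → ℝ := fun t => (F (t, 0, 0)).1
  have hf : Continuous f :=
    continuous_fst.comp (hF.1.continuous.comp (by fun_prop))
  have hsurj : Function.Surjective f := by
    refine hf.surjective ?_ ?_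
    · refine Filter.tendsto_id.congr' ?_
      filter_upwards [Filter.eventually_gt_atTop (max R 0)] with t ht
      have h0 : 0 < t := lt_of_le_of_lt (le_max_right _ _) ht
      simp only [f, id]
      rw [hid' t (by rw [abs_of_pos h0]; exact lt_of_le_of_lt (le_max_left _ _) ht)]
    · refine Filter.tendsto_id.congr' ?_
      filter_upwards [Filter.eventually_lt_atBot (- max R 0)] with t ht
      have h0 : t < 0 := by linarith [le_max_right R 0]
      simp only [f, id]
      rw [hid' t (by rw [abs_of_neg h0]; linarith [le_max_left R 0])]
  obtain ⟨t, ht⟩ := hsurj (F x).1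
  have h1 : F (t, 0, 0) = F x := by
    have h2 : F (t, 0, 0) ∈ axis := h _ rfl
    exact Prod.ext ht (h2.trans (Eq.symm hx))
  rw [← F.injective h1]
  rfl

/-- Germs that are close to the identity to first order extend. -/
theorem exists_germExt_radius : ∃ δ > 0, ∀ g : E3 → E3, (∃ O ∈ nhds (0 : E3), ContDiffOn ℝ ∞ g O) →
    g 0 = 0 → ‖fderiv ℝ g 0 - ContinuousLinearMap.id ℝ E3‖ < δ →
    (∀ᶠ x in nhds 0, x ∈ axis → g x ∈ axis) → GermExt g := by
  let χ : ContDiffBump (0 : E3) := ⟨1, 2, one_pos, one_lt_two⟩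
  have hχ : ContDiff ℝ ∞ (χ : E3 → ℝ) := χ.contDiff
  obtain ⟨C, hC⟩ : ∃ C, ∀ x, ‖fderiv ℝ (χ : E3 → ℝ) x‖ ≤ C :=
    (χ.hasCompactSupport.fderiv (𝕜 := ℝ)).exists_bound_of_continuous
      (hχ.continuous_fderiv (by simp))
  have hC0 : 0 ≤ C := (norm_nonneg _).trans (hC 0)
  set δ : ℝ := 1 / (4 * (1 + 2 * C)) with hδ
  have hδ0 : 0 < δ := by positivity
  refine ⟨δ, hδ0, ?_⟩
  rintro g ⟨O, hO, hg⟩ hg0 hg' hax ε hε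
  let ψ : E3 → E3 := fun x => g x - x
  obtain ⟨O', hO'O, hO'o, hO'0⟩ := _root_.mem_nhds_iff.1 hO
  have hg1 : ContDiffOn ℝ ∞ g O' := hg.mono hO'O
  have hψ : ContDiffOn ℝ ∞ ψ O' := hg1.sub contDiffOn_id
  have hψ' : ∀ x ∈ O', fderiv ℝ ψ x = fderiv ℝ g x - ContinuousLinearMap.id ℝ E3 := by
    intro x hx
    have h1 : DifferentiableAt ℝ g x :=
      (hg1.contDiffAt (hO'o.mem_nhds hx)).differentiableAt (by simp)
    exact (h1.hasFDerivAt.sub (hasFDerivAt_id x)).fderiv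
  have hcont : ContinuousAt (fderiv ℝ ψ) 0 :=
    ((hψ.contDiffAt (hO'o.mem_nhds hO'0)).fderiv_right (m := 0) (by simp)).continuousAt
  have hev : ∀ᶠ x in nhds (0 : E3), x ∈ O' ∧ ‖fderiv ℝ ψ x‖ < δ ∧ (x ∈ axis → g x ∈ axis) := by
    have hO1 : ∀ᶠ x in nhds (0 : E3), x ∈ O' := hO'o.mem_nhds hO'0
    refine hO1.and (Filter.Eventually.and ?_ hax)
    have : ‖fderiv ℝ ψ 0‖ < δ := by rw [hψ' 0 hO'0]; exact hg'
    exact hcont.norm.eventually_lt continuousAt_const this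
  obtain ⟨r, hr, hball⟩ := Metric.eventually_nhds_iff_ball.1 hev
  set η : ℝ := min ε r / 3 with hη
  have hm : 0 < min ε r := lt_min hε hr
  have hη0 : 0 < η := by positivity
  have hηε : 2 * η < ε := by linarith [min_le_left ε r]
  have hηr : 2 * η < r := by linarith [min_le_right ε r]
  let χη : E3 → ℝ := fun x => χ (η⁻¹ • x)
  have hχη : ContDiff ℝ ∞ χη := hχ.comp (contDiff_const_smul _)
  have hχη1 : ∀ x, ‖fderiv ℝ χη x‖ ≤ C * η⁻¹ := by
    intro x
    have h1 : HasFDerivAt χη ((fderiv ℝ χ (η⁻¹ • x)).comp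
        (η⁻¹ • ContinuousLinearMap.id ℝ E3)) x :=
      ((hχ.differentiable (by simp)) _).hasFDerivAt.comp x ((hasFDerivAt_id x).const_smul η⁻¹)
    rw [h1.fderiv]
    refine (ContinuousLinearMap.opNorm_comp_le _ _).trans ?_
    refine mul_le_mul (hC _) ?_ (norm_nonneg _) hC0
    rw [norm_smul, Real.norm_of_nonneg (by positivity)]
    have := ContinuousLinearMap.norm_id_le (𝕜 := ℝ) (E := E3)
    have h3 : 0 < η⁻¹ := by positivity
    nlinarith
  have hχ0 : ∀ x ∉ ball (0 : E3) (2 * η), χη x = 0 := by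
    intro x hx
    refine χ.zero_of_le_dist ?_
    rw [mem_ball_zero_iff, not_lt] at hx
    change 2 ≤ dist (η⁻¹ • x) 0
    rw [dist_zero_right, norm_smul, norm_inv, Real.norm_of_nonneg hη0.le, inv_mul_eq_div,
      le_div_iff₀ hη0]
    exact hx
  let k : E3 → E3 := fun x => χη x • ψ x
  have hk0 : ∀ x ∉ ball (0 : E3) (2 * η), k x = 0 := fun x hx => by
    simp only [k]; rw [hχ0 x hx, zero_smul]
  have hk0' : ∀ x ∉ ball (0 : E3) r, ∀ᶠ y in nhds x, k y = 0 := by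
    intro x hx
    have : x ∈ (closedBall (0 : E3) (2 * η))ᶜ := fun h =>
      hx (closedBall_subset_ball hηr h)
    filter_upwards [isClosed_closedBall.isOpen_compl.mem_nhds this] with y hy
    exact hk0 y fun h => hy (ball_subset_closedBall h)
  have hk : ContDiff ℝ ∞ k := by
    rw [contDiff_iff_contDiffAt]
    intro x
    by_cases hx : x ∈ ball (0 : E3) r
    · exact hχη.contDiffAt.smul (hψ.contDiffAt (hO'o.mem_nhds (hball x hx).1))
    · exact contDiffAt_const.congr_of_eventuallyEq (hk0' x hx)
  have hψ0 : ψ 0 = 0 := by simp [ψ, hg0]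
  have hψb : ∀ x ∈ ball (0 : E3) r, ‖ψ x‖ ≤ δ * ‖x‖ := by
    intro x hx
    have := (convex_ball (0 : E3) r).norm_image_sub_le_of_norm_fderiv_le (𝕜 := ℝ) (f := ψ) (C := δ)
      (fun y hy => (hψ.contDiffAt (hO'o.mem_nhds (hball y hy).1)).differentiableAt (by simp))
      (fun y hy => (hball y hy).2.1.le) (mem_ball_self hr) hx
    simpa [hψ0] using this
  have hk' : ∀ x, ‖fderiv ℝ k x‖ ≤ 1 / 2 := by
    intro x
    by_cases hx : x ∈ ball (0 : E3) (2 * η)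
    · have hxr : x ∈ ball (0 : E3) r := ball_subset_ball hηr.le hx
      have h1 : DifferentiableAt ℝ ψ x :=
        (hψ.contDiffAt (hO'o.mem_nhds (hball x hxr).1)).differentiableAt (by simp)
      have h2 : DifferentiableAt ℝ χη x := (hχη.differentiable (by simp)) x
      have h3 := (h2.hasFDerivAt.smul h1.hasFDerivAt).fderiv
      have h4 : fderiv ℝ k x = χη x • fderiv ℝ ψ x + (fderiv ℝ χη x).smulRight (ψ x) := h3
      rw [h4]
      have h5 : ‖χη x • fderiv ℝ ψ x‖ ≤ δ := by
        rw [norm_smul, Real.norm_of_nonneg (χ.nonneg' _)]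
        have := χ.le_one (x := η⁻¹ • x)
        have h6 := (hball x hxr).2.1
        calc χη x * ‖fderiv ℝ ψ x‖ ≤ 1 * δ := by
              refine mul_le_mul this h6.le (norm_nonneg _) zero_le_one
          _ = δ := one_mul _
      have h6 : ‖(fderiv ℝ χη x).smulRight (ψ x)‖ ≤ 2 * C * δ := by
        rw [ContinuousLinearMap.norm_smulRight_apply]
        have hxn : ‖x‖ ≤ 2 * η := (mem_ball_zero_iff.1 hx).le
        calc ‖fderiv ℝ χη x‖ * ‖ψ x‖ ≤ (C * η⁻¹) * (δ * (2 * η)) := by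
              refine mul_le_mul (hχη1 x) ((hψb x hxr).trans ?_) (norm_nonneg _) (by positivity)
              gcongr
          _ = 2 * C * δ := by field_simp
      calc _ ≤ δ + 2 * C * δ := (norm_add_le _ _).trans (add_le_add h5 h6)
        _ ≤ 1 / 2 := by
          have : δ * (1 + 2 * C) = 1 / 4 := by rw [hδ]; field_simp
          linarith
    · by_cases hx' : x ∈ ball (0 : E3) r
      · have hxn : 2 * η ≤ ‖x‖ := by simpa using hx
        have h1 : DifferentiableAt ℝ ψ x :=
          (hψ.contDiffAt (hO'o.mem_nhds (hball x hx').1)).differentiableAt (by simp)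
        have h2 : DifferentiableAt ℝ χη x := (hχη.differentiable (by simp)) x
        have h3 := (h2.hasFDerivAt.smul h1.hasFDerivAt).fderiv
        have h4 : fderiv ℝ k x = χη x • fderiv ℝ ψ x + (fderiv ℝ χη x).smulRight (ψ x) := h3
        have h5 : χη x = 0 := hχ0 x hx
        have h6 : fderiv ℝ χη x = 0 := by
          refine IsLocalMin.fderiv_eq_zero (Filter.Eventually.of_forall fun y => ?_)
          rw [h5]; exact χ.nonneg' _
        rw [h4, h5, h6]; simp
      · have : fderiv ℝ k x = 0 := by
          rw [Filter.EventuallyEq.fderiv_eq (hk0' x hx')]; simp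
        rw [this]; simp
  obtain ⟨F, hF, hFk⟩ := exists_diffeoIn_add hk hk' (isCompact_closedBall (0 : E3) (2 * η))
    (closedBall_subset_ball hηε) (fun x hx => hk0 x fun h => hx (ball_subset_closedBall h))
  refine ⟨F, hF, ?_, mem_axis_iff_of_mapsTo hF ?_⟩
  · filter_upwards [ball_mem_nhds (0 : E3) hη0] with x hx
    have : χη x = 1 := by
      refine χ.one_of_mem_closedBall ?_
      rw [mem_closedBall_zero_iff, norm_smul, norm_inv, Real.norm_of_nonneg hη0.le,
        inv_mul_eq_div]
      change ‖x‖ / η ≤ 1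
      rw [div_le_one hη0]
      exact (mem_ball_zero_iff.1 hx).le
    rw [hFk]; simp only [k, ψ]; rw [this]; simp
  · intro x hx
    by_cases hx' : x ∈ ball (0 : E3) r
    · have h1 := (hball x hx').2.2 hx
      rw [hFk]
      have hx2 : x.2 = 0 := hx
      have h12 : (g x).2 = 0 := h1
      change (x + χη x • (g x - x)).2 = 0
      simp [hx2, h12]
    · rw [hFk, hk0 x fun h => hx' (ball_subset_ball hηr.le h), add_zero]; exact hx

/-- The linear maps preserving the first axis from which all germs are built: `p` scales the axis,
`q₁ + i q₂` is a complex scaling of the normal plane, and `a` a shear. -/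
noncomputable def axisMap (p a q₁ q₂ : ℝ) : E3 →L[ℝ] E3 :=
  let u := ContinuousLinearMap.fst ℝ ℝ (ℝ × ℝ)
  let x := (ContinuousLinearMap.fst ℝ ℝ ℝ).comp (ContinuousLinearMap.snd ℝ ℝ (ℝ × ℝ))
  let v := (ContinuousLinearMap.snd ℝ ℝ ℝ).comp (ContinuousLinearMap.snd ℝ ℝ (ℝ × ℝ))
  (p • u + a • x).prod ((q₁ • x - q₂ • v).prod (q₂ • x + q₁ • v))

@[simp] lemma axisMap_apply (p a q₁ q₂ : ℝ) (x : E3) : axisMap p a q₁ q₂ x =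
    (p * x.1 + a * x.2.1, q₁ * x.2.1 - q₂ * x.2.2, q₂ * x.2.1 + q₁ * x.2.2) := by
  simp [axisMap]

lemma continuous_axisMap : Continuous fun t : ℝ × ℝ × ℝ × ℝ => axisMap t.1 t.2.1 t.2.2.1 t.2.2.2 := by
  have : (fun t : ℝ × ℝ × ℝ × ℝ => axisMap t.1 t.2.1 t.2.2.1 t.2.2.2) = fun t =>
      t.1 • axisMap 1 0 0 0 + t.2.1 • axisMap 0 1 0 0 + t.2.2.1 • axisMap 0 0 1 0
        + t.2.2.2 • axisMap 0 0 0 1 := by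
    funext t
    refine ContinuousLinearMap.ext fun x => ?_
    simp only [add_apply, smul_apply, axisMap_apply]
    refine Prod.ext ?_ (Prod.ext ?_ ?_) <;> simp <;> ring
  rw [this]
  fun_prop

lemma axisMap_one : axisMap 1 0 1 0 = ContinuousLinearMap.id ℝ E3 := by
  refine ContinuousLinearMap.ext fun x => ?_
  simp

lemma GermExt.iterate {A : E3 →L[ℝ] E3} (h : GermExt A) (m : ℕ) : GermExt (A^[m + 1]) := by
  induction m with
  | zero => simpa using h
  | succ m ih =>
    rw [Function.iterate_succ]
    exact ih.comp h A.continuous.continuousAt (map_zero A)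

/-- The maps `axisMap` lie on paths through the identity, so they are products of maps near the
identity. -/
theorem germExt_axisMap {p a q₁ q₂ : ℝ} (hp : 0 < p) (hq : q₁ ≠ 0 ∨ q₂ ≠ 0) :
    GermExt (axisMap p a q₁ q₂) := by
  obtain ⟨δ, hδ, hext⟩ := exists_germExt_radius
  have hnear : ∀ t : ℝ × ℝ × ℝ × ℝ,
      ‖axisMap t.1 t.2.1 t.2.2.1 t.2.2.2 - ContinuousLinearMap.id ℝ E3‖ < δ →
      GermExt (axisMap t.1 t.2.1 t.2.2.1 t.2.2.2) := by
    intro t ht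
    refine hext _ ⟨univ, Filter.univ_mem, (ContinuousLinearMap.contDiff _).contDiffOn⟩ (map_zero _)
      ?_ (Filter.Eventually.of_forall fun x hx => ?_)
    · rwa [ContinuousLinearMap.fderiv]
    · have hx' : x.2 = 0 := hx
      change (axisMap _ _ _ _ x).2 = 0
      rw [axisMap_apply]; simp [hx']
  have htend : ∀ γ : ℝ → ℝ × ℝ × ℝ × ℝ, ContinuousAt γ 0 → γ 0 = (1, 0, 1, 0) →
      ∃ m : ℕ, GermExt (axisMap (γ (1 / (m + 1))).1 (γ (1 / (m + 1))).2.1 (γ (1 / (m + 1))).2.2.1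
        (γ (1 / (m + 1))).2.2.2) := by
    intro γ hγ h0
    have h1 : Filter.Tendsto (fun m : ℕ => (1 : ℝ) / (m + 1)) Filter.atTop (nhds 0) :=
      tendsto_one_div_add_atTop_nhds_zero_nat
    have h2 := (continuous_axisMap.continuousAt.comp hγ).tendsto.comp h1
    have h3 : ∀ᶠ t in nhds ((fun t : ℝ × ℝ × ℝ × ℝ => axisMap t.1 t.2.1 t.2.2.1 t.2.2.2) (γ 0)),
        ‖t - ContinuousLinearMap.id ℝ E3‖ < δ := by
      have : ‖(fun t : ℝ × ℝ × ℝ × ℝ => axisMap t.1 t.2.1 t.2.2.1 t.2.2.2) (γ 0) -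
        ContinuousLinearMap.id ℝ E3‖ < δ := by
        rw [h0]; simp only; rw [axisMap_one, sub_self, norm_zero]; exact hδ
      exact (continuous_id.sub continuous_const).norm.continuousAt.eventually_lt
        continuousAt_const this
    obtain ⟨m, hm⟩ := (h2.eventually h3).exists
    exact ⟨m, hnear _ hm⟩
  have hT : ∀ b, GermExt (axisMap 1 b 1 0) := by
    intro b
    obtain ⟨m, hm⟩ := htend (fun t => (1, t * b, 1, 0)) (by fun_prop) (by simp)
    have := hm.iterate m
    have hiter : ∀ (n : ℕ) (x : E3), ((axisMap 1 (1 / ((m : ℝ) + 1) * b) 1 0)^[n]) x =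
        (x.1 + n * (1 / ((m : ℝ) + 1) * b) * x.2.1, x.2.1, x.2.2) := by
      intro n
      induction n with
      | zero => intro x; simp
      | succ n ih =>
        intro x
        rw [Function.iterate_succ_apply, ih, axisMap_apply]
        refine Prod.ext ?_ (Prod.ext ?_ ?_) <;> simp
        ring
    convert this using 1
    funext x
    rw [hiter, axisMap_apply]
    refine Prod.ext ?_ (Prod.ext ?_ ?_) <;> simp
    have : (m : ℝ) + 1 ≠ 0 := by positivity
    field_simp
    simp
  have hS : GermExt (axisMap p 0 q₁ q₂) := by
    set ζ : ℂ := ⟨q₁, q₂⟩ with hζ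
    have hζ0 : ζ ≠ 0 := by
      intro h
      have h1 : q₁ = 0 := congrArg Complex.re h
      have h2 : q₂ = 0 := congrArg Complex.im h
      rcases hq with h | h <;> exact h (by assumption)
    obtain ⟨m, hm⟩ := htend (fun t => (Real.exp (t * Real.log p), 0,
      (Complex.exp (t * Complex.log ζ)).re, (Complex.exp (t * Complex.log ζ)).im))
      (by fun_prop) (by simp)
    have := hm.iterate m
    have hiter : ∀ (n : ℕ) (x : E3), ((axisMap (Real.exp (1 / ((m : ℝ) + 1) * Real.log p)) 0
        (Complex.exp ((1 / ((m : ℝ) + 1) : ℝ) * Complex.log ζ)).re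
        (Complex.exp ((1 / ((m : ℝ) + 1) : ℝ) * Complex.log ζ)).im)^[n]) x =
        (Real.exp (1 / ((m : ℝ) + 1) * Real.log p) ^ n * x.1,
          ((Complex.exp ((1 / ((m : ℝ) + 1) : ℝ) * Complex.log ζ)) ^ n * ⟨x.2.1, x.2.2⟩ : ℂ).re,
          ((Complex.exp ((1 / ((m : ℝ) + 1) : ℝ) * Complex.log ζ)) ^ n * ⟨x.2.1, x.2.2⟩ : ℂ).im) := by
      intro n
      induction n with
      | zero => intro x; simp
      | succ n ih =>
        intro x
        rw [Function.iterate_succ_apply, ih, axisMap_apply]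
        have e : (⟨(Complex.exp ((1 / ((m : ℝ) + 1) : ℝ) * Complex.log ζ)).re * x.2.1 -
            (Complex.exp ((1 / ((m : ℝ) + 1) : ℝ) * Complex.log ζ)).im * x.2.2,
            (Complex.exp ((1 / ((m : ℝ) + 1) : ℝ) * Complex.log ζ)).im * x.2.1 +
            (Complex.exp ((1 / ((m : ℝ) + 1) : ℝ) * Complex.log ζ)).re * x.2.2⟩ : ℂ) =
            Complex.exp ((1 / ((m : ℝ) + 1) : ℝ) * Complex.log ζ) * ⟨x.2.1, x.2.2⟩ := by
          apply Complex.ext <;> simp only [Complex.mul_re, Complex.mul_im] <;> ring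
        dsimp only
        rw [e, ← mul_assoc, ← pow_succ, zero_mul, add_zero, ← mul_assoc, ← pow_succ]
    convert this using 1
    funext x
    have hm0 : (m : ℝ) + 1 ≠ 0 := by positivity
    have hm0' : (m : ℂ) + 1 ≠ 0 := by exact_mod_cast hm0
    rw [hiter, axisMap_apply, ← Real.exp_nat_mul, ← Complex.exp_nat_mul]
    have e1 : ((m + 1 : ℕ) : ℝ) * (1 / ((m : ℝ) + 1) * Real.log p) = Real.log p := by
      push_cast; field_simp
    have e2 : ((m + 1 : ℕ) : ℂ) * ((1 / ((m : ℝ) + 1) : ℝ) * Complex.log ζ) = Complex.log ζ := by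
      push_cast; field_simp
    rw [e1, e2, Real.exp_log hp, Complex.exp_log hζ0]
    simp [hζ, Complex.mul_re, Complex.mul_im]
    ring
  have := hS.comp (hT (a / p)) (ContinuousLinearMap.continuous _).continuousAt (map_zero _)
  convert this using 1
  funext x
  simp only [Function.comp, axisMap_apply]
  refine Prod.ext ?_ (Prod.ext ?_ ?_) <;> simp
  field_simp

/-- A smooth germ that preserves the axis, whose derivative at the origin is an `axisMap`, extends to
diffeomorphisms with small support. -/
theorem germExt_of_fderiv {g : E3 → E3} {p a q₁ q₂ : ℝ} (hp : 0 < p) (hq : q₁ ≠ 0 ∨ q₂ ≠ 0)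
    (hg : ∃ O ∈ nhds (0 : E3), ContDiffOn ℝ ∞ g O) (hg0 : g 0 = 0)
    (hg' : fderiv ℝ g 0 = axisMap p a q₁ q₂)
    (hax : ∀ᶠ x in nhds 0, x ∈ axis → g x ∈ axis) : GermExt g := by
  obtain ⟨δ, hδ, hext⟩ := exists_germExt_radius
  set n := q₁ ^ 2 + q₂ ^ 2 with hn
  have hn0 : 0 < n := by
    rcases hq with h | h
    · have := pow_pos (abs_pos.2 h) 2; rw [sq_abs] at this; nlinarith [sq_nonneg q₂]
    · have := pow_pos (abs_pos.2 h) 2; rw [sq_abs] at this; nlinarith [sq_nonneg q₁]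
  let B' : E3 →L[ℝ] E3 := (axisMap p⁻¹ 0 1 0).comp
    ((axisMap 1 (-a) 1 0).comp (axisMap 1 0 (q₁ / n) (-q₂ / n)))
  have hB : ∀ x, axisMap p a q₁ q₂ (B' x) = x := by
    intro x
    simp only [B', ContinuousLinearMap.comp_apply, axisMap_apply]
    refine Prod.ext ?_ (Prod.ext ?_ ?_) <;> simp <;> field_simp <;> (rw [hn]; ring)
  have hB2 : ∀ x, B' (axisMap p a q₁ q₂ x) = x := by
    intro x
    simp only [B', ContinuousLinearMap.comp_apply, axisMap_apply]
    refine Prod.ext ?_ (Prod.ext ?_ ?_) <;> simp <;> field_simp <;> (rw [hn]; ring)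
  obtain ⟨O, hO, hgO⟩ := hg
  have h1 : GermExt (B' ∘ g) := by
    refine hext _ ⟨O, hO, B'.contDiff.comp_contDiffOn hgO⟩ (by simp [hg0]) ?_ ?_
    · have hd : DifferentiableAt ℝ g 0 := (hgO.contDiffAt hO).differentiableAt (by simp)
      have h2 : HasFDerivAt (B' ∘ g) (B'.comp (fderiv ℝ g 0)) 0 :=
        B'.hasFDerivAt.comp 0 hd.hasFDerivAt
      rw [h2.fderiv, hg']
      have : B'.comp (axisMap p a q₁ q₂) = ContinuousLinearMap.id ℝ E3 :=
        ContinuousLinearMap.ext fun x => hB2 x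
      rw [this, sub_self, norm_zero]; exact hδ
    · filter_upwards [hax] with x hx hx'
      have h2 : (g x).2 = 0 := hx hx'
      change (B' (g x)).2 = 0
      simp only [B', ContinuousLinearMap.comp_apply, axisMap_apply]
      simp [h2]
  have h2 := (germExt_axisMap (a := a) hp hq).comp h1
    (B'.continuous.continuousAt.comp (hgO.contDiffAt hO).continuousAt) (by simp [hg0])
  convert h2 using 1
  funext x
  exact (hB (g x)).symm

/-! ### Families of ribbon disks in Euclidean space -/

/-- A parametrization of the double points of a family of disks by arcs, which exhibits them as
ribbon singularities: along the arc `s`, the interior arc `α s` of the disk `a s` meets the properly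
embedded arc `β s` of the disk `b s`. Only the restrictions to `[0, 1]` matter. -/
structure DoubleArcs {ι : Type} (D : ι → ℂ → E3) (κ : Type) where
  a : κ → ι
  b : κ → ι
  α : κ → ℝ → ℂ
  β : κ → ℝ → ℂ
  α_smooth : ∀ s, ContDiffOn ℝ 1 (α s) (Icc 0 1)
  β_smooth : ∀ s, ContDiffOn ℝ 1 (β s) (Icc 0 1)
  α_mem : ∀ s, ∀ t ∈ Icc (0 : ℝ) 1, α s t ∈ ball (0 : ℂ) 1
  β_mem : ∀ s, ∀ t ∈ Icc (0 : ℝ) 1, β s t ∈ closedBall (0 : ℂ) 1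
  β_sphere : ∀ s, ∀ t ∈ Icc (0 : ℝ) 1, β s t ∈ sphere (0 : ℂ) 1 ↔ t = 0 ∨ t = 1
  α_inj : ∀ s s', ∀ t ∈ Icc (0 : ℝ) 1, ∀ t' ∈ Icc (0 : ℝ) 1, a s = a s' → α s t = α s' t' →
    s = s' ∧ t = t'
  β_inj : ∀ s s', ∀ t ∈ Icc (0 : ℝ) 1, ∀ t' ∈ Icc (0 : ℝ) 1, b s = b s' → β s t = β s' t' →
    s = s' ∧ t = t'
  αβ_ne : ∀ s s', ∀ t ∈ Icc (0 : ℝ) 1, ∀ t' ∈ Icc (0 : ℝ) 1, a s = b s' → α s t ≠ β s' t'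
  double : ∀ s, ∀ t ∈ Icc (0 : ℝ) 1, D (a s) (α s t) = D (b s) (β s t)
  transverse : ∀ s, ∀ t ∈ Icc (0 : ℝ) 1,
    range (fderiv ℝ (D (a s)) (α s t)) ≠ range (fderiv ℝ (D (b s)) (β s t))
  complete : ∀ i j, ∀ p ∈ closedBall (0 : ℂ) 1, ∀ q ∈ closedBall (0 : ℂ) 1,
    (i, p) ≠ (j, q) → D i p = D j q → ∃ s, ∃ t ∈ Icc (0 : ℝ) 1,
      ((i, p) = (a s, α s t) ∧ (j, q) = (b s, β s t)) ∨
      ((j, q) = (a s, α s t) ∧ (i, p) = (b s, β s t))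

/-- A family of smooth maps of the plane into Euclidean space which restrict to immersions of the
closed unit disk with only ribbon singularities. -/
def IsRibbonFamily {ι : Type} (D : ι → ℂ → E3) : Prop :=
  (∀ i, ContDiff ℝ ∞ (D i)) ∧
  (∀ i, ∀ p ∈ closedBall (0 : ℂ) 1, Function.Injective (fderiv ℝ (D i) p)) ∧
  ∃ κ : Type, Finite κ ∧ Nonempty (DoubleArcs D κ)

namespace IsRibbonFamily

variable {ι : Type} {D : ι → ℂ → E3}

lemma contDiff (hD : IsRibbonFamily D) (i : ι) : ContDiff ℝ ∞ (D i) := hD.1 i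

lemma differentiable (hD : IsRibbonFamily D) (i : ι) : Differentiable ℝ (D i) :=
  (hD.1 i).differentiable (by simp)

/-- The boundaries of ribbon disks are disjoint embedded circles. -/
lemma boundary_inj (hD : IsRibbonFamily D) {i j : ι} {p q : ℂ} (hp : p ∈ sphere (0 : ℂ) 1)
    (hq : q ∈ sphere (0 : ℂ) 1) (h : D i p = D j q) : i = j ∧ p = q := by
  obtain ⟨-, -, κ, -, ⟨A⟩⟩ := hD
  by_contra hne
  have hne' : (i, p) ≠ (j, q) := fun h => hne (Prod.mk.inj h)
  obtain ⟨s, t, ht, ⟨h1, -⟩ | ⟨h1, -⟩⟩ := A.complete i j p (sphere_subset_closedBall hp) q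
    (sphere_subset_closedBall hq) hne' h
  · have h2 := A.α_mem s t ht
    rw [← (Prod.mk.inj h1).2, mem_ball, (mem_sphere.1 hp)] at h2
    exact lt_irrefl _ h2
  · have h2 := A.α_mem s t ht
    rw [← (Prod.mk.inj h1).2, mem_ball, (mem_sphere.1 hq)] at h2
    exact lt_irrefl _ h2

/-- Ribbon disks stay ribbon disks under injective immersions of the ambient space. -/
theorem post (hD : IsRibbonFamily D) {G : E3 → E3} (hG : ContDiff ℝ ∞ G)
    (hinj : Function.Injective G) (himm : ∀ x, Function.Injective (fderiv ℝ G x)) :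
    IsRibbonFamily fun i z => G (D i z) := by
  have hd : ∀ i p, fderiv ℝ (fun z => G (D i z)) p = (fderiv ℝ G (D i p)).comp (fderiv ℝ (D i) p) :=
    fun i p => fderiv_comp p ((hG.differentiable (by simp)) _) (hD.differentiable i p)
  obtain ⟨h1, h2, κ, hκ, ⟨A⟩⟩ := hD
  refine ⟨fun i => hG.comp (h1 i), fun i p hp => ?_, κ, hκ, ⟨{ A with
    double := fun s t ht => congrArg G (A.double s t ht)
    transverse := fun s t ht h => ?_
    complete := fun i j p hp q hq hne h => A.complete i j p hp q hq hne (hinj h) }⟩⟩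
  · rw [hd]; exact (himm _).comp (h2 i p hp)
  · refine A.transverse s t ht ?_
    have h' : range (fderiv ℝ (fun z => G (D (A.a s) z)) (A.α s t)) =
      range (fderiv ℝ (fun z => G (D (A.b s) z)) (A.β s t)) := h
    rw [hd, hd, ContinuousLinearMap.coe_comp, ContinuousLinearMap.coe_comp, range_comp, range_comp,
      A.double s t ht] at h'
    exact (himm _).image_injective h'

theorem perm (hD : IsRibbonFamily D) {C : Set E3} {G : Equiv.Perm E3} (hG : DiffeoIn C G) :
    IsRibbonFamily fun i z => G (D i z) :=
  hD.post hG.1 G.injective hG.fderiv_injective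

/-- The disks may be rotated and reflected. -/
theorem rotate (hD : IsRibbonFamily D) (R : ι → ℂ ≃ₗᵢ[ℝ] ℂ) :
    IsRibbonFamily fun i z => D i (R i z) := by
  have hd : ∀ i p, fderiv ℝ (fun z => D i (R i z)) p =
      (fderiv ℝ (D i) (R i p)).comp ((R i).toContinuousLinearEquiv : ℂ →L[ℝ] ℂ) := by
    intro i p
    exact ((hD.differentiable i (R i p)).hasFDerivAt.comp p
      (R i).toContinuousLinearEquiv.hasFDerivAt).fderiv
  have hr : ∀ i p, range (fderiv ℝ (fun z => D i (R i z)) p) = range (fderiv ℝ (D i) (R i p)) := by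
    intro i p
    rw [hd, ContinuousLinearMap.coe_comp]
    exact (R i).surjective.range_comp _
  have hball : ∀ i p, p ∈ ball (0 : ℂ) 1 → (R i).symm p ∈ ball (0 : ℂ) 1 := by
    intro i p; simp
  have hcball : ∀ i p, p ∈ closedBall (0 : ℂ) 1 → (R i) p ∈ closedBall (0 : ℂ) 1 := by
    intro i p; simp
  obtain ⟨h1, h2, κ, hκ, ⟨A⟩⟩ := hD
  refine ⟨fun i => (h1 i).comp (R i).contDiff, fun i p hp => ?_, κ, hκ, ⟨{
    a := A.a
    b := A.b
    α := fun s t => (R (A.a s)).symm (A.α s t)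
    β := fun s t => (R (A.b s)).symm (A.β s t)
    α_smooth := fun s => (R (A.a s)).symm.contDiff.comp_contDiffOn (A.α_smooth s)
    β_smooth := fun s => (R (A.b s)).symm.contDiff.comp_contDiffOn (A.β_smooth s)
    α_mem := fun s t ht => by simpa using A.α_mem s t ht
    β_mem := fun s t ht => by simpa using A.β_mem s t ht
    β_sphere := fun s t ht => by simpa using A.β_sphere s t ht
    α_inj := fun s s' t ht t' ht' h1 h2 => A.α_inj s s' t ht t' ht' h1 (by
      rw [h1] at h2; exact (R _).symm.injective h2)
    β_inj := fun s s' t ht t' ht' h1 h2 => A.β_inj s s' t ht t' ht' h1 (by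
      rw [h1] at h2; exact (R _).symm.injective h2)
    αβ_ne := fun s s' t ht t' ht' h1 h2 => A.αβ_ne s s' t ht t' ht' h1 (by
      rw [h1] at h2; exact (R _).symm.injective h2)
    double := fun s t ht => by simpa using A.double s t ht
    transverse := fun s t ht => by
      rw [hr, hr]; simpa using A.transverse s t ht
    complete := fun i j p hp q hq hne h => by
      have hne' : (i, R i p) ≠ (j, R j q) := by
        intro h
        obtain ⟨rfl, h2⟩ := Prod.mk.inj h
        exact hne (by rw [(R i).injective h2])
      obtain ⟨s, t, ht, h⟩ := A.complete i j _ (hcball i p hp) _ (hcball j q hq) hne' h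
      refine ⟨s, t, ht, ?_⟩
      simp only [Prod.mk.injEq] at h ⊢
      refine h.imp ?_ ?_
      · rintro ⟨⟨rfl, h3⟩, ⟨rfl, h4⟩⟩
        exact ⟨⟨rfl, by rw [← h3]; simp⟩, ⟨rfl, by rw [← h4]; simp⟩⟩
      · rintro ⟨⟨rfl, h3⟩, ⟨rfl, h4⟩⟩
        exact ⟨⟨rfl, by rw [← h3]; simp⟩, ⟨rfl, by rw [← h4]; simp⟩⟩ }⟩⟩
  rw [hd]
  exact (h2 i _ (hcball i p hp)).comp (R i).injective

theorem reindex (hD : IsRibbonFamily D) {ι' : Type} (e : ι' ≃ ι) :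
    IsRibbonFamily fun i => D (e i) := by
  obtain ⟨h1, h2, κ, hκ, ⟨A⟩⟩ := hD
  refine ⟨fun i => h1 _, fun i => h2 _, κ, hκ, ⟨{
    a := fun s => e.symm (A.a s)
    b := fun s => e.symm (A.b s)
    α := A.α
    β := A.β
    α_smooth := A.α_smooth
    β_smooth := A.β_smooth
    α_mem := A.α_mem
    β_mem := A.β_mem
    β_sphere := A.β_sphere
    α_inj := fun s s' t ht t' ht' h => A.α_inj s s' t ht t' ht' (e.symm.injective h)
    β_inj := fun s s' t ht t' ht' h => A.β_inj s s' t ht t' ht' (e.symm.injective h)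
    αβ_ne := fun s s' t ht t' ht' h => A.αβ_ne s s' t ht t' ht' (e.symm.injective h)
    double := fun s t ht => by simpa using A.double s t ht
    transverse := fun s t ht => by simpa using A.transverse s t ht
    complete := fun i j p hp q hq hne h => by
      obtain ⟨s, t, ht, h⟩ := A.complete (e i) (e j) p hp q hq (by simpa using hne) h
      refine ⟨s, t, ht, ?_⟩
      simp only [Prod.mk.injEq, e.eq_symm_apply] at h ⊢
      exact h }⟩⟩

/-- Two families of ribbon disks that do not meet form one family. -/
theorem sum (hD : IsRibbonFamily D) {ι' : Type} {D' : ι' → ℂ → E3} (hD' : IsRibbonFamily D')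
    (hdisj : ∀ i j, ∀ p ∈ closedBall (0 : ℂ) 1, ∀ q ∈ closedBall (0 : ℂ) 1, D i p ≠ D' j q) :
    IsRibbonFamily (Sum.elim D D') := by
  obtain ⟨h1, h2, κ, hκ, ⟨A⟩⟩ := hD
  obtain ⟨h1', h2', κ', hκ', ⟨A'⟩⟩ := hD'
  refine ⟨fun i => ?_, fun i => ?_, κ ⊕ κ', inferInstance, ⟨{
    a := Sum.map A.a A'.a
    b := Sum.map A.b A'.b
    α := Sum.elim A.α A'.α
    β := Sum.elim A.β A'.β
    α_smooth := by rintro (s | s); exacts [A.α_smooth s, A'.α_smooth s]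
    β_smooth := by rintro (s | s); exacts [A.β_smooth s, A'.β_smooth s]
    α_mem := by rintro (s | s); exacts [A.α_mem s, A'.α_mem s]
    β_mem := by rintro (s | s); exacts [A.β_mem s, A'.β_mem s]
    β_sphere := by rintro (s | s); exacts [A.β_sphere s, A'.β_sphere s]
    α_inj := by
      rintro (s | s) (s' | s') t ht t' ht' h h'
      · obtain ⟨rfl, rfl⟩ := A.α_inj s s' t ht t' ht' (Sum.inl_injective h) h'
        exact ⟨rfl, rfl⟩
      · simp at h
      · simp at h
      · obtain ⟨rfl, rfl⟩ := A'.α_inj s s' t ht t' ht' (Sum.inr_injective h) h'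
        exact ⟨rfl, rfl⟩
    β_inj := by
      rintro (s | s) (s' | s') t ht t' ht' h h'
      · obtain ⟨rfl, rfl⟩ := A.β_inj s s' t ht t' ht' (Sum.inl_injective h) h'
        exact ⟨rfl, rfl⟩
      · simp at h
      · simp at h
      · obtain ⟨rfl, rfl⟩ := A'.β_inj s s' t ht t' ht' (Sum.inr_injective h) h'
        exact ⟨rfl, rfl⟩
    αβ_ne := by
      rintro (s | s) (s' | s') t ht t' ht' h
      · exact A.αβ_ne s s' t ht t' ht' (Sum.inl_injective h)
      · simp at h
      · simp at h
      · exact A'.αβ_ne s s' t ht t' ht' (Sum.inr_injective h)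
    double := by rintro (s | s); exacts [A.double s, A'.double s]
    transverse := by rintro (s | s); exacts [A.transverse s, A'.transverse s]
    complete := by
      rintro (i | i) (j | j) p hp q hq hne h
      · obtain ⟨s, t, ht, h⟩ := A.complete i j p hp q hq (by simpa using hne) h
        exact ⟨Sum.inl s, t, ht, by simpa using h⟩
      · exact absurd h (hdisj i j p hp q hq)
      · exact absurd h.symm (hdisj j i q hq p hp)
      · obtain ⟨s, t, ht, h⟩ := A'.complete i j p hp q hq (by simpa using hne) h
        exact ⟨Sum.inr s, t, ht, by simpa using h⟩ }⟩⟩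
  · cases i; exacts [h1 _, h1' _]
  · cases i; exacts [h2 _, h2' _]

/-- Disjoint embedded disks are ribbon disks. -/
theorem of_embedded (h1 : ∀ i, ContDiff ℝ ∞ (D i))
    (h2 : ∀ i, ∀ p ∈ closedBall (0 : ℂ) 1, Function.Injective (fderiv ℝ (D i) p))
    (h3 : ∀ i j, ∀ p ∈ closedBall (0 : ℂ) 1, ∀ q ∈ closedBall (0 : ℂ) 1, D i p = D j q →
      (i, p) = (j, q)) : IsRibbonFamily D :=
  ⟨h1, h2, Empty, inferInstance, ⟨{
    a := Empty.elim, b := Empty.elim, α := fun s => s.elim, β := fun s => s.elim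
    α_smooth := fun s => s.elim, β_smooth := fun s => s.elim, α_mem := fun s => s.elim
    β_mem := fun s => s.elim, β_sphere := fun s => s.elim, α_inj := fun s => s.elim
    β_inj := fun s => s.elim, αβ_ne := fun s => s.elim, double := fun s => s.elim
    transverse := fun s => s.elim
    complete := fun i j p hp q hq hne h => absurd (h3 i j p hp q hq h) hne }⟩⟩

end IsRibbonFamily

/-! ### The profile of a band surgery -/

lemma smoothTransition_one_sub (x : ℝ) :
    Real.smoothTransition (1 - x) = 1 - Real.smoothTransition x := by
  have := Real.smoothTransition.pos_denom x
  simp only [Real.smoothTransition, sub_sub_cancel]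
  rw [add_comm (expNegInvGlue (1 - x))]
  field_simp
  ring

lemma contDiff_smoothStep : ContDiff ℝ ∞ smoothStep := by
  unfold smoothStep
  exact (contDiff_const.mul (Real.smoothTransition.contDiff.comp
    ((contDiff_id.add contDiff_const).div_const 2))).sub contDiff_const

lemma smoothStep_neg (τ : ℝ) : smoothStep (-τ) = -smoothStep τ := by
  unfold smoothStep
  rw [show (-τ + 1) / 2 = 1 - (τ + 1) / 2 by ring, smoothTransition_one_sub]
  ring

lemma monotone_smoothStep : Monotone smoothStep := by
  intro a b hab
  have := Real.smoothTransition.monotone (show (a + 1) / 2 ≤ (b + 1) / 2 by linarith)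
  unfold smoothStep
  linarith

lemma smoothStep_of_one_le {τ : ℝ} (h : 1 ≤ τ) : smoothStep τ = 1 := by
  unfold smoothStep
  rw [Real.smoothTransition.one_of_one_le (by linarith)]
  norm_num

lemma smoothStep_of_le_neg_one {τ : ℝ} (h : τ ≤ -1) : smoothStep τ = -1 := by
  rw [← neg_neg τ, smoothStep_neg, smoothStep_of_one_le (by linarith)]

lemma abs_smoothStep_le (τ : ℝ) : |smoothStep τ| ≤ 1 := by
  unfold smoothStep
  have h1 := Real.smoothTransition.nonneg ((τ + 1) / 2)
  have h2 := Real.smoothTransition.le_one ((τ + 1) / 2)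
  rw [abs_le]; constructor <;> linarith

lemma hasDerivAt_expNegInvGlue {x : ℝ} (hx : 0 < x) :
    ∃ d > 0, HasDerivAt expNegInvGlue d x := by
  refine ⟨Real.exp (-x⁻¹) * (-(-(x ^ 2)⁻¹)), by
    rw [neg_neg]; positivity, ?_⟩
  have h1 : HasDerivAt (fun y : ℝ => Real.exp (-y⁻¹)) (Real.exp (-x⁻¹) * (-(-(x ^ 2)⁻¹))) x :=
    ((hasDerivAt_inv hx.ne').neg).exp
  refine h1.congr_of_eventuallyEq ?_
  filter_upwards [lt_mem_nhds hx] with y hy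
  simp [expNegInvGlue, not_le.2 hy]

lemma deriv_smoothStep_pos {τ : ℝ} (h : |τ| < 1) : 0 < deriv smoothStep τ := by
  rw [abs_lt] at h
  set x := (τ + 1) / 2 with hx
  obtain ⟨d, hd, h1⟩ := hasDerivAt_expNegInvGlue (x := x) (by linarith)
  obtain ⟨e, he, h2⟩ := hasDerivAt_expNegInvGlue (x := 1 - x) (by linarith)
  have h2' : HasDerivAt (fun y : ℝ => expNegInvGlue (1 - y)) (e * (-1)) x :=
    HasDerivAt.comp x h2 ((hasDerivAt_id x).const_sub 1)
  have h3 := h1.div (h1.add h2') (Real.smoothTransition.pos_denom x).ne'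
  have h4 : HasDerivAt smoothStep (2 * ((d * (expNegInvGlue x + expNegInvGlue (1 - x)) -
      expNegInvGlue x * (d + e * (-1))) / (expNegInvGlue x + expNegInvGlue (1 - x)) ^ 2 *
      (1 / 2))) τ := by
    have h5 : HasDerivAt (fun t : ℝ => (t + 1) / 2) (1 / 2) τ :=
      ((hasDerivAt_id τ).add_const 1).div_const 2
    exact ((HasDerivAt.comp τ h3 h5).const_mul 2).sub_const 1
  rw [h4.deriv]
  have p1 := Real.smoothTransition.pos_denom x
  have p2 := expNegInvGlue.pos_of_pos (show 0 < x by linarith)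
  have p3 := expNegInvGlue.pos_of_pos (show 0 < 1 - x by linarith)
  have : d * (expNegInvGlue x + expNegInvGlue (1 - x)) - expNegInvGlue x * (d + e * (-1)) =
      d * expNegInvGlue (1 - x) + e * expNegInvGlue x := by ring
  rw [this]
  positivity

lemma deriv_smoothStep_nonneg (τ : ℝ) : 0 ≤ deriv smoothStep τ :=
  monotone_smoothStep.deriv_nonneg

lemma strictMonoOn_smoothStep : StrictMonoOn smoothStep (Icc (-1) 1) := by
  refine strictMonoOn_of_deriv_pos (convex_Icc _ _) contDiff_smoothStep.continuous.continuousOn ?_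
  intro x hx
  rw [interior_Icc] at hx
  exact deriv_smoothStep_pos (abs_lt.2 hx)

lemma smoothStep_zero : smoothStep 0 = 0 := by
  have := smoothStep_neg 0
  rw [neg_zero] at this
  linarith

lemma abs_smoothStep (τ : ℝ) : |smoothStep τ| = smoothStep |τ| := by
  rcases le_total 0 τ with h | h
  · rw [abs_of_nonneg h, abs_of_nonneg]
    rw [← smoothStep_zero]; exact monotone_smoothStep h
  · rw [abs_of_nonpos h, smoothStep_neg, abs_of_nonpos]
    rw [← smoothStep_zero]; exact monotone_smoothStep h

lemma abs_smoothStep_lt {τ : ℝ} (h : |τ| < 1) : |smoothStep τ| < 1 := by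
  rw [abs_smoothStep, ← smoothStep_of_one_le le_rfl]
  exact strictMonoOn_smoothStep ⟨by linarith [abs_nonneg τ], h.le⟩ ⟨by norm_num, le_rfl⟩ h

lemma mul_smoothStep_nonneg (τ : ℝ) : 0 ≤ τ * smoothStep τ := by
  rcases le_total 0 τ with h | h
  · refine mul_nonneg h ?_
    rw [← smoothStep_zero]; exact monotone_smoothStep h
  · refine mul_nonneg_of_nonpos_of_nonpos h ?_
    rw [← smoothStep_zero]; exact monotone_smoothStep h

lemma mul_smoothStep_eq (τ : ℝ) : τ * smoothStep τ = |τ| * |smoothStep τ| := by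
  rw [← abs_mul, abs_of_nonneg (mul_smoothStep_nonneg τ)]

/-- The inverse of the restriction of `smoothStep` to `(-1, 1)`. -/
noncomputable def stepInv : ℝ → ℝ := Function.invFunOn smoothStep (Ioo (-1) 1)

lemma smoothStep_surjOn : SurjOn smoothStep (Ioo (-1) 1) (Ioo (-1) 1) := by
  intro s hs
  have h1 : s ∈ Ioo (smoothStep (-1)) (smoothStep 1) := by
    rw [smoothStep_of_one_le le_rfl, smoothStep_of_le_neg_one le_rfl]; exact hs
  exact intermediate_value_Ioo (by norm_num) contDiff_smoothStep.continuous.continuousOn h1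

lemma stepInv_mem {s : ℝ} (hs : |s| < 1) : |stepInv s| < 1 :=
  abs_lt.2 (Function.invFunOn_mem (smoothStep_surjOn (abs_lt.1 hs)))

lemma smoothStep_stepInv {s : ℝ} (hs : |s| < 1) : smoothStep (stepInv s) = s :=
  Function.invFunOn_eq (smoothStep_surjOn (abs_lt.1 hs))

lemma stepInv_smoothStep {τ : ℝ} (h : |τ| < 1) : stepInv (smoothStep τ) = τ :=
  (strictMonoOn_smoothStep.injOn.mono Ioo_subset_Icc_self).leftInvOn_invFunOn (abs_lt.1 h)

lemma injective_fderiv_of_deriv_ne_zero {f : ℝ → ℝ} {x : ℝ} (h : deriv f x ≠ 0) :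
    Function.Injective (fderiv ℝ f x) := by
  rw [injective_iff_map_eq_zero]
  intro v hv
  have h1 : fderiv ℝ f x v = v * deriv f x := by
    have := (fderiv ℝ f x).map_smul v 1
    rwa [smul_eq_mul, mul_one, smul_eq_mul, fderiv_apply_one_eq_deriv] at this
  rw [h1] at hv
  exact (mul_eq_zero.1 hv).resolve_right h

lemma contDiffOn_stepInv : ContDiffOn ℝ ∞ stepInv (Ioo (-1) 1) := by
  obtain ⟨-, g, hg, hgs⟩ := exists_smooth_inverse (f := smoothStep) isOpen_Ioo
    contDiff_smoothStep.contDiffOn (strictMonoOn_smoothStep.injOn.mono Ioo_subset_Icc_self)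
    (fun x hx => injective_fderiv_of_deriv_ne_zero (deriv_smoothStep_pos (abs_lt.2 hx)).ne')
  refine (hg.mono smoothStep_surjOn).congr ?_
  intro s hs
  have hs' := abs_lt.2 hs
  conv_rhs => rw [← smoothStep_stepInv hs']
  exact (hgs _ (abs_lt.1 (stepInv_mem hs'))).symm

/-- The half width of the neck of a band surgery at the height `s`, in the coordinates of the band:
the rounded sides of the band are the curves `u = ± neckWidth s`. -/
noncomputable def neckWidth (s : ℝ) : ℝ := 1 + s * stepInv s

lemma contDiffOn_neckWidth : ContDiffOn ℝ ∞ neckWidth (Ioo (-1) 1) :=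
  contDiffOn_const.add (contDiffOn_id.mul contDiffOn_stepInv)

lemma neckWidth_smoothStep {τ : ℝ} (h : |τ| < 1) :
    neckWidth (smoothStep τ) = 1 + τ * smoothStep τ := by
  rw [neckWidth, stepInv_smoothStep h, mul_comm]

lemma neckWidth_eq {s : ℝ} (hs : |s| < 1) : neckWidth s = 1 + |stepInv s| * |s| := by
  have h := mul_smoothStep_eq (stepInv s)
  rw [smoothStep_stepInv hs] at h
  rw [neckWidth, mul_comm, h]

lemma one_le_neckWidth {s : ℝ} (hs : |s| < 1) : 1 ≤ neckWidth s := by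
  rw [neckWidth_eq hs]; have := mul_nonneg (abs_nonneg (stepInv s)) (abs_nonneg s); linarith

lemma neckWidth_lt_two {s : ℝ} (hs : |s| < 1) : neckWidth s < 2 := by
  rw [neckWidth_eq hs]
  have := mul_lt_one_of_nonneg_of_lt_one_left (abs_nonneg _) (stepInv_mem hs) hs.le
  linarith

lemma neckWidth_mono {s t : ℝ} (h : |s| ≤ |t|) (ht : |t| < 1) : neckWidth s ≤ neckWidth t := by
  have hs := h.trans_lt ht
  rw [neckWidth_eq hs, neckWidth_eq ht]
  have : |stepInv s| ≤ |stepInv t| := by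
    by_contra hlt
    rw [not_le] at hlt
    have h1 := strictMonoOn_smoothStep
      ⟨by linarith [abs_nonneg (stepInv t)], (stepInv_mem ht).le⟩
      ⟨by linarith [abs_nonneg (stepInv s)], (stepInv_mem hs).le⟩ hlt
    rw [← abs_smoothStep, ← abs_smoothStep, smoothStep_stepInv hs, smoothStep_stepInv ht] at h1
    linarith
  gcongr

/-! ### The dumbbell -/

/-- The side facing the origin of the unit disks around `2` and `-2` is the curve
`|X| = nearSide Y`. -/
noncomputable def nearSide (Y : ℝ) : ℝ := 2 - √(1 - Y ^ 2)

lemma one_le_nearSide (Y : ℝ) : 1 ≤ nearSide Y := by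
  have : √(1 - Y ^ 2) ≤ 1 := by
    rw [Real.sqrt_le_left (by norm_num)]; nlinarith [sq_nonneg Y]
  unfold nearSide; linarith

lemma nearSide_pos (Y : ℝ) : 0 < nearSide Y := one_pos.trans_le (one_le_nearSide Y)

lemma nearSide_le_two (Y : ℝ) : nearSide Y ≤ 2 := by
  have := Real.sqrt_nonneg (1 - Y ^ 2)
  unfold nearSide; linarith

lemma nearSide_zero : nearSide 0 = 1 := by
  unfold nearSide; norm_num

lemma nearSide_mono {Y Z : ℝ} (h : |Y| ≤ |Z|) : nearSide Y ≤ nearSide Z := by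
  have : √(1 - Z ^ 2) ≤ √(1 - Y ^ 2) := Real.sqrt_le_sqrt (by
    have := sq_le_sq.2 h; linarith)
  unfold nearSide; linarith

lemma nearSide_strictMono {Y Z : ℝ} (h : |Y| < |Z|) (hZ : |Y| < 1) : nearSide Y < nearSide Z := by
  have : √(1 - Z ^ 2) < √(1 - Y ^ 2) := (Real.sqrt_lt_sqrt_iff_of_pos (by
    have := (sq_lt_one_iff_abs_lt_one Y).2 hZ; linarith)).2 (by
    have := sq_lt_sq.2 h; linarith)
  unfold nearSide; linarith

lemma hasDerivAt_nearSide {Y : ℝ} (h : |Y| < 1) :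
    HasDerivAt nearSide (Y / √(1 - Y ^ 2)) Y := by
  have h1 : 0 < 1 - Y ^ 2 := by have := (sq_lt_one_iff_abs_lt_one Y).2 h; linarith
  have h2 : HasDerivAt (fun y : ℝ => 1 - y ^ 2) (-(2 * Y)) Y := by
    simpa using (hasDerivAt_pow 2 Y).const_sub 1
  have h3 := (h2.sqrt h1.ne').const_sub 2
  refine h3.congr_deriv ?_
  have := Real.sqrt_pos.2 h1
  field_simp

lemma contDiffAt_nearSide {Y : ℝ} (h : |Y| < 1) : ContDiffAt ℝ ∞ nearSide Y := by
  have h1 : 0 < 1 - Y ^ 2 := by have := (sq_lt_one_iff_abs_lt_one Y).2 h; linarith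
  exact contDiffAt_const.sub ((contDiffAt_const.sub (contDiffAt_id.pow 2)).sqrt h1.ne')

/-- A point lies in the unit disk around `2` or `-2` if and only if it lies beyond the near side
(it cannot lie beyond the far side when `|X| ≤ 2`). -/
lemma nearSide_le_abs_iff {X Y : ℝ} (hX : |X| ≤ 2) (hY : |Y| ≤ 1) :
    nearSide Y ≤ |X| ↔ (|X| - 2) ^ 2 + Y ^ 2 ≤ 1 := by
  have hY2 : 0 ≤ 1 - Y ^ 2 := by have := (sq_le_one_iff_abs_le_one Y).2 hY; linarith
  unfold nearSide
  rw [show (2 - √(1 - Y ^ 2) ≤ |X|) ↔ (2 - |X| ≤ √(1 - Y ^ 2)) by constructor <;> intro h <;> linarith]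
  rw [Real.le_sqrt (by linarith)]
  · constructor <;> intro h <;> nlinarith
  · exact hY2

/-- The half width of the dumbbell in the neck, as a function of the parameter of the sides. -/
noncomputable def sideHalf (c τ : ℝ) : ℝ := c * (1 + τ * smoothStep τ)

/-- The abscissa of the side of the neck, as a function of the parameter. -/
noncomputable def sideAbs (c τ : ℝ) : ℝ := smoothStep τ * nearSide (sideHalf c τ)

lemma sideHalf_pos {c : ℝ} (hc : 0 < c) (τ : ℝ) : 0 < sideHalf c τ := by
  have := mul_smoothStep_nonneg τ
  unfold sideHalf; positivity

lemma sideHalf_lt_one {c τ : ℝ} (hc : 0 < c) (hc1 : c ≤ 1 / 10) (hτ : |τ| ≤ 3) :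
    sideHalf c τ < 1 := by
  have : τ * smoothStep τ ≤ 3 * 1 := by
    rw [mul_smoothStep_eq]
    exact mul_le_mul hτ (abs_smoothStep_le τ) (abs_nonneg _) (by norm_num)
  unfold sideHalf
  nlinarith

lemma contDiff_sideHalf (c : ℝ) : ContDiff ℝ ∞ (sideHalf c) :=
  contDiff_const.mul (contDiff_const.add (contDiff_id.mul contDiff_smoothStep))

lemma contDiffAt_sideAbs {c τ : ℝ} (hc : 0 < c) (hc1 : c ≤ 1 / 10) (hτ : |τ| ≤ 3) :
    ContDiffAt ℝ ∞ (sideAbs c) τ := by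
  refine contDiff_smoothStep.contDiffAt.mul ?_
  refine ContDiffAt.comp (g := nearSide) τ (contDiffAt_nearSide ?_) (contDiff_sideHalf c).contDiffAt
  rw [abs_of_pos (sideHalf_pos hc τ)]
  exact sideHalf_lt_one hc hc1 hτ

lemma deriv_sideAbs_pos {c τ : ℝ} (hc : 0 < c) (hc1 : c ≤ 1 / 10) (hτ : |τ| ≤ 3) :
    0 < deriv (sideAbs c) τ := by
  have hσ : HasDerivAt smoothStep (deriv smoothStep τ) τ :=
    ((contDiff_smoothStep.differentiable (by simp)) τ).hasDerivAt
  have hh : HasDerivAt (sideHalf c) (c * (1 * smoothStep τ + τ * deriv smoothStep τ)) τ :=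
    (((hasDerivAt_id τ).mul hσ).const_add 1).const_mul c
  have hp := sideHalf_pos hc τ
  have h1 := sideHalf_lt_one hc hc1 hτ
  have hn := hasDerivAt_nearSide (Y := sideHalf c τ) (by rw [abs_of_pos hp]; exact h1)
  have hd : HasDerivAt (sideAbs c) _ τ := hσ.mul (HasDerivAt.comp (h₂ := nearSide) τ hn hh)
  rw [hd.deriv]
  have hs := deriv_smoothStep_nonneg τ
  have hg := nearSide_pos (sideHalf c τ)
  have hq : 0 < sideHalf c τ / √(1 - sideHalf c τ ^ 2) := by
    have : 0 < 1 - sideHalf c τ ^ 2 := by nlinarith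
    have := Real.sqrt_pos.2 this
    positivity
  set q := sideHalf c τ / √(1 - sideHalf c τ ^ 2)
  have e : smoothStep τ * (q * (c * (1 * smoothStep τ + τ * deriv smoothStep τ))) =
      q * c * (smoothStep τ ^ 2 + (τ * smoothStep τ) * deriv smoothStep τ) := by ring
  have hm := mul_smoothStep_nonneg τ
  rw [e]
  rcases lt_or_ge |τ| 1 with h | h
  · have := deriv_smoothStep_pos h
    positivity
  · have : smoothStep τ ^ 2 = 1 := by
      rw [← sq_abs, abs_smoothStep, smoothStep_of_one_le h]; norm_num
    rw [this]
    positivity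

lemma strictMonoOn_sideAbs {c : ℝ} (hc : 0 < c) (hc1 : c ≤ 1 / 10) :
    StrictMonoOn (sideAbs c) (Icc (-2) 2) := by
  have h3 : ∀ x ∈ Icc (-2 : ℝ) 2, |x| ≤ 3 := fun x hx => abs_le.2 ⟨by linarith [hx.1], by linarith [hx.2]⟩
  refine strictMonoOn_of_deriv_pos (convex_Icc _ _)
    (fun x hx => (contDiffAt_sideAbs hc hc1 (h3 x hx)).continuousAt.continuousWithinAt) ?_
  intro x hx
  rw [interior_Icc] at hx
  exact deriv_sideAbs_pos hc hc1 (h3 x (Ioo_subset_Icc_self hx))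

lemma abs_sideAbs (c τ : ℝ) : |sideAbs c τ| = |smoothStep τ| * nearSide (sideHalf c τ) := by
  rw [sideAbs, abs_mul, abs_of_pos (nearSide_pos _)]

lemma exists_sideAbs_inverse {c : ℝ} (hc : 0 < c) (hc1 : c ≤ 1 / 10) :
    ∃ T : ℝ → ℝ, ContDiffOn ℝ ∞ T {X | |X| < nearSide (3 * c)} ∧
      ∀ X, |X| < nearSide (3 * c) → |T X| < 2 ∧ sideAbs c (T X) = X := by
  have h3 : ∀ x ∈ Ioo (-2 : ℝ) 2, |x| ≤ 3 := fun x hx => abs_le.2 ⟨by linarith [hx.1], by linarith [hx.2]⟩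
  obtain ⟨hopen, T, hT, hTs⟩ := exists_smooth_inverse (f := sideAbs c) (U := Ioo (-2) 2) isOpen_Ioo
    (fun x hx => (contDiffAt_sideAbs hc hc1 (h3 x hx)).contDiffWithinAt)
    ((strictMonoOn_sideAbs hc hc1).injOn.mono Ioo_subset_Icc_self)
    (fun x hx => injective_fderiv_of_deriv_ne_zero (deriv_sideAbs_pos hc hc1 (h3 x hx)).ne')
  have hsub : ∀ X, |X| < nearSide (3 * c) → X ∈ sideAbs c '' Ioo (-2) 2 := by
    intro X hX
    have e1 : sideAbs c 2 = nearSide (3 * c) := by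
      rw [sideAbs, sideHalf, smoothStep_of_one_le (by norm_num)]; norm_num; congr 1; ring
    have e2 : sideAbs c (-2) = -nearSide (3 * c) := by
      rw [sideAbs, sideHalf, smoothStep_of_le_neg_one (by norm_num)]; norm_num; congr 1; ring
    have hcont : ContinuousOn (sideAbs c) (Icc (-2) 2) := fun x hx =>
      (contDiffAt_sideAbs hc hc1 (abs_le.2 ⟨by linarith [hx.1], by linarith [hx.2]⟩)).continuousAt.continuousWithinAt
    exact intermediate_value_Ioo (by norm_num) hcont (by rw [e1, e2]; exact abs_lt.1 hX)
  refine ⟨T, hT.mono hsub, fun X hX => ?_⟩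
  obtain ⟨τ, hτ, rfl⟩ := hsub X hX
  rw [hTs τ hτ]
  exact ⟨abs_lt.2 hτ, rfl⟩

/-- The half width of the dumbbell at the abscissa `X`, divided by the half width of the ellipse
`X = 3 x`: near the neck the boundary of the dumbbell consists of the sides of the neck, away from
the neck of the circles around `±2`. -/
theorem exists_dumbbell_ratio {c : ℝ} (hc : 0 < c) (hc1 : c ≤ 1 / 10) :
    ∃ V : ℝ → ℝ, ContDiffOn ℝ ∞ V (Ioo (-2) 2) ∧ (∀ x ∈ Ioo (-2 : ℝ) 2, 0 < V x) ∧
      (∀ x, |x| ≤ 1 → nearSide (2 * c) ≤ |3 * x| → V x ^ 2 * (1 - x ^ 2) = 1 - (|3 * x| - 2) ^ 2) ∧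
      (∀ x, |3 * x| < nearSide (2 * c) → ∃ τ, |τ| < 1 ∧ sideAbs c τ = 3 * x ∧
        V x * √(1 - x ^ 2) = sideHalf c τ) := by
  obtain ⟨T, hT, hT2⟩ := exists_sideAbs_inverse hc hc1
  set m := nearSide (5 / 2 * c) with hm
  have c3 : |3 * c| = 3 * c := abs_of_pos (by linarith)
  have c2 : |2 * c| = 2 * c := abs_of_pos (by linarith)
  have c5 : |5 / 2 * c| = 5 / 2 * c := abs_of_pos (by linarith)
  have hm2 : nearSide (2 * c) < m := nearSide_strictMono (by rw [c2, c5]; linarith)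
    (by rw [c2]; linarith)
  have hm3 : m < nearSide (3 * c) := nearSide_strictMono (by rw [c3, c5]; linarith)
    (by rw [c5]; linarith)
  have hn2 : 1 ≤ nearSide (2 * c) := one_le_nearSide _
  have hn3 : nearSide (3 * c) < 3 / 2 := by
    have h1 : (3 * c) ^ 2 ≤ 9 / 100 := by nlinarith
    have : 1 / 2 < √(1 - (3 * c) ^ 2) := by
      rw [Real.lt_sqrt (by norm_num)]; nlinarith
    unfold nearSide; linarith
  let V₁ : ℝ → ℝ := fun x => sideHalf c (T (3 * x)) / √(1 - x ^ 2)
  let V₂ : ℝ → ℝ := fun x => √(3 * (3 * |x| - 1) / (1 + |x|))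
  have habs : ∀ x : ℝ, |3 * x| = 3 * |x| := fun x => by rw [abs_mul]; norm_num
  have hx1 : ∀ x : ℝ, |3 * x| < nearSide (3 * c) → 0 < 1 - x ^ 2 := by
    intro x hx
    rw [habs] at hx
    have : |x| < 1 / 2 := by linarith
    have := sq_abs x
    nlinarith [abs_nonneg x]
  have hagree : ∀ x : ℝ, |3 * x| < nearSide (3 * c) → nearSide (2 * c) ≤ |3 * x| → V₁ x = V₂ x := by
    intro x hx hx'
    obtain ⟨h1, h2⟩ := hT2 _ hx
    set τ := T (3 * x) with hτ
    have hp := sideHalf_pos hc τ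
    have h3 : 1 ≤ |τ| := by
      by_contra hlt
      rw [not_le] at hlt
      have h4 := abs_sideAbs c τ
      have h5 : sideHalf c τ < 2 * c := by
        have : τ * smoothStep τ < 1 := by
          rw [mul_smoothStep_eq]
          exact mul_lt_one_of_nonneg_of_lt_one_left (abs_nonneg _) hlt (abs_smoothStep_le _)
        unfold sideHalf; nlinarith
      have h6 : nearSide (sideHalf c τ) < nearSide (2 * c) :=
        nearSide_strictMono (by rw [abs_of_pos hp, c2]; exact h5) (by rw [abs_of_pos hp]; linarith)
      rw [h2] at h4
      have := abs_smoothStep_le τ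
      have := nearSide_pos (sideHalf c τ)
      nlinarith
    have h4 : |3 * x| = nearSide (sideHalf c τ) := by
      rw [← h2, abs_sideAbs, abs_smoothStep, smoothStep_of_one_le h3, one_mul]
    have h5 := sideHalf_lt_one hc hc1 (h1.le.trans (by norm_num : (2 : ℝ) ≤ 3))
    have h6 : sideHalf c τ ^ 2 = 1 - (2 - |3 * x|) ^ 2 := by
      rw [h4, nearSide, sub_sub_cancel, Real.sq_sqrt (by nlinarith)]; ring
    have h7 := hx1 x hx
    change sideHalf c τ / √(1 - x ^ 2) = √(3 * (3 * |x| - 1) / (1 + |x|))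
    rw [div_eq_iff (Real.sqrt_pos.2 h7).ne', ← Real.sqrt_mul (by
      rw [habs] at hx'
      have := abs_nonneg x
      apply div_nonneg <;> linarith)]
    have h8 : 3 * (3 * |x| - 1) / (1 + |x|) * (1 - x ^ 2) = sideHalf c τ ^ 2 := by
      rw [h6, habs, ← sq_abs x]
      have := abs_nonneg x
      field_simp
      ring
    rw [h8, Real.sqrt_sq hp.le]
  let V : ℝ → ℝ := fun x => if |3 * x| < m then V₁ x else V₂ x
  have hV1 : ∀ x, |3 * x| < nearSide (3 * c) → V x = V₁ x := by
    intro x hx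
    by_cases h : |3 * x| < m
    · exact if_pos h
    · rw [hagree x hx (hm2.le.trans (not_lt.1 h))]; exact if_neg h
  have hV2 : ∀ x, nearSide (2 * c) ≤ |3 * x| → V x = V₂ x := by
    intro x hx
    by_cases h : |3 * x| < m
    · rw [← hagree x (h.trans hm3) hx]; exact if_pos h
    · exact if_neg h
  have hcont : Continuous fun x : ℝ => |3 * x| := by fun_prop
  refine ⟨V, ?_, ?_, ?_, ?_⟩
  · intro x hx
    refine ContDiffAt.contDiffWithinAt ?_
    by_cases h : |3 * x| < nearSide (3 * c)
    · have h1 : ContDiffAt ℝ ∞ V₁ x := by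
        refine ContDiffAt.div ?_ ?_ (Real.sqrt_pos.2 (hx1 x h)).ne'
        · refine (contDiff_sideHalf c).contDiffAt.comp x ?_
          refine ContDiffAt.comp (g := T) x (hT.contDiffAt ?_)
            (contDiffAt_const.mul contDiffAt_id)
          exact (isOpen_lt continuous_abs continuous_const).mem_nhds h
        · exact (contDiffAt_const.sub (contDiffAt_id.pow 2)).sqrt (hx1 x h).ne'
      refine h1.congr_of_eventuallyEq ?_
      filter_upwards [(isOpen_lt hcont continuous_const).mem_nhds h] with y hy
      exact hV1 y hy
    · have h' : nearSide (2 * c) < |3 * x| := (hm2.trans hm3).trans_le (not_lt.1 h)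
      have h0 : 1 < 3 * |x| := by rw [← habs]; linarith
      have hxne : x ≠ 0 := by rintro rfl; simp at h0; linarith
      have hx0 := abs_nonneg x
      have h1 : ContDiffAt ℝ ∞ V₂ x := by
        have ha : ContDiffAt ℝ ∞ (fun y : ℝ => |y|) x := contDiffAt_abs hxne
        refine ContDiffAt.sqrt ?_ ?_
        · refine ContDiffAt.div ?_ (contDiffAt_const.add ha) (by linarith)
          exact contDiffAt_const.mul ((contDiffAt_const.mul ha).sub contDiffAt_const)
        · refine (div_pos ?_ ?_).ne' <;> linarith
      refine h1.congr_of_eventuallyEq ?_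
      filter_upwards [(isOpen_lt continuous_const hcont).mem_nhds h'] with y hy
      exact hV2 y (le_of_lt hy)
  · intro x hx
    by_cases h : |3 * x| < nearSide (3 * c)
    · rw [hV1 x h]
      exact div_pos (sideHalf_pos hc _) (Real.sqrt_pos.2 (hx1 x h))
    · have h' : nearSide (2 * c) < |3 * x| := (hm2.trans hm3).trans_le (not_lt.1 h)
      have h0 : 1 < 3 * |x| := by rw [← habs]; linarith
      rw [hV2 x h'.le]
      refine Real.sqrt_pos.2 (div_pos ?_ ?_) <;> linarith [abs_nonneg x]
  · intro x hx hx'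
    have h0 : 1 ≤ 3 * |x| := by rw [← habs]; linarith
    have hx0 := abs_nonneg x
    rw [hV2 x hx']
    change √(3 * (3 * |x| - 1) / (1 + |x|)) ^ 2 * (1 - x ^ 2) = _
    rw [Real.sq_sqrt (by apply div_nonneg <;> linarith), habs, ← sq_abs x]
    field_simp
    ring
  · intro x hx
    have h3 : |3 * x| < nearSide (3 * c) := hx.trans (hm2.trans hm3)
    obtain ⟨h1, h2⟩ := hT2 _ h3
    refine ⟨T (3 * x), ?_, h2, ?_⟩
    · by_contra hge
      rw [not_lt] at hge
      have h4 := abs_sideAbs c (T (3 * x))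
      rw [h2, abs_smoothStep, smoothStep_of_one_le hge, one_mul] at h4
      rw [h4] at hx
      have h5 : 2 * c ≤ sideHalf c (T (3 * x)) := by
        have : 1 ≤ T (3 * x) * smoothStep (T (3 * x)) := by
          rw [mul_smoothStep_eq, abs_smoothStep, smoothStep_of_one_le hge]; linarith
        unfold sideHalf; nlinarith
      have := nearSide_mono (Y := 2 * c) (Z := sideHalf c (T (3 * x)))
        (by rw [c2, abs_of_pos (sideHalf_pos hc _)]; exact h5)
      linarith
    · rw [hV1 x h3]
      exact div_mul_cancel₀ _ (Real.sqrt_pos.2 (hx1 x h3)).ne'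

/-- A smooth map which is the identity near the closed unit ball and has values in a slightly
larger ball. -/
lemma exists_smooth_retract (E : Type*) [NormedAddCommGroup E] [NormedSpace ℝ E]
    [HasContDiffBump E] {R : ℝ} (hR : 1 < R) :
    ∃ ρ : E → E, ContDiff ℝ ∞ ρ ∧ (∀ x, ρ x ∈ ball 0 R) ∧
      ∃ R' > 1, ∀ x ∈ ball (0 : E) R', ρ x = x := by
  let χ : ContDiffBump (0 : E) := ⟨(1 + R) / 2, R, by linarith, by linarith⟩
  refine ⟨fun x => χ x • x, χ.contDiff.smul contDiff_id, fun x => ?_, (1 + R) / 2, by linarith,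
    fun x hx => ?_⟩
  · rw [mem_ball_zero_iff, norm_smul, Real.norm_of_nonneg (χ.nonneg' _)]
    rcases lt_or_ge ‖x‖ R with h | h
    · calc χ x * ‖x‖ ≤ 1 * ‖x‖ := by gcongr; exact χ.le_one
        _ < R := by rwa [one_mul]
    · rw [χ.zero_of_le_dist (by rwa [dist_zero_right]), zero_mul]; linarith
  · change χ x • x = x
    rw [χ.one_of_mem_closedBall (ball_subset_closedBall hx), one_smul]

/-- The neck of the dumbbell, between the disks around `±2`. It is the region between the rounded
sides of the band, in the coordinates `u = Y / c`, `s = X / nearSide Y`. -/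
def neckZone (c : ℝ) : Set ℂ :=
  {z | |z.im| < 1 ∧ |z.re| < nearSide z.im ∧ |z.im| ≤ c * neckWidth (z.re / nearSide z.im)}

/-- Two unit disks joined by a neck. -/
def dumbbell (c : ℝ) : Set ℂ := closedBall 2 1 ∪ closedBall (-2) 1 ∪ neckZone c

/-- The boundary curve of the dumbbell: the two circles without the arcs at which the neck is
attached, and the sides of the neck. -/
def dumbbellBoundary (c : ℝ) : Set ℂ :=
  {z | z ∈ sphere (2 : ℂ) 1 ∪ sphere (-2 : ℂ) 1 ∧ ¬ (|z.re| < 2 ∧ |z.im| < 2 * c)} ∪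
  {z | z ∈ neckZone c ∧ |z.im| = c * neckWidth (z.re / nearSide z.im)}

lemma dist_two_sq (z : ℂ) : dist z 2 ^ 2 = (z.re - 2) ^ 2 + z.im ^ 2 := by
  rw [Complex.dist_eq, Complex.sq_norm, Complex.normSq_apply]; simp; ring

lemma dist_neg_two_sq (z : ℂ) : dist z (-2) ^ 2 = (z.re + 2) ^ 2 + z.im ^ 2 := by
  rw [Complex.dist_eq, Complex.sq_norm, Complex.normSq_apply]; simp; ring

lemma mem_closedBall_two {z : ℂ} : z ∈ closedBall (2 : ℂ) 1 ↔ (z.re - 2) ^ 2 + z.im ^ 2 ≤ 1 := by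
  rw [mem_closedBall, ← dist_two_sq, sq_le_one_iff₀ dist_nonneg]

lemma mem_closedBall_neg_two {z : ℂ} :
    z ∈ closedBall (-2 : ℂ) 1 ↔ (z.re + 2) ^ 2 + z.im ^ 2 ≤ 1 := by
  rw [mem_closedBall, ← dist_neg_two_sq, sq_le_one_iff₀ dist_nonneg]

lemma mem_sphere_two {z : ℂ} : z ∈ sphere (2 : ℂ) 1 ↔ (z.re - 2) ^ 2 + z.im ^ 2 = 1 := by
  rw [mem_sphere, ← dist_two_sq, pow_eq_one_iff_of_nonneg dist_nonneg two_ne_zero]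

lemma mem_sphere_neg_two {z : ℂ} : z ∈ sphere (-2 : ℂ) 1 ↔ (z.re + 2) ^ 2 + z.im ^ 2 = 1 := by
  rw [mem_sphere, ← dist_neg_two_sq, pow_eq_one_iff_of_nonneg dist_nonneg two_ne_zero]

lemma mem_closedBalls_iff {z : ℂ} : z ∈ closedBall (2 : ℂ) 1 ∪ closedBall (-2 : ℂ) 1 ↔
    (|z.re| - 2) ^ 2 + z.im ^ 2 ≤ 1 := by
  rw [mem_union, mem_closedBall_two, mem_closedBall_neg_two]
  rcases le_total 0 z.re with h | h
  · rw [abs_of_nonneg h, or_iff_left]; nlinarith [sq_nonneg z.im]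
  · rw [abs_of_nonpos h, or_iff_right]
    · rw [show (-z.re - 2) ^ 2 = (z.re + 2) ^ 2 by ring]
    · nlinarith [sq_nonneg z.im]

lemma mem_spheres_iff {z : ℂ} : z ∈ sphere (2 : ℂ) 1 ∪ sphere (-2 : ℂ) 1 ↔
    (|z.re| - 2) ^ 2 + z.im ^ 2 = 1 := by
  rw [mem_union, mem_sphere_two, mem_sphere_neg_two]
  rcases le_total 0 z.re with h | h
  · rw [abs_of_nonneg h, or_iff_left]; nlinarith [sq_nonneg z.im]
  · rw [abs_of_nonpos h, or_iff_right]
    · rw [show (-z.re - 2) ^ 2 = (z.re + 2) ^ 2 by ring]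
    · nlinarith [sq_nonneg z.im]

lemma abs_div_nearSide (X Y : ℝ) : |X / nearSide Y| = |X| / nearSide Y := by
  rw [abs_div, abs_of_pos (nearSide_pos Y)]

lemma abs_div_nearSide_lt {X Y : ℝ} (h : |X| < nearSide Y) : |X / nearSide Y| < 1 := by
  rw [abs_div_nearSide, div_lt_one (nearSide_pos Y)]; exact h

/-- Away from the neck, the dumbbell consists of two disks. -/
lemma mem_dumbbell_of_le {c : ℝ} (hc : 0 < c) (hc1 : c ≤ 1 / 10) {z : ℂ}
    (hz : nearSide (2 * c) ≤ |z.re|) :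
    (z ∈ dumbbell c ↔ z.im ^ 2 ≤ 1 - (|z.re| - 2) ^ 2) ∧
    (z ∈ dumbbellBoundary c ↔ z.im ^ 2 = 1 - (|z.re| - 2) ^ 2) := by
  have hN : z ∉ neckZone c := by
    rintro ⟨h1, h2, h3⟩
    have h4 := neckWidth_lt_two (abs_div_nearSide_lt h2)
    have h5 := nearSide_strictMono (Y := z.im) (Z := 2 * c)
      (by rw [abs_of_pos (by linarith : 0 < 2 * c)]; nlinarith) h1
    linarith
  constructor
  · rw [dumbbell, mem_union, or_iff_left hN, mem_closedBalls_iff]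
    constructor <;> intro h <;> linarith
  · rw [dumbbellBoundary, mem_union, mem_ofPred_eq, mem_ofPred_eq, mem_spheres_iff,
      or_iff_left (fun h => hN h.1)]
    constructor
    · rintro ⟨h, -⟩; linarith
    · intro h
      refine ⟨by linarith, ?_⟩
      rintro ⟨h1, h2⟩
      have h3 : |z.im| < 1 := by linarith
      have h4 := nearSide_strictMono (Y := z.im) (Z := 2 * c)
        (by rwa [abs_of_pos (by linarith : 0 < 2 * c)]) h3
      have h5 : nearSide z.im = |z.re| := by
        have : 1 - z.im ^ 2 = (2 - |z.re|) ^ 2 := by linarith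
        rw [nearSide, this, Real.sqrt_sq (by linarith)]; ring
      linarith

/-- In the neck, the dumbbell lies between the two sides. -/
lemma mem_dumbbell_of_lt {c : ℝ} (hc : 0 < c) (hc1 : c ≤ 1 / 10) {z : ℂ} {τ : ℝ} (hτ : |τ| < 1)
    (hz : sideAbs c τ = z.re) :
    (z ∈ dumbbell c ↔ |z.im| ≤ sideHalf c τ) ∧
    (z ∈ dumbbellBoundary c ↔ |z.im| = sideHalf c τ) := by
  have hs := abs_smoothStep_lt hτ
  set s := smoothStep τ with hs'
  set W := sideHalf c τ with hW
  have hW0 : 0 < W := sideHalf_pos hc τ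
  have hWa : |W| = W := abs_of_pos hW0
  have hWw : W = c * neckWidth s := by rw [hW, sideHalf, hs', neckWidth_smoothStep hτ]
  have hW2 : W < 2 * c := by rw [hWw]; nlinarith [neckWidth_lt_two hs]
  have hW1 : W < 1 := by linarith
  have hX : |z.re| = |s| * nearSide W := by rw [← hz, abs_sideAbs]
  have hgW := nearSide_pos W
  have hXW : |z.re| < nearSide W := by rw [hX]; nlinarith
  have hX2 : |z.re| < 2 := hXW.trans_le (nearSide_le_two W)
  rcases lt_or_ge |z.im| 1 with hY | hY
  swap
  · have hY2 : 1 ≤ z.im ^ 2 := by rw [← sq_abs]; nlinarith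
    have h1 : ¬ (|z.re| - 2) ^ 2 + z.im ^ 2 ≤ 1 := by
      intro h
      have : (|z.re| - 2) ^ 2 > 0 := by apply sq_pos_of_neg; linarith
      linarith
    have hN : z ∉ neckZone c := fun h => by linarith [h.1]
    have h2 : z ∉ dumbbell c := by
      rw [dumbbell, mem_union, mem_closedBalls_iff]; exact not_or.2 ⟨h1, hN⟩
    have h3 : z ∉ dumbbellBoundary c := by
      rw [dumbbellBoundary, mem_union, mem_ofPred_eq, mem_ofPred_eq, mem_spheres_iff]
      exact not_or.2 ⟨fun h => h1 h.1.le, fun h => hN h.1⟩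
    exact ⟨iff_of_false h2 (by linarith), iff_of_false h3 (by linarith)⟩
  rcases le_or_gt (nearSide z.im) |z.re| with h | h
  · have hlt : |z.im| < W := by
      by_contra hge
      have := nearSide_mono (Y := W) (Z := z.im) (by rw [hWa]; linarith)
      linarith
    have h1 := (nearSide_le_abs_iff hX2.le hY.le).1 h
    have hN : z ∉ neckZone c := fun h' => by linarith [h'.2.1]
    have h2 : z ∈ dumbbell c := by
      rw [dumbbell, mem_union, mem_closedBalls_iff]; exact Or.inl h1
    have h3 : z ∉ dumbbellBoundary c := by
      rw [dumbbellBoundary, mem_union]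
      exact not_or.2 ⟨fun h => h.2 ⟨hX2, by linarith⟩, fun h => hN h.1⟩
    exact ⟨iff_of_true h2 hlt.le, iff_of_false h3 hlt.ne⟩
  · have h1 : ¬ (|z.re| - 2) ^ 2 + z.im ^ 2 ≤ 1 := by
      rw [← nearSide_le_abs_iff hX2.le hY.le]; linarith
    set t := z.re / nearSide z.im with ht
    have ht1 : |t| < 1 := abs_div_nearSide_lt h
    have ht2 : |t| * nearSide z.im = |s| * nearSide W := by
      rw [← hX, ht, abs_div_nearSide, div_mul_cancel₀ _ (nearSide_pos _).ne']
    have hgY := nearSide_pos z.im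
    have hle : |z.im| ≤ W → W ≤ c * neckWidth t := by
      intro h
      have h2 := nearSide_mono (Y := z.im) (Z := W) (by rwa [hWa])
      have : |s| ≤ |t| := by
        by_contra hlt
        rw [not_le] at hlt
        have : |t| * nearSide z.im < |s| * nearSide W :=
          mul_lt_mul hlt h2 hgY (abs_nonneg _)
        linarith
      rw [hWw]
      exact mul_le_mul_of_nonneg_left (neckWidth_mono this ht1) hc.le
    have hge : W ≤ |z.im| → c * neckWidth t ≤ W := by
      intro h
      have h2 := nearSide_mono (Y := W) (Z := z.im) (by rwa [hWa])
      have : |t| ≤ |s| := by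
        by_contra hlt
        rw [not_le] at hlt
        have : |s| * nearSide W < |t| * nearSide z.im :=
          mul_lt_mul hlt h2 hgW (abs_nonneg _)
        linarith
      rw [hWw]
      exact mul_le_mul_of_nonneg_left (neckWidth_mono this hs) hc.le
    constructor
    · rw [dumbbell, mem_union, mem_closedBalls_iff, or_iff_right h1]
      constructor
      · rintro ⟨-, -, h2⟩
        by_contra hlt
        rw [not_le] at hlt
        have := hge hlt.le
        linarith
      · intro h2
        exact ⟨hY, h, h2.trans (hle h2)⟩
    · rw [dumbbellBoundary, mem_union, mem_ofPred_eq, mem_ofPred_eq, mem_spheres_iff,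
        or_iff_right (fun h => h1 h.1.le)]
      constructor
      · rintro ⟨-, h2⟩
        rcases le_total |z.im| W with h3 | h3
        · have := hle h3; linarith
        · have := hge h3; linarith
      · intro h2
        have h3 : |z.im| = c * neckWidth t := le_antisymm (h2.le.trans (hle h2.le))
          ((hge h2.ge).trans h2.ge)
        exact ⟨⟨hY, h, h3.le⟩, h3⟩

lemma abs_re_le_of_mem_dumbbell {c : ℝ} {z : ℂ}
    (hz : z ∈ dumbbell c ∪ dumbbellBoundary c) : |z.re| ≤ 3 := by
  have h1 : (|z.re| - 2) ^ 2 + z.im ^ 2 ≤ 1 → |z.re| ≤ 3 := by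
    intro h; nlinarith [sq_nonneg z.im]
  have h2 : z ∈ neckZone c → |z.re| ≤ 3 := fun h => by
    linarith [h.2.1, nearSide_le_two z.im]
  rw [dumbbell, dumbbellBoundary, mem_union, mem_union, mem_closedBalls_iff, mem_union,
    mem_ofPred_eq, mem_ofPred_eq, mem_spheres_iff] at hz
  rcases hz with (h | h) | (h | h)
  exacts [h1 h, h2 h, h1 h.1.le, h2 h.1]

/-- A diffeomorphism of the plane which maps the unit disk onto the dumbbell, preserving the
vertical direction. -/
theorem exists_dumbbell_param {c : ℝ} (hc : 0 < c) (hc1 : c ≤ 1 / 10) :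
    ∃ J : Equiv.Perm ℂ, ContDiff ℝ ∞ J ∧ ContDiff ℝ ∞ J.symm ∧
      (∀ z, J z ∈ dumbbell c ↔ z ∈ closedBall (0 : ℂ) 1) ∧
      (∀ z, J z ∈ dumbbellBoundary c ↔ z ∈ sphere (0 : ℂ) 1) := by
  obtain ⟨V₀, hV₀, hV₀pos, hV₀1, hV₀2⟩ := exists_dumbbell_ratio hc hc1
  obtain ⟨ρ, hρ, hρ2, R', hR', hρ1⟩ := exists_smooth_retract ℝ one_lt_two
  have hρ3 : ∀ x, ρ x ∈ Ioo (-2 : ℝ) 2 := fun x => by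
    have := hρ2 x; rwa [Real.ball_eq_Ioo, zero_sub, zero_add] at this
  let V : ℝ → ℝ := fun x => V₀ (ρ x)
  have hV : ContDiff ℝ ∞ V := hV₀.comp_contDiff hρ hρ3
  have hVpos : ∀ x, 0 < V x := fun x => hV₀pos _ (hρ3 x)
  have hVeq : ∀ x, |x| ≤ 1 → V x = V₀ x := fun x hx => by
    simp only [V]; rw [hρ1]; rw [mem_ball_zero_iff, Real.norm_eq_abs]; linarith
  have hcd : ∀ f g : ℂ → ℝ, ContDiff ℝ ∞ f → ContDiff ℝ ∞ g →
      ContDiff ℝ ∞ fun z => (⟨f z, g z⟩ : ℂ) := by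
    intro f g hf hg
    have : (fun z => (⟨f z, g z⟩ : ℂ)) = fun z => Complex.equivRealProdCLM.symm (f z, g z) := by
      funext z; rfl
    rw [this]
    exact Complex.equivRealProdCLM.symm.contDiff.comp (hf.prodMk hg)
  have hre : ContDiff ℝ ∞ fun z : ℂ => z.re := Complex.reCLM.contDiff
  have him : ContDiff ℝ ∞ fun z : ℂ => z.im := Complex.imCLM.contDiff
  let J : Equiv.Perm ℂ :=
    { toFun := fun z => ⟨3 * z.re, z.im * V z.re⟩
      invFun := fun z => ⟨z.re / 3, z.im / V (z.re / 3)⟩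
      left_inv := fun z => by
        apply Complex.ext
        · simp
        · have : 3 * z.re / 3 = z.re := by ring
          simp only [this]
          exact mul_div_cancel_right₀ _ (hVpos _).ne'
      right_inv := fun z => by
        apply Complex.ext
        · simp only; ring
        · exact div_mul_cancel₀ _ (hVpos _).ne' }
  have hJ : ∀ z, J z = ⟨3 * z.re, z.im * V z.re⟩ := fun z => rfl
  have hlow : ∀ z : ℂ, |z.re| ≤ 1 → (J z ∈ dumbbell c ↔ z.re ^ 2 + z.im ^ 2 ≤ 1) ∧
      (J z ∈ dumbbellBoundary c ↔ z.re ^ 2 + z.im ^ 2 = 1) := by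
    intro z hz
    have hV1 := hVeq _ hz
    have hp := hVpos z.re
    have hp2 : 0 < V z.re ^ 2 := by positivity
    rcases le_or_gt (nearSide (2 * c)) |3 * z.re| with h | h
    · obtain ⟨h1, h2⟩ := mem_dumbbell_of_le hc hc1 (z := J z) h
      rw [h1, h2]
      have h3 := hV₀1 _ hz h
      rw [← hV1] at h3
      have e : 1 - (|(J z).re| - 2) ^ 2 = V z.re ^ 2 * (1 - z.re ^ 2) := h3.symm
      have e' : (J z).im ^ 2 = V z.re ^ 2 * z.im ^ 2 := by rw [hJ]; ring
      rw [e, e', mul_le_mul_iff_right₀ hp2, mul_right_inj' hp2.ne']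
      constructor <;> constructor <;> intro h <;> linarith
    · obtain ⟨τ, hτ, h1, h2⟩ := hV₀2 _ h
      obtain ⟨h3, h4⟩ := mem_dumbbell_of_lt hc hc1 (z := J z) hτ h1
      have hx : 0 < 1 - z.re ^ 2 := by
        have h5 : |3 * z.re| < 2 := h.trans_le (nearSide_le_two _)
        rw [abs_mul, abs_of_pos (by norm_num : (0 : ℝ) < 3)] at h5
        rw [← sq_abs]
        nlinarith [abs_nonneg z.re]
      rw [h3, h4, ← h2, ← hV1]
      have e' : |(J z).im| = V z.re * |z.im| := by rw [hJ, abs_mul, abs_of_pos hp, mul_comm]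
      rw [e', mul_le_mul_iff_right₀ hp, mul_right_inj' hp.ne', Real.le_sqrt (abs_nonneg _), sq_abs]
      · refine ⟨by constructor <;> intro h <;> linarith, ?_⟩
        rw [eq_comm, Real.sqrt_eq_iff_eq_sq hx.le (abs_nonneg _), sq_abs]
        constructor <;> intro h <;> linarith
      · exact hx.le
  have hnot : ∀ z : ℂ, J z ∈ dumbbell c ∪ dumbbellBoundary c → |z.re| ≤ 1 := by
    intro z h
    have h1 : |3 * z.re| ≤ 3 := abs_re_le_of_mem_dumbbell h
    rw [abs_mul, abs_of_pos (by norm_num : (0 : ℝ) < 3)] at h1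
    linarith
  have hn : ∀ z : ℂ, ‖z‖ ^ 2 = z.re ^ 2 + z.im ^ 2 := fun z => by
    rw [Complex.sq_norm, Complex.normSq_apply]; ring
  have hcb : ∀ z : ℂ, z ∈ closedBall (0 : ℂ) 1 ↔ z.re ^ 2 + z.im ^ 2 ≤ 1 := fun z => by
    rw [mem_closedBall_zero_iff, ← hn, sq_le_one_iff₀ (norm_nonneg z)]
  have hsp : ∀ z : ℂ, z ∈ sphere (0 : ℂ) 1 ↔ z.re ^ 2 + z.im ^ 2 = 1 := fun z => by
    rw [mem_sphere_zero_iff_norm, ← hn, pow_eq_one_iff_of_nonneg (norm_nonneg z) two_ne_zero]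
  have hre1 : ∀ z : ℂ, z.re ^ 2 + z.im ^ 2 ≤ 1 → |z.re| ≤ 1 := fun z h => by
    rw [← sq_le_one_iff_abs_le_one]; nlinarith [sq_nonneg z.im]
  refine ⟨J, ?_, ?_, fun z => ?_, fun z => ?_⟩
  · exact hcd _ _ (contDiff_const.mul hre) (him.mul (hV.comp hre))
  · exact hcd _ _ (hre.div_const 3) (him.div (hV.comp (hre.div_const 3)) fun z => (hVpos _).ne')
  · rw [hcb]
    exact ⟨fun h => (hlow z (hnot z (Or.inl h))).1.1 h, fun h => (hlow z (hre1 z h)).1.2 h⟩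
  · rw [hsp]
    exact ⟨fun h => (hlow z (hnot z (Or.inr h))).2.1 h, fun h => (hlow z (hre1 z h.le)).2.2 h⟩

/-! ### Joining two disks by an adapted band -/

lemma injective_fderiv_of_leftInverse {E F : Type*} [NormedAddCommGroup E] [NormedSpace ℝ E]
    [NormedAddCommGroup F] [NormedSpace ℝ F] {f : E → F} {g : F → E} {x : E}
    (hf : DifferentiableAt ℝ f x) (hg : DifferentiableAt ℝ g (f x))
    (h : ∀ᶠ y in nhds x, g (f y) = y) : Function.Injective (fderiv ℝ f x) := by
  have h1 := hg.hasFDerivAt.comp x hf.hasFDerivAt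
  have h2 : HasFDerivAt (g ∘ f) (ContinuousLinearMap.id ℝ E) x :=
    (hasFDerivAt_id x).congr_of_eventuallyEq h
  have h3 := h1.unique h2
  intro v w hvw
  have e (v : E) : fderiv ℝ g (f x) (fderiv ℝ f x v) = v := DFunLike.congr_fun h3 v
  rw [← e v, ← e w, hvw]

/-- `Φ` is a box around a band that joins the boundary of the disk `none` to the boundary of the
disk `some a` and is otherwise disjoint from the boundaries of the disks of the family. -/
structure IsBand {ι : Type} (D : Option ι → ℂ → E3) (a : ι) (Φ : E3 → E3) : Prop where
  contDiff : ContDiff ℝ ∞ Φ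
  inj : InjOn Φ bandBox
  imm : ∀ x ∈ bandBox, Function.Injective (fderiv ℝ Φ x)
  meets : bandBox ∩ Φ ⁻¹' (⋃ i, D i '' sphere (0 : ℂ) 1) = startStrand ∪ endStrand
  start_sub : Φ '' startStrand ⊆ D none '' sphere (0 : ℂ) 1
  end_sub : Φ '' endStrand ⊆ D (some a) '' sphere (0 : ℂ) 1

/-- Coordinates on the unit disk near the boundary point `1`; the boundary is the line `s = 1`. -/
noncomputable def endChart (s Y : ℝ) : ℂ := ⟨2 - s * nearSide Y, Y⟩

/-- The band is adapted to the disks: near its ends it prolongs the two disks that it joins, and it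
meets no other disk there. -/
structure IsAdapted {ι : Type} (D : Option ι → ℂ → E3) (a : ι) (Φ : E3 → E3) (c η : ℝ) : Prop where
  c_pos : 0 < c
  c_le : c ≤ 1 / 10
  η_pos : 0 < η
  η_le : η ≤ 1
  end_eq : ∀ s Y : ℝ, |Y| < 5 / 2 * c → |s - 1| < η →
    D (some a) (endChart s Y) = Φ (Y / c, s, 0)
  start_eq : ∀ s Y : ℝ, |Y| < 5 / 2 * c → |s - 1| < η →
    D none (endChart s Y) = Φ (Y / c, -s, 0)
  end_unique : ∀ i, ∀ p ∈ closedBall (0 : ℂ) 1, ∀ u : ℝ, |u| ≤ 2 → D i p = Φ (u, 1, 0) →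
    i = some a ∧ p = endChart 1 (c * u)
  start_unique : ∀ i, ∀ p ∈ closedBall (0 : ℂ) 1, ∀ u : ℝ, |u| ≤ 2 → D i p = Φ (u, -1, 0) →
    i = none ∧ p = endChart 1 (c * u)

/-- The disks cross the neck of the band transversely along the arcs `γ r`, which lie at the height
`s r` in the band. -/
structure BandCrossings {ι : Type} (D : ι → ℂ → E3) (Φ : E3 → E3) (κ : Type) where
  i : κ → ι
  γ : κ → ℝ → ℂ
  s : κ → ℝ → ℝ
  γ_smooth : ∀ r, ContDiffOn ℝ 1 (γ r) (Icc (-1) 1)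
  s_smooth : ∀ r, ContDiffOn ℝ 1 (s r) (Icc (-1) 1)
  s_lt : ∀ r, ∀ y ∈ Icc (-1 : ℝ) 1, |s r y| < 1
  γ_mem : ∀ r, ∀ y ∈ Icc (-1 : ℝ) 1, γ r y ∈ ball (0 : ℂ) 1
  eq : ∀ r, ∀ y ∈ Icc (-1 : ℝ) 1, D (i r) (γ r y) = Φ (y * neckWidth (s r y), s r y, 0)
  complete : ∀ j, ∀ p ∈ closedBall (0 : ℂ) 1, ∀ y ∈ Icc (-1 : ℝ) 1, ∀ t : ℝ, |t| < 1 →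
    D j p = Φ (y * neckWidth t, t, 0) → ∃ r, j = i r ∧ p = γ r y ∧ t = s r y
  unique : ∀ r, ∀ y ∈ Icc (-1 : ℝ) 1, ∀ j, ∀ p ∈ closedBall (0 : ℂ) 1,
    D j p = D (i r) (γ r y) → j = i r ∧ p = γ r y
  inj : ∀ r r', ∀ y ∈ Icc (-1 : ℝ) 1, ∀ y' ∈ Icc (-1 : ℝ) 1, i r = i r' → γ r y = γ r' y' →
    r = r' ∧ y = y'
  transverse : ∀ r, ∀ y ∈ Icc (-1 : ℝ) 1, ¬ range (fderiv ℝ (D (i r)) (γ r y)) ⊆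
    fderiv ℝ Φ (y * neckWidth (s r y), s r y, 0) '' {v | v.2.2 = 0}

lemma continuous_nearSide : Continuous nearSide := by unfold nearSide; fun_prop

/-- The point of the dumbbell plane with band coordinates `u` and `s`. -/
noncomputable def neckPoint (c u s : ℝ) : ℂ := ⟨s * nearSide (c * u), c * u⟩

/-- The union of the two disks and the band, as a map on the plane of the dumbbell. -/
noncomputable def dumbbellMap (D₁ D₂ : ℂ → E3) (Φ : E3 → E3) (c η : ℝ) (z : ℂ) : E3 :=
  open Classical in
  if (1 - η) * nearSide z.im < z.re then D₁ (2 - (starRingEnd ℂ) z)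
  else if z.re < -((1 - η) * nearSide z.im) then D₂ (2 + z)
  else Φ (z.im / c, z.re / nearSide z.im, 0)

section DumbbellMap

variable {ι : Type} {D : Option ι → ℂ → E3} {a : ι} {Φ : E3 → E3} {c η : ℝ}

lemma endChart_eq_of_re (z : ℂ) :
    2 - (starRingEnd ℂ) z = endChart (z.re / nearSide z.im) z.im := by
  apply Complex.ext
  · simp [endChart, div_mul_cancel₀ _ (nearSide_pos z.im).ne']
  · simp [endChart]

lemma endChart_eq_of_re' (z : ℂ) :
    2 + z = endChart (-z.re / nearSide z.im) z.im := by
  apply Complex.ext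
  · simp [endChart, div_mul_cancel₀ _ (nearSide_pos z.im).ne']
  · simp [endChart]

lemma dumbbellMap_right {D₁ D₂ : ℂ → E3} {z : ℂ} (h : (1 - η) * nearSide z.im < z.re) :
    dumbbellMap D₁ D₂ Φ c η z = D₁ (2 - (starRingEnd ℂ) z) := if_pos h

lemma dumbbellMap_left {D₁ D₂ : ℂ → E3} {z : ℂ} (hη : η ≤ 1)
    (h : z.re < -((1 - η) * nearSide z.im)) : dumbbellMap D₁ D₂ Φ c η z = D₂ (2 + z) := by
  have h1 : ¬ (1 - η) * nearSide z.im < z.re := by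
    have := mul_nonneg (sub_nonneg.2 hη) (nearSide_pos z.im).le
    linarith
  rw [dumbbellMap, if_neg h1, if_pos h]

lemma dumbbellMap_neck (hA : IsAdapted D a Φ c η) {z : ℂ} (h1 : |z.im| < 5 / 2 * c)
    (h2 : |z.re| < nearSide z.im) : dumbbellMap (D (some a)) (D none) Φ c η z =
      Φ (z.im / c, z.re / nearSide z.im, 0) := by
  have hg := nearSide_pos z.im
  rw [abs_lt] at h2
  by_cases h3 : (1 - η) * nearSide z.im < z.re
  · rw [dumbbellMap_right h3, endChart_eq_of_re, hA.end_eq _ _ h1]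
    have h5 : 1 - η < z.re / nearSide z.im := (lt_div_iff₀ hg).2 h3
    rw [abs_lt]
    constructor
    · linarith
    · have : z.re / nearSide z.im < 1 := by rw [div_lt_one hg]; linarith
      linarith [hA.η_pos]
  · by_cases h4 : z.re < -((1 - η) * nearSide z.im)
    · rw [dumbbellMap_left hA.η_le h4, endChart_eq_of_re', hA.start_eq _ _ h1]
      · rw [neg_div, neg_neg]
      · have h5 : 1 - η < -z.re / nearSide z.im := (lt_div_iff₀ hg).2 (by linarith)
        rw [abs_lt]
        constructor
        · linarith
        · have : -z.re / nearSide z.im < 1 := by rw [div_lt_one hg]; linarith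
          linarith [hA.η_pos]
    · rw [dumbbellMap, if_neg h3, if_neg h4]

lemma right_mem_nhds {z : ℂ} (h : (1 - η) * nearSide z.im < z.re) :
    ∀ᶠ w in nhds z, (1 - η) * nearSide w.im < w.re :=
  (isOpen_lt (continuous_const.mul (continuous_nearSide.comp Complex.continuous_im))
    Complex.continuous_re).mem_nhds h

lemma left_mem_nhds {z : ℂ} (h : z.re < -((1 - η) * nearSide z.im)) :
    ∀ᶠ w in nhds z, w.re < -((1 - η) * nearSide w.im) :=
  (isOpen_lt Complex.continuous_re
    (continuous_const.mul (continuous_nearSide.comp Complex.continuous_im)).neg).mem_nhds h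

lemma neck_mem_nhds {z : ℂ} (h1 : |z.im| < 5 / 2 * c) (h2 : |z.re| < nearSide z.im) :
    ∀ᶠ w in nhds z, |w.im| < 5 / 2 * c ∧ |w.re| < nearSide w.im := by
  have e1 : ∀ᶠ w in nhds z, |w.im| < 5 / 2 * c :=
    (isOpen_lt (continuous_abs.comp Complex.continuous_im) continuous_const).mem_nhds h1
  have e2 : ∀ᶠ w in nhds z, |w.re| < nearSide w.im :=
    (isOpen_lt (continuous_abs.comp Complex.continuous_re)
      (continuous_nearSide.comp Complex.continuous_im)).mem_nhds h2
  exact e1.and e2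

/-- The coordinates of the neck. -/
noncomputable def neckCoord (c : ℝ) (z : ℂ) : E3 := (z.im / c, z.re / nearSide z.im, 0)

lemma contDiffAt_neckCoord {z : ℂ} (h : |z.im| < 1) : ContDiffAt ℝ ∞ (neckCoord c) z := by
  have hre : ContDiffAt ℝ ∞ (fun z : ℂ => z.re) z := Complex.reCLM.contDiff.contDiffAt
  have him : ContDiffAt ℝ ∞ (fun z : ℂ => z.im) z := Complex.imCLM.contDiff.contDiffAt
  refine (him.div_const c).prodMk (ContDiffAt.prodMk ?_ contDiffAt_const)
  exact hre.div (ContDiffAt.comp (g := nearSide) z (contDiffAt_nearSide h) him) (nearSide_pos _).ne'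

lemma contDiffAt_neckPoint {u s : ℝ} (h : |c * u| < 1) :
    ContDiffAt ℝ ∞ (fun x : ℝ × ℝ => neckPoint c x.1 x.2) (u, s) := by
  have e : (fun x : ℝ × ℝ => neckPoint c x.1 x.2) = fun x =>
      Complex.equivRealProdCLM.symm (x.2 * nearSide (c * x.1), c * x.1) := by
    funext x; rfl
  rw [e]
  refine Complex.equivRealProdCLM.symm.contDiff.contDiffAt.comp (u, s) ?_
  have h1 : ContDiffAt ℝ ∞ (fun x : ℝ × ℝ => c * x.1) (u, s) := contDiffAt_const.mul contDiffAt_fst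
  exact (contDiffAt_snd.mul (ContDiffAt.comp (g := nearSide) (u, s) (contDiffAt_nearSide h) h1)).prodMk
    h1

lemma neckCoord_neckPoint (hc : 0 < c) (u s : ℝ) : neckCoord c (neckPoint c u s) = (u, s, 0) := by
  simp only [neckCoord, neckPoint]
  rw [mul_div_cancel_left₀ _ hc.ne', mul_div_cancel_right₀ _ (nearSide_pos _).ne']

lemma neckPoint_neckCoord (hc : 0 < c) (z : ℂ) :
    neckPoint c (neckCoord c z).1 (neckCoord c z).2.1 = z := by
  simp only [neckCoord, neckPoint]
  rw [mul_div_cancel₀ _ hc.ne', div_mul_cancel₀ _ (nearSide_pos _).ne']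

lemma injective_fderiv_neckCoord (hc : 0 < c) {z : ℂ} (h : |z.im| < 1) :
    Function.Injective (fderiv ℝ (neckCoord c) z) := by
  refine injective_fderiv_of_leftInverse
    (g := fun x : E3 => neckPoint c x.1 x.2.1) ((contDiffAt_neckCoord h).differentiableAt (by simp))
    ?_ (Filter.Eventually.of_forall fun y => neckPoint_neckCoord hc y)
  have h1 : ContDiffAt ℝ ∞ (fun x : ℝ × ℝ => neckPoint c x.1 x.2)
      ((neckCoord c z).1, (neckCoord c z).2.1) := by
    apply contDiffAt_neckPoint
    simp only [neckCoord]; rwa [mul_div_cancel₀ _ hc.ne']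
  have h2 : DifferentiableAt ℝ (fun x : E3 => (x.1, x.2.1)) (neckCoord c z) := by fun_prop
  exact DifferentiableAt.comp (g := fun x : ℝ × ℝ => neckPoint c x.1 x.2) (neckCoord c z)
    (h1.differentiableAt (by simp)) h2

lemma fderiv_neckCoord_snd_snd {z v : ℂ} (h : |z.im| < 1) :
    (fderiv ℝ (neckCoord c) z v).2.2 = 0 := by
  have h1 := ((contDiffAt_neckCoord (c := c) h).differentiableAt (by simp)).hasFDerivAt
  have h2 : HasFDerivAt (fun w => (neckCoord c w).2.2)
      ((ContinuousLinearMap.snd ℝ ℝ ℝ).comp ((ContinuousLinearMap.snd ℝ ℝ (ℝ × ℝ)).comp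
        (fderiv ℝ (neckCoord c) z))) z := h1.snd.snd
  have h3 : HasFDerivAt (fun w : ℂ => (neckCoord c w).2.2) (0 : ℂ →L[ℝ] ℝ) z :=
    hasFDerivAt_const (0 : ℝ) z
  exact DFunLike.congr_fun (h2.unique h3) v

end DumbbellMap

lemma two_sub_conj_two_sub_conj (z : ℂ) :
    2 - (starRingEnd ℂ) (2 - (starRingEnd ℂ) z) = z := by
  rw [map_sub, Complex.conj_conj, map_ofNat]; ring

/-- The reflection of the plane which exchanges the unit disk with the disk around `2`. -/
noncomputable def rightPerm : Equiv.Perm ℂ where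
  toFun z := 2 - (starRingEnd ℂ) z
  invFun z := 2 - (starRingEnd ℂ) z
  left_inv := two_sub_conj_two_sub_conj
  right_inv := two_sub_conj_two_sub_conj

/-- The translation of the plane which maps the disk around `-2` to the unit disk. -/
noncomputable def leftPerm : Equiv.Perm ℂ where
  toFun z := 2 + z
  invFun z := z - 2
  left_inv z := by simp
  right_inv z := by simp

/-- The reparametrization of the disk of index `i` as a part of the disk which results from joining
the disks `some a` and `none`. -/
noncomputable def diskChart {ι : Type} (J : Equiv.Perm ℂ) (a : ι) (i : Option ι) : Equiv.Perm ℂ :=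
  open Classical in
  i.elim (J.trans leftPerm) fun j => if j = a then J.trans rightPerm else Equiv.refl ℂ

/-- The family of disks in which the disks `some a` and `none` have been joined by a band. -/
noncomputable def glued {ι : Type} (D : Option ι → ℂ → E3) (a : ι) (Φ : E3 → E3) (c η : ℝ)
    (J : Equiv.Perm ℂ) (ρ : ℂ → ℂ) (j : ι) (z : ℂ) : E3 :=
  open Classical in
  if j = a then dumbbellMap (D (some a)) (D none) Φ c η (J (ρ z)) else D (some j) z

section Glue

variable {ι : Type} {D : Option ι → ℂ → E3} {a : ι} {Φ : E3 → E3} {c η : ℝ} {J : Equiv.Perm ℂ}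
  {ρ : ℂ → ℂ}

lemma contDiff_rightPerm : ContDiff ℝ ∞ rightPerm :=
  contDiff_const.sub Complex.conjCLE.contDiff

lemma contDiff_leftPerm : ContDiff ℝ ∞ leftPerm := contDiff_const.add contDiff_id

lemma contDiff_leftPerm_symm : ContDiff ℝ ∞ leftPerm.symm := contDiff_id.sub contDiff_const

lemma diskChart_none : diskChart J a none = J.trans leftPerm := rfl

lemma diskChart_some_self : diskChart J a (some a) = J.trans rightPerm := by
  simp [diskChart]

lemma diskChart_some_of_ne {j : ι} (h : j ≠ a) : diskChart J a (some j) = Equiv.refl ℂ := by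
  simp [diskChart, h]

lemma contDiff_diskChart (hJ : ContDiff ℝ ∞ J) (i : Option ι) :
    ContDiff ℝ ∞ (diskChart J a i) := by
  rcases i with _ | j
  · exact contDiff_leftPerm.comp hJ
  · by_cases h : j = a
    · subst h; rw [diskChart_some_self]; exact contDiff_rightPerm.comp hJ
    · rw [diskChart_some_of_ne h]; exact contDiff_id

lemma contDiff_diskChart_symm (hJ : ContDiff ℝ ∞ J.symm) (i : Option ι) :
    ContDiff ℝ ∞ (diskChart J a i).symm := by
  rcases i with _ | j
  · exact hJ.comp contDiff_leftPerm_symm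
  · by_cases h : j = a
    · subst h; rw [diskChart_some_self]; exact hJ.comp contDiff_rightPerm
    · rw [diskChart_some_of_ne h]; exact contDiff_id

lemma apply_diskChart_none (p : ℂ) : J ((diskChart J a none).symm p) = p - 2 := by
  rw [diskChart_none]; simp [leftPerm]

lemma apply_diskChart_some (p : ℂ) :
    J ((diskChart J a (some a)).symm p) = 2 - (starRingEnd ℂ) p := by
  rw [diskChart_some_self]; simp [rightPerm]

lemma glued_of_ne {j : ι} (h : j ≠ a) : glued D a Φ c η J ρ j = D (some j) := by
  funext z; simp [glued, h]

lemma glued_self (z : ℂ) : glued D a Φ c η J ρ a z =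
    dumbbellMap (D (some a)) (D none) Φ c η (J (ρ z)) := by
  simp [glued]

lemma nearSide_im_le {p : ℂ} (hp : p ∈ closedBall (0 : ℂ) 1) : nearSide p.im ≤ 2 - |p.re| := by
  have h : p.re ^ 2 + p.im ^ 2 ≤ 1 := by
    rw [mem_closedBall_zero_iff] at hp
    have := Complex.sq_norm p
    rw [Complex.normSq_apply] at this
    nlinarith [norm_nonneg p]
  have : |p.re| ≤ √(1 - p.im ^ 2) := Real.abs_le_sqrt (by linarith)
  unfold nearSide; linarith

lemma sub_mem_closedBall_two {p : ℂ} :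
    2 - (starRingEnd ℂ) p ∈ closedBall (2 : ℂ) 1 ↔ p ∈ closedBall (0 : ℂ) 1 := by
  rw [mem_closedBall, mem_closedBall, dist_eq_norm, dist_eq_norm, sub_sub_cancel_left, norm_neg,
    RCLike.norm_conj, sub_zero]

lemma sub_mem_closedBall_neg_two {p : ℂ} :
    p - 2 ∈ closedBall (-2 : ℂ) 1 ↔ p ∈ closedBall (0 : ℂ) 1 := by
  rw [mem_closedBall, mem_closedBall, dist_eq_norm, dist_eq_norm]; simp

/-- The point of the disk of index `i` lies in the dumbbell, in the disk `some a` or `none`. -/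
lemma apply_diskChart_cases {i : Option ι} (hi : i.getD a = a) (p : ℂ) :
    let z := J ((diskChart J a i).symm p)
    z.im = p.im ∧ ((i = some a ∧ z = 2 - (starRingEnd ℂ) p ∧ z.re = 2 - p.re) ∨
      (i = none ∧ z = p - 2 ∧ z.re = p.re - 2)) := by
  rcases i with _ | j
  · simp only [apply_diskChart_none]; simp
  · obtain rfl : j = a := by simpa using hi
    simp only [apply_diskChart_some]; simp

lemma nearSide_le_abs_diskChart {i : Option ι} (hi : i.getD a = a) {p : ℂ}
    (hp : p ∈ closedBall (0 : ℂ) 1) :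
    nearSide (J ((diskChart J a i).symm p)).im ≤ |(J ((diskChart J a i).symm p)).re| := by
  obtain ⟨h1, ⟨-, -, h2⟩ | ⟨-, -, h2⟩⟩ := apply_diskChart_cases (J := J) hi p
  · rw [h1, h2]
    have := nearSide_im_le hp
    exact this.trans ((by linarith [le_abs_self p.re] : 2 - |p.re| ≤ 2 - p.re).trans
      (le_abs_self _))
  · rw [h1, h2]
    have := nearSide_im_le hp
    exact this.trans ((by linarith [le_abs_self p.re] : 2 - |p.re| ≤ -(p.re - 2)).trans
      (neg_le_abs _))

lemma diskChart_mem_closedBall (hJ : ∀ z, J z ∈ dumbbell c ↔ z ∈ closedBall (0 : ℂ) 1)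
    (i : Option ι) {p : ℂ} (hp : p ∈ closedBall (0 : ℂ) 1) :
    (diskChart J a i).symm p ∈ closedBall (0 : ℂ) 1 := by
  by_cases hi : i.getD a = a
  · rw [← hJ]
    obtain ⟨-, ⟨-, h2, -⟩ | ⟨-, h2, -⟩⟩ := apply_diskChart_cases (J := J) hi p
    · rw [h2]; exact Or.inl (Or.inl (sub_mem_closedBall_two.2 hp))
    · rw [h2]; exact Or.inl (Or.inr (sub_mem_closedBall_neg_two.2 hp))
  · rcases i with _ | j
    · simp at hi
    · rw [diskChart_some_of_ne (by simpa using hi)]; exact hp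

lemma abs_re_neckPoint_lt {u t : ℝ} (ht : |t| < 1) :
    |(neckPoint c u t).re| < nearSide (neckPoint c u t).im := by
  simp only [neckPoint]
  rw [abs_mul, abs_of_pos (nearSide_pos _)]
  exact mul_lt_of_lt_one_left (nearSide_pos _) ht

lemma neckPoint_inj (hc : 0 < c) {u t u' t' : ℝ} (h : neckPoint c u t = neckPoint c u' t') :
    u = u' ∧ t = t' := by
  have := congrArg (neckCoord c) h
  rw [neckCoord_neckPoint hc, neckCoord_neckPoint hc] at this
  simpa using this

lemma diskChart_ne_neckPoint {i : Option ι} (hi : i.getD a = a) {p : ℂ}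
    (hp : p ∈ closedBall (0 : ℂ) 1) {u t : ℝ} (ht : |t| < 1) :
    (diskChart J a i).symm p ≠ J.symm (neckPoint c u t) := by
  intro h
  have h1 := nearSide_le_abs_diskChart (J := J) hi hp
  rw [h, Equiv.apply_symm_apply] at h1
  exact absurd (abs_re_neckPoint_lt ht) (not_lt.2 h1)

lemma diskChart_inj {i i' : Option ι} {p p' : ℂ} (hi : i.getD a = i'.getD a)
    (hp : p ∈ closedBall (0 : ℂ) 1) (hp' : p' ∈ closedBall (0 : ℂ) 1)
    (h : (diskChart J a i).symm p = (diskChart J a i').symm p') : i = i' ∧ p = p' := by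
  suffices i = i' by subst this; exact ⟨rfl, (diskChart J a i).symm.injective h⟩
  by_cases ha : i.getD a = a
  · have hr : ∀ q : ℂ, q ∈ closedBall (0 : ℂ) 1 → q.re ≤ 1 := fun q hq =>
      (Complex.re_le_norm q).trans (mem_closedBall_zero_iff.1 hq)
    have h1 := hr p hp
    have h2 := hr p' hp'
    obtain ⟨-, ⟨rfl, -, h3⟩ | ⟨rfl, -, h3⟩⟩ := apply_diskChart_cases (J := J) ha p <;>
    obtain ⟨-, ⟨rfl, -, h4⟩ | ⟨rfl, -, h4⟩⟩ := apply_diskChart_cases (J := J) (hi ▸ ha) p'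
    · rfl
    · rw [h] at h3; linarith
    · rw [h] at h3; linarith
    · rfl
  · rcases i with _ | j
    · simp at ha
    rcases i' with _ | j'
    · exact absurd hi ha
    · simpa using hi

lemma neckPoint_mem_neckZone (hc : 0 < c) (hc1 : c ≤ 1 / 10) {y t : ℝ} (hy : |y| ≤ 1)
    (ht : |t| < 1) : neckPoint c (y * neckWidth t) t ∈ neckZone c ∧
      |(neckPoint c (y * neckWidth t) t).im| =
        c * neckWidth ((neckPoint c (y * neckWidth t) t).re /
          nearSide (neckPoint c (y * neckWidth t) t).im) * |y| := by
  have h1 := one_le_neckWidth ht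
  have h2 := neckWidth_lt_two ht
  have h3 : (neckPoint c (y * neckWidth t) t).re / nearSide (neckPoint c (y * neckWidth t) t).im
      = t := by
    simp only [neckPoint]; rw [mul_div_cancel_right₀ _ (nearSide_pos _).ne']
  have h4 : |(neckPoint c (y * neckWidth t) t).im| = c * neckWidth t * |y| := by
    simp only [neckPoint]
    rw [abs_mul, abs_mul, abs_of_pos hc, abs_of_pos (by linarith : 0 < neckWidth t)]; ring
  have h5 : c * neckWidth t * |y| ≤ c * neckWidth t :=
    mul_le_of_le_one_right (by positivity) hy
  refine ⟨⟨?_, abs_re_neckPoint_lt ht, ?_⟩, ?_⟩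
  · rw [h4]; nlinarith
  · rw [h3, h4]; exact h5
  · rw [h3, h4]

lemma exists_neckPoint_of_mem_neckZone (hc : 0 < c) {z : ℂ} (hz : z ∈ neckZone c) :
    ∃ y t : ℝ, |y| ≤ 1 ∧ |t| < 1 ∧ z = neckPoint c (y * neckWidth t) t := by
  obtain ⟨h1, h2, h3⟩ := hz
  have ht := abs_div_nearSide_lt h2
  have hw := one_le_neckWidth ht
  have hw' : 0 < neckWidth (z.re / nearSide z.im) := by linarith
  refine ⟨z.im / c / neckWidth (z.re / nearSide z.im), z.re / nearSide z.im, ?_, ht, ?_⟩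
  · rw [abs_div, abs_div, abs_of_pos hc, abs_of_pos hw', div_div, div_le_one (by positivity)]
    exact h3
  · rw [div_mul_cancel₀ _ hw'.ne']
    exact (neckPoint_neckCoord hc z).symm

lemma glue_cases (hc : 0 < c) (hJ : ∀ z, J z ∈ dumbbell c ↔ z ∈ closedBall (0 : ℂ) 1) (j : ι)
    {z : ℂ} (hz : z ∈ closedBall (0 : ℂ) 1) :
    (∃ i : Option ι, ∃ p ∈ closedBall (0 : ℂ) 1, i.getD a = j ∧ z = (diskChart J a i).symm p) ∨
    (j = a ∧ ∃ y t : ℝ, |y| ≤ 1 ∧ |t| < 1 ∧ z = J.symm (neckPoint c (y * neckWidth t) t)) := by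
  by_cases hj : j = a
  · subst hj
    rcases (hJ z).2 hz with (h | h) | h
    · refine Or.inl ⟨some j, rightPerm (J z), ?_, rfl, ?_⟩
      · rw [← sub_mem_closedBall_two]
        convert h using 1
        exact two_sub_conj_two_sub_conj _
      · rw [diskChart_some_self, Equiv.eq_symm_apply]; rfl
    · refine Or.inl ⟨none, leftPerm (J z), ?_, rfl, ?_⟩
      · rw [← sub_mem_closedBall_neg_two]
        convert h using 1
        simp [leftPerm]
      · rw [diskChart_none, Equiv.eq_symm_apply]; rfl
    · obtain ⟨y, t, hy, ht, h⟩ := exists_neckPoint_of_mem_neckZone hc h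
      exact Or.inr ⟨rfl, y, t, hy, ht, by rw [← h, Equiv.symm_apply_apply]⟩
  · exact Or.inl ⟨some j, z, hz, rfl, by rw [diskChart_some_of_ne hj]; rfl⟩

/-- The arc of the boundary of the unit disk at which the band is attached. -/
def attachArc (c : ℝ) : Set ℂ := {p | 0 < p.re ∧ |p.im| < 2 * c}

lemma diskChart_mem_sphere (hJ' : ∀ z, J z ∈ dumbbellBoundary c ↔ z ∈ sphere (0 : ℂ) 1)
    (i : Option ι) {p : ℂ} (hp : p ∈ closedBall (0 : ℂ) 1) :
    (diskChart J a i).symm p ∈ sphere (0 : ℂ) 1 ↔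
      p ∈ sphere (0 : ℂ) 1 ∧ ¬ (i.getD a = a ∧ p ∈ attachArc c) := by
  by_cases hi : i.getD a = a
  · have hr : p.re ≤ 1 := (Complex.re_le_norm p).trans (mem_closedBall_zero_iff.1 hp)
    have h0 := nearSide_le_abs_diskChart (J := J) hi hp
    set z := J ((diskChart J a i).symm p) with hz
    have hN : z ∉ neckZone c := fun h => absurd h.2.1 (not_lt.2 h0)
    rw [← hJ', ← hz, dumbbellBoundary]
    have e1 : z ∈ {z | z ∈ neckZone c ∧ |z.im| = c * neckWidth (z.re / nearSide z.im)} ↔ False :=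
      ⟨fun h => hN h.1, False.elim⟩
    rw [mem_union, e1, or_false]
    change (_ ∧ _) ↔ _
    have hsq : p.re ^ 2 + p.im ^ 2 = 1 ↔ p ∈ sphere (0 : ℂ) 1 := by
      rw [mem_sphere_zero_iff_norm, ← pow_eq_one_iff_of_nonneg (norm_nonneg p) two_ne_zero,
        Complex.sq_norm, Complex.normSq_apply, sq, sq]
    have h1 : z.im = p.im ∧ |z.re| = 2 - p.re := by
      obtain ⟨h1, ⟨-, -, h2⟩ | ⟨-, -, h2⟩⟩ := apply_diskChart_cases (J := J) hi p
      · exact ⟨h1, by rw [hz, h2, abs_of_nonneg (by linarith)]⟩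
      · exact ⟨h1, by rw [hz, h2, abs_of_nonpos (by linarith)]; ring⟩
    rw [mem_spheres_iff, h1.1, h1.2, ← hsq, attachArc, Set.mem_ofPred_eq]
    simp only [hi, true_and]
    have e2 : (2 - p.re - 2) ^ 2 = p.re ^ 2 := by ring
    have e3 : 2 - p.re < 2 ↔ 0 < p.re := by constructor <;> intro <;> linarith
    rw [e2, e3]
  · rcases i with _ | j
    · simp at hi
    · rw [diskChart_some_of_ne (by simpa using hi)]
      simp only [hi, false_and, not_false_eq_true, and_true]
      rfl

lemma eq_endChart_of_mem_attachArc {p : ℂ} (hp : p ∈ sphere (0 : ℂ) 1) (h : p ∈ attachArc c) :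
    p = endChart 1 p.im := by
  have hsq : p.re ^ 2 + p.im ^ 2 = 1 := by
    rw [mem_sphere_zero_iff_norm] at hp
    have := Complex.sq_norm p
    rw [Complex.normSq_apply, hp] at this
    linarith
  apply Complex.ext
  · simp only [endChart, nearSide]
    rw [show 1 - p.im ^ 2 = p.re ^ 2 by linarith, Real.sqrt_sq h.1.le]; ring
  · rfl

lemma neckPoint_mem_sphere (hc : 0 < c) (hc1 : c ≤ 1 / 10)
    (hJ' : ∀ z, J z ∈ dumbbellBoundary c ↔ z ∈ sphere (0 : ℂ) 1) {y t : ℝ} (hy : |y| ≤ 1)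
    (ht : |t| < 1) :
    J.symm (neckPoint c (y * neckWidth t) t) ∈ sphere (0 : ℂ) 1 ↔ |y| = 1 := by
  obtain ⟨h1, h2⟩ := neckPoint_mem_neckZone hc hc1 hy ht
  rw [← hJ', Equiv.apply_symm_apply]
  set z := neckPoint c (y * neckWidth t) t
  have h3 := one_le_neckWidth (abs_div_nearSide_lt h1.2.1)
  have h4 : 0 < c * neckWidth (z.re / nearSide z.im) := by positivity
  have h5 : z ∉ sphere (2 : ℂ) 1 ∪ sphere (-2 : ℂ) 1 := by
    rw [mem_spheres_iff]
    intro h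
    refine absurd h1.2.1 (not_lt.2 ?_)
    rw [nearSide_le_abs_iff (h1.2.1.le.trans (nearSide_le_two _)) h1.1.le]
    exact h.le
  constructor
  · rintro (⟨h, -⟩ | ⟨-, h⟩)
    · exact absurd h h5
    · rw [h2] at h
      exact (mul_eq_left₀ h4.ne').1 h
  · intro h
    exact Or.inr ⟨h1, by rw [h2, h, mul_one]⟩

/-- The joined disks agree with the old ones, near each point of the old ones. -/
lemma glued_diskChart (hη : 0 < η) (hη1 : η ≤ 1) (hJs : Continuous J)
    (hJ : ∀ z, J z ∈ dumbbell c ↔ z ∈ closedBall (0 : ℂ) 1) {R : ℝ} (hR : 1 < R)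
    (hρ : ∀ x ∈ ball (0 : ℂ) R, ρ x = x) (i : Option ι) {p : ℂ} (hp : p ∈ closedBall (0 : ℂ) 1) :
    ∀ᶠ z in nhds ((diskChart J a i).symm p),
      glued D a Φ c η J ρ (i.getD a) z = D i (diskChart J a i z) := by
  have e0 : ∀ᶠ z in nhds ((diskChart J a i).symm p), ρ z = z := by
    filter_upwards [isOpen_ball.mem_nhds (closedBall_subset_ball hR
      (diskChart_mem_closedBall hJ i hp))] with z hz using hρ z hz
  have hg := nearSide_pos p.im
  have hle := nearSide_im_le hp
  have hlt : (1 - η) * nearSide p.im < nearSide p.im := by nlinarith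
  rcases i with _ | j
  · have e1 : ∀ᶠ z in nhds ((diskChart J a none).symm p),
        (J z).re < -((1 - η) * nearSide (J z).im) := by
      refine hJs.continuousAt.eventually (left_mem_nhds (η := η) ?_)
      rw [apply_diskChart_none]
      simp only [Complex.sub_re, Complex.sub_im, Complex.re_ofNat, Complex.im_ofNat, sub_zero]
      linarith [le_abs_self p.re]
    filter_upwards [e0, e1] with z h0 h1
    rw [Option.getD_none, glued_self, h0, dumbbellMap_left hη1 h1]; rfl
  · by_cases hj : j = a
    · subst hj
      have e1 : ∀ᶠ z in nhds ((diskChart J j (some j)).symm p),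
          (1 - η) * nearSide (J z).im < (J z).re := by
        refine hJs.continuousAt.eventually (right_mem_nhds (η := η) ?_)
        rw [apply_diskChart_some]
        simp only [Complex.sub_re, Complex.sub_im, Complex.re_ofNat, Complex.im_ofNat,
          Complex.conj_re, Complex.conj_im, sub_neg_eq_add, zero_add]
        linarith [le_abs_self p.re]
      filter_upwards [e0, e1] with z h0 h1
      rw [Option.getD_some, glued_self, h0, dumbbellMap_right h1, diskChart_some_self]; rfl
    · refine Filter.Eventually.of_forall fun z => ?_
      rw [Option.getD_some, glued_of_ne hj, diskChart_some_of_ne hj]; rfl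

/-- The joined disks agree with the band, near each point of the neck. -/
lemma glued_neck (hA : IsAdapted D a Φ c η) (hJs : Continuous J)
    (hJ : ∀ z, J z ∈ dumbbell c ↔ z ∈ closedBall (0 : ℂ) 1) {R : ℝ} (hR : 1 < R)
    (hρ : ∀ x ∈ ball (0 : ℂ) R, ρ x = x) {y t : ℝ} (hy : |y| ≤ 1) (ht : |t| < 1) :
    ∀ᶠ z in nhds (J.symm (neckPoint c (y * neckWidth t) t)),
      glued D a Φ c η J ρ a z = Φ (neckCoord c (J z)) := by
  have hz := (neckPoint_mem_neckZone hA.c_pos hA.c_le hy ht).1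
  have h2 := neckWidth_lt_two (abs_div_nearSide_lt hz.2.1)
  have hm : J.symm (neckPoint c (y * neckWidth t) t) ∈ closedBall (0 : ℂ) 1 := by
    rw [← hJ, Equiv.apply_symm_apply]; exact Or.inr hz
  have e0 : ∀ᶠ z in nhds (J.symm (neckPoint c (y * neckWidth t) t)), ρ z = z := by
    filter_upwards [isOpen_ball.mem_nhds (closedBall_subset_ball hR hm)] with z hz using hρ z hz
  have e1 : ∀ᶠ z in nhds (J.symm (neckPoint c (y * neckWidth t) t)),
      |(J z).im| < 5 / 2 * c ∧ |(J z).re| < nearSide (J z).im := by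
    refine hJs.continuousAt.eventually (neck_mem_nhds ?_ ?_) <;> rw [Equiv.apply_symm_apply]
    · have := hz.2.2
      nlinarith [hA.c_pos]
    · exact hz.2.1
  filter_upwards [e0, e1] with z h0 h1
  rw [glued_self, h0, dumbbellMap_neck hA h1.1 h1.2]; rfl

lemma glued_diskChart_apply (hη : 0 < η) (hη1 : η ≤ 1) (hJs : Continuous J)
    (hJ : ∀ z, J z ∈ dumbbell c ↔ z ∈ closedBall (0 : ℂ) 1) {R : ℝ} (hR : 1 < R)
    (hρ : ∀ x ∈ ball (0 : ℂ) R, ρ x = x) (i : Option ι) {p : ℂ} (hp : p ∈ closedBall (0 : ℂ) 1) :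
    glued D a Φ c η J ρ (i.getD a) ((diskChart J a i).symm p) = D i p := by
  rw [(glued_diskChart hη hη1 hJs hJ hR hρ i hp).self_of_nhds, Equiv.apply_symm_apply]

lemma glued_neck_apply (hA : IsAdapted D a Φ c η) (hJs : Continuous J)
    (hJ : ∀ z, J z ∈ dumbbell c ↔ z ∈ closedBall (0 : ℂ) 1) {R : ℝ} (hR : 1 < R)
    (hρ : ∀ x ∈ ball (0 : ℂ) R, ρ x = x) {y t : ℝ} (hy : |y| ≤ 1) (ht : |t| < 1) :
    glued D a Φ c η J ρ a (J.symm (neckPoint c (y * neckWidth t) t)) =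
      Φ (y * neckWidth t, t, 0) := by
  rw [(glued_neck hA hJs hJ hR hρ hy ht).self_of_nhds, Equiv.apply_symm_apply,
    neckCoord_neckPoint hA.c_pos]

lemma dumbbellMap_contDiffAt (hD : ∀ i, ContDiff ℝ ∞ (D i)) (hΦ : ContDiff ℝ ∞ Φ)
    (hA : IsAdapted D a Φ c η) {z : ℂ} (hz : (1 - η) * nearSide z.im < z.re ∨
      z.re < -((1 - η) * nearSide z.im) ∨ (|z.im| < 5 / 2 * c ∧ |z.re| < nearSide z.im)) :
    ContDiffAt ℝ ∞ (dumbbellMap (D (some a)) (D none) Φ c η) z := by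
  rcases hz with h | h | ⟨h, h'⟩
  · have : ContDiffAt ℝ ∞ (fun z => D (some a) (rightPerm z)) z :=
      ((hD _).comp contDiff_rightPerm).contDiffAt
    refine this.congr_of_eventuallyEq ?_
    filter_upwards [right_mem_nhds h] with w hw using dumbbellMap_right hw
  · have : ContDiffAt ℝ ∞ (fun z => D none (leftPerm z)) z :=
      ((hD _).comp contDiff_leftPerm).contDiffAt
    refine this.congr_of_eventuallyEq ?_
    filter_upwards [left_mem_nhds h] with w hw using dumbbellMap_left hA.η_le hw
  · have h1 : |z.im| < 1 := by have := hA.c_le; linarith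
    refine ContDiffAt.congr_of_eventuallyEq (hΦ.contDiffAt.comp z (contDiffAt_neckCoord (c := c) h1))
      ?_
    filter_upwards [neck_mem_nhds h h'] with w hw using dumbbellMap_neck hA hw.1 hw.2

lemma isOpen_dumbbell_cover (c η : ℝ) : IsOpen {z : ℂ | (1 - η) * nearSide z.im < z.re ∨
      z.re < -((1 - η) * nearSide z.im) ∨ (|z.im| < 5 / 2 * c ∧ |z.re| < nearSide z.im)} := by
  rw [isOpen_iff_mem_nhds]
  rintro z (h | h | ⟨h, h'⟩)
  · filter_upwards [right_mem_nhds h] with w hw using Or.inl hw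
  · filter_upwards [left_mem_nhds h] with w hw using Or.inr (Or.inl hw)
  · filter_upwards [neck_mem_nhds h h'] with w hw using Or.inr (Or.inr hw)

lemma dumbbell_subset_cover (hc : 0 < c) (hη : 0 < η) {z : ℂ} (hz : z ∈ dumbbell c) :
    (1 - η) * nearSide z.im < z.re ∨
      z.re < -((1 - η) * nearSide z.im) ∨ (|z.im| < 5 / 2 * c ∧ |z.re| < nearSide z.im) := by
  have hg := nearSide_pos z.im
  have hlt : (1 - η) * nearSide z.im < nearSide z.im := by nlinarith
  rcases hz with h | h
  · rw [mem_closedBalls_iff] at h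
    have h1 : |z.im| ≤ 1 := by rw [← sq_le_one_iff_abs_le_one]; nlinarith [sq_nonneg (|z.re| - 2)]
    have h2 : nearSide z.im ≤ |z.re| := by
      have : 2 - |z.re| ≤ √(1 - z.im ^ 2) := Real.le_sqrt_of_sq_le (by linarith)
      unfold nearSide; linarith
    rcases le_total 0 z.re with h0 | h0
    · rw [abs_of_nonneg h0] at h2; left; linarith
    · rw [abs_of_nonpos h0] at h2; right; left; linarith
  · have h2 := neckWidth_lt_two (abs_div_nearSide_lt h.2.1)
    refine Or.inr (Or.inr ⟨?_, h.2.1⟩)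
    have := h.2.2
    nlinarith

end Glue

section GlueRibbon

variable {ι : Type} {D : Option ι → ℂ → E3} {a : ι} {Φ : E3 → E3} {c η : ℝ} {J : Equiv.Perm ℂ}
  {ρ : ℂ → ℂ}

lemma Option.getD_eq_iff_of_neck {i : Option ι} : i.getD a = a ↔ i = some a ∨ i = none := by
  rcases i with _ | j <;> simp

lemma two_mul_mem_Icc {t : ℝ} (ht : t ∈ Icc (0 : ℝ) 1) : 2 * t - 1 ∈ Icc (-1 : ℝ) 1 :=
  ⟨by linarith [ht.1], by linarith [ht.2]⟩

/-- Points of the attaching arcs are not double points. -/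
lemma IsAdapted.not_double (hA : IsAdapted D a Φ c η) {i i' : Option ι} {p p' : ℂ}
    (hi : i.getD a = a) (hp : p ∈ sphere (0 : ℂ) 1) (hpa : p ∈ attachArc c)
    (hp' : p' ∈ closedBall (0 : ℂ) 1) (h : D i' p' = D i p) : i' = i ∧ p' = p := by
  have e := eq_endChart_of_mem_attachArc hp hpa
  have hc := hA.c_pos
  have hu : |p.im / c| ≤ 2 := by
    rw [abs_div, abs_of_pos hc, div_le_iff₀ hc]; exact hpa.2.le
  have hY : |p.im| < 5 / 2 * c := by have := hpa.2; linarith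
  have h1 : |(1 : ℝ) - 1| < η := by simpa using hA.η_pos
  have e2 : endChart 1 (c * (p.im / c)) = p := by rw [mul_div_cancel₀ _ hc.ne', ← e]
  rcases Option.getD_eq_iff_of_neck.1 hi with rfl | rfl
  · rw [e, hA.end_eq 1 _ hY h1] at h
    obtain ⟨rfl, rfl⟩ := hA.end_unique i' p' hp' _ hu h
    exact ⟨rfl, e2⟩
  · rw [e, hA.start_eq 1 _ hY h1] at h
    obtain ⟨rfl, rfl⟩ := hA.start_unique i' p' hp' _ hu h
    exact ⟨rfl, e2⟩

lemma mem_bandBox_of_neck {y t : ℝ} (hy : |y| ≤ 1) (ht : |t| < 1) :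
    ((y * neckWidth t, t, 0) : E3) ∈ bandBox := by
  have h1 := one_le_neckWidth ht
  have h2 := neckWidth_lt_two ht
  rw [abs_le] at hy
  rw [abs_lt] at ht
  refine ⟨⟨?_, ?_⟩, ⟨by linarith, by linarith⟩, ⟨by norm_num, by norm_num⟩⟩ <;> simp only <;> nlinarith

lemma neckPoint_arc_smooth (hc : 0 < c) (hc1 : c ≤ 1 / 10) (hJ : ContDiff ℝ ∞ J.symm) {s : ℝ → ℝ}
    (hs : ContDiffOn ℝ 1 s (Icc (-1) 1)) (hs1 : ∀ y ∈ Icc (-1 : ℝ) 1, |s y| < 1) :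
    ContDiffOn ℝ 1 (fun t => J.symm (neckPoint c ((2 * t - 1) * neckWidth (s (2 * t - 1)))
      (s (2 * t - 1)))) (Icc 0 1) := by
  have h1 : ContDiffOn ℝ 1 (fun t : ℝ => s (2 * t - 1)) (Icc 0 1) :=
    hs.comp (by fun_prop) fun t ht => two_mul_mem_Icc ht
  have h2 : ContDiffOn ℝ 1 (fun t : ℝ => (2 * t - 1) * neckWidth (s (2 * t - 1))) (Icc 0 1) := by
    refine ContDiffOn.mul (by fun_prop) ?_
    exact (contDiffOn_neckWidth.of_le (by simp)).comp h1 fun t ht =>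
      abs_lt.1 (hs1 _ (two_mul_mem_Icc ht))
  intro t ht
  have h3 := hs1 _ (two_mul_mem_Icc ht)
  have h4 : |c * ((2 * t - 1) * neckWidth (s (2 * t - 1)))| < 1 := by
    have e1 := one_le_neckWidth h3
    have e2 := neckWidth_lt_two h3
    have e3 : |2 * t - 1| ≤ 1 := abs_le.2 (two_mul_mem_Icc ht)
    rw [abs_mul, abs_mul, abs_of_pos hc, abs_of_pos (by linarith : 0 < neckWidth _)]
    have e4 : |2 * t - 1| * neckWidth (s (2 * t - 1)) ≤ 2 := by
      nlinarith [abs_nonneg (2 * t - 1)]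
    nlinarith [mul_nonneg (abs_nonneg (2 * t - 1)) (by linarith : 0 ≤ neckWidth (s (2 * t - 1)))]
  have h5 := (contDiffAt_neckPoint (s := s (2 * t - 1)) h4).of_le (m := 1) (by simp)
  have h6 := h5.comp_contDiffWithinAt (x := t) (f := fun t : ℝ =>
    ((2 * t - 1) * neckWidth (s (2 * t - 1)), s (2 * t - 1))) (h2.prodMk h1 t ht)
  exact (hJ.of_le (by simp)).contDiffAt.comp_contDiffWithinAt t h6

lemma injective_fderiv_perm {E : Type*} [NormedAddCommGroup E] [NormedSpace ℝ E] {J : Equiv.Perm E}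
    (h1 : ContDiff ℝ ∞ J) (h2 : ContDiff ℝ ∞ J.symm) (x : E) :
    Function.Injective (fderiv ℝ J x) :=
  injective_fderiv_of_leftInverse (g := J.symm) (h1.differentiable (by simp) x)
    (h2.differentiable (by simp) _) (Filter.Eventually.of_forall J.symm_apply_apply)

lemma surjective_fderiv_perm {E : Type*} [NormedAddCommGroup E] [NormedSpace ℝ E] {J : Equiv.Perm E}
    (h1 : ContDiff ℝ ∞ J) (h2 : ContDiff ℝ ∞ J.symm) (x : E) :
    Function.Surjective (fderiv ℝ J x) := by
  intro v
  have e1 := (h2.differentiable (by simp) (J x)).hasFDerivAt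
  have e2 : HasFDerivAt J (fderiv ℝ J x) (J.symm (J x)) := by
    rw [J.symm_apply_apply]; exact (h1.differentiable (by simp) x).hasFDerivAt
  have e3 := e2.comp (J x) e1
  have e4 : HasFDerivAt (J ∘ J.symm) (ContinuousLinearMap.id ℝ E) (J x) :=
    (hasFDerivAt_id (J x)).congr_of_eventuallyEq
      (Filter.Eventually.of_forall J.apply_symm_apply)
  exact ⟨_, DFunLike.congr_fun (e3.unique e4) v⟩

/-- The family obtained by joining two disks along an adapted band is again a ribbon family: the
new singularities are the arcs in which the disks cross the neck. -/
theorem isRibbonFamily_glued (hD : IsRibbonFamily D) (hB : IsBand D a Φ)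
    (hA : IsAdapted D a Φ c η) {κ' : Type} [Finite κ'] (X : BandCrossings D Φ κ')
    (hJ1 : ContDiff ℝ ∞ J) (hJ2 : ContDiff ℝ ∞ J.symm)
    (hJ : ∀ z, J z ∈ dumbbell c ↔ z ∈ closedBall (0 : ℂ) 1)
    (hJ' : ∀ z, J z ∈ dumbbellBoundary c ↔ z ∈ sphere (0 : ℂ) 1)
    {R : ℝ} (hR : 1 < R) (hρ1 : ContDiff ℝ ∞ ρ) (hρ : ∀ x ∈ ball (0 : ℂ) R, ρ x = x)
    (hcov : ∀ z, (1 - η) * nearSide (J (ρ z)).im < (J (ρ z)).re ∨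
      (J (ρ z)).re < -((1 - η) * nearSide (J (ρ z)).im) ∨
      (|(J (ρ z)).im| < 5 / 2 * c ∧ |(J (ρ z)).re| < nearSide (J (ρ z)).im)) :
    IsRibbonFamily (glued D a Φ c η J ρ) := by
  have hc := hA.c_pos
  have hJc := hJ1.continuous
  have gC := fun i p (hp : p ∈ closedBall (0 : ℂ) 1) =>
    glued_diskChart (D := D) (a := a) (Φ := Φ) hA.η_pos hA.η_le hJc hJ hR hρ i hp
  have gCa := fun i p (hp : p ∈ closedBall (0 : ℂ) 1) =>
    glued_diskChart_apply (D := D) (a := a) (Φ := Φ) hA.η_pos hA.η_le hJc hJ hR hρ i hp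
  have gN := fun y t (hy : |y| ≤ 1) (ht : |t| < 1) => glued_neck hA hJc hJ hR hρ hy ht
  have gNa := fun y t (hy : |y| ≤ 1) (ht : |t| < 1) => glued_neck_apply hA hJc hJ hR hρ hy ht
  have hmem := fun i p (hp : p ∈ closedBall (0 : ℂ) 1) => diskChart_mem_closedBall (a := a) hJ i hp
  have hsph := fun i p (hp : p ∈ closedBall (0 : ℂ) 1) => diskChart_mem_sphere (a := a) hJ' i hp
  have hnm : ∀ y t, |y| ≤ 1 → |t| < 1 →
      J.symm (neckPoint c (y * neckWidth t) t) ∈ closedBall (0 : ℂ) 1 := by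
    intro y t hy ht
    rw [← hJ, Equiv.apply_symm_apply]
    exact Or.inr (neckPoint_mem_neckZone hc hA.c_le hy ht).1
  have hballc : ∀ i p, p ∈ ball (0 : ℂ) 1 → (diskChart J a i).symm p ∈ ball (0 : ℂ) 1 := by
    intro i p hp
    have h1 := hmem i p (ball_subset_closedBall hp)
    have h2 : (diskChart J a i).symm p ∉ sphere (0 : ℂ) 1 := fun h => by
      have := ((hsph i p (ball_subset_closedBall hp)).1 h).1
      rw [mem_sphere] at this
      exact absurd (mem_ball.1 hp) (by rw [this]; exact lt_irrefl _)
    exact mem_ball.2 (lt_of_le_of_ne (mem_closedBall.1 h1) h2)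
  -- the derivatives of the joined disks
  have dC : ∀ i p, p ∈ closedBall (0 : ℂ) 1 →
      fderiv ℝ (glued D a Φ c η J ρ (i.getD a)) ((diskChart J a i).symm p) =
        (fderiv ℝ (D i) p).comp (fderiv ℝ (diskChart J a i) ((diskChart J a i).symm p)) := by
    intro i p hp
    rw [Filter.EventuallyEq.fderiv_eq (gC i p hp)]
    have h1 := hD.differentiable i (diskChart J a i ((diskChart J a i).symm p))
    have h2 := (contDiff_diskChart (a := a) hJ1 i).differentiable (by simp)
      ((diskChart J a i).symm p)
    have h3 := fderiv_comp ((diskChart J a i).symm p) h1 h2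
    rw [Equiv.apply_symm_apply] at h3
    exact h3
  have dN : ∀ y t, |y| ≤ 1 → |t| < 1 →
      fderiv ℝ (glued D a Φ c η J ρ a) (J.symm (neckPoint c (y * neckWidth t) t)) =
        (fderiv ℝ Φ (y * neckWidth t, t, 0)).comp
          ((fderiv ℝ (neckCoord c) (neckPoint c (y * neckWidth t) t)).comp
            (fderiv ℝ J (J.symm (neckPoint c (y * neckWidth t) t)))) ∧
      |(neckPoint c (y * neckWidth t) t).im| < 1 := by
    intro y t hy ht
    have him := (neckPoint_mem_neckZone hc hA.c_le hy ht).1.1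
    refine ⟨?_, him⟩
    rw [Filter.EventuallyEq.fderiv_eq (gN y t hy ht)]
    have h1 := (hJ1.differentiable (by simp) (J.symm (neckPoint c (y * neckWidth t) t))).hasFDerivAt
    have h2 := ((contDiffAt_neckCoord (c := c) him).differentiableAt (by simp)).hasFDerivAt
    have h3 := (hB.contDiff.differentiable (by simp)
      ((y * neckWidth t, t, 0) : E3)).hasFDerivAt
    have e1 : neckPoint c (y * neckWidth t) t = J (J.symm (neckPoint c (y * neckWidth t) t)) :=
      (Equiv.apply_symm_apply _ _).symm
    rw [e1] at h2
    have h4 := h2.comp _ h1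
    have e2 : ((y * neckWidth t, t, 0) : E3) = (neckCoord c ∘ J)
        (J.symm (neckPoint c (y * neckWidth t) t)) := by
      rw [Function.comp_apply, ← e1, neckCoord_neckPoint hc]
    rw [e2] at h3
    have h5 := (h3.comp _ h4).fderiv
    rw [← e2] at h5
    simp only [← e1] at h5
    exact h5
  obtain ⟨h1, h2, κ, hκ, ⟨A⟩⟩ := hD
  have hαc : ∀ s, ∀ t ∈ Icc (0 : ℝ) 1, A.α s t ∈ closedBall (0 : ℂ) 1 := fun s t ht =>
    ball_subset_closedBall (A.α_mem s t ht)
  have hγc : ∀ r, ∀ y ∈ Icc (-1 : ℝ) 1, X.γ r y ∈ closedBall (0 : ℂ) 1 := fun r y hy =>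
    ball_subset_closedBall (X.γ_mem r y hy)
  -- a crossing of the band is not an old double point
  have hγα : ∀ r, ∀ y ∈ Icc (-1 : ℝ) 1, ∀ s, ∀ t ∈ Icc (0 : ℝ) 1,
      ¬ (A.a s = X.i r ∧ A.α s t = X.γ r y) := by
    rintro r y hy s t ht ⟨e1, e2⟩
    obtain ⟨e3, e4⟩ := X.unique r y hy (A.b s) _ (A.β_mem s t ht)
      (by rw [← e1, ← e2, A.double s t ht])
    exact A.αβ_ne s s t ht t ht (e1.trans e3.symm) (e2.trans e4.symm)
  have hγβ : ∀ r, ∀ y ∈ Icc (-1 : ℝ) 1, ∀ s, ∀ t ∈ Icc (0 : ℝ) 1,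
      ¬ (A.b s = X.i r ∧ A.β s t = X.γ r y) := by
    rintro r y hy s t ht ⟨e1, e2⟩
    obtain ⟨e3, e4⟩ := X.unique r y hy (A.a s) _ (hαc s t ht)
      (by rw [← e1, ← e2, A.double s t ht])
    exact A.αβ_ne s s t ht t ht (e3.trans e1.symm) (e4.trans e2.symm)
  refine ⟨fun j => ?_, fun j z hz => ?_, κ ⊕ κ', inferInstance, ⟨{
    a := Sum.elim (fun s => (A.a s).getD a) (fun r => (X.i r).getD a)
    b := Sum.elim (fun s => (A.b s).getD a) (fun _ => a)
    α := Sum.elim (fun s t => (diskChart J a (A.a s)).symm (A.α s t))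
      (fun r t => (diskChart J a (X.i r)).symm (X.γ r (2 * t - 1)))
    β := Sum.elim (fun s t => (diskChart J a (A.b s)).symm (A.β s t))
      (fun r t => J.symm (neckPoint c ((2 * t - 1) * neckWidth (X.s r (2 * t - 1)))
        (X.s r (2 * t - 1))))
    α_smooth := ?_
    β_smooth := ?_
    α_mem := ?_
    β_mem := ?_
    β_sphere := ?_
    α_inj := ?_
    β_inj := ?_
    αβ_ne := ?_
    double := ?_
    transverse := ?_
    complete := ?_ }⟩⟩
  · by_cases hj : j = a
    · subst hj
      refine contDiff_iff_contDiffAt.2 fun z => ?_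
      have := (dumbbellMap_contDiffAt h1 hB.contDiff hA (hcov z)).comp z
        ((hJ1.comp hρ1).contDiffAt (x := z))
      refine this.congr_of_eventuallyEq (Filter.Eventually.of_forall fun w => ?_)
      exact glued_self w
    · rw [glued_of_ne hj]; exact h1 _
  · rcases glue_cases (a := a) hc hJ j hz with ⟨i, p, hp, rfl, rfl⟩ | ⟨rfl, y, t, hy, ht, rfl⟩
    · rw [dC i p hp]
      exact (h2 i p hp).comp (injective_fderiv_perm (contDiff_diskChart hJ1 i)
        (contDiff_diskChart_symm hJ2 i) _)
    · obtain ⟨e, him⟩ := dN y t hy ht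
      rw [e]
      exact (hB.imm _ (mem_bandBox_of_neck hy ht)).comp
        ((injective_fderiv_neckCoord hc him).comp (injective_fderiv_perm hJ1 hJ2 _))
  · rintro (s | r)
    · exact ((contDiff_diskChart_symm hJ2 _).of_le (by simp)).comp_contDiffOn (A.α_smooth s)
    · refine ((contDiff_diskChart_symm hJ2 _).of_le (by simp)).comp_contDiffOn ?_
      exact (X.γ_smooth r).comp (by fun_prop) fun t ht => two_mul_mem_Icc ht
  · rintro (s | r)
    · exact ((contDiff_diskChart_symm hJ2 _).of_le (by simp)).comp_contDiffOn (A.β_smooth s)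
    · exact neckPoint_arc_smooth hc hA.c_le hJ2 (X.s_smooth r) (X.s_lt r)
  · rintro (s | r) t ht
    · exact hballc _ _ (A.α_mem s t ht)
    · exact hballc _ _ (X.γ_mem r _ (two_mul_mem_Icc ht))
  · rintro (s | r) t ht
    · exact hmem _ _ (A.β_mem s t ht)
    · exact hnm _ _ (abs_le.2 (two_mul_mem_Icc ht)) (X.s_lt r _ (two_mul_mem_Icc ht))
  · rintro (s | r) t ht
    · simp only [Sum.elim_inl]
      rw [hsph _ _ (A.β_mem s t ht), A.β_sphere s t ht]
      refine ⟨fun h => h.1, fun h => ⟨h, ?_⟩⟩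
      rintro ⟨h3, h4⟩
      have h5 := hA.not_double h3 ((A.β_sphere s t ht).2 h) h4 (hαc s t ht) (A.double s t ht)
      exact A.αβ_ne s s t ht t ht h5.1 h5.2
    · simp only [Sum.elim_inr]
      rw [neckPoint_mem_sphere hc hA.c_le hJ' (abs_le.2 (two_mul_mem_Icc ht))
        (X.s_lt r _ (two_mul_mem_Icc ht)), abs_eq one_pos.le]
      constructor
      · rintro (h | h)
        · right; linarith
        · left; linarith
      · rintro (rfl | rfl) <;> norm_num
  · rintro (s | r) (s' | r') t ht t' ht' e1 e2
    · obtain ⟨e3, e4⟩ := diskChart_inj e1 (hαc s t ht) (hαc s' t' ht') e2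
      obtain ⟨rfl, rfl⟩ := A.α_inj s s' t ht t' ht' e3 e4
      exact ⟨rfl, rfl⟩
    · obtain ⟨e3, e4⟩ := diskChart_inj e1 (hαc s t ht) (hγc r' _ (two_mul_mem_Icc ht')) e2
      exact absurd ⟨e3, e4⟩ (hγα r' _ (two_mul_mem_Icc ht') s t ht)
    · obtain ⟨e3, e4⟩ := diskChart_inj e1 (hγc r _ (two_mul_mem_Icc ht)) (hαc s' t' ht') e2
      exact absurd ⟨e3.symm, e4.symm⟩ (hγα r _ (two_mul_mem_Icc ht) s' t' ht')
    · obtain ⟨e3, e4⟩ := diskChart_inj e1 (hγc r _ (two_mul_mem_Icc ht))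
        (hγc r' _ (two_mul_mem_Icc ht')) e2
      obtain ⟨rfl, e5⟩ := X.inj r r' _ (two_mul_mem_Icc ht) _ (two_mul_mem_Icc ht') e3 e4
      exact ⟨rfl, by linarith⟩
  · rintro (s | r) (s' | r') t ht t' ht' e1 e2
    · obtain ⟨e3, e4⟩ := diskChart_inj e1 (A.β_mem s t ht) (A.β_mem s' t' ht') e2
      obtain ⟨rfl, rfl⟩ := A.β_inj s s' t ht t' ht' e3 e4
      exact ⟨rfl, rfl⟩
    · exact absurd e2 (diskChart_ne_neckPoint e1 (A.β_mem s t ht)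
        (X.s_lt r' _ (two_mul_mem_Icc ht')))
    · exact absurd e2.symm (diskChart_ne_neckPoint e1.symm (A.β_mem s' t' ht')
        (X.s_lt r _ (two_mul_mem_Icc ht)))
    · obtain ⟨e3, e4⟩ := neckPoint_inj hc (J.symm.injective e2)
      have e5 : D (X.i r) (X.γ r (2 * t - 1)) = D (X.i r') (X.γ r' (2 * t' - 1)) := by
        rw [X.eq r _ (two_mul_mem_Icc ht), X.eq r' _ (two_mul_mem_Icc ht'), e3, e4]
      obtain ⟨e6, e7⟩ := X.unique r' _ (two_mul_mem_Icc ht') _ _ (hγc r _ (two_mul_mem_Icc ht)) e5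
      obtain ⟨rfl, e8⟩ := X.inj r r' _ (two_mul_mem_Icc ht) _ (two_mul_mem_Icc ht') e6 e7
      exact ⟨rfl, by linarith⟩
  · rintro (s | r) (s' | r') t ht t' ht' e1 e2
    · obtain ⟨e3, e4⟩ := diskChart_inj e1 (hαc s t ht) (A.β_mem s' t' ht') e2
      exact A.αβ_ne s s' t ht t' ht' e3 e4
    · exact diskChart_ne_neckPoint e1 (hαc s t ht) (X.s_lt r' _ (two_mul_mem_Icc ht')) e2
    · obtain ⟨e3, e4⟩ := diskChart_inj e1 (hγc r _ (two_mul_mem_Icc ht)) (A.β_mem s' t' ht') e2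
      exact hγβ r _ (two_mul_mem_Icc ht) s' t' ht' ⟨e3.symm, e4.symm⟩
    · exact diskChart_ne_neckPoint e1 (hγc r _ (two_mul_mem_Icc ht))
        (X.s_lt r' _ (two_mul_mem_Icc ht')) e2
  · rintro (s | r) t ht
    · simp only [Sum.elim_inl]
      rw [gCa _ _ (hαc s t ht), gCa _ _ (A.β_mem s t ht), A.double s t ht]
    · simp only [Sum.elim_inr]
      rw [gCa _ _ (hγc r _ (two_mul_mem_Icc ht)), gNa _ _ (abs_le.2 (two_mul_mem_Icc ht))
        (X.s_lt r _ (two_mul_mem_Icc ht)), X.eq r _ (two_mul_mem_Icc ht)]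
  · have hr : ∀ i p, p ∈ closedBall (0 : ℂ) 1 →
        range (fderiv ℝ (glued D a Φ c η J ρ (i.getD a)) ((diskChart J a i).symm p)) =
          range (fderiv ℝ (D i) p) := by
      intro i p hp
      rw [dC i p hp, ContinuousLinearMap.coe_comp]
      exact (surjective_fderiv_perm (contDiff_diskChart hJ1 i)
        (contDiff_diskChart_symm hJ2 i) _).range_comp _
    rintro (s | r) t ht
    · simp only [Sum.elim_inl]
      rw [hr _ _ (hαc s t ht), hr _ _ (A.β_mem s t ht)]
      exact A.transverse s t ht
    · simp only [Sum.elim_inr]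
      rw [hr _ _ (hγc r _ (two_mul_mem_Icc ht))]
      intro h
      apply X.transverse r _ (two_mul_mem_Icc ht)
      obtain ⟨e, him⟩ := dN _ _ (abs_le.2 (two_mul_mem_Icc ht)) (X.s_lt r _ (two_mul_mem_Icc ht))
      rw [h, e]
      rintro _ ⟨v, rfl⟩
      exact ⟨_, fderiv_neckCoord_snd_snd him, rfl⟩
  · have key : ∀ i p, p ∈ closedBall (0 : ℂ) 1 → ∀ y t, |y| ≤ 1 → |t| < 1 →
        D i p = Φ (y * neckWidth t, t, 0) → ∃ r, ∃ t' ∈ Icc (0 : ℝ) 1,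
        (i = X.i r ∧ p = X.γ r (2 * t' - 1)) ∧
        J.symm (neckPoint c (y * neckWidth t) t) =
          J.symm (neckPoint c ((2 * t' - 1) * neckWidth (X.s r (2 * t' - 1)))
            (X.s r (2 * t' - 1))) := by
      intro i p hp y t hy ht h
      obtain ⟨r, e1, e2, e3⟩ := X.complete i p hp y (abs_le.1 hy) t ht h
      have e : 2 * ((y + 1) / 2) - 1 = y := by ring
      have hy' := abs_le.1 hy
      refine ⟨r, (y + 1) / 2, ⟨by linarith, by linarith⟩, ?_⟩
      rw [e, ← e3]
      exact ⟨⟨e1, e2⟩, rfl⟩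
    intro j j' z hz z' hz' hne h
    rcases glue_cases (a := a) hc hJ j hz with ⟨i, p, hp, rfl, rfl⟩ | ⟨hj, y, t, hy, ht, rfl⟩ <;>
    rcases glue_cases (a := a) hc hJ j' hz' with ⟨i', p', hp', rfl, rfl⟩ | ⟨hj', y', t', hy', ht', rfl⟩
    · rw [gCa _ _ hp, gCa _ _ hp'] at h
      have hne' : (i, p) ≠ (i', p') := by
        intro e
        obtain ⟨rfl, rfl⟩ := Prod.mk.inj e
        exact hne rfl
      obtain ⟨s, t, ht, h⟩ := A.complete i i' p hp p' hp' hne' h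
      refine ⟨Sum.inl s, t, ht, ?_⟩
      simp only [Prod.mk.injEq, Sum.elim_inl] at h ⊢
      refine h.imp ?_ ?_
      · rintro ⟨⟨rfl, rfl⟩, rfl, rfl⟩; exact ⟨⟨rfl, rfl⟩, rfl, rfl⟩
      · rintro ⟨⟨rfl, rfl⟩, rfl, rfl⟩; exact ⟨⟨rfl, rfl⟩, rfl, rfl⟩
    · subst hj'
      rw [gCa _ _ hp, gNa _ _ hy' ht'] at h
      obtain ⟨r, t, ht, ⟨rfl, rfl⟩, e⟩ := key i p hp y' t' hy' ht' h
      exact ⟨Sum.inr r, t, ht, Or.inl ⟨rfl, by rw [e]; rfl⟩⟩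
    · subst hj
      rw [gCa _ _ hp', gNa _ _ hy ht] at h
      obtain ⟨r, t, ht, ⟨rfl, rfl⟩, e⟩ := key i' p' hp' y t hy ht h.symm
      exact ⟨Sum.inr r, t, ht, Or.inr ⟨rfl, by rw [e]; rfl⟩⟩
    · subst hj
      subst hj'
      rw [gNa _ _ hy ht, gNa _ _ hy' ht'] at h
      have := hB.inj (mem_bandBox_of_neck hy ht) (mem_bandBox_of_neck hy' ht') h
      simp only [Prod.mk.injEq, and_true] at this
      exact absurd (by rw [this.1, this.2]) hne

/-- The disks `D'` are obtained from the disks `D` by joining the disks `some a` and `none` along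
the band `Φ`. -/
structure IsJoin (D : Option ι → ℂ → E3) (a : ι) (Φ : E3 → E3) (D' : ι → ℂ → E3) : Prop where
  ribbon : IsRibbonFamily D'
  boundary_of_ne : ∀ j ≠ a, D' j '' sphere (0 : ℂ) 1 = D (some j) '' sphere (0 : ℂ) 1
  boundary : D' a '' sphere (0 : ℂ) 1 =
    ((D (some a) '' sphere (0 : ℂ) 1 ∪ D none '' sphere (0 : ℂ) 1) \ Φ '' bandBox) ∪
      Φ '' sideStrands
  image_subset : ∀ j, D' j '' closedBall (0 : ℂ) 1 ⊆
    (⋃ i, D i '' closedBall (0 : ℂ) 1) ∪ Φ '' bandBox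

lemma IsAdapted.apply_of_mem_attachArc (hA : IsAdapted D a Φ c η) {i : Option ι} {p : ℂ}
    (hi : i.getD a = a) (hp : p ∈ sphere (0 : ℂ) 1) (hpa : p ∈ attachArc c) :
    |p.im / c| < 2 ∧ (i = some a ∧ D i p = Φ (p.im / c, 1, 0) ∨
      i = none ∧ D i p = Φ (p.im / c, -1, 0)) := by
  have e := eq_endChart_of_mem_attachArc hp hpa
  have hc := hA.c_pos
  have hu : |p.im / c| < 2 := by
    rw [abs_div, abs_of_pos hc, div_lt_iff₀ hc]; exact hpa.2
  have hY : |p.im| < 5 / 2 * c := by have := hpa.2; linarith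
  have h1 : |(1 : ℝ) - 1| < η := by simpa using hA.η_pos
  refine ⟨hu, ?_⟩
  rcases Option.getD_eq_iff_of_neck.1 hi with rfl | rfl
  · left; rw [← hA.end_eq 1 _ hY h1, ← e]; exact ⟨rfl, rfl⟩
  · right; rw [← hA.start_eq 1 _ hY h1, ← e]; exact ⟨rfl, rfl⟩

lemma endChart_mem_attachArc (hc : 0 < c) (hc1 : c ≤ 1 / 10) {u : ℝ} (hu : |u| < 2) :
    endChart 1 (c * u) ∈ attachArc c := by
  have h : |c * u| < 2 * c := by rw [abs_mul, abs_of_pos hc]; nlinarith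
  refine ⟨?_, h⟩
  have h1 : nearSide (c * u) < nearSide 1 := nearSide_strictMono (by rw [abs_one]; linarith)
    (by linarith)
  have h2 := nearSide_le_two 1
  simp only [endChart]; linarith

lemma mem_sideStrands_of_two_le {u s : ℝ} (hu : u ∈ Icc (-3 : ℝ) 3) (hu2 : 2 ≤ |u|)
    (hs : s = 1 ∨ s = -1) : ((u, s, 0) : E3) ∈ sideStrands := by
  have h3 : |u| ≤ 3 := abs_le.2 hu
  obtain ⟨ε, hε, hεu⟩ : ∃ ε : ℝ, (ε = 1 ∨ ε = -1) ∧ ε * |u| = u := by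
    rcases le_total 0 u with h | h
    · exact ⟨1, Or.inl rfl, by rw [abs_of_nonneg h, one_mul]⟩
    · exact ⟨-1, Or.inr rfl, by rw [abs_of_nonpos h]; ring⟩
  rcases hs with rfl | rfl
  · refine ⟨|u| - 1, ⟨by linarith, by linarith⟩, ε, hε, ?_⟩
    rw [smoothStep_of_one_le (by linarith)]
    rw [show 1 + (|u| - 1) * 1 = |u| by ring, hεu]
  · refine ⟨1 - |u|, ⟨by linarith, by linarith⟩, ε, hε, ?_⟩
    rw [smoothStep_of_le_neg_one (by linarith)]
    rw [show 1 + (1 - |u|) * -1 = |u| by ring, hεu]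

/-- A disk can be joined to another one along an adapted band that crosses the disks
transversely. -/
theorem exists_isJoin_of_isAdapted (hD : IsRibbonFamily D) (hB : IsBand D a Φ)
    (hA : IsAdapted D a Φ c η) {κ' : Type} [Finite κ'] (X : BandCrossings D Φ κ') :
    ∃ D' : ι → ℂ → E3, IsJoin D a Φ D' := by
  have hc := hA.c_pos
  obtain ⟨J, hJ1, hJ2, hJ, hJ'⟩ := exists_dumbbell_param hc hA.c_le
  have hJc := hJ1.continuous
  obtain ⟨δ, hδ, hδO⟩ := (isCompact_closedBall (0 : ℂ) 1).exists_thickening_subset_open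
    ((isOpen_dumbbell_cover c η).preimage hJc)
    (fun z hz => dumbbell_subset_cover hc hA.η_pos ((hJ z).2 hz))
  rw [thickening_closedBall hδ zero_le_one] at hδO
  obtain ⟨ρ, hρ1, hρ2, R, hR, hρ⟩ := exists_smooth_retract ℂ (by linarith : 1 < δ + 1)
  have gCa := fun i p (hp : p ∈ closedBall (0 : ℂ) 1) =>
    glued_diskChart_apply (D := D) (a := a) (Φ := Φ) hA.η_pos hA.η_le hJc hJ hR hρ i hp
  have gNa := fun y t (hy : |y| ≤ 1) (ht : |t| < 1) => glued_neck_apply hA hJc hJ hR hρ hy ht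
  have hsph := fun i p (hp : p ∈ closedBall (0 : ℂ) 1) => diskChart_mem_sphere (a := a) hJ' i hp
  have hstrand : ∀ i : Option ι, i.getD a = a → ∀ p ∈ sphere (0 : ℂ) 1, ∀ x ∈ bandBox,
      D i p = Φ x → ∃ u ∈ Icc (-3 : ℝ) 3, ∃ s : ℝ, (s = 1 ∨ s = -1) ∧ x = (u, s, 0) := by
    intro i hi p hp x hx h
    have : x ∈ startStrand ∪ endStrand := by
      rw [← hB.meets]
      exact ⟨hx, mem_iUnion.2 ⟨i, p, hp, h⟩⟩
    obtain ⟨u, s, v⟩ := x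
    rcases this with ⟨h1, h2, h3⟩ | ⟨h1, h2, h3⟩
    · simp only [mem_singleton_iff] at h2 h3; subst h2 h3
      exact ⟨u, h1, -1, Or.inr rfl, rfl⟩
    · simp only [mem_singleton_iff] at h2 h3; subst h2 h3
      exact ⟨u, h1, 1, Or.inl rfl, rfl⟩
  have hbox : ∀ u s : ℝ, |u| ≤ 3 → (s = 1 ∨ s = -1) → ((u, s, 0) : E3) ∈ bandBox := by
    rintro u s hu hs
    refine ⟨abs_le.1 hu, ?_, by norm_num, by norm_num⟩
    rcases hs with rfl | rfl <;> exact ⟨by norm_num, by norm_num⟩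
  refine ⟨glued D a Φ c η J ρ, isRibbonFamily_glued hD hB hA X hJ1 hJ2 hJ hJ' hR hρ1 hρ
    fun z => hδO (hρ2 z), fun j hj => by rw [glued_of_ne hj], ?_, ?_⟩
  · apply Subset.antisymm
    · rintro _ ⟨z, hz, rfl⟩
      rcases glue_cases (a := a) hc hJ a (sphere_subset_closedBall hz) with
        ⟨i, p, hp, hi, rfl⟩ | ⟨-, y, t, hy, ht, rfl⟩
      · obtain ⟨hps, hpa⟩ := (hsph i p hp).1 hz
        have e := gCa i p hp
        rw [hi] at e
        rw [e]
        by_cases hx : D i p ∈ Φ '' bandBox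
        · obtain ⟨x, hx, hxe⟩ := hx
          obtain ⟨u, hu, s, hs, rfl⟩ := hstrand i hi p hps x hx hxe.symm
          rcases lt_or_ge |u| 2 with h2 | h2
          · refine absurd ⟨hi, ?_⟩ hpa
            rcases hs with rfl | rfl
            · rw [(hA.end_unique i p hp u h2.le hxe.symm).2]
              exact endChart_mem_attachArc hc hA.c_le h2
            · rw [(hA.start_unique i p hp u h2.le hxe.symm).2]
              exact endChart_mem_attachArc hc hA.c_le h2
          · exact Or.inr ⟨_, mem_sideStrands_of_two_le hu h2 hs, hxe⟩
        · refine Or.inl ⟨?_, hx⟩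
          rcases Option.getD_eq_iff_of_neck.1 hi with rfl | rfl
          · exact Or.inl ⟨p, hps, rfl⟩
          · exact Or.inr ⟨p, hps, rfl⟩
      · rw [gNa y t hy ht]
        rw [neckPoint_mem_sphere hc hA.c_le hJ' hy ht] at hz
        refine Or.inr ⟨_, ⟨stepInv t, ?_, y, ?_, ?_⟩, rfl⟩
        · have := abs_lt.1 (stepInv_mem ht)
          exact ⟨by linarith, by linarith⟩
        · exact (abs_eq one_pos.le).1 hz
        · rw [smoothStep_stepInv ht, neckWidth, mul_comm t]
    · have main : ∀ i : Option ι, i.getD a = a → ∀ p ∈ sphere (0 : ℂ) 1, p ∉ attachArc c →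
          D i p ∈ glued D a Φ c η J ρ a '' sphere 0 1 := by
        intro i hi p hp hpa
        have hp' := sphere_subset_closedBall hp
        have e := gCa i p hp'
        rw [hi] at e
        exact ⟨_, (hsph i p hp').2 ⟨hp, fun h => hpa h.2⟩, e⟩
      rintro x (⟨hx, hxΦ⟩ | ⟨_, ⟨τ, hτ, ε, hε, rfl⟩, rfl⟩)
      · obtain ⟨i, hi, p, hp, rfl⟩ : ∃ i : Option ι, i.getD a = a ∧ x ∈ D i '' sphere 0 1 := by
          rcases hx with hx | hx
          · exact ⟨some a, rfl, hx⟩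
          · exact ⟨none, rfl, hx⟩
        refine main i hi p hp fun hpa => hxΦ ?_
        obtain ⟨hu, ⟨-, h⟩ | ⟨-, h⟩⟩ := hA.apply_of_mem_attachArc hi hp hpa
        · exact ⟨_, hbox _ _ (by linarith) (Or.inl rfl), h.symm⟩
        · exact ⟨_, hbox _ _ (by linarith) (Or.inr rfl), h.symm⟩
      · have hε1 : |ε| = 1 := (abs_eq one_pos.le).2 hε
        rcases lt_or_ge |τ| 1 with h1 | h1
        · have ht := abs_smoothStep_lt h1
          rw [← neckWidth_smoothStep h1, ← gNa ε _ hε1.le ht]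
          exact ⟨_, (neckPoint_mem_sphere hc hA.c_le hJ' hε1.le ht).2 hε1, rfl⟩
        · have hτ2 : |τ| ≤ 2 := abs_le.2 hτ
          obtain ⟨s, hs, hsτ⟩ : ∃ s, (s = 1 ∨ s = -1) ∧ smoothStep τ = s ∧ τ * s = |τ| := by
            rcases le_total 0 τ with h | h
            · rw [abs_of_nonneg h] at h1 ⊢
              exact ⟨1, Or.inl rfl, smoothStep_of_one_le h1, mul_one _⟩
            · rw [abs_of_nonpos h] at h1 ⊢
              exact ⟨-1, Or.inr rfl, smoothStep_of_le_neg_one (by linarith), by ring⟩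
          rw [hsτ.1, hsτ.2]
          have hu : |ε * (1 + |τ|)| = 1 + |τ| := by
            rw [abs_mul, hε1, one_mul, abs_of_nonneg (by positivity)]
          have hu3 : |ε * (1 + |τ|)| ≤ 3 := by linarith
          have hmem := hbox _ _ hu3 hs
          obtain ⟨i, hi, p, hp, hpe⟩ : ∃ i : Option ι, i.getD a = a ∧
              Φ (ε * (1 + |τ|), s, 0) ∈ D i '' sphere 0 1 := by
            rcases hs with rfl | rfl
            · exact ⟨some a, rfl, hB.end_sub (mem_image_of_mem Φ
                (show _ ∈ endStrand from ⟨abs_le.1 hu3, mem_singleton _, mem_singleton _⟩))⟩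
            · exact ⟨none, rfl, hB.start_sub (mem_image_of_mem Φ
                (show _ ∈ startStrand from ⟨abs_le.1 hu3, mem_singleton _, mem_singleton _⟩))⟩
          rw [← hpe]
          refine main i hi p hp fun hpa => ?_
          obtain ⟨hu', h⟩ := hA.apply_of_mem_attachArc hi hp hpa
          obtain ⟨s', hs', h⟩ : ∃ s', (s' = 1 ∨ s' = -1) ∧ D i p = Φ (p.im / c, s', 0) := by
            rcases h with ⟨-, h⟩ | ⟨-, h⟩
            · exact ⟨1, Or.inl rfl, h⟩
            · exact ⟨-1, Or.inr rfl, h⟩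
          have e := hB.inj hmem (hbox _ _ (by linarith) hs') (hpe.symm.trans h)
          rw [Prod.mk.injEq] at e
          rw [e.1] at hu
          linarith
  · rintro j _ ⟨z, hz, rfl⟩
    rcases glue_cases (a := a) hc hJ j hz with ⟨i, p, hp, rfl, rfl⟩ | ⟨rfl, y, t, hy, ht, rfl⟩
    · rw [gCa i p hp]
      exact Or.inl (mem_iUnion.2 ⟨i, p, hp, rfl⟩)
    · rw [gNa y t hy ht]
      exact Or.inr ⟨_, mem_bandBox_of_neck hy ht, rfl⟩

end GlueRibbon

/-! ### Moving the disks inside the box of a band -/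

lemma interior_bandBox : interior bandBox = Ioo (-3) 3 ×ˢ Ioo (-2) 2 ×ˢ Ioo (-1) 1 := by
  rw [bandBox, interior_prod_eq, interior_prod_eq, interior_Icc, interior_Icc, interior_Icc]

lemma mem_interior_bandBox {x : E3} : x ∈ interior bandBox ↔ |x.1| < 3 ∧ |x.2.1| < 2 ∧ |x.2.2| < 1 := by
  rw [interior_bandBox, abs_lt, abs_lt, abs_lt]; rfl

/-- The line of the band coordinates that contains the strand at the height `ς = ±1`. -/
def bandLine (ς : ℝ) : Set E3 := {x | x.2.1 = ς ∧ x.2.2 = 0}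

/-- A smooth function which is `1` on a neighbourhood of the middle of the box of a band, and has
compact support in its interior. -/
noncomputable def boxCut (x : E3) : ℝ :=
  Real.smoothTransition ((8 - x.1 ^ 2) * (4 / 7)) * Real.smoothTransition (3 - x.2.1 ^ 2) *
    Real.smoothTransition (2 - 4 * x.2.2 ^ 2)

/-- A compact set that contains the support of `boxCut`. -/
def boxCore : Set E3 := {x | x.1 ^ 2 ≤ 8 ∧ x.2.1 ^ 2 ≤ 3 ∧ 4 * x.2.2 ^ 2 ≤ 2}

lemma contDiff_boxCut : ContDiff ℝ ∞ boxCut := by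
  have h : ContDiff ℝ ∞ Real.smoothTransition := Real.smoothTransition.contDiff
  exact ((h.comp (g := Real.smoothTransition) (f := fun x : E3 => (8 - x.1 ^ 2) * (4 / 7))
    (by fun_prop)).mul (h.comp (g := Real.smoothTransition) (f := fun x : E3 => 3 - x.2.1 ^ 2)
    (by fun_prop))).mul (h.comp (g := Real.smoothTransition)
    (f := fun x : E3 => 2 - 4 * x.2.2 ^ 2) (by fun_prop))

lemma boxCore_subset : boxCore ⊆ interior bandBox := by
  rintro x ⟨h1, h2, h3⟩
  rw [mem_interior_bandBox]
  refine ⟨?_, ?_, ?_⟩ <;> refine abs_lt_of_sq_lt_sq ?_ (by norm_num) <;> nlinarith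

lemma isCompact_boxCore : IsCompact boxCore := by
  have h : IsCompact bandBox := isCompact_Icc.prod (isCompact_Icc.prod isCompact_Icc)
  refine h.of_isClosed_subset ?_ (boxCore_subset.trans interior_subset)
  exact (isClosed_le (f := fun x : E3 => x.1 ^ 2) (g := fun _ => (8 : ℝ)) (by fun_prop) (by fun_prop)).inter
    ((isClosed_le (f := fun x : E3 => x.2.1 ^ 2) (g := fun _ => (3 : ℝ)) (by fun_prop) (by fun_prop)).inter
    (isClosed_le (f := fun x : E3 => 4 * x.2.2 ^ 2) (g := fun _ => (2 : ℝ)) (by fun_prop) (by fun_prop)))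

lemma boxCut_eq_zero {x : E3} (hx : x ∉ boxCore) : boxCut x = 0 := by
  unfold boxCut
  by_cases h1 : x.1 ^ 2 ≤ 8
  · by_cases h2 : x.2.1 ^ 2 ≤ 3
    · have h3 : ¬ 4 * x.2.2 ^ 2 ≤ 2 := fun h3 => hx ⟨h1, h2, h3⟩
      rw [Real.smoothTransition.zero_of_nonpos (x := 2 - 4 * x.2.2 ^ 2) (by linarith), mul_zero]
    · rw [Real.smoothTransition.zero_of_nonpos (x := 3 - x.2.1 ^ 2) (by linarith), mul_zero, zero_mul]
  · rw [Real.smoothTransition.zero_of_nonpos (x := (8 - x.1 ^ 2) * (4 / 7)) (by linarith), zero_mul,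
      zero_mul]

lemma boxCut_eq_one {x : E3} (h1 : |x.1| ≤ 5 / 2) (h2 : |x.2.1| ≤ 4 / 3) (h3 : |x.2.2| ≤ 1 / 2) :
    boxCut x = 1 := by
  have e1 : x.1 ^ 2 ≤ (5 / 2) ^ 2 := sq_le_sq' (abs_le.1 h1).1 (abs_le.1 h1).2
  have e2 : x.2.1 ^ 2 ≤ (4 / 3) ^ 2 := sq_le_sq' (abs_le.1 h2).1 (abs_le.1 h2).2
  have e3 : x.2.2 ^ 2 ≤ (1 / 2) ^ 2 := sq_le_sq' (abs_le.1 h3).1 (abs_le.1 h3).2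
  unfold boxCut
  rw [Real.smoothTransition.one_of_one_le (by linarith),
    Real.smoothTransition.one_of_one_le (by linarith),
    Real.smoothTransition.one_of_one_le (by linarith)]
  norm_num

/-- Translations by short vectors can be cut off. -/
lemma exists_shift {χ : E3 → ℝ} (hχ : ContDiff ℝ ∞ χ) {K C : Set E3} (hK : IsCompact K)
    (hKC : K ⊆ C) (h0 : ∀ x ∉ K, χ x = 0) :
    ∃ r > 0, ∀ w : E3, ‖w‖ < r → ∃ F : Equiv.Perm E3, DiffeoIn C F ∧ ∀ x, F x = x + χ x • w := by
  have hc : Continuous (fderiv ℝ χ) := hχ.continuous_fderiv (by simp)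
  have hsupp : HasCompactSupport χ := HasCompactSupport.intro hK h0
  obtain ⟨B, hB⟩ := (hsupp.fderiv (𝕜 := ℝ)).exists_bound_of_continuous hc
  have hB0 : 0 ≤ B := (norm_nonneg _).trans (hB 0)
  refine ⟨1 / (2 * (B + 1)), by positivity, fun w hw => ?_⟩
  refine exists_diffeoIn_add (k := fun x => χ x • w) (hχ.smul contDiff_const) (fun x => ?_) hK hKC
    (fun x hx => by simp [h0 x hx])
  have h1 : HasFDerivAt (fun x => χ x • w) ((fderiv ℝ χ x).smulRight w) x :=
    ((hχ.differentiable (by simp)) x).hasFDerivAt.smul_const w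
  rw [h1.fderiv, ContinuousLinearMap.norm_smulRight_apply]
  rw [lt_div_iff₀ (by positivity)] at hw
  have h2 := hB x
  have h3 := norm_nonneg w
  nlinarith

section Moves

variable {ι : Type} {D : Option ι → ℂ → E3} {a : ι} {Φ : E3 → E3}

/-- The disks `D'` arise from the disks `D` by a change inside the box of the band `Φ`, which does
not change the boundary curves. -/
structure IsMoved (D : Option ι → ℂ → E3) (Φ : E3 → E3) (D' : Option ι → ℂ → E3) : Prop where
  ribbon : IsRibbonFamily D'
  boundary : ∀ i, D' i '' sphere (0 : ℂ) 1 = D i '' sphere (0 : ℂ) 1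
  image_subset : ∀ i, D' i '' closedBall (0 : ℂ) 1 ⊆
    (⋃ j, D j '' closedBall (0 : ℂ) 1) ∪ Φ '' bandBox

lemma IsMoved.trans {D₁ D₂ D₃ : Option ι → ℂ → E3} (h : IsMoved D₁ Φ D₂) (h' : IsMoved D₂ Φ D₃) :
    IsMoved D₁ Φ D₃ where
  ribbon := h'.ribbon
  boundary i := (h'.boundary i).trans (h.boundary i)
  image_subset i := (h'.image_subset i).trans
    (union_subset (iUnion_subset h.image_subset) subset_union_right)

lemma IsMoved.isBand {D' : Option ι → ℂ → E3} (h : IsMoved D Φ D') (hB : IsBand D a Φ) :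
    IsBand D' a Φ where
  contDiff := hB.contDiff
  inj := hB.inj
  imm := hB.imm
  meets := by simp only [h.boundary]; exact hB.meets
  start_sub := by rw [h.boundary]; exact hB.start_sub
  end_sub := by rw [h.boundary]; exact hB.end_sub

lemma IsMoved.isJoin {D' : Option ι → ℂ → E3} (h : IsMoved D Φ D') {D'' : ι → ℂ → E3}
    (h' : IsJoin D' a Φ D'') : IsJoin D a Φ D'' where
  ribbon := h'.ribbon
  boundary_of_ne j hj := (h'.boundary_of_ne j hj).trans (h.boundary _)
  boundary := by rw [h'.boundary, h.boundary, h.boundary]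
  image_subset j := (h'.image_subset j).trans
    (union_subset (iUnion_subset h.image_subset) subset_union_right)

/-- The boundaries of the disks in the coordinates of the band. -/
lemma IsBand.mem_boundary_iff (hD : IsRibbonFamily D) (hB : IsBand D a Φ) {x : E3}
    (hx : x ∈ bandBox) (i : Option ι) : Φ x ∈ D i '' sphere (0 : ℂ) 1 ↔
      (i = some a ∧ x ∈ bandLine 1) ∨ (i = none ∧ x ∈ bandLine (-1)) := by
  have h1 : ∀ i j : Option ι, Φ x ∈ D i '' sphere (0 : ℂ) 1 → Φ x ∈ D j '' sphere (0 : ℂ) 1 →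
      i = j := by
    rintro i j ⟨p, hp, hpx⟩ ⟨q, hq, hqx⟩
    exact (hD.boundary_inj hp hq (hpx.trans hqx.symm)).1
  have h2 : x ∈ bandLine 1 → Φ x ∈ D (some a) '' sphere (0 : ℂ) 1 := fun h =>
    hB.end_sub (mem_image_of_mem Φ (show x ∈ endStrand from ⟨hx.1, h.1, h.2⟩))
  have h3 : x ∈ bandLine (-1) → Φ x ∈ D none '' sphere (0 : ℂ) 1 := fun h =>
    hB.start_sub (mem_image_of_mem Φ (show x ∈ startStrand from ⟨hx.1, h.1, h.2⟩))
  constructor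
  · intro h
    have : x ∈ startStrand ∪ endStrand := by
      rw [← hB.meets]; exact ⟨hx, mem_iUnion.2 ⟨i, h⟩⟩
    rcases this with h' | h'
    · have e : x ∈ bandLine (-1) := ⟨h'.2.1, h'.2.2⟩
      exact Or.inr ⟨h1 _ _ h (h3 e), e⟩
    · have e : x ∈ bandLine 1 := ⟨h'.2.1, h'.2.2⟩
      exact Or.inl ⟨h1 _ _ h (h2 e), e⟩
  · rintro (⟨rfl, h⟩ | ⟨rfl, h⟩)
    · exact h2 h
    · exact h3 h

/-- A diffeomorphism of the box of the band which preserves the two strands moves the disks, without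
changing their boundaries. The disks may be rotated at the same time. -/
lemma exists_isMoved (hD : IsRibbonFamily D) (hB : IsBand D a Φ) {H : Equiv.Perm E3}
    (hH : DiffeoIn (interior bandBox) H)
    (hL : ∀ ς : ℝ, ς = 1 ∨ ς = -1 → ∀ x, H x ∈ bandLine ς ↔ x ∈ bandLine ς)
    (R : Option ι → ℂ ≃ₗᵢ[ℝ] ℂ) :
    ∃ D' : Option ι → ℂ → E3, IsMoved D Φ D' ∧
      ∀ i p x, x ∈ interior bandBox → (D' i p = Φ (H x) ↔ D i (R i p) = Φ x) := by
  have hsub : interior bandBox ⊆ bandBox := interior_subset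
  obtain ⟨G, hG, hGΦ⟩ := exists_transplant isOpen_interior hB.contDiff (hB.inj.mono hsub)
    (fun x hx => hB.imm x (hsub hx)) hH
  have hRs : ∀ i, R i '' sphere (0 : ℂ) 1 = sphere (0 : ℂ) 1 := fun i => by
    rw [LinearIsometryEquiv.image_sphere, map_zero]
  have hRc : ∀ i, R i '' closedBall (0 : ℂ) 1 = closedBall (0 : ℂ) 1 := fun i => by
    rw [LinearIsometryEquiv.image_closedBall, map_zero]
  have hGK : ∀ i x, G x ∈ D i '' sphere (0 : ℂ) 1 ↔ x ∈ D i '' sphere (0 : ℂ) 1 := by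
    intro i x
    by_cases hx : x ∈ Φ '' interior bandBox
    · obtain ⟨y, hy, rfl⟩ := hx
      rw [hGΦ y hy, hB.mem_boundary_iff hD (hsub (hH.map_mem.2 hy)),
        hB.mem_boundary_iff hD (hsub hy), hL 1 (Or.inl rfl), hL (-1) (Or.inr rfl)]
    · rw [hG.eq_self hx]
  refine ⟨fun i z => G (D i (R i z)), ⟨(hD.rotate R).perm hG, fun i => ?_, fun i => ?_⟩,
    fun i p x hx => ?_⟩
  · have e : (fun z => G (D i (R i z))) '' sphere (0 : ℂ) 1 = G '' (D i '' (R i '' sphere 0 1)) := by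
      rw [image_image, image_image]
    rw [e, hRs]
    ext x
    obtain ⟨y, rfl⟩ := G.surjective x
    rw [hGK, G.injective.mem_set_image]
  · rintro _ ⟨p, hp, rfl⟩
    have hp' : R i p ∈ closedBall (0 : ℂ) 1 := by rw [← hRc i]; exact mem_image_of_mem _ hp
    by_cases hx : D i (R i p) ∈ Φ '' interior bandBox
    · right
      exact image_mono hsub (hG.map_mem.2 hx)
    · left
      simp only [hG.eq_self hx]
      exact mem_iUnion.2 ⟨i, _, hp', rfl⟩
  · rw [← hGΦ x hx]
    exact G.injective.eq_iff

/-- The point `x` is not a double point of the disks. -/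
def IsSimplePoint (D : Option ι → ℂ → E3) (x : E3) : Prop :=
  ∀ i j, ∀ p ∈ closedBall (0 : ℂ) 1, ∀ q ∈ closedBall (0 : ℂ) 1, D i p = x → D j q = x →
    i = j ∧ p = q

/-- The strand at the height `ς = ±1` is contained in the boundary of the disk `i₀`. -/
def IsEndIndex (a : ι) (ς : ℝ) (i₀ : Option ι) : Prop :=
  (ς = 1 ∧ i₀ = some a) ∨ (ς = -1 ∧ i₀ = none)

lemma IsEndIndex.sign {ς : ℝ} {i₀ : Option ι} (h : IsEndIndex a ς i₀) : ς = 1 ∨ ς = -1 :=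
  h.imp And.left And.left

lemma IsEndIndex.boundary (hD : IsRibbonFamily D) (hB : IsBand D a Φ) {ς : ℝ} {i₀ : Option ι}
    (h : IsEndIndex a ς i₀) {x : E3} (hx : x ∈ bandBox) :
    Φ x ∈ D i₀ '' sphere (0 : ℂ) 1 ↔ x ∈ bandLine ς := by
  rw [hB.mem_boundary_iff hD hx]
  rcases h with ⟨rfl, rfl⟩ | ⟨rfl, rfl⟩ <;> simp

lemma strandPoint_mem {u ς : ℝ} (hu : |u| < 3) (hς : ς = 1 ∨ ς = -1) :
    ((u, ς, 0) : E3) ∈ interior bandBox := by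
  rw [mem_interior_bandBox]
  refine ⟨hu, ?_, by norm_num⟩
  rcases hς with rfl | rfl <;> norm_num

/-- All but finitely many points of the strands are simple. -/
lemma finite_not_isSimplePoint (hD : IsRibbonFamily D) (hB : IsBand D a Φ) {ς : ℝ}
    {i₀ : Option ι} (h : IsEndIndex a ς i₀) :
    {u : ℝ | |u| < 3 ∧ ¬ IsSimplePoint D (Φ (u, ς, 0))}.Finite := by
  obtain ⟨-, -, κ, hκ, ⟨A⟩⟩ := id hD
  let X : Set E3 := range (fun s => D (A.b s) (A.β s 0)) ∪ range (fun s => D (A.b s) (A.β s 1))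
  have hX : X.Finite := (finite_range _).union (finite_range _)
  have hinj : InjOn (fun u : ℝ => Φ (u, ς, 0)) {u | |u| < 3} := by
    intro u hu u' hu' e
    have := hB.inj (interior_subset (strandPoint_mem hu h.sign))
      (interior_subset (strandPoint_mem hu' h.sign)) e
    exact (Prod.mk.inj this).1
  refine Set.Finite.of_finite_image (f := fun u : ℝ => Φ (u, ς, 0)) (hX.subset ?_)
    (hinj.mono fun u hu => hu.1)
  rintro _ ⟨u, ⟨hu, hns⟩, rfl⟩
  obtain ⟨p₀, hp₀, e0⟩ := (h.boundary hD hB (interior_subset (strandPoint_mem hu h.sign))).2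
    ⟨rfl, rfl⟩
  have key : ∀ j q, q ∈ closedBall (0 : ℂ) 1 → D j q = Φ (u, ς, 0) → (i₀, p₀) ≠ (j, q) →
      Φ (u, ς, 0) ∈ X := by
    intro j q hq e hne
    obtain ⟨s, t, ht, ⟨h1, -⟩ | ⟨-, h1⟩⟩ := A.complete i₀ j p₀ (sphere_subset_closedBall hp₀) q hq
      hne (e0.trans e.symm)
    · have h2 := A.α_mem s t ht
      rw [← (Prod.mk.inj h1).2, mem_ball, mem_sphere.1 hp₀] at h2
      exact absurd h2 (lt_irrefl _)
    · obtain ⟨rfl, rfl⟩ := Prod.mk.inj h1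
      rcases (A.β_sphere s t ht).1 hp₀ with rfl | rfl
      · exact Or.inl ⟨s, e0⟩
      · exact Or.inr ⟨s, e0⟩
  unfold IsSimplePoint at hns
  push Not at hns
  obtain ⟨i, j, p, hp, q, hq, e1, e2, h3⟩ := hns
  by_cases h1 : (i₀, p₀) = (i, p)
  · by_cases h2 : (i₀, p₀) = (j, q)
    · have := Prod.mk.inj (h1.symm.trans h2)
      exact absurd this.2 (h3 this.1)
    · exact key j q hq e2 h2
  · exact key i p hp e1 h1

/-- After a small shift of the disks along the strands, the midpoints of the strands are simple. -/
lemma exists_isSimplePoint (hD : IsRibbonFamily D) (hB : IsBand D a Φ) :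
    ∃ D', IsMoved D Φ D' ∧ IsSimplePoint D' (Φ (0, 1, 0)) ∧ IsSimplePoint D' (Φ (0, -1, 0)) := by
  obtain ⟨r, hr, hF⟩ := exists_shift contDiff_boxCut isCompact_boxCore boxCore_subset
    (fun x hx => boxCut_eq_zero hx)
  have hfin := (finite_not_isSimplePoint hD hB (Or.inl ⟨rfl, rfl⟩ : IsEndIndex a 1 (some a))).union
    (finite_not_isSimplePoint hD hB (Or.inr ⟨rfl, rfl⟩ : IsEndIndex a (-1) none))
  have hinf : (Ioo 0 (min r 1)).Infinite := Ioo_infinite (by positivity)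
  obtain ⟨u₀, ⟨h1, h2⟩, h3⟩ := (hinf.sdiff hfin).nonempty
  rw [lt_min_iff] at h2
  have hu3 : |u₀| < 3 := by rw [abs_of_pos h1]; linarith
  simp only [mem_union, Set.mem_ofPred_eq, hu3, true_and, not_or, not_not] at h3
  obtain ⟨H, hH, hHx⟩ := hF ((-u₀, 0, 0) : E3) (by
    rw [Prod.norm_def, norm_neg]; simp [abs_of_pos h1, hr, h2.1])
  obtain ⟨D', hD', hrel⟩ := exists_isMoved hD hB hH (fun ς hς x => by
    rw [hHx]; simp [bandLine]) (fun _ => LinearIsometryEquiv.refl ℝ ℂ)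
  have key : ∀ ς : ℝ, ς = 1 ∨ ς = -1 → IsSimplePoint D (Φ (u₀, ς, 0)) →
      IsSimplePoint D' (Φ (0, ς, 0)) := by
    intro ς hς h i j p hp q hq e1 e2
    have e : H (u₀, ς, 0) = (0, ς, 0) := by
      rw [hHx, boxCut_eq_one]
      · simp
      · simp only [abs_of_pos h1]; linarith
      · rcases hς with rfl | rfl <;> norm_num
      · norm_num
    rw [← e, hrel _ _ _ (strandPoint_mem hu3 hς)] at e1 e2
    exact h i j p hp q hq e1 e2
  exact ⟨D', hD', key 1 (Or.inl rfl) h3.1, key (-1) (Or.inr rfl) h3.2⟩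

/-- The disks in the coordinates of the band. -/
lemma exists_bandCoord (hD : ∀ i, ContDiff ℝ ∞ (D i)) (hB : IsBand D a Φ) {i : Option ι} {p : ℂ}
    {x : E3} (hx : x ∈ interior bandBox) (h : D i p = Φ x) :
    ∃ (m : ℂ → E3) (O : Set ℂ), IsOpen O ∧ p ∈ O ∧ ContDiffOn ℝ ∞ m O ∧ m p = x ∧
      ∀ z ∈ O, m z ∈ interior bandBox ∧ D i z = Φ (m z) := by
  have hsub : interior bandBox ⊆ bandBox := interior_subset
  obtain ⟨ho, g, hg, hgΦ⟩ := exists_smooth_inverse isOpen_interior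
    (hB.contDiff.contDiffOn) (hB.inj.mono hsub) (fun x hx => hB.imm x (hsub hx))
  have hm : D i p ∈ Φ '' interior bandBox := ⟨x, hx, h.symm⟩
  refine ⟨fun z => g (D i z), D i ⁻¹' (Φ '' interior bandBox), ho.preimage (hD i).continuous, hm,
    hg.comp (hD i).contDiffOn fun z hz => hz, by simp only [h, hgΦ x hx], ?_⟩
  rintro z ⟨y, hy, hyz⟩
  have e : g (D i z) = y := by rw [← hyz, hgΦ y hy]
  simp only [e]
  exact ⟨hy, hyz.symm⟩

lemma fderiv_eq_of_bandCoord (hB : IsBand D a Φ) {i : Option ι} {p : ℂ} {m : ℂ → E3}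
    (hm : ContDiffAt ℝ ∞ m p) (h : ∀ᶠ z in nhds p, D i z = Φ (m z)) :
    fderiv ℝ (D i) p = (fderiv ℝ Φ (m p)).comp (fderiv ℝ m p) := by
  have h' : D i =ᶠ[nhds p] fun z => Φ (m z) := h
  rw [h'.fderiv_eq]
  exact fderiv_comp p (hB.contDiff.differentiable (by simp) _) (hm.differentiableAt (by simp))

end Moves

/-! ### The normal form of the disks at the ends of a band -/

lemma DiffeoIn.conj {E : Type*} [NormedAddCommGroup E] [NormedSpace ℝ E] {C : Set E}
    {F σ : Equiv.Perm E} (hF : DiffeoIn C F) (h1 : ContDiff ℝ ∞ σ) (h2 : ContDiff ℝ ∞ σ.symm) :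
    DiffeoIn (σ '' C) (σ * F * σ⁻¹) := by
  obtain ⟨hF1, hF2, K, hK, hKC, hid⟩ := hF
  refine ⟨(h1.comp hF1).comp h2, (h1.comp hF2).comp h2, σ '' K, hK.image h1.continuous,
    image_mono hKC, fun x hx => ?_⟩
  obtain ⟨y, rfl⟩ := σ.surjective x
  have hy : y ∉ K := fun h => hx (mem_image_of_mem _ h)
  simp [hid y hy]

/-- Coordinates around the midpoint of the strand at the height `ς = ±1`, in which the strand is the
first axis and the band lies where the second coordinate is negative. -/
noncomputable def endFrame (ς : ℝ) (hς : ς = 1 ∨ ς = -1) : Equiv.Perm E3 where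
  toFun x := (x.1, ς * (1 + x.2.1), x.2.2)
  invFun x := (x.1, ς * x.2.1 - 1, x.2.2)
  left_inv x := by
    have h : ς * ς = 1 := by rcases hς with rfl | rfl <;> norm_num
    refine Prod.ext rfl (Prod.ext ?_ rfl)
    simp only
    linear_combination (1 + x.2.1) * h
  right_inv x := by
    have h : ς * ς = 1 := by rcases hς with rfl | rfl <;> norm_num
    refine Prod.ext rfl (Prod.ext ?_ rfl)
    simp only
    linear_combination x.2.1 * h

section EndFrame

variable {ς : ℝ} (hς : ς = 1 ∨ ς = -1)

lemma contDiff_endFrame : ContDiff ℝ ∞ (endFrame ς hς) := by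
  change ContDiff ℝ ∞ fun x : E3 => (x.1, ς * (1 + x.2.1), x.2.2)
  fun_prop

lemma contDiff_endFrame_symm : ContDiff ℝ ∞ (endFrame ς hς).symm := by
  change ContDiff ℝ ∞ fun x : E3 => (x.1, ς * x.2.1 - 1, x.2.2)
  fun_prop

lemma endFrame_apply (x : E3) : endFrame ς hς x = (x.1, ς * (1 + x.2.1), x.2.2) := rfl

lemma endFrame_mem_ball (x : E3) (r : ℝ) :
    endFrame ς hς x ∈ ball ((0, ς, 0) : E3) r ↔ x ∈ ball (0 : E3) r := by
  have h : |ς| = 1 := (abs_eq one_pos.le).2 hς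
  rw [mem_ball, mem_ball, dist_eq_norm, dist_zero_right, endFrame_apply, Prod.norm_def,
    Prod.norm_def, Prod.norm_def (x := x), Prod.norm_def (x := x.2)]
  simp only [Prod.fst_sub, Prod.snd_sub, sub_zero, Real.norm_eq_abs]
  rw [show ς * (1 + x.2.1) - ς = ς * x.2.1 by ring, abs_mul, h, one_mul]

lemma endFrame_mem_bandLine (x : E3) : endFrame ς hς x ∈ bandLine ς ↔ x ∈ axis := by
  have h : ς ≠ 0 := by rcases hς with rfl | rfl <;> norm_num
  rw [endFrame_apply, axis, bandLine]
  change (ς * (1 + x.2.1) = ς ∧ x.2.2 = 0) ↔ x.2 = 0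
  rw [Prod.ext_iff, mul_eq_left₀ h]
  simp

end EndFrame

lemma endChart_one_zero : endChart 1 0 = 1 := by
  apply Complex.ext <;> simp [endChart, nearSide_zero]; norm_num

lemma one_le_of_endChart_mem {s Y : ℝ} (h : endChart s Y ∈ closedBall (0 : ℂ) 1) : 1 ≤ s := by
  have h1 := nearSide_im_le h
  have h2 := nearSide_pos Y
  simp only [endChart] at h1
  have h3 := le_abs_self (2 - s * nearSide Y)
  have h4 : 1 * nearSide Y ≤ s * nearSide Y := by linarith
  exact le_of_mul_le_mul_right h4 h2

lemma endChart_one_mem_sphere {Y : ℝ} (hY : |Y| ≤ 1) : endChart 1 Y ∈ sphere (0 : ℂ) 1 := by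
  have h := (sq_le_one_iff_abs_le_one Y).2 hY
  rw [mem_sphere_zero_iff_norm, ← pow_eq_one_iff_of_nonneg (norm_nonneg _) two_ne_zero,
    Complex.sq_norm, Complex.normSq_apply]
  simp only [endChart, nearSide, one_mul, sub_sub_cancel]
  rw [Real.mul_self_sqrt (by linarith)]
  ring

lemma endChart_neg (s Y : ℝ) : endChart s (-Y) = (starRingEnd ℂ) (endChart s Y) := by
  apply Complex.ext <;> simp [endChart, nearSide]

/-- `endChart` on the first two coordinates, centred at the point `1`. -/
noncomputable def endParam (x : E3) : ℂ := endChart (1 + x.2.1) x.1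

lemma endParam_zero : endParam 0 = 1 := by
  simp [endParam, endChart_one_zero]

lemma hasFDerivAt_endParam : HasFDerivAt endParam
    ((Complex.equivRealProdCLM.symm : ℝ × ℝ →L[ℝ] ℂ).comp
      ((-(ContinuousLinearMap.fst ℝ ℝ ℝ).comp (ContinuousLinearMap.snd ℝ ℝ (ℝ × ℝ))).prod
        (ContinuousLinearMap.fst ℝ ℝ (ℝ × ℝ)))) (0 : E3) := by
  have e : endParam = fun x : E3 => Complex.equivRealProdCLM.symm
      (2 - (1 + x.2.1) * nearSide x.1, x.1) := by
    funext x; rfl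
  rw [e]
  refine Complex.equivRealProdCLM.symm.hasFDerivAt.comp (0 : E3) ?_
  have h1 : HasFDerivAt (fun x : E3 => x.1) (ContinuousLinearMap.fst ℝ ℝ (ℝ × ℝ)) 0 :=
    hasFDerivAt_fst
  have h2 : HasFDerivAt (fun x : E3 => x.2.1)
      ((ContinuousLinearMap.fst ℝ ℝ ℝ).comp (ContinuousLinearMap.snd ℝ ℝ (ℝ × ℝ))) 0 :=
    hasFDerivAt_snd.fst
  have h3 : HasDerivAt nearSide (0 / √(1 - 0 ^ 2)) ((0 : E3).1) := hasDerivAt_nearSide (by simp)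
  have h4 := h3.comp_hasFDerivAt (0 : E3) h1
  refine HasFDerivAt.prodMk ?_ h1
  have h5 := ((h2.const_add 1).mul h4).const_sub 2
  refine HasFDerivAt.congr_fderiv h5 (ContinuousLinearMap.ext fun x => ?_)
  simp [nearSide_zero]

lemma contDiffOn_endParam : ContDiffOn ℝ ∞ endParam {x | |x.1| < 1} := by
  intro x hx
  have e : endParam = fun x : E3 => Complex.equivRealProdCLM.symm
      (2 - (1 + x.2.1) * nearSide x.1, x.1) := by
    funext x; rfl
  rw [e]
  have h0 : ContDiffAt ℝ ∞ (fun x : E3 => x.1) x := contDiffAt_fst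
  have h1 : ContDiffAt ℝ ∞ (fun x : E3 => nearSide x.1) x :=
    ContDiffAt.comp (g := nearSide) x (contDiffAt_nearSide hx) h0
  have h2 : ContDiffAt ℝ ∞ (fun x : E3 => 1 + x.2.1) x := ContDiff.contDiffAt (by fun_prop)
  have h3 : ContDiffAt ℝ ∞ (fun x : E3 => (2 - (1 + x.2.1) * nearSide x.1, x.1)) x :=
    (contDiffAt_const.sub (h2.mul h1)).prodMk h0
  exact (Complex.equivRealProdCLM.symm.contDiff.contDiffAt.comp x h3).contDiffWithinAt

section EndForm

variable {ι : Type} {D : Option ι → ℂ → E3} {a : ι} {Φ : E3 → E3}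

/-- Near the midpoint of the strand at the height `ς`, the disk `i₀` lies in the plane of the
band. -/
def EndForm (D : Option ι → ℂ → E3) (Φ : E3 → E3) (i₀ : Option ι) (ς ε : ℝ) : Prop :=
  ∀ s Y : ℝ, |Y| < ε → |s - 1| < ε → D i₀ (endChart s Y) = Φ (Y, ς * s, 0)

/-- The disk near an end of the band, in the coordinates of the band. -/
lemma exists_endGerm (hD : IsRibbonFamily D) (hB : IsBand D a Φ) {ς : ℝ} {i₀ : Option ι}
    (h : IsEndIndex a ς i₀) : ∃ (R : ℂ ≃ₗᵢ[ℝ] ℂ) (f : E3 → E3) (p b q₁ q₂ : ℝ),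
    0 < p ∧ (q₁ ≠ 0 ∨ q₂ ≠ 0) ∧ (∃ O ∈ nhds (0 : E3), ContDiffOn ℝ ∞ f O) ∧ f 0 = 0 ∧
    HasFDerivAt f ((axisMap p b q₁ q₂).comp ((ContinuousLinearMap.fst ℝ ℝ (ℝ × ℝ)).prod
      (((ContinuousLinearMap.fst ℝ ℝ ℝ).comp (ContinuousLinearMap.snd ℝ ℝ (ℝ × ℝ))).prod 0))) 0 ∧
    (∀ᶠ x in nhds 0, x ∈ axis → f x ∈ axis) ∧
    (∀ᶠ x in nhds 0, endFrame ς h.sign (f x) ∈ interior bandBox ∧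
      D i₀ (R (endParam x)) = Φ (endFrame ς h.sign (f x))) := by
  have hς := h.sign
  have hx0 : ((0, ς, 0) : E3) ∈ interior bandBox := strandPoint_mem (by norm_num) hς
  obtain ⟨p₀, hp₀, e0⟩ := (h.boundary hD hB (interior_subset hx0)).2 ⟨rfl, rfl⟩
  obtain ⟨m, O, hO, hpO, hm, hmp, hmD⟩ := exists_bandCoord hD.1 hB hx0 e0
  -- everything but the orientation of the strand
  have main : ∀ R : ℂ ≃ₗᵢ[ℝ] ℂ, R 1 = p₀ →
      let f : E3 → E3 := fun x => (endFrame ς hς).symm (m (R (endParam x)))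
      (∃ O ∈ nhds (0 : E3), ContDiffOn ℝ ∞ f O) ∧ f 0 = 0 ∧
      (∀ᶠ x in nhds 0, x ∈ axis → f x ∈ axis) ∧
      (∀ᶠ x in nhds 0, endFrame ς h.sign (f x) ∈ interior bandBox ∧
        D i₀ (R (endParam x)) = Φ (endFrame ς h.sign (f x))) ∧
      ∃ L : E3 →L[ℝ] E3, HasFDerivAt f L 0 ∧ L (0, 0, 1) = 0 ∧ (L (1, 0, 0)).2 = 0 ∧
        ∀ y x : ℝ, L (y, x, 0) = 0 → y = 0 ∧ x = 0 := by
    intro R hR f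
    have hO1 : IsOpen ({x : E3 | |x.1| < 1} ∩ (fun x => R (endParam x)) ⁻¹' O) := by
      refine ContinuousOn.isOpen_inter_preimage ?_ (isOpen_lt (f := fun x : E3 => |x.1|)
        (g := fun _ => 1) (by fun_prop) (by fun_prop)) hO
      exact R.continuous.comp_continuousOn contDiffOn_endParam.continuousOn
    have h0 : (0 : E3) ∈ {x : E3 | |x.1| < 1} ∩ (fun x => R (endParam x)) ⁻¹' O := by
      refine ⟨by simp, ?_⟩
      change R (endParam 0) ∈ O
      rw [endParam_zero, hR]; exact hpO
    have hO1n := hO1.mem_nhds h0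
    have hf0 : f 0 = 0 := by
      change (endFrame ς hς).symm (m (R (endParam 0))) = 0
      rw [endParam_zero, hR, hmp, Equiv.symm_apply_eq, endFrame_apply]
      simp
    have hsm : ContDiffOn ℝ ∞ f ({x : E3 | |x.1| < 1} ∩ (fun x => R (endParam x)) ⁻¹' O) := by
      refine (contDiff_endFrame_symm hς).comp_contDiffOn (hm.comp ?_ fun x hx => hx.2)
      exact R.contDiff.comp_contDiffOn (contDiffOn_endParam.mono inter_subset_left)
    have hD' : ∀ᶠ x in nhds (0 : E3), endFrame ς h.sign (f x) ∈ interior bandBox ∧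
        D i₀ (R (endParam x)) = Φ (endFrame ς h.sign (f x)) := by
      filter_upwards [hO1n] with x hx
      change endFrame ς h.sign ((endFrame ς hς).symm _) ∈ _ ∧
        _ = Φ (endFrame ς h.sign ((endFrame ς hς).symm _))
      rw [Equiv.apply_symm_apply]
      exact hmD _ hx.2
    have hax : ∀ᶠ x in nhds (0 : E3), x ∈ axis → f x ∈ axis := by
      filter_upwards [hO1n, hD'] with x hx hx' hxa
      rw [← endFrame_mem_bandLine hς, ← h.boundary hD hB (interior_subset hx'.1), ← hx'.2]
      refine mem_image_of_mem _ ?_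
      have e : x.2.1 = 0 := by rw [show x.2 = 0 from hxa]; rfl
      have e1 : endParam x ∈ sphere (0 : ℂ) 1 := by
        rw [endParam, e, add_zero]
        exact endChart_one_mem_sphere (le_of_lt hx.1)
      simpa using e1
    refine ⟨⟨_, hO1n, hsm⟩, hf0, hax, hD', ?_⟩
    have hd1 : HasFDerivAt m (fderiv ℝ m p₀) (R (endParam 0)) := by
      rw [endParam_zero, hR]
      exact ((hm.contDiffAt (hO.mem_nhds hpO)).differentiableAt (by simp)).hasFDerivAt
    have hd2 := ((contDiff_endFrame_symm hς).differentiable (by simp)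
      (m (R (endParam 0)))).hasFDerivAt
    have hd3 : HasFDerivAt R (R.toContinuousLinearEquiv : ℂ →L[ℝ] ℂ) (endParam 0) :=
      R.toContinuousLinearEquiv.hasFDerivAt
    have hL := hd2.comp (0 : E3) (hd1.comp (0 : E3) (hd3.comp (0 : E3) hasFDerivAt_endParam))
    have hax2 : ∀ L : E3 →L[ℝ] E3, HasFDerivAt f L 0 → (L (1, 0, 0)).2 = 0 := by
      intro L hL'
      have hl : HasFDerivAt (fun t : ℝ => ((t, 0, 0) : E3))
          (ContinuousLinearMap.inl ℝ ℝ (ℝ × ℝ)) 0 :=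
        (ContinuousLinearMap.inl ℝ ℝ (ℝ × ℝ)).hasFDerivAt
      have h1 : HasFDerivAt (fun t : ℝ => (f (t, 0, 0)).2) _ 0 :=
        (HasFDerivAt.comp (g := f) (0 : ℝ) hL' hl).snd
      have h2 : (fun t : ℝ => (f (t, 0, 0)).2) =ᶠ[nhds 0] fun _ => 0 := by
        have hc : Filter.Tendsto (fun t : ℝ => ((t, 0, 0) : E3)) (nhds 0) (nhds 0) :=
          hl.continuousAt
        filter_upwards [hc.eventually hax] with t ht
        exact ht rfl
      have h3 := h1.unique ((hasFDerivAt_const (0 : ℝ × ℝ) (0 : ℝ)).congr_of_eventuallyEq h2)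
      exact DFunLike.congr_fun h3 1
    refine ⟨_, hL, ?_, hax2 _ hL, ?_⟩
    · simp [show ((0 : ℝ), (0 : ℝ)) = 0 from rfl]
    · intro y x hyx
      simp only [ContinuousLinearMap.comp_apply] at hyx
      have i1 : Function.Injective (fderiv ℝ (endFrame ς hς).symm (m (R (endParam 0)))) :=
        injective_fderiv_perm (contDiff_endFrame_symm hς) (contDiff_endFrame hς) _
      have i2 : Function.Injective (fderiv ℝ m p₀) := by
        have := hD.2.1 i₀ p₀ (sphere_subset_closedBall hp₀)
        rw [fderiv_eq_of_bandCoord hB (hm.contDiffAt (hO.mem_nhds hpO))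
          (Filter.mem_of_superset (hO.mem_nhds hpO) fun z hz => (hmD z hz).2)] at this
        rw [ContinuousLinearMap.coe_comp] at this
        exact this.of_comp
      have h3 := (map_eq_zero_iff _ i1).1 hyx
      have h4 := (map_eq_zero_iff _ i2).1 h3
      have h5 := (map_eq_zero_iff (R.toContinuousLinearEquiv : ℂ →L[ℝ] ℂ)
        R.toContinuousLinearEquiv.injective).1 h4
      have h6 := (map_eq_zero_iff (Complex.equivRealProdCLM.symm : ℝ × ℝ →L[ℝ] ℂ)
        Complex.equivRealProdCLM.symm.injective).1 h5
      simpa [and_comm] using h6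
  let c₀ : Circle := ⟨p₀, by simpa [Submonoid.unitSphere] using hp₀⟩
  have hR₀ : rotation c₀ 1 = p₀ := by
    rw [rotation_apply]; exact mul_one p₀
  obtain ⟨R, hR, hpos⟩ : ∃ R : ℂ ≃ₗᵢ[ℝ] ℂ, R 1 = p₀ ∧
      0 < (fderiv ℝ (fun x => (endFrame ς hς).symm (m (R (endParam x)))) 0 (1, 0, 0)).1 := by
    obtain ⟨-, -, -, -, L, hL, -, hL2, hL3⟩ := main _ hR₀
    have hne : (L (1, 0, 0)).1 ≠ 0 := fun h0 => by
      have : L (1, 0, 0) = 0 := Prod.ext h0 hL2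
      exact one_ne_zero (hL3 1 0 this).1
    rcases hne.lt_or_gt with hlt | hgt
    · refine ⟨Complex.conjLIE.trans (rotation c₀), by simpa using hR₀, ?_⟩
      let ν : E3 →L[ℝ] E3 := (-ContinuousLinearMap.fst ℝ ℝ (ℝ × ℝ)).prod
        (ContinuousLinearMap.snd ℝ ℝ (ℝ × ℝ))
      have e : (fun x => (endFrame ς hς).symm (m ((Complex.conjLIE.trans (rotation c₀))
          (endParam x)))) = (fun x => (endFrame ς hς).symm (m (rotation c₀ (endParam x)))) ∘ ν := by
        funext x
        have : endParam (ν x) = (starRingEnd ℂ) (endParam x) := by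
          rw [endParam, endParam, ← endChart_neg]; rfl
        simp only [Function.comp_apply, this]
        rfl
      have hL' : HasFDerivAt (fun x => (endFrame ς hς).symm (m (rotation c₀ (endParam x)))) L
        (ν 0) := by rw [map_zero]; exact hL
      rw [e, (hL'.comp (0 : E3) ν.hasFDerivAt).fderiv]
      have : ν (1, 0, 0) = -(1, 0, 0) := by simp [ν]
      rw [ContinuousLinearMap.comp_apply, this, map_neg]
      simpa using hlt
    · exact ⟨_, hR₀, by rw [hL.fderiv]; exact hgt⟩
  obtain ⟨h1, h2, h3, h4, L, hL, hL1, hL2, hL3⟩ := main R hR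
  rw [hL.fderiv] at hpos
  refine ⟨R, _, (L (1, 0, 0)).1, (L (0, 1, 0)).1, (L (0, 1, 0)).2.1, (L (0, 1, 0)).2.2, hpos, ?_,
    h1, h2, ?_, h3, h4⟩
  · by_contra! hq
    -- otherwise the two partial derivatives would be parallel
    set P := (L (1, 0, 0)).1
    set b := (L (0, 1, 0)).1
    have e1 : L (1, 0, 0) = (P, 0, 0) := Prod.ext rfl hL2
    have e2 : L (0, 1, 0) = (b, 0, 0) := Prod.ext rfl (Prod.ext hq.1 hq.2)
    have e3 : L (-b, P, 0) = 0 := by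
      have : ((-b, P, 0) : E3) = -b • (1, 0, 0) + P • (0, 1, 0) := by simp
      rw [this, map_add, map_smul, map_smul, e1, e2]
      ext <;> simp; ring
    exact hpos.ne' (hL3 _ _ e3).2
  · convert hL using 1
    refine ContinuousLinearMap.ext fun x => ?_
    have e : x = x.1 • (1, 0, 0) + x.2.1 • (0, 1, 0) + x.2.2 • (0, 0, 1) := by
      ext <;> simp
    have e' : L x = x.1 • L (1, 0, 0) + x.2.1 • L (0, 1, 0) := by
      conv_lhs => rw [e]
      rw [map_add, map_add, map_smul, map_smul, map_smul, hL1, smul_zero, add_zero]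
    have e1 : L (1, 0, 0) = ((L (1, 0, 0)).1, 0, 0) := Prod.ext rfl hL2
    rw [e', e1]
    ext <;> simp [mul_comm]

/-- After a change near the midpoint of the strand at the height `ς`, the disk that it bounds
prolongs the band there. -/
lemma exists_endForm (hD : IsRibbonFamily D) (hB : IsBand D a Φ) {ς : ℝ} {i₀ : Option ι}
    (h : IsEndIndex a ς i₀) : ∃ (D' : Option ι → ℂ → E3) (R : Option ι → ℂ ≃ₗᵢ[ℝ] ℂ),
    IsMoved D Φ D' ∧ (∀ i ≠ i₀, R i = LinearIsometryEquiv.refl ℝ ℂ) ∧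
    (∃ ε > 0, EndForm D' Φ i₀ ς ε) ∧
    (∀ i p x, x ∈ interior bandBox → x ∉ ball ((0, ς, 0) : E3) (1 / 2) →
      (D' i p = Φ x ↔ D i (R i p) = Φ x)) ∧
    (IsSimplePoint D (Φ (0, ς, 0)) → IsSimplePoint D' (Φ (0, ς, 0))) := by
  classical
  obtain ⟨R, f, p, b, q₁, q₂, hp, hq, ⟨O, hO, hfO⟩, hf0, hf', hax, hfD⟩ := exists_endGerm hD hB h
  have hς := h.sign
  -- the missing third direction is filled in by a constant vector
  let g : E3 → E3 := fun x => f x + x.2.2 • (0, -q₂, q₁)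
  have hfg : ∀ x : E3, x.2.2 = 0 → g x = f x := fun x hx => by simp [g, hx]
  have hg0 : g 0 = 0 := by rw [hfg 0 rfl, hf0]
  have hg : GermExt g := by
    refine germExt_of_fderiv hp hq ⟨O, hO, ?_⟩ hg0 (a := b) ?_ ?_
    · exact hfO.add (ContDiff.contDiffOn (by fun_prop))
    · have h1 : HasFDerivAt (fun x : E3 => x.2.2) ((ContinuousLinearMap.snd ℝ ℝ ℝ).comp
          (ContinuousLinearMap.snd ℝ ℝ (ℝ × ℝ))) 0 := hasFDerivAt_snd.snd
      have h2 := hf'.add (h1.smul_const ((0, -q₂, q₁) : E3))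
      have h3 : HasFDerivAt g _ 0 := h2
      rw [h3.fderiv]
      refine ContinuousLinearMap.ext fun x => ?_
      ext <;> simp <;> ring
    · filter_upwards [hax] with x hx hxa
      rw [hfg x (by rw [show x.2 = 0 from hxa]; rfl)]
      exact hx hxa
  obtain ⟨F, hF, hFg, hFa⟩ := hg (1 / 2) (by norm_num)
  have hF0 : F 0 = 0 := by rw [hFg.self_of_nhds, hg0]
  set σ := endFrame ς hς with hσ
  have himg : σ '' ball (0 : E3) (1 / 2) = ball ((0, ς, 0) : E3) (1 / 2) := by
    ext x
    obtain ⟨y, rfl⟩ := σ.surjective x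
    rw [σ.injective.mem_set_image, hσ, endFrame_mem_ball]
  have hsub : ball ((0, ς, 0) : E3) (1 / 2) ⊆ interior bandBox := by
    intro x hx
    rw [mem_ball, dist_eq_norm, Prod.norm_def, Prod.norm_def, max_lt_iff, max_lt_iff] at hx
    simp only [Prod.fst_sub, Prod.snd_sub, sub_zero, Real.norm_eq_abs] at hx
    rw [mem_interior_bandBox]
    refine ⟨by linarith, ?_, by linarith⟩
    have := abs_lt.1 hx.2.1
    rw [abs_lt]
    rcases hς with rfl | rfl <;> constructor <;> linarith
  have hH : DiffeoIn (ball ((0, ς, 0) : E3) (1 / 2)) (σ * F⁻¹ * σ⁻¹) := by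
    rw [← himg]
    exact hF.inv.conj (contDiff_endFrame hς) (contDiff_endFrame_symm hς)
  set H := σ * F⁻¹ * σ⁻¹ with hHdef
  have hL : ∀ ς' : ℝ, ς' = 1 ∨ ς' = -1 → ∀ x, H x ∈ bandLine ς' ↔ x ∈ bandLine ς' := by
    intro ς' hς' x
    by_cases he : ς' = ς
    · subst he
      obtain ⟨y, rfl⟩ := σ.surjective x
      have : H (σ y) = σ (F⁻¹ y) := by simp [hHdef]
      rw [this, hσ, endFrame_mem_bandLine, endFrame_mem_bandLine, ← hFa (F⁻¹ y)]
      simp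
    · by_cases hx : x ∈ ball ((0, ς, 0) : E3) (1 / 2)
      · have hno : ∀ y ∈ ball ((0, ς, 0) : E3) (1 / 2), y ∉ bandLine ς' := by
          rintro y hy ⟨hy1, -⟩
          rw [mem_ball, dist_eq_norm, Prod.norm_def, Prod.norm_def, max_lt_iff, max_lt_iff] at hy
          simp only [Prod.fst_sub, Prod.snd_sub, sub_zero, Real.norm_eq_abs, hy1] at hy
          have := abs_lt.1 hy.2.1
          rcases hς with rfl | rfl <;> rcases hς' with rfl | rfl <;>
            first | exact he rfl | linarith [this.1, this.2]
        exact ⟨fun h => absurd h (hno _ (hH.map_mem.2 hx)), fun h => absurd h (hno _ hx)⟩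
      · rw [hH.eq_self hx]
  obtain ⟨D', hD', hrel⟩ := exists_isMoved hD hB (hH.mono hsub) hL
    (fun i => if i = i₀ then R else LinearIsometryEquiv.refl ℝ ℂ)
  refine ⟨D', fun i => if i = i₀ then R else LinearIsometryEquiv.refl ℝ ℂ, hD',
    fun i hi => if_neg hi, ?_, fun i p x hx hx' => ?_, fun hs => ?_⟩
  · have hev : ∀ᶠ x in nhds (0 : E3), x.2.2 = 0 → D' i₀ (endParam x) = Φ (σ x) := by
      filter_upwards [hfD, hFg] with x hx1 hx2 hx3
      have e : H (σ (f x)) = σ x := by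
        rw [← hfg x hx3, ← hx2]; simp [hHdef]
      rw [← e, hrel _ _ _ hx1.1, if_pos rfl]
      exact hx1.2
    obtain ⟨ε, hε, hball⟩ := Metric.eventually_nhds_iff_ball.1 hev
    refine ⟨ε, hε, fun s Y hY hs => ?_⟩
    have := hball (Y, s - 1, 0) (by
      rw [mem_ball_zero_iff, Prod.norm_def, Prod.norm_def]
      simp [hY, hs]) rfl
    rw [endParam, hσ, endFrame_apply] at this
    simpa using this
  · rw [← hrel _ _ _ hx, hH.eq_self hx']
  · have e : H (0, ς, 0) = (0, ς, 0) := by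
      have e1 : ((0, ς, 0) : E3) = σ 0 := by rw [hσ, endFrame_apply]; simp
      have e2 : F.symm 0 = 0 := by rw [Equiv.symm_apply_eq, hF0]
      rw [e1]
      simp [hHdef, e2]
    intro i j p hp q hq e1 e2
    rw [← e, hrel _ _ _ (strandPoint_mem (by norm_num) hς)] at e1 e2
    have hmem : ∀ (T : ℂ ≃ₗᵢ[ℝ] ℂ) z, z ∈ closedBall (0 : ℂ) 1 → T z ∈ closedBall (0 : ℂ) 1 := by
      intro T z hz; simpa using hz
    obtain ⟨rfl, h2⟩ := hs i j _ (hmem _ p hp) _ (hmem _ q hq) e1 e2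
    exact ⟨rfl, (LinearIsometryEquiv.injective _) h2⟩

end EndForm

/-! ### Making the core of a band transverse to the disks -/

section CoreTransverse

variable {ι : Type} {D : Option ι → ℂ → E3} {a : ι} {Φ : E3 → E3}

/-- Near the midpoint of the strand at the height `ς`, the disks are the half plane of `i₀`. -/
def EndUnique (D : Option ι → ℂ → E3) (Φ : E3 → E3) (i₀ : Option ι) (ς δ : ℝ) : Prop :=
  ∀ i, ∀ p ∈ closedBall (0 : ℂ) 1, ∀ x ∈ ball ((0, ς, 0) : E3) δ, D i p = Φ x →
    i = i₀ ∧ 1 ≤ ς * x.2.1 ∧ x.2.2 = 0 ∧ p = endChart (ς * x.2.1) x.1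

lemma isOpen_endChart_image (ε : ℝ) :
    IsOpen {z : ℂ | |z.im| < ε ∧ |(2 - z.re) / nearSide z.im - 1| < ε} := by
  have h : Continuous fun z : ℂ => (2 - z.re) / nearSide z.im - 1 :=
    ((continuous_const.sub Complex.continuous_re).div
      (continuous_nearSide.comp Complex.continuous_im) fun z => (nearSide_pos _).ne').sub
      continuous_const
  exact (isOpen_lt (continuous_abs.comp Complex.continuous_im) continuous_const).inter
    (isOpen_lt (continuous_abs.comp h) continuous_const)

lemma endChart_div_nearSide (z : ℂ) : endChart ((2 - z.re) / nearSide z.im) z.im = z := by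
  apply Complex.ext
  · simp [endChart, div_mul_cancel₀ _ (nearSide_pos z.im).ne']
  · rfl

lemma exists_endUnique [Finite ι] (hD : IsRibbonFamily D) (hB : IsBand D a Φ) {ς : ℝ}
    {i₀ : Option ι} (h : IsEndIndex a ς i₀) {ε : ℝ} (hε : 0 < ε) (hE : EndForm D Φ i₀ ς ε)
    (hs : IsSimplePoint D (Φ (0, ς, 0))) : ∃ δ > 0, EndUnique D Φ i₀ ς δ := by
  classical
  have hς := h.sign
  have hςς : ς * ς = 1 := by rcases hς with rfl | rfl <;> norm_num
  set ε' := min ε (1 / 2) with hε'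
  have hε'0 : 0 < ε' := by positivity
  set N := {z : ℂ | |z.im| < ε' ∧ |(2 - z.re) / nearSide z.im - 1| < ε'} with hN
  have hNo : IsOpen N := isOpen_endChart_image ε'
  let K : Option ι → Set ℂ := fun i => if i = i₀ then closedBall 0 1 \ N else closedBall 0 1
  have hK : ∀ i, IsCompact (K i) := by
    intro i
    by_cases hi : i = i₀
    · simp only [K, hi, if_true]; exact (isCompact_closedBall 0 1).diff hNo
    · simp only [K, hi, if_false]; exact isCompact_closedBall 0 1
  have h1 : D i₀ 1 = Φ (0, ς, 0) := by
    have := hE 1 0 (by simpa using hε) (by simpa using hε)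
    rwa [endChart_one_zero, mul_one] at this
  have h1N : (1 : ℂ) ∈ N := by
    refine ⟨by simpa using hε'0, ?_⟩
    simp only [Complex.one_im, Complex.one_re, nearSide_zero]
    norm_num
    exact hε'0
  have hopen : IsOpen {x : E3 | ∀ i, Φ x ∉ D i '' K i} := by
    have : {x : E3 | ∀ i, Φ x ∉ D i '' K i} = ⋂ i, Φ ⁻¹' (D i '' K i)ᶜ := by
      ext x; simp
    rw [this]
    exact isOpen_iInter_of_finite fun i =>
      (((hK i).image (hD.contDiff i).continuous).isClosed.isOpen_compl).preimage
        hB.contDiff.continuous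
  have hmem : ((0, ς, 0) : E3) ∈ {x : E3 | ∀ i, Φ x ∉ D i '' K i} := by
    rintro i ⟨p, hp, hpx⟩
    have hpc : p ∈ closedBall (0 : ℂ) 1 := by
      by_cases hi : i = i₀
      · simp only [K, hi, if_true] at hp; exact hp.1
      · simp only [K, hi, if_false] at hp; exact hp
    obtain ⟨rfl, rfl⟩ := hs i i₀ p hpc 1 (by simp) hpx h1
    simp only [K, if_true] at hp
    exact hp.2 h1N
  have hx0 : ((0, ς, 0) : E3) ∈ interior bandBox := strandPoint_mem (by norm_num) hς
  obtain ⟨δ, hδ, hball⟩ := Metric.isOpen_iff.1 (hopen.inter isOpen_interior) _ ⟨hmem, hx0⟩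
  refine ⟨δ, hδ, fun i p hp x hx hpx => ?_⟩
  obtain ⟨hxK, hxU⟩ := hball hx
  have hpK : p ∉ K i := fun hk => hxK i ⟨p, hk, hpx⟩
  have hi : i = i₀ := by
    by_contra hi
    simp only [K, hi, if_false] at hpK
    exact hpK hp
  subst hi
  simp only [K, if_true, Set.mem_sdiff, not_and, not_not] at hpK
  obtain ⟨hY, hS⟩ := hpK hp
  have hlt : ε' ≤ ε := min_le_left _ _
  have hlt2 : ε' ≤ 1 / 2 := min_le_right _ _
  have e := hE _ _ (hY.trans_le hlt) (hS.trans_le hlt)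
  rw [endChart_div_nearSide, hpx] at e
  have hbox : ((p.im, ς * ((2 - p.re) / nearSide p.im), 0) : E3) ∈ bandBox := by
    apply interior_subset
    rw [mem_interior_bandBox]
    refine ⟨by linarith, ?_, by norm_num⟩
    have := abs_lt.1 hS
    rw [abs_mul, (abs_eq one_pos.le).2 hς, one_mul, abs_lt]
    constructor <;> linarith
  have ex := hB.inj (interior_subset hxU) hbox e
  have e1 : ς * x.2.1 = (2 - p.re) / nearSide p.im := by
    rw [ex, ← mul_assoc, hςς, one_mul]
  refine ⟨rfl, ?_, by rw [ex], ?_⟩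
  · rw [e1]
    refine one_le_of_endChart_mem (Y := p.im) ?_
    rw [endChart_div_nearSide]; exact hp
  · rw [e1, ex, endChart_div_nearSide]

/-- The projection along the direction of the band. -/
noncomputable def planeProj : E3 →L[ℝ] ℂ :=
  (Complex.equivRealProdCLM.symm : ℝ × ℝ →L[ℝ] ℂ).comp
    ((ContinuousLinearMap.fst ℝ ℝ (ℝ × ℝ)).prod
      ((ContinuousLinearMap.snd ℝ ℝ ℝ).comp (ContinuousLinearMap.snd ℝ ℝ (ℝ × ℝ))))

lemma planeProj_apply (x : E3) : planeProj x = ⟨x.1, x.2.2⟩ := rfl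

/-- Along its core, the band crosses the disks transversely in simple points. -/
def CoreTransverse (D : Option ι → ℂ → E3) (Φ : E3 → E3) : Prop :=
  ∀ i, ∀ p ∈ closedBall (0 : ℂ) 1, ∀ s : ℝ, |s| < 1 → D i p = Φ (0, s, 0) →
    IsSimplePoint D (Φ (0, s, 0)) ∧ ∃ (m : ℂ → E3) (O : Set ℂ), IsOpen O ∧ p ∈ O ∧
      ContDiffOn ℝ ∞ m O ∧ m p = (0, s, 0) ∧ (∀ z ∈ O, m z ∈ interior bandBox ∧ D i z = Φ (m z)) ∧
      Function.Injective (fderiv ℝ (fun z => planeProj (m z)) p)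

lemma det_eq_zero_of_not_injective {A : ℂ →L[ℝ] ℂ} (h : ¬ Function.Injective A) : A.det = 0 := by
  rw [ContinuousLinearMap.det, LinearMap.det_eq_zero_iff_ker_ne_bot]
  intro hk
  exact h (LinearMap.ker_eq_bot.1 hk)

open MeasureTheory in
/-- Almost all lines in the direction of the band are transverse to the disks and avoid their
double points. -/
lemma exists_generic_line [Finite ι] (hD : IsRibbonFamily D) (hB : IsBand D a Φ) {r : ℝ}
    (hr : 0 < r) : ∃ w ∈ ball (0 : ℂ) r, ∀ i, ∀ p ∈ closedBall (0 : ℂ) 1, ∀ x ∈ interior bandBox,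
      planeProj x = w → D i p = Φ x →
      IsSimplePoint D (Φ x) ∧ ∃ (m : ℂ → E3) (O : Set ℂ), IsOpen O ∧ p ∈ O ∧
      ContDiffOn ℝ ∞ m O ∧ m p = x ∧ (∀ z ∈ O, m z ∈ interior bandBox ∧ D i z = Φ (m z)) ∧
      Function.Injective (fderiv ℝ (fun z => planeProj (m z)) p) := by
  obtain ⟨hD1, -, κ, hκ, ⟨A⟩⟩ := id hD
  have hsub : interior bandBox ⊆ bandBox := interior_subset
  obtain ⟨ho, g, hg, hgΦ⟩ := exists_smooth_inverse isOpen_interior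
    (hB.contDiff.contDiffOn) (hB.inj.mono hsub) (fun x hx => hB.imm x (hsub hx))
  let O : Option ι → Set ℂ := fun i => D i ⁻¹' (Φ '' interior bandBox)
  have hO : ∀ i, IsOpen (O i) := fun i => ho.preimage (hD1 i).continuous
  have hm : ∀ i, ContDiffOn ℝ ∞ (fun z => g (D i z)) (O i) := fun i =>
    hg.comp (hD1 i).contDiffOn fun z hz => hz
  let f : Option ι → ℂ → ℂ := fun i z => planeProj (g (D i z))
  have hf : ∀ i, ContDiffOn ℝ ∞ (f i) (O i) := fun i => planeProj.contDiff.comp_contDiffOn (hm i)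
  have hfd : ∀ i, ∀ z ∈ O i, HasFDerivAt (f i) (fderiv ℝ (f i) z) z := fun i z hz =>
    (((hf i).contDiffAt ((hO i).mem_nhds hz)).differentiableAt (by simp)).hasFDerivAt
  -- a line is not transverse to a disk exactly if it lies over a critical value of the projection of
  -- the disk along the band; by Sard's theorem these form a null set
  let B₁ : Set ℂ := ⋃ i, f i '' {z | z ∈ O i ∧ ¬ Function.Injective (fderiv ℝ (f i) z)}
  -- the lines through double points lie over finitely many smooth arcs, again a null set
  let S : κ → Set ℂ := fun s => {z | z.re ∈ Icc (0 : ℝ) 1 ∧ A.α s z.re ∈ O (A.a s)}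
  let B₂ : Set ℂ := ⋃ s, (fun z : ℂ => f (A.a s) (A.α s z.re)) '' S s
  have hB₁ : volume B₁ = 0 := by
    rw [measure_iUnion_null_iff]
    intro i
    refine addHaar_image_eq_zero_of_det_fderivWithin_eq_zero volume
      (f' := fderiv ℝ (f i)) (fun z hz => (hfd i z hz.1).hasFDerivWithinAt)
      fun z hz => det_eq_zero_of_not_injective hz.2
  have hB₂ : volume B₂ = 0 := by
    rw [measure_iUnion_null_iff]
    intro s
    have hα : ∀ z ∈ S s, HasFDerivWithinAt (fun z : ℂ => f (A.a s) (A.α s z.re))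
        ((fderiv ℝ (f (A.a s)) (A.α s z.re)).comp
          ((fderivWithin ℝ (A.α s) (Icc 0 1) z.re).comp Complex.reCLM)) (S s) z := by
      intro z hz
      have h1 : HasFDerivWithinAt (A.α s) _ (Icc 0 1) (Complex.reCLM z) :=
        (((A.α_smooth s).differentiableOn (by simp)) z.re hz.1).hasFDerivWithinAt
      have h2 : HasFDerivWithinAt Complex.reCLM Complex.reCLM (S s) z :=
        Complex.reCLM.hasFDerivAt.hasFDerivWithinAt
      have h3 := h1.comp z h2 fun w hw => hw.1
      exact (hfd _ _ hz.2).comp_hasFDerivWithinAt z h3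
    refine addHaar_image_eq_zero_of_det_fderivWithin_eq_zero volume hα fun z hz => ?_
    refine det_eq_zero_of_not_injective fun hinj => ?_
    refine Complex.I_ne_zero ((map_eq_zero_iff _ hinj).1 ?_)
    simp
  have hB : ¬ ball (0 : ℂ) r ⊆ B₁ ∪ B₂ := by
    intro hsub
    have h1 : volume (ball (0 : ℂ) r) ≤ 0 := by
      refine (measure_mono hsub).trans ((measure_union_le _ _).trans ?_)
      rw [hB₁, hB₂, add_zero]
    exact absurd h1 (not_le.2 (isOpen_ball.measure_pos volume ⟨0, mem_ball_self hr⟩))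
  obtain ⟨w, hw, hwB⟩ := not_subset.1 hB
  rw [mem_union, not_or] at hwB
  refine ⟨w, hw, fun i p hp x hx hxw hpx => ⟨?_, fun z => g (D i z), O i, hO i, ⟨x, hx, hpx.symm⟩,
    hm i, by simp only [hpx, hgΦ x hx], ?_, ?_⟩⟩
  · intro j k q hq q' hq' e1 e2
    by_contra hne
    have hne' : (j, q) ≠ (k, q') := fun h => hne (Prod.mk.inj h)
    have key : ∀ s, ∀ t ∈ Icc (0 : ℝ) 1, D (A.a s) (A.α s t) ≠ Φ x := by
      intro s t ht h
      refine hwB.2 (mem_iUnion.2 ⟨s, (t : ℂ), ⟨by simpa using ht, ?_⟩, ?_⟩)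
      · rw [Complex.ofReal_re]; exact ⟨x, hx, h.symm⟩
      · simp only [Complex.ofReal_re, f]
        rw [h, hgΦ x hx, hxw]
    obtain ⟨s, t, ht, ⟨h1, -⟩ | ⟨h1, -⟩⟩ := A.complete j k q hq q' hq' hne' (e1.trans e2.symm)
    · obtain ⟨rfl, rfl⟩ := Prod.mk.inj h1; exact key s t ht e1
    · obtain ⟨rfl, rfl⟩ := Prod.mk.inj h1; exact key s t ht e2
  · rintro z ⟨y, hy, hyz⟩
    have e : g (D i z) = y := by rw [← hyz, hgΦ y hy]
    simp only [e]
    exact ⟨hy, hyz.symm⟩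
  · by_contra hinj
    refine hwB.1 (mem_iUnion.2 ⟨i, p, ⟨⟨x, hx, hpx.symm⟩, hinj⟩, ?_⟩)
    simp only [f]
    rw [hpx, hgΦ x hx, hxw]

/-- The cutoff for the shift of the core, which vanishes near the two strands. -/
noncomputable def coreCut (κ : ℝ) (x : E3) : ℝ :=
  boxCut x * Real.smoothTransition ((1 - x.2.1 ^ 2) / κ - 1)

lemma contDiff_coreCut (κ : ℝ) : ContDiff ℝ ∞ (coreCut κ) := by
  have h : ContDiff ℝ ∞ Real.smoothTransition := Real.smoothTransition.contDiff
  exact contDiff_boxCut.mul (h.comp (g := Real.smoothTransition)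
    (f := fun x : E3 => (1 - x.2.1 ^ 2) / κ - 1) (by fun_prop))

lemma boxCut_mem (x : E3) : boxCut x ∈ Icc (0 : ℝ) 1 := by
  unfold boxCut
  have h := fun y => Real.smoothTransition.nonneg y
  have h' := fun y => Real.smoothTransition.le_one y
  exact ⟨mul_nonneg (mul_nonneg (h _) (h _)) (h _),
    mul_le_one₀ (mul_le_one₀ (h' _) (h _) (h' _)) (h _) (h' _)⟩

lemma coreCut_mem (κ : ℝ) (x : E3) : coreCut κ x ∈ Icc (0 : ℝ) 1 :=
  ⟨mul_nonneg (boxCut_mem x).1 (Real.smoothTransition.nonneg _),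
    mul_le_one₀ (boxCut_mem x).2 (Real.smoothTransition.nonneg _) (Real.smoothTransition.le_one _)⟩

/-- After a small shift, the core of the band is transverse to the disks. -/
theorem exists_coreTransverse [Finite ι] (hD : IsRibbonFamily D) (hB : IsBand D a Φ) {ε : ℝ}
    (hε : 0 < ε) (hE : EndForm D Φ (some a) 1 ε) (hE' : EndForm D Φ none (-1) ε)
    (hs : IsSimplePoint D (Φ (0, 1, 0))) (hs' : IsSimplePoint D (Φ (0, -1, 0))) :
    ∃ D', IsMoved D Φ D' ∧ (∃ ε > 0, EndForm D' Φ (some a) 1 ε ∧ EndForm D' Φ none (-1) ε) ∧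
      IsSimplePoint D' (Φ (0, 1, 0)) ∧ IsSimplePoint D' (Φ (0, -1, 0)) ∧ CoreTransverse D' Φ := by
  obtain ⟨δ₁, hδ₁, hU₁⟩ := exists_endUnique hD hB (Or.inl ⟨rfl, rfl⟩) hε hE hs
  obtain ⟨δ₂, hδ₂, hU₂⟩ := exists_endUnique hD hB (Or.inr ⟨rfl, rfl⟩) hε hE' hs'
  set δ := min (min δ₁ δ₂) (1 / 2) with hδdef
  have hδ : 0 < δ := by positivity
  have hδ1 : δ ≤ δ₁ := (min_le_left _ _).trans (min_le_left _ _)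
  have hδ2 : δ ≤ δ₂ := (min_le_left _ _).trans (min_le_right _ _)
  have hδh : δ ≤ 1 / 2 := min_le_right _ _
  set κ := δ / 4 with hκ
  have hκ0 : 0 < κ := by positivity
  obtain ⟨r, hr, hshift⟩ := exists_shift (contDiff_coreCut κ) isCompact_boxCore boxCore_subset
    (fun x hx => by rw [coreCut, boxCut_eq_zero hx, zero_mul])
  obtain ⟨w, hw, hgen⟩ := exists_generic_line hD hB (r := min r δ) (by positivity)
  rw [mem_ball_zero_iff, lt_min_iff] at hw
  have hw1 : |w.re| < δ := (Complex.abs_re_le_norm w).trans_lt hw.2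
  have hw2 : |w.im| < δ := (Complex.abs_im_le_norm w).trans_lt hw.2
  obtain ⟨H, hH, hHx⟩ := hshift ((-w.re, 0, -w.im) : E3) (by
    rw [Prod.norm_def, Prod.norm_def]
    simp only [norm_neg, norm_zero, Real.norm_eq_abs]
    exact max_lt ((Complex.abs_re_le_norm w).trans_lt hw.1) (max_lt hr
      ((Complex.abs_im_le_norm w).trans_lt hw.1)))
  have hHs : ∀ x, (H x).2.1 = x.2.1 := fun x => by rw [hHx]; simp
  have hHid : ∀ x : E3, 1 - κ ≤ x.2.1 ^ 2 → H x = x := by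
    intro x hx
    rw [hHx, coreCut, Real.smoothTransition.zero_of_nonpos, mul_zero, zero_smul, add_zero]
    rw [sub_nonpos, div_le_one hκ0]; linarith
  obtain ⟨D', hD', hrel⟩ := exists_isMoved hD hB hH (fun ς hς x => by
    by_cases hx : x.2.1 = ς
    · rw [hHid x (by rw [hx]; rcases hς with rfl | rfl <;> norm_num <;> linarith)]
    · exact iff_of_false (fun h => hx ((hHs x).symm.trans h.1)) fun h => hx h.1)
      (fun _ => LinearIsometryEquiv.refl ℝ ℂ)
  have hrel' : ∀ i p x, x ∈ interior bandBox → (D' i p = Φ (H x) ↔ D i p = Φ x) := hrel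
  have hsimple : ∀ x ∈ interior bandBox, IsSimplePoint D (Φ x) → IsSimplePoint D' (Φ (H x)) := by
    intro x hx h i j p hp q hq e1 e2
    rw [hrel' _ _ _ hx] at e1 e2
    exact h i j p hp q hq e1 e2
  have hend : ∀ ς : ℝ, ς = 1 ∨ ς = -1 → H (0, ς, 0) = (0, ς, 0) := by
    intro ς hς
    refine hHid _ ?_
    rcases hς with rfl | rfl <;> norm_num <;> linarith
  have hform : ∀ ς : ℝ, ς = 1 ∨ ς = -1 → ∀ i₀, EndForm D Φ i₀ ς ε →
      EndForm D' Φ i₀ ς (min ε (κ / 2)) := by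
    intro ς hς i₀ h s Y hY hsY
    rw [lt_min_iff] at hY hsY
    have h1 := abs_lt.1 hsY.2
    have h2 : ς * ς = 1 := by rcases hς with rfl | rfl <;> norm_num
    have hid : H (Y, ς * s, 0) = (Y, ς * s, 0) := by
      refine hHid _ ?_
      simp only
      rw [show (ς * s) ^ 2 = (ς * ς) * s ^ 2 by ring, h2]
      nlinarith
    rw [← hid, hrel' _ _ _ ?_]
    · exact h s Y hY.1 hsY.1
    · rw [mem_interior_bandBox]
      refine ⟨by linarith [hY.2], ?_, by norm_num⟩
      rw [abs_mul, (abs_eq one_pos.le).2 hς, one_mul, abs_lt]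
      constructor <;> linarith
  refine ⟨D', hD', ⟨min ε (κ / 2), by positivity, hform 1 (Or.inl rfl) _ hE,
    hform (-1) (Or.inr rfl) _ hE'⟩, ?_, ?_, ?_⟩
  · rw [← hend 1 (Or.inl rfl)]
    exact hsimple _ (strandPoint_mem (by norm_num) (Or.inl rfl)) hs
  · rw [← hend (-1) (Or.inr rfl)]
    exact hsimple _ (strandPoint_mem (by norm_num) (Or.inr rfl)) hs'
  · intro i p hp s hs1 hps
    obtain ⟨y, hy⟩ := H.surjective (0, s, 0)
    have hyU : y ∈ interior bandBox := by
      rw [← hH.map_mem, hy, mem_interior_bandBox]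
      exact ⟨by norm_num, by simp only; linarith, by norm_num⟩
    have hpy : D i p = Φ y := by rw [← hrel' _ _ _ hyU, hy]; exact hps
    have hys : y.2.1 = s := by rw [← hHs, hy]
    have hyx := (hHx y).symm.trans hy
    have hχ := coreCut_mem κ y
    have hy1 : y.1 = coreCut κ y * w.re := by
      have := congrArg Prod.fst hyx
      simp at this; linarith
    have hy2 : y.2.2 = coreCut κ y * w.im := by
      have := congrArg (fun x : E3 => x.2.2) hyx
      simp at this; linarith
    have hb1 : |y.1| < δ := by
      rw [hy1, abs_mul, abs_of_nonneg hχ.1]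
      exact (mul_le_of_le_one_left (abs_nonneg _) hχ.2).trans_lt hw1
    have hb2 : |y.2.2| < δ := by
      rw [hy2, abs_mul, abs_of_nonneg hχ.1]
      exact (mul_le_of_le_one_left (abs_nonneg _) hχ.2).trans_lt hw2
    -- near the strands, there are no disks on the side of the band
    have hs2 : |s| ≤ 1 - δ := by
      by_contra! hlt
      have hin : ∀ ς : ℝ, |s - ς| < δ → y ∈ ball ((0, ς, 0) : E3) δ := by
        intro ς hς
        rw [mem_ball, dist_eq_norm, Prod.norm_def, Prod.norm_def]
        simp only [Prod.fst_sub, Prod.snd_sub, sub_zero, Real.norm_eq_abs, hys]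
        exact max_lt hb1 (max_lt hς hb2)
      have h1 := abs_lt.1 hs1
      rcases le_total 0 s with h0 | h0
      · rw [abs_of_nonneg h0] at hlt
        have := (hU₁ i p hp y (ball_subset_ball hδ1 (hin 1 (by rw [abs_lt]; constructor <;> linarith)))
          hpy).2.1
        rw [hys] at this; linarith
      · rw [abs_of_nonpos h0] at hlt
        have := (hU₂ i p hp y (ball_subset_ball hδ2 (hin (-1) (by rw [abs_lt]; constructor <;> linarith)))
          hpy).2.1
        rw [hys] at this; linarith
    have hone : ∀ x : E3, |x.1| < δ → |x.2.1| < 1 - δ / 2 → |x.2.2| < δ →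
        H x = x + ((-w.re, 0, -w.im) : E3) := by
      intro x h1 h2 h3
      rw [hHx, coreCut, boxCut_eq_one (by linarith) (by linarith) (by linarith), one_mul,
        Real.smoothTransition.one_of_one_le, one_smul]
      rw [le_sub_iff_add_le, le_div_iff₀ hκ0]
      have : x.2.1 ^ 2 ≤ (1 - δ / 2) ^ 2 := sq_le_sq' (by linarith [abs_lt.1 h2]) (abs_lt.1 h2).2.le
      nlinarith
    have hyone := hone y hb1 (by rw [hys]; linarith) hb2
    have hyw : planeProj y = w := by
      rw [hyone] at hy
      have h1 := congrArg Prod.fst hy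
      have h2 := congrArg (fun x : E3 => x.2.2) hy
      simp at h1 h2
      apply Complex.ext
      · simp only [planeProj_apply]; linarith
      · simp only [planeProj_apply]; linarith
    obtain ⟨hsimp, m, O, hO, hpO, hm, hmp, hmD, hinj⟩ := hgen i p hp y hyU hyw hpy
    refine ⟨by rw [← hy]; exact hsimple y hyU hsimp, fun z => H (m z), O, hO, hpO,
      hH.1.comp_contDiffOn hm, by simp only [hmp, hy], fun z hz => ⟨hH.map_mem.2 (hmD z hz).1,
      (hrel' _ _ _ (hmD z hz).1).2 (hmD z hz).2⟩, ?_⟩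
    have hmc : ContinuousAt m p := (hm.contDiffAt (hO.mem_nhds hpO)).continuousAt
    have hopen : IsOpen {x : E3 | |x.1| < δ ∧ |x.2.1| < 1 - δ / 2 ∧ |x.2.2| < δ} :=
      (isOpen_lt (f := fun x : E3 => |x.1|) (g := fun _ => δ) (by fun_prop) (by fun_prop)).inter
      ((isOpen_lt (f := fun x : E3 => |x.2.1|) (g := fun _ => 1 - δ / 2) (by fun_prop)
        (by fun_prop)).inter
      (isOpen_lt (f := fun x : E3 => |x.2.2|) (g := fun _ => δ) (by fun_prop) (by fun_prop)))
    have hev : (fun z => planeProj (H (m z))) =ᶠ[nhds p]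
        fun z => planeProj (m z) + planeProj (-w.re, 0, -w.im) := by
      have : ∀ᶠ z in nhds p, |(m z).1| < δ ∧ |(m z).2.1| < 1 - δ / 2 ∧ |(m z).2.2| < δ := by
        refine hmc.eventually (hopen.mem_nhds ?_)
        rw [hmp]
        exact ⟨hb1, by rw [hys]; linarith, hb2⟩
      filter_upwards [this] with z hz
      rw [hone _ hz.1 hz.2.1 hz.2.2, map_add]
    rw [hev.fderiv_eq, fderiv_add_const]
    exact hinj

end CoreTransverse

/-! ### Narrow bands -/

/-- The compression of the box of a band towards its core by the factor `c`. -/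
noncomputable def compress (c : ℝ) (x : E3) : E3 := (x.1 * (1 - (1 - c) * boxCut x), x.2)

lemma hasDerivAt_compress {c : ℝ} (hc : 0 < c) (hc1 : c ≤ 1) (y : ℝ × ℝ) (u : ℝ) :
    ∃ d > 0, HasDerivAt (fun u : ℝ => u * (1 - (1 - c) * boxCut (u, y))) d u := by
  set B := Real.smoothTransition (3 - y.1 ^ 2) * Real.smoothTransition (2 - 4 * y.2 ^ 2) with hB
  have hB0 : 0 ≤ B := mul_nonneg (Real.smoothTransition.nonneg _) (Real.smoothTransition.nonneg _)
  have hB1 : B ≤ 1 := mul_le_one₀ (Real.smoothTransition.le_one _)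
    (Real.smoothTransition.nonneg _) (Real.smoothTransition.le_one _)
  set T := Real.smoothTransition with hT
  have hTd : Differentiable ℝ T :=
    (Real.smoothTransition.contDiff (n := 1)).differentiable (by simp)
  have hT' : 0 ≤ deriv T ((8 - u ^ 2) * (4 / 7)) :=
    Real.smoothTransition.monotone.deriv_nonneg
  have h1 : HasDerivAt (fun u : ℝ => (8 - u ^ 2) * (4 / 7)) (-(2 * u) * (4 / 7)) u := by
    have := ((hasDerivAt_pow 2 u).const_sub 8).mul_const (4 / 7 : ℝ)
    simpa using this
  have h2 : HasDerivAt (fun u : ℝ => T ((8 - u ^ 2) * (4 / 7)))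
      (deriv T ((8 - u ^ 2) * (4 / 7)) * (-(2 * u) * (4 / 7))) u :=
    ((hTd _).hasDerivAt).comp u h1
  have h3 : HasDerivAt (fun u : ℝ => u * (1 - (1 - c) * (T ((8 - u ^ 2) * (4 / 7)) * B))) _ u :=
    (hasDerivAt_id u).mul (((h2.mul_const B).const_mul (1 - c)).const_sub 1)
  have e : (fun u : ℝ => u * (1 - (1 - c) * boxCut (u, y))) =
      fun u : ℝ => u * (1 - (1 - c) * (T ((8 - u ^ 2) * (4 / 7)) * B)) := by
    funext u
    simp only [boxCut, hB, hT, mul_assoc]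
  rw [e]
  refine ⟨_, ?_, h3⟩
  have hT0 := Real.smoothTransition.nonneg ((8 - u ^ 2) * (4 / 7))
  have hT1 := Real.smoothTransition.le_one ((8 - u ^ 2) * (4 / 7))
  simp only [id]
  have e1 : T ((8 - u ^ 2) * (4 / 7)) * B ≤ 1 := mul_le_one₀ hT1 hB0 hB1
  have e2 : 0 ≤ T ((8 - u ^ 2) * (4 / 7)) * B := mul_nonneg hT0 hB0
  have e3 : 0 ≤ (1 - c) * (deriv T ((8 - u ^ 2) * (4 / 7)) * (u ^ 2) * B) :=
    mul_nonneg (by linarith) (by positivity)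
  nlinarith

lemma exists_compress {c : ℝ} (hc : 0 < c) (hc1 : c ≤ 1) :
    ∃ C : Equiv.Perm E3, DiffeoIn (interior bandBox) C ∧ ∀ x, C x = compress c x := by
  have hsm : ContDiff ℝ ∞ (compress c) :=
    (contDiff_fst.mul (contDiff_const.sub (contDiff_const.mul contDiff_boxCut))).prodMk contDiff_snd
  have hmono : ∀ y : ℝ × ℝ, StrictMono fun u : ℝ => u * (1 - (1 - c) * boxCut (u, y)) := by
    intro y
    refine strictMono_of_deriv_pos fun u => ?_
    obtain ⟨d, hd, h⟩ := hasDerivAt_compress hc hc1 y u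
    rw [h.deriv]; exact hd
  have hinj : Function.Injective (compress c) := by
    rintro ⟨u, y⟩ ⟨u', y'⟩ h
    obtain ⟨h1, h2⟩ := Prod.mk.inj h
    simp only at h2
    subst h2
    have h3 : u = u' := (hmono y).injective h1
    rw [h3]
  have himm : ∀ x, Function.Injective (fderiv ℝ (compress c) x) := by
    rintro ⟨u, y⟩
    have hd := ((hsm.differentiable (by simp)) (u, y)).hasFDerivAt
    rw [injective_iff_map_eq_zero]
    rintro ⟨v, w⟩ hv
    have h1 : HasFDerivAt (fun x => (compress c x).2) _ (u, y) := hd.snd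
    have h2 : HasFDerivAt (fun x : E3 => (compress c x).2) (ContinuousLinearMap.snd ℝ ℝ (ℝ × ℝ))
        (u, y) :=
      hasFDerivAt_snd
    have h3 := DFunLike.congr_fun (h1.unique h2) (v, w)
    have hw : w = 0 := by
      rw [ContinuousLinearMap.comp_apply, hv] at h3
      simpa using h3.symm
    subst hw
    obtain ⟨d, hd0, h⟩ := hasDerivAt_compress hc hc1 y u
    have hl : HasDerivAt (fun t : ℝ => ((t, y) : E3)) (1, 0) u :=
      (hasDerivAt_id u).prodMk (hasDerivAt_const u y)
    have h4 := HasFDerivAt.comp_hasDerivAt (l := compress c) u hd hl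
    have h5 : HasDerivAt (fun t : ℝ => (compress c (t, y)).1) _ u := h4.fst
    have h6 := h5.unique h
    have e : ((v, 0) : E3) = v • (1, 0) := by simp
    rw [e, map_smul] at hv
    have h7 := congrArg Prod.fst hv
    simp only [Prod.smul_fst, Prod.fst_zero, smul_eq_mul] at h7
    rw [h6] at h7
    rcases mul_eq_zero.1 h7 with h8 | h8
    · rw [h8]; rfl
    · exact absurd h8 hd0.ne'
  obtain ⟨F, hF, hFe⟩ := exists_diffeoIn hsm hinj himm isCompact_boxCore boxCore_subset
    (fun x hx => by simp [compress, boxCut_eq_zero hx])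
  exact ⟨F, hF, fun x => by rw [hFe]⟩

section Crossings

variable {ι : Type} {D : Option ι → ℂ → E3} {a : ι} {Φ : E3 → E3}

/-- The projection of the box along the sides of the neck. -/
noncomputable def neckProj (x : E3) : ℂ := ⟨x.1 / neckWidth x.2.1, x.2.2⟩

lemma contDiffAt_neckProj {x : E3} (hx : |x.2.1| < 1) : ContDiffAt ℝ ∞ neckProj x := by
  have e : neckProj = fun x : E3 => Complex.equivRealProdCLM.symm
      (x.1 / neckWidth x.2.1, x.2.2) := by
    funext x; rfl
  rw [e]
  refine Complex.equivRealProdCLM.symm.contDiff.contDiffAt.comp x ?_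
  have h0 : ContDiffAt ℝ ∞ (fun x : E3 => x.2.1) x := ContDiff.contDiffAt (by fun_prop)
  have h1 : ContDiffAt ℝ ∞ neckWidth x.2.1 :=
    contDiffOn_neckWidth.contDiffAt (isOpen_Ioo.mem_nhds (abs_lt.1 hx))
  have h2 : ContDiffAt ℝ ∞ (fun x : E3 => neckWidth x.2.1) x :=
    ContDiffAt.comp (g := neckWidth) x h1 h0
  have h3 : ContDiffAt ℝ ∞ (fun x : E3 => x.1) x := contDiffAt_fst
  have h4 : ContDiffAt ℝ ∞ (fun x : E3 => x.2.2) x := ContDiff.contDiffAt (by fun_prop)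
  exact (h3.div h2 (by linarith [one_le_neckWidth hx])).prodMk h4

lemma fderiv_neckProj {s : ℝ} (hs : |s| < 1) (v : E3) :
    fderiv ℝ neckProj (0, s, 0) v = ⟨(neckWidth s)⁻¹ * v.1, v.2.2⟩ := by
  have e : neckProj = fun x : E3 => Complex.equivRealProdCLM.symm
      (x.1 * (neckWidth x.2.1)⁻¹, x.2.2) := by
    funext x; rfl
  have h0 : ContDiffAt ℝ ∞ (fun x : E3 => x.2.1) (0, s, 0) := ContDiff.contDiffAt (by fun_prop)
  have h1 : ContDiffAt ℝ ∞ neckWidth s :=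
    contDiffOn_neckWidth.contDiffAt (isOpen_Ioo.mem_nhds (abs_lt.1 hs))
  have h2 : ContDiffAt ℝ ∞ (fun x : E3 => (neckWidth x.2.1)⁻¹) (0, s, 0) :=
    (ContDiffAt.comp (g := neckWidth) ((0, s, 0) : E3) h1 h0).inv
      (zero_lt_one.trans_le (one_le_neckWidth hs)).ne'
  have h3 := (h2.differentiableAt (by simp)).hasFDerivAt
  have h4 : HasFDerivAt (fun x : E3 => x.1) (ContinuousLinearMap.fst ℝ ℝ (ℝ × ℝ)) (0, s, 0) :=
    hasFDerivAt_fst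
  have h5 : HasFDerivAt (fun x : E3 => x.2.2) ((ContinuousLinearMap.snd ℝ ℝ ℝ).comp
      (ContinuousLinearMap.snd ℝ ℝ (ℝ × ℝ))) (0, s, 0) := hasFDerivAt_snd.snd
  have h6 := Complex.equivRealProdCLM.symm.hasFDerivAt.comp ((0, s, 0) : E3) ((h4.mul h3).prodMk h5)
  have h7 := h6.congr_of_eventuallyEq (f₁ := neckProj)
    (Filter.Eventually.of_forall fun x => congrFun e x)
  rw [h7.fderiv]
  apply Complex.ext <;> simp

/-- The disk `i` crosses the band at the point `p`, in the piece `V` of the disk, on which `m` is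
the disk in band coordinates. -/
structure CrossingChart (D : Option ι → ℂ → E3) (Φ : E3 → E3) (i : Option ι) (p : ℂ)
    (m : ℂ → E3) (V : Set ℂ) : Prop where
  isOpen : IsOpen V
  mem : p ∈ V
  subset : V ⊆ ball 0 1
  smooth : ContDiffOn ℝ ∞ m V
  eq : ∀ z ∈ V, m z ∈ interior bandBox ∧ D i z = Φ (m z)
  lt : ∀ z ∈ V, |(m z).2.1| < 1
  inj : InjOn (fun z => neckProj (m z)) V
  imm : ∀ z ∈ V, Function.Injective (fderiv ℝ (fun z => neckProj (m z)) z)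
  zero : neckProj (m p) = 0
  unique : ∀ z ∈ V, ∀ j, ∀ q ∈ closedBall (0 : ℂ) 1, D j q = D i z → j = i ∧ q = z

lemma exists_crossingChart [Finite ι] (hD : IsRibbonFamily D) (hB : IsBand D a Φ)
    (hT : CoreTransverse D Φ) {i : Option ι} {p : ℂ} (hp : p ∈ closedBall (0 : ℂ) 1) {s : ℝ}
    (hs : |s| < 1) (h : D i p = Φ (0, s, 0)) {W : Set ℂ} (hW : IsOpen W) (hpW : p ∈ W) :
    ∃ m V, V ⊆ W ∧ CrossingChart D Φ i p m V := by
  classical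
  obtain ⟨hsimp, m, O, hO, hpO, hm, hmp, hmD, hinj⟩ := hT i p hp s hs h
  have hx0 : ((0, s, 0) : E3) ∈ bandBox := by
    have := abs_lt.1 hs
    refine ⟨⟨by norm_num, by norm_num⟩, ⟨by linarith, by linarith⟩, by norm_num, by norm_num⟩
  have hpb : p ∈ ball (0 : ℂ) 1 := by
    refine mem_ball.2 (lt_of_le_of_ne (mem_closedBall.1 hp) fun hps => ?_)
    have h1 : Φ (0, s, 0) ∈ D i '' sphere (0 : ℂ) 1 := ⟨p, hps, h⟩
    rw [hB.mem_boundary_iff hD hx0] at h1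
    rcases h1 with ⟨-, h1, -⟩ | ⟨-, h1, -⟩ <;> (simp only at h1; rw [h1] at hs; norm_num at hs)
  -- points of the disk where the coordinate along the band is in range
  have hmc := hm.continuousOn
  set O₁ := O ∩ m ⁻¹' {x | |x.2.1| < 1} with hO₁
  have hO₁o : IsOpen O₁ := hmc.isOpen_inter_preimage hO
    (isOpen_lt (f := fun x : E3 => |x.2.1|) (g := fun _ => 1) (by fun_prop) (by fun_prop))
  have hpO₁ : p ∈ O₁ := ⟨hpO, by simp only [mem_preimage, hmp]; exact hs⟩
  set f : ℂ → ℂ := fun z => neckProj (m z) with hf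
  have hfs : ContDiffOn ℝ ∞ f O₁ := fun z hz =>
    ((contDiffAt_neckProj hz.2).comp z (hm.contDiffAt (hO.mem_nhds hz.1))).contDiffWithinAt
  have hfp : ContDiffAt ℝ ∞ f p := hfs.contDiffAt (hO₁o.mem_nhds hpO₁)
  have hmd : DifferentiableAt ℝ m p := (hm.contDiffAt (hO.mem_nhds hpO)).differentiableAt (by simp)
  have hfinj : Function.Injective (fderiv ℝ f p) := by
    have e1 : fderiv ℝ f p = (fderiv ℝ neckProj (m p)).comp (fderiv ℝ m p) := by
      refine fderiv_comp p ((contDiffAt_neckProj ?_).differentiableAt (by simp)) hmd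
      rw [hmp]; exact hs
    have e2 : fderiv ℝ (fun z => planeProj (m z)) p = planeProj.comp (fderiv ℝ m p) :=
      (planeProj.hasFDerivAt.comp p hmd.hasFDerivAt).fderiv
    rw [e2] at hinj
    rw [e1, injective_iff_map_eq_zero]
    intro v hv
    rw [ContinuousLinearMap.comp_apply, hmp, fderiv_neckProj hs] at hv
    refine (map_eq_zero_iff _ hinj).1 ?_
    rw [ContinuousLinearMap.comp_apply, planeProj_apply]
    have h1 := congrArg Complex.re hv
    have h2 := congrArg Complex.im hv
    have hw : (neckWidth s)⁻¹ ≠ 0 := inv_ne_zero (by linarith [one_le_neckWidth hs])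
    simp only [Complex.zero_re, Complex.zero_im, mul_eq_zero, hw, false_or] at h1 h2
    rw [h1, h2]; rfl
  -- the projection is a local diffeomorphism
  obtain ⟨V₁, hV₁, hpV₁, hV₁inj⟩ : ∃ V₁, IsOpen V₁ ∧ p ∈ V₁ ∧ InjOn f V₁ := by
    have h1 := hfp.hasStrictFDerivAt (by simp)
    rw [← coe_clmEquivOfInjective _ hfinj] at h1
    exact ⟨_, (h1.toOpenPartialHomeomorph f).open_source, h1.mem_toOpenPartialHomeomorph_source,
      (h1.toOpenPartialHomeomorph f).injOn⟩
  have himm : ∀ᶠ z in nhds p, Function.Injective (fderiv ℝ f z) := by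
    have h1 : ContinuousAt (fderiv ℝ f) p :=
      (hfp.fderiv_right (m := 0) (by simp)).continuousAt
    have h2 := ContinuousLinearEquiv.nhds (clmEquivOfInjective _ hfinj)
    rw [coe_clmEquivOfInjective] at h2
    filter_upwards [h1.preimage_mem_nhds h2] with z hz
    obtain ⟨e, he⟩ := hz
    rw [← he]
    exact e.injective
  obtain ⟨V₂, hV₂, hV₂o, hpV₂⟩ := _root_.mem_nhds_iff.1 himm
  set V₃ := V₁ ∩ O₁ with hV₃
  -- the disks do not return to the crossing
  let K : Option ι → Set ℂ := fun j => if j = i then closedBall 0 1 \ V₃ else closedBall 0 1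
  have hK : ∀ i, IsCompact (K i) := by
    intro j
    by_cases hj : j = i
    · simp only [K, hj, if_true]
      exact (isCompact_closedBall 0 1).diff (hV₁.inter hO₁o)
    · simp only [K, hj, if_false]; exact isCompact_closedBall 0 1
  have hopen : IsOpen {z : ℂ | ∀ j, D i z ∉ D j '' K j} := by
    have : {z : ℂ | ∀ j, D i z ∉ D j '' K j} = ⋂ j, D i ⁻¹' (D j '' K j)ᶜ := by
      ext x; simp
    rw [this]
    exact isOpen_iInter_of_finite fun j =>
      (((hK j).image (hD.contDiff j).continuous).isClosed.isOpen_compl).preimage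
        (hD.contDiff i).continuous
  have hmem : p ∈ {z : ℂ | ∀ j, D i z ∉ D j '' K j} := by
    rintro j ⟨q, hq, hqp⟩
    have hqc : q ∈ closedBall (0 : ℂ) 1 := by
      by_cases hj : j = i
      · simp only [K, hj, if_true] at hq; exact hq.1
      · simp only [K, hj, if_false] at hq; exact hq
    obtain ⟨rfl, rfl⟩ := hsimp j i q hqc p hp (hqp.trans h) h
    simp only [K, if_true] at hq
    exact hq.2 ⟨hpV₁, hpO₁⟩
  refine ⟨m, W ∩ ball 0 1 ∩ V₃ ∩ V₂ ∩ {z : ℂ | ∀ j, D i z ∉ D j '' K j},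
    fun z hz => hz.1.1.1.1, ?_⟩
  exact {
    isOpen := (((hW.inter isOpen_ball).inter (hV₁.inter hO₁o)).inter hV₂o).inter hopen
    mem := ⟨⟨⟨⟨hpW, hpb⟩, hpV₁, hpO₁⟩, hpV₂⟩, hmem⟩
    subset := fun z hz => hz.1.1.1.2
    smooth := hm.mono fun z hz => hz.1.1.2.2.1
    eq := fun z hz => hmD z hz.1.1.2.2.1
    lt := fun z hz => hz.1.1.2.2.2
    inj := hV₁inj.mono fun z hz => hz.1.1.2.1
    imm := fun z hz => hV₂ hz.1.2
    zero := by rw [hmp]; simp [neckProj]; rfl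
    unique := by
      intro z hz j q hq hqz
      have hqK : q ∉ K j := fun hk => hz.2 j ⟨q, hk, hqz⟩
      have hj : j = i := by
        by_contra hj
        simp only [K, hj, if_false] at hqK
        exact hqK hq
      subst hj
      simp only [K, if_true, Set.mem_sdiff, not_and, not_not] at hqK
      have hqV := hqK hq
      refine ⟨rfl, hV₁inj hqV.1 hz.1.1.2.1 ?_⟩
      have e1 := hmD q hqV.2.1
      have e2 := hmD z hz.1.1.2.2.1
      have e3 := hB.inj (interior_subset e1.1) (interior_subset e2.1)
        (e1.2.symm.trans (hqz.trans e2.2))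
      simp only [hf, e3] }

lemma CrossingChart.eq_of_core {i : Option ι} {p : ℂ} {m : ℂ → E3} {V : Set ℂ}
    (hB : IsBand D a Φ) (h : CrossingChart D Φ i p m V) {z : ℂ} (hz : z ∈ V) {s : ℝ}
    (hs : |s| < 1) (hzs : D i z = Φ (0, s, 0)) : z = p := by
  have hx0 : ((0, s, 0) : E3) ∈ interior bandBox := by
    rw [mem_interior_bandBox]; exact ⟨by norm_num, by simp only; linarith, by norm_num⟩
  have e1 := h.eq z hz
  have e2 := hB.inj (interior_subset e1.1) (interior_subset hx0) (e1.2.symm.trans hzs)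
  refine h.inj hz h.mem ?_
  change neckProj (m z) = neckProj (m p)
  rw [h.zero, e2]
  simp [neckProj]
  rfl

lemma finite_coreCrossings [Finite ι] (hD : IsRibbonFamily D) (hB : IsBand D a Φ)
    (hT : CoreTransverse D Φ) {δ : ℝ} (hδ : 0 < δ)
    (hend : ∀ i, ∀ p ∈ closedBall (0 : ℂ) 1, ∀ s : ℝ, |s| < 1 → D i p = Φ (0, s, 0) → |s| ≤ 1 - δ) :
    {q : Option ι × ℂ | q.2 ∈ closedBall (0 : ℂ) 1 ∧
      ∃ s : ℝ, |s| < 1 ∧ D q.1 q.2 = Φ (0, s, 0)}.Finite := by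
  have hone : ∀ i : Option ι, {p : ℂ | p ∈ closedBall (0 : ℂ) 1 ∧
      ∃ s : ℝ, |s| < 1 ∧ D i p = Φ (0, s, 0)}.Finite := by
    intro i
    set X := {p : ℂ | p ∈ closedBall (0 : ℂ) 1 ∧ ∃ s : ℝ, |s| < 1 ∧ D i p = Φ (0, s, 0)} with hX
    have hXc : IsCompact X := by
      have e : X = closedBall (0 : ℂ) 1 ∩
          D i ⁻¹' ((fun s : ℝ => Φ (0, s, 0)) '' Icc (-(1 - δ)) (1 - δ)) := by
        ext p
        constructor
        · rintro ⟨hp, s, hs, h⟩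
          exact ⟨hp, s, abs_le.1 (hend i p hp s hs h), h.symm⟩
        · rintro ⟨hp, s, hs, h⟩
          exact ⟨hp, s, (abs_le.2 hs).trans_lt (by linarith), h.symm⟩
      rw [e]
      refine (isCompact_closedBall 0 1).inter_right (IsClosed.preimage (hD.contDiff i).continuous ?_)
      refine (isCompact_Icc.image ?_).isClosed
      exact hB.contDiff.continuous.comp (by fun_prop)
    have hV : ∀ p ∈ X, ∃ V ∈ nhds p, V ∩ X ⊆ {p} := by
      rintro p ⟨hp, s, hs, h⟩
      obtain ⟨m, V, -, hV⟩ := exists_crossingChart hD hB hT hp hs h isOpen_univ (mem_univ p)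
      refine ⟨V, hV.isOpen.mem_nhds hV.mem, ?_⟩
      rintro z ⟨hz, -, t, ht, hzt⟩
      exact hV.eq_of_core hB hz ht hzt
    choose! V hV1 hV2 using hV
    obtain ⟨t, htX, ht⟩ := hXc.elim_nhds_subcover V hV1
    refine t.finite_toSet.subset fun z hz => ?_
    obtain ⟨p, hp, hzp⟩ := mem_iUnion₂.1 (ht hz)
    have := hV2 p (htX p hp) ⟨hzp, hz⟩
    rw [mem_singleton_iff.1 this]
    exact hp
  refine (Set.finite_iUnion fun i => (hone i).image (Prod.mk i)).subset ?_
  rintro ⟨i, p⟩ h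
  exact mem_iUnion.2 ⟨i, p, h, rfl⟩

end Crossings

section Fusion

variable {ι : Type} {D : Option ι → ℂ → E3} {a : ι} {Φ : E3 → E3}

lemma CrossingChart.surjective {i : Option ι} {p : ℂ} {m : ℂ → E3} {V : Set ℂ}
    (h : CrossingChart D Φ i p m V) {z : ℂ} (hz : z ∈ V) :
    ∃ v : ℂ, (fderiv ℝ m z v).2.2 = 1 := by
  obtain ⟨v, hv⟩ := surjective_of_injective_clm (h.imm z hz) Complex.I
  refine ⟨v, ?_⟩
  have hm := ((h.smooth.contDiffAt (h.isOpen.mem_nhds hz)).differentiableAt (by simp)).hasFDerivAt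
  have hk := ((contDiffAt_neckProj (h.lt z hz)).differentiableAt (by simp)).hasFDerivAt
  have h1 : HasFDerivAt (fun w => (neckProj (m w)).im) _ z :=
    Complex.imCLM.hasFDerivAt.comp z (hk.comp z hm)
  have h2 : HasFDerivAt (fun w => (neckProj (m w)).im) _ z := hm.snd.snd
  have h3 := DFunLike.congr_fun (h1.unique h2) v
  have h4 := (hk.comp z hm).fderiv
  have h5 : fderiv ℝ (fun z => neckProj (m z)) z v =
      ((fderiv ℝ neckProj (m z)).comp (fderiv ℝ m z)) v := DFunLike.congr_fun h4 v
  rw [hv] at h5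
  rw [ContinuousLinearMap.comp_apply, ← h5] at h3
  simpa using h3.symm

/-- The curve in the disk along which it crosses the neck. -/
lemma CrossingChart.exists_inverse {i : Option ι} {p : ℂ} {m : ℂ → E3} {V : Set ℂ}
    (h : CrossingChart D Φ i p m V) : ∃ (g : ℂ → ℂ) (r : ℝ), 0 < r ∧
      ContDiffOn ℝ ∞ g (ball 0 r) ∧ (∀ w ∈ ball (0 : ℂ) r, g w ∈ V ∧ neckProj (m (g w)) = w) ∧
      ∀ z ∈ V, g (neckProj (m z)) = z := by
  have hf : ContDiffOn ℝ ∞ (fun z => neckProj (m z)) V := fun z hz =>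
    ((contDiffAt_neckProj (h.lt z hz)).comp z
      (h.smooth.contDiffAt (h.isOpen.mem_nhds hz))).contDiffWithinAt
  obtain ⟨ho, g, hg, hgf⟩ := exists_smooth_inverse h.isOpen hf h.inj h.imm
  have h0 : (0 : ℂ) ∈ (fun z => neckProj (m z)) '' V := ⟨p, h.mem, h.zero⟩
  obtain ⟨r, hr, hball⟩ := Metric.isOpen_iff.1 ho 0 h0
  refine ⟨g, r, hr, hg.mono hball, fun w hw => ?_, hgf⟩
  obtain ⟨z, hz, rfl⟩ := hball hw
  have e := hgf z hz
  simp only at e ⊢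
  rw [e]
  exact ⟨hz, rfl⟩

/-- A band with a transverse core can be made narrow enough to be adapted to the disks. -/
theorem exists_isJoin_of_coreTransverse [Finite ι] (hD : IsRibbonFamily D) (hB : IsBand D a Φ)
    {ε : ℝ} (hε : 0 < ε) (hE : EndForm D Φ (some a) 1 ε) (hE' : EndForm D Φ none (-1) ε)
    (hs : IsSimplePoint D (Φ (0, 1, 0))) (hs' : IsSimplePoint D (Φ (0, -1, 0)))
    (hT : CoreTransverse D Φ) : ∃ D' : ι → ℂ → E3, IsJoin D a Φ D' := by
  classical
  obtain ⟨δ₁, hδ₁, hU₁⟩ := exists_endUnique hD hB (Or.inl ⟨rfl, rfl⟩) hε hE hs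
  obtain ⟨δ₂, hδ₂, hU₂⟩ := exists_endUnique hD hB (Or.inr ⟨rfl, rfl⟩) hε hE' hs'
  set δ := min (min δ₁ δ₂) (1 / 2) with hδdef
  have hδ : 0 < δ := by positivity
  have hδ1 : δ ≤ δ₁ := (min_le_left _ _).trans (min_le_left _ _)
  have hδ2 : δ ≤ δ₂ := (min_le_left _ _).trans (min_le_right _ _)
  have hδh : δ ≤ 1 / 2 := min_le_right _ _
  have hball : ∀ ς u s : ℝ, |u| < δ → |s - ς| < δ → ((u, s, 0) : E3) ∈ ball ((0, ς, 0) : E3) δ := by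
    intro ς u s hu hs
    rw [mem_ball, dist_eq_norm, Prod.norm_def, Prod.norm_def]
    simp only [Prod.fst_sub, Prod.snd_sub, sub_zero, Real.norm_eq_abs, abs_zero]
    exact max_lt hu (max_lt hs hδ)
  -- no disk meets the band near its ends
  have hend : ∀ i, ∀ p ∈ closedBall (0 : ℂ) 1, ∀ u s : ℝ, |u| < δ → |s| < 1 →
      D i p = Φ (u, s, 0) → |s| ≤ 1 - δ := by
    intro i p hp u s hu hs1 h
    by_contra! hlt
    have h1 := abs_lt.1 hs1
    rcases le_total 0 s with h0 | h0
    · rw [abs_of_nonneg h0] at hlt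
      have := (hU₁ i p hp _ (ball_subset_ball hδ1
        (hball 1 u s hu (by rw [abs_lt]; constructor <;> linarith))) h).2.1
      simp only at this; linarith
    · rw [abs_of_nonpos h0] at hlt
      have := (hU₂ i p hp _ (ball_subset_ball hδ2
        (hball (-1) u s hu (by rw [abs_lt]; constructor <;> linarith))) h).2.1
      simp only at this; linarith
  set X := {q : Option ι × ℂ | q.2 ∈ closedBall (0 : ℂ) 1 ∧
      ∃ s : ℝ, |s| < 1 ∧ D q.1 q.2 = Φ (0, s, 0)} with hX
  have hXf : X.Finite := finite_coreCrossings hD hB hT hδ fun i p hp s hs h =>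
    hend i p hp 0 s (by simpa using hδ) hs h
  obtain ⟨W, hW, hWd⟩ := (hXf.image Prod.snd).t2_separation
  have : Finite X := hXf
  have hchart : ∀ r : X, ∃ m V, V ⊆ W r.1.2 ∧ CrossingChart D Φ r.1.1 r.1.2 m V := by
    rintro ⟨q, hq, s, hs, h⟩
    exact exists_crossingChart hD hB hT hq hs h (hW q.2).2 (hW q.2).1
  choose m V hVW hV using hchart
  have hinv := fun r => (hV r).exists_inverse
  choose g ρ hρ hgs hgV hgl using hinv
  obtain ⟨ρ₀, hρ₀, hρle⟩ : ∃ ρ₀ > 0, ∀ r, ρ₀ ≤ ρ r := by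
    rcases isEmpty_or_nonempty X with hX | hX
    · exact ⟨1, one_pos, fun r => (hX.false r).elim⟩
    · obtain ⟨r₀, h⟩ := Finite.exists_min ρ
      exact ⟨ρ r₀, hρ r₀, h⟩
  -- a neighbourhood of the core in which all crossings are in the charts
  let K : Option ι → Set ℂ := fun j => closedBall 0 1 \ ⋃ (r : X) (_ : r.1.1 = j), V r
  have hKc : ∀ j, IsCompact (K j) := fun j => (isCompact_closedBall 0 1).diff
    (isOpen_iUnion fun r => isOpen_iUnion fun _ => (hV r).isOpen)
  have hΩ : IsOpen {x : E3 | ∀ j, Φ x ∉ D j '' K j} := by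
    have : {x : E3 | ∀ j, Φ x ∉ D j '' K j} = ⋂ j, Φ ⁻¹' (D j '' K j)ᶜ := by
      ext x; simp
    rw [this]
    exact isOpen_iInter_of_finite fun j =>
      (((hKc j).image (hD.contDiff j).continuous).isClosed.isOpen_compl).preimage
        hB.contDiff.continuous
  have hcore : (fun s : ℝ => ((0, s, 0) : E3)) '' Icc (-(1 - δ)) (1 - δ) ⊆
      {x : E3 | ∀ j, Φ x ∉ D j '' K j} := by
    rintro _ ⟨s, hs, rfl⟩ j ⟨p, hp, hps⟩
    have hs1 : |s| < 1 := (abs_le.2 hs).trans_lt (by linarith)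
    refine hp.2 (mem_iUnion₂.2 ⟨⟨(j, p), hp.1, s, hs1, hps⟩, rfl, ?_⟩)
    exact (hV ⟨(j, p), hp.1, s, hs1, hps⟩).mem
  obtain ⟨θ, hθ, hθs⟩ := (isCompact_Icc.image (f := fun s : ℝ => ((0, s, 0) : E3))
    (by fun_prop)).exists_thickening_subset_open hΩ hcore
  have hcover : ∀ j, ∀ p ∈ closedBall (0 : ℂ) 1, ∀ u s : ℝ, |u| < min θ δ → |s| < 1 →
      D j p = Φ (u, s, 0) → ∃ r : X, r.1.1 = j ∧ p ∈ V r := by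
    intro j p hp u s hu hs h
    rw [lt_min_iff] at hu
    have hs2 := hend j p hp u s hu.2 hs h
    by_contra! hno
    have hin : ((u, s, 0) : E3) ∈ thickening θ
        ((fun s : ℝ => ((0, s, 0) : E3)) '' Icc (-(1 - δ)) (1 - δ)) := by
      refine mem_thickening_iff.2 ⟨(0, s, 0), ⟨s, abs_le.1 hs2, rfl⟩, ?_⟩
      rw [dist_eq_norm, Prod.norm_def, Prod.norm_def]
      simpa [hθ] using hu.1
    refine hθs hin j ⟨p, ⟨hp, ?_⟩, h⟩
    simp only [mem_iUnion, not_exists]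
    exact hno
  -- the factor of compression: the neck has to fit into the regions of the normal form at both ends
  -- (`ε`), into the charts of all crossings (`ρ₀`), and into the neighbourhood of the core (`θ`, `δ`)
  set c := min (min (1 / 10) (2 / 5 * ε)) (min (ρ₀ / 2) (min (θ / 3) (δ / 3))) with hc
  have hc0 : 0 < c := by positivity
  have hc10 : c ≤ 1 / 10 := (min_le_left _ _).trans (min_le_left _ _)
  have hcε : c ≤ 2 / 5 * ε := (min_le_left _ _).trans (min_le_right _ _)
  have hcρ : c ≤ ρ₀ / 2 := (min_le_right _ _).trans (min_le_left _ _)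
  have hcθ : c ≤ θ / 3 := (min_le_right _ _).trans ((min_le_right _ _).trans (min_le_left _ _))
  have hcδ : c ≤ δ / 3 := (min_le_right _ _).trans ((min_le_right _ _).trans (min_le_right _ _))
  obtain ⟨C, hC, hCx⟩ := exists_compress hc0 (by linarith : c ≤ 1)
  have hC2 : ∀ x, (C⁻¹ x).2 = x.2 := by
    intro x
    obtain ⟨y, rfl⟩ := C.surjective x
    have e : C⁻¹ (C y) = y := C.symm_apply_apply y
    rw [e, hCx]; rfl
  obtain ⟨D', hD', hrel⟩ := exists_isMoved hD hB hC.inv (fun ς hς x => by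
    simp only [bandLine, Set.mem_ofPred_eq, hC2]) (fun _ => LinearIsometryEquiv.refl ℝ ℂ)
  have hrel1 : ∀ i p x, x ∈ interior bandBox → (D' i p = Φ (C⁻¹ x) ↔ D i p = Φ x) := hrel
  have hrel2 : ∀ i p, ∀ u s : ℝ, |u| ≤ 5 / 2 → |s| ≤ 4 / 3 →
      (D' i p = Φ (u, s, 0) ↔ D i p = Φ (c * u, s, 0)) := by
    intro i p u s hu hs
    have e : C (u, s, 0) = (c * u, s, 0) := by
      rw [hCx, compress, boxCut_eq_one hu hs (by norm_num)]
      refine Prod.ext ?_ rfl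
      simp only; ring
    have hU : C (u, s, 0) ∈ interior bandBox := by
      rw [hC.map_mem, mem_interior_bandBox]
      exact ⟨by simp only; linarith, by simp only; linarith, by norm_num⟩
    have e' : C⁻¹ (C (u, s, 0)) = (u, s, 0) := C.symm_apply_apply _
    rw [← e, ← hrel1 i p _ hU, e']
  have hA : IsAdapted D' a Φ c (min ε (1 / 3)) := by
    have hform : ∀ ς : ℝ, ς = 1 ∨ ς = -1 → ∀ i₀, EndForm D Φ i₀ ς ε → ∀ s Y : ℝ,
        |Y| < 5 / 2 * c → |s - 1| < min ε (1 / 3) →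
        D' i₀ (endChart s Y) = Φ (Y / c, ς * s, 0) := by
      intro ς hς i₀ h s Y hY hs
      rw [lt_min_iff] at hs
      have h1 := abs_lt.1 hs.2
      rw [hrel2, mul_div_cancel₀ _ hc0.ne']
      · exact h s Y (by linarith) hs.1
      · rw [abs_div, abs_of_pos hc0, div_le_iff₀ hc0]; exact hY.le
      · rw [abs_mul, (abs_eq one_pos.le).2 hς, one_mul, abs_le]
        constructor <;> linarith
    have hcu : ∀ u : ℝ, |u| ≤ 2 → |c * u| < δ := by
      intro u hu
      rw [abs_mul, abs_of_pos hc0]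
      nlinarith [abs_nonneg u]
    exact {
      c_pos := hc0
      c_le := hc10
      η_pos := by positivity
      η_le := (min_le_right _ _).trans (by norm_num)
      end_eq := fun s Y hY hs => by simpa using hform 1 (Or.inl rfl) _ hE s Y hY hs
      start_eq := fun s Y hY hs => by simpa using hform (-1) (Or.inr rfl) _ hE' s Y hY hs
      end_unique := by
        intro i p hp u hu h
        rw [hrel2 _ _ _ _ (by linarith) (by norm_num)] at h
        obtain ⟨h1, -, -, h2⟩ := hU₁ i p hp _ (ball_subset_ball hδ1
          (hball 1 (c * u) 1 (hcu u hu) (by simpa using hδ))) h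
        refine ⟨h1, ?_⟩
        simpa using h2
      start_unique := by
        intro i p hp u hu h
        rw [hrel2 _ _ _ _ (by linarith) (by norm_num)] at h
        obtain ⟨h1, -, -, h2⟩ := hU₂ i p hp _ (ball_subset_ball hδ2
          (hball (-1) (c * u) (-1) (hcu u hu) (by simpa using hδ))) h
        refine ⟨h1, ?_⟩
        simpa using h2 }
  -- in the chart of a crossing, the disk meets the neck along the preimage of a segment
  let γ : X → ℝ → ℂ := fun r y => g r ((c * y : ℝ) : ℂ)
  have hcy : ∀ r : X, ∀ y ∈ Icc (-1 : ℝ) 1, ((c * y : ℝ) : ℂ) ∈ ball (0 : ℂ) (ρ r) := by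
    intro r y hy
    rw [mem_ball_zero_iff, Complex.norm_real, Real.norm_eq_abs, abs_mul, abs_of_pos hc0]
    have := hρle r
    nlinarith [abs_le.2 hy, abs_nonneg y]
  have hγV : ∀ r : X, ∀ y ∈ Icc (-1 : ℝ) 1, γ r y ∈ V r := fun r y hy => (hgV r _ (hcy r y hy)).1
  have hγm : ∀ r : X, ∀ y ∈ Icc (-1 : ℝ) 1, m r (γ r y) =
      (c * (y * neckWidth (m r (γ r y)).2.1), (m r (γ r y)).2.1, 0) := by
    intro r y hy
    have h1 := (hgV r _ (hcy r y hy)).2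
    have h2 := congrArg Complex.re h1
    have h3 := congrArg Complex.im h1
    have hw := one_le_neckWidth ((hV r).lt _ (hγV r y hy))
    have hw' : neckWidth (m r (γ r y)).2.1 ≠ 0 := by linarith
    simp only [neckProj, Complex.ofReal_re, Complex.ofReal_im] at h2 h3
    refine Prod.ext ?_ (Prod.ext rfl h3)
    change (m r (γ r y)).1 / neckWidth (m r (γ r y)).2.1 = c * y at h2
    rw [div_eq_iff hw'] at h2
    simp only
    rw [h2]; ring
  have hnb : ∀ y ∈ Icc (-1 : ℝ) 1, ∀ t : ℝ, |t| < 1 → |y * neckWidth t| ≤ 2 := by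
    intro y hy t ht
    have h1 := one_le_neckWidth ht
    have h2 := neckWidth_lt_two ht
    rw [abs_mul, abs_of_pos (by linarith : 0 < neckWidth t)]
    nlinarith [abs_le.2 hy, abs_nonneg y]
  have hDγ : ∀ r : X, ∀ y ∈ Icc (-1 : ℝ) 1, D r.1.1 (γ r y) =
      Φ (c * (y * neckWidth (m r (γ r y)).2.1), (m r (γ r y)).2.1, 0) := by
    intro r y hy
    rw [← hγm r y hy]
    exact ((hV r).eq _ (hγV r y hy)).2
  have hγsm : ∀ r : X, ContDiffOn ℝ 1 (γ r) (Icc (-1) 1) := by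
    intro r
    refine ((hgs r).of_le (by simp)).comp ?_ fun y hy => hcy r y hy
    exact (Complex.ofRealCLM.contDiff.comp (contDiff_const.mul contDiff_id)).contDiffOn
  have XC : BandCrossings D' Φ X := {
    i := fun r => r.1.1
    γ := γ
    s := fun r y => (m r (γ r y)).2.1
    γ_smooth := hγsm
    s_smooth := fun r =>
      ((((hV r).smooth.of_le (by simp)).comp (hγsm r) fun y hy => hγV r y hy).snd).fst
    s_lt := fun r y hy => (hV r).lt _ (hγV r y hy)
    γ_mem := fun r y hy => (hV r).subset (hγV r y hy)
    eq := by
      intro r y hy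
      have hs := (hV r).lt _ (hγV r y hy)
      rw [hrel2 _ _ _ _ ((hnb y hy _ hs).trans (by norm_num)) (by linarith)]
      exact hDγ r y hy
    complete := by
      intro j p hp y hy t ht h
      have hw := hnb y hy t ht
      rw [hrel2 _ _ _ _ (hw.trans (by norm_num)) (by linarith)] at h
      have hu : |c * (y * neckWidth t)| < min θ δ := by
        rw [abs_mul, abs_of_pos hc0, lt_min_iff]
        constructor <;> nlinarith [abs_nonneg (y * neckWidth t)]
      obtain ⟨r, rfl, hpV⟩ := hcover j p hp _ t hu ht h
      have hbox : ((c * (y * neckWidth t), t, 0) : E3) ∈ bandBox := by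
        apply interior_subset
        rw [mem_interior_bandBox]
        exact ⟨by simp only; linarith [lt_min_iff.1 hu], by simp only; linarith, by norm_num⟩
      have e1 := (hV r).eq p hpV
      have e2 := hB.inj (interior_subset e1.1) hbox (e1.2.symm.trans h)
      have hw' : neckWidth t ≠ 0 := by linarith [one_le_neckWidth ht]
      have e3 : neckProj (m r p) = ((c * y : ℝ) : ℂ) := by
        rw [e2]
        apply Complex.ext
        · simp only [neckProj, Complex.ofReal_re]
          rw [← mul_assoc, mul_div_cancel_right₀ _ hw']
        · simp [neckProj]
      have e4 : p = γ r y := by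
        simp only [γ]
        rw [← e3, hgl r p hpV]
      exact ⟨r, rfl, e4, by rw [← e4, e2]⟩
    unique := by
      intro r y hy j p hp h
      have hs := (hV r).lt _ (hγV r y hy)
      have hw := (hnb y hy _ hs).trans (by norm_num : (2 : ℝ) ≤ 5 / 2)
      have h1 := (hrel2 r.1.1 (γ r y) _ _ hw (by linarith)).2 (hDγ r y hy)
      rw [h1, hrel2 _ _ _ _ hw (by linarith), ← hDγ r y hy] at h
      exact (hV r).unique _ (hγV r y hy) j p hp h
    inj := by
      intro r r' y hy y' hy' hi hγ
      have hrr : r = r' := by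
        apply Subtype.ext
        refine Prod.ext hi ?_
        by_contra hne
        have hd := hWd (mem_image_of_mem Prod.snd r.2) (mem_image_of_mem Prod.snd r'.2) hne
        refine disjoint_left.1 hd (hVW r (hγV r y hy)) ?_
        rw [hγ]
        exact hVW r' (hγV r' y' hy')
      subst hrr
      refine ⟨rfl, ?_⟩
      have e1 := (hgV r _ (hcy r y hy)).2
      have e2 := (hgV r _ (hcy r y' hy')).2
      have e3 : g r ((c * y : ℝ) : ℂ) = g r ((c * y' : ℝ) : ℂ) := hγ
      rw [e3, e2, Complex.ofReal_inj] at e1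
      exact (mul_left_cancel₀ hc0.ne' e1).symm
    transverse := by
      intro r y hy hsub
      set z := γ r y with hz
      have hzV := hγV r y hy
      have hs := (hV r).lt _ hzV
      have hmd := ((hV r).smooth.contDiffAt ((hV r).isOpen.mem_nhds hzV)).differentiableAt (by simp)
      have hCd : DifferentiableAt ℝ C.symm (m r z) := (hC.2.1.differentiable (by simp)) _
      have hn : HasFDerivAt (fun w => C⁻¹ (m r w)) ((fderiv ℝ C.symm (m r z)).comp
          (fderiv ℝ (m r) z)) z := hCd.hasFDerivAt.comp z hmd.hasFDerivAt
      have hx' : C⁻¹ (m r z) = (y * neckWidth (m r z).2.1, (m r z).2.1, 0) := by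
        have hw := hnb y hy _ hs
        rw [Equiv.Perm.inv_eq_iff_eq, hCx, compress, boxCut_eq_one (by simp only; linarith)
          (by simp only; linarith) (by norm_num)]
        conv_lhs => rw [hz, hγm r y hy]
        refine Prod.ext ?_ rfl
        simp only; ring
      have hev : D' r.1.1 =ᶠ[nhds z] fun w => Φ (C⁻¹ (m r w)) := by
        filter_upwards [(hV r).isOpen.mem_nhds hzV] with w hw
        have := (hV r).eq w hw
        exact (hrel1 _ _ _ this.1).2 this.2
      have hΦd := (hB.contDiff.differentiable (by simp) (C⁻¹ (m r z))).hasFDerivAt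
      have hd := (hΦd.comp z hn).congr_of_eventuallyEq hev
      obtain ⟨v, hv⟩ := (hV r).surjective hzV
      have hmem := hsub (mem_range_self v)
      rw [hd.fderiv, ← hx'] at hmem
      obtain ⟨w, hw0, hw⟩ := hmem
      have hbox : C⁻¹ (m r z) ∈ bandBox :=
        interior_subset (hC.inv.map_mem.2 ((hV r).eq z hzV).1)
      have hw2 := hB.imm _ hbox hw
      have h1 : HasFDerivAt (fun w => (C⁻¹ (m r w)).2.2) _ z := hn.snd.snd
      have h2 : HasFDerivAt (fun w => (m r w).2.2) _ z := hmd.hasFDerivAt.snd.snd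
      have e : (fun w => (C⁻¹ (m r w)).2.2) = fun w => (m r w).2.2 := by
        funext w; rw [hC2]
      rw [e] at h1
      have h3 := DFunLike.congr_fun (h1.unique h2) v
      have h4 : (((fderiv ℝ C.symm (m r z)).comp (fderiv ℝ (m r) z)) v).2.2 =
          (fderiv ℝ (m r) z v).2.2 := h3
      rw [hv] at h4
      have h5 : w.2.2 = 1 := (congrArg (fun x : E3 => x.2.2) hw2).trans h4
      exact zero_ne_one (hw0.symm.trans h5) }
  obtain ⟨D'', hD''⟩ := exists_isJoin_of_isAdapted hD'.ribbon (hD'.isBand hB) hA XC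
  exact ⟨D'', hD'.isJoin hD''⟩

/-- **Fusion.** If two boundary components of a family of ribbon disks are joined by a band, which may
cross the disks arbitrarily in its interior, then the new link bounds ribbon disks again. -/
theorem exists_isJoin [Finite ι] (hD : IsRibbonFamily D) (hB : IsBand D a Φ) :
    ∃ D' : ι → ℂ → E3, IsJoin D a Φ D' := by
  obtain ⟨D₁, hD₁, hs, hs'⟩ := exists_isSimplePoint hD hB
  have hB₁ := hD₁.isBand hB
  obtain ⟨D₂, R₂, hD₂, -, ⟨ε₂, hε₂, hE₂⟩, hrel₂, hs₂⟩ := exists_endForm hD₁.ribbon hB₁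
    (Or.inl ⟨rfl, rfl⟩ : IsEndIndex a 1 (some a))
  have hfar : ∀ ς ς' : ℝ, (ς = 1 ∧ ς' = -1) ∨ (ς = -1 ∧ ς' = 1) → ∀ Y s : ℝ, |s - 1| < 1 / 2 →
      ((Y, ς * s, 0) : E3) ∉ ball ((0, ς', 0) : E3) (1 / 2) := by
    intro ς ς' h Y s hs hmem
    rw [mem_ball, dist_eq_norm, Prod.norm_def, Prod.norm_def, max_lt_iff, max_lt_iff] at hmem
    simp only [Prod.fst_sub, Prod.snd_sub, sub_zero, Real.norm_eq_abs] at hmem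
    have h1 := abs_lt.1 hmem.2.1
    have h2 := abs_lt.1 hs
    rcases h with ⟨rfl, rfl⟩ | ⟨rfl, rfl⟩ <;> linarith
  have hB₂ := hD₂.isBand hB₁
  have hs₂' : IsSimplePoint D₂ (Φ (0, -1, 0)) := by
    have hfar' : ((0, -1, 0) : E3) ∉ ball ((0, 1, 0) : E3) (1 / 2) := by
      simpa using hfar (-1) 1 (Or.inr ⟨rfl, rfl⟩) 0 1 (by norm_num)
    intro i j p hp q hq e1 e2
    rw [hrel₂ _ _ _ (strandPoint_mem (by norm_num) (Or.inr rfl)) hfar'] at e1 e2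
    obtain ⟨rfl, h⟩ := hs' i j _ (by simpa using hp) _ (by simpa using hq) e1 e2
    exact ⟨rfl, (R₂ i).injective h⟩
  obtain ⟨D₃, R₃, hD₃, hR₃, ⟨ε₃, hε₃, hE₃⟩, hrel₃, hs₃⟩ := exists_endForm hD₂.ribbon hB₂
    (Or.inr ⟨rfl, rfl⟩ : IsEndIndex a (-1) none)
  have hs₃' : IsSimplePoint D₃ (Φ (0, 1, 0)) := by
    have hfar' : ((0, 1, 0) : E3) ∉ ball ((0, -1, 0) : E3) (1 / 2) := by
      simpa using hfar 1 (-1) (Or.inl ⟨rfl, rfl⟩) 0 1 (by norm_num)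
    intro i j p hp q hq e1 e2
    rw [hrel₃ _ _ _ (strandPoint_mem (by norm_num) (Or.inl rfl)) hfar'] at e1 e2
    obtain ⟨rfl, h⟩ := hs₂ hs i j _ (by simpa using hp) _ (by simpa using hq) e1 e2
    exact ⟨rfl, (R₃ i).injective h⟩
  have hE₃' : EndForm D₃ Φ (some a) 1 (min ε₂ (1 / 2)) := by
    intro s Y hY hs
    rw [lt_min_iff] at hY hs
    have h2 := abs_lt.1 hs.2
    rw [hrel₃ _ _ _ _ (hfar 1 (-1) (Or.inl ⟨rfl, rfl⟩) Y s hs.2), hR₃ _ (by simp)]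
    · exact hE₂ s Y hY.1 hs.1
    · rw [mem_interior_bandBox]
      refine ⟨by simp only; linarith, ?_, by norm_num⟩
      simp only [one_mul]
      rw [abs_lt]; constructor <;> linarith
  obtain ⟨D₄, hD₄, ⟨ε, hε, hE, hE'⟩, hs₄, hs₄', hT⟩ := exists_coreTransverse hD₃.ribbon
    (hD₃.isBand hB₂) (ε := min (min ε₂ (1 / 2)) ε₃) (by positivity)
    (fun s Y hY hs => hE₃' s Y (hY.trans_le (min_le_left _ _)) (hs.trans_le (min_le_left _ _)))
    (fun s Y hY hs => hE₃ s Y (hY.trans_le (min_le_right _ _)) (hs.trans_le (min_le_right _ _)))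
    hs₃' (hs₃ hs₂')
  have hM := ((hD₁.trans hD₂).trans hD₃).trans hD₄
  obtain ⟨D', hD'⟩ := exists_isJoin_of_coreTransverse hD₄.ribbon (hM.isBand hB) hε hE hE' hs₄ hs₄' hT
  exact ⟨D', hM.isJoin hD'⟩

end Fusion

/-! ### Links that bound ribbon disks in a region -/

/-- The sets `K i` bound ribbon disks inside `W`. -/
def BoundsRibbon {ι : Type} (K : ι → Set E3) (W : Set E3) : Prop :=
  ∃ D : ι → ℂ → E3, IsRibbonFamily D ∧
    ∀ i, D i '' sphere (0 : ℂ) 1 = K i ∧ D i '' closedBall (0 : ℂ) 1 ⊆ W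

/-- `Φ` restricts to a smooth embedding of `bandBox` into Euclidean space. -/
def IsBox (Φ : E3 → E3) : Prop :=
  ContDiff ℝ ∞ Φ ∧ InjOn Φ bandBox ∧ ∀ x ∈ bandBox, Function.Injective (fderiv ℝ Φ x)

lemma sideStrands_subset_bandBox : sideStrands ⊆ bandBox := by
  rintro _ ⟨τ, hτ, ε, hε, rfl⟩
  have h0 := Real.smoothTransition.nonneg ((τ + 1) / 2)
  have h1 := Real.smoothTransition.le_one ((τ + 1) / 2)
  have hs : |smoothStep τ| ≤ 1 := by
    rw [smoothStep, abs_le]; constructor <;> linarith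
  have hτ' : |τ| ≤ 2 := abs_le.2 hτ
  have h2 : |τ * smoothStep τ| ≤ 2 := by
    rw [abs_mul]
    calc |τ| * |smoothStep τ| ≤ 2 * 1 := by gcongr
      _ = 2 := by norm_num
  have h3 := abs_le.1 h2
  have h4 := abs_le.1 hs
  have h5 : (0 : ℝ) ∈ Icc (-1 : ℝ) 1 := ⟨by norm_num, by norm_num⟩
  have h6 : smoothStep τ ∈ Icc (-2 : ℝ) 2 := ⟨by linarith, by linarith⟩
  refine ⟨?_, h6, h5⟩
  have h7 : 0 ≤ 1 + τ * smoothStep τ := by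
    rcases le_total τ (-1) with h | h
    · have : smoothStep τ = -1 := by
        rw [smoothStep, Real.smoothTransition.zero_of_nonpos (by linarith)]; norm_num
      rw [this]; linarith
    · rcases le_total 1 τ with h' | h'
      · have : smoothStep τ = 1 := by
          rw [smoothStep, Real.smoothTransition.one_of_one_le (by linarith)]; norm_num
        rw [this]; linarith
      · have : |τ * smoothStep τ| ≤ 1 := by
          rw [abs_mul]
          calc |τ| * |smoothStep τ| ≤ 1 * 1 := by
                gcongr; exact abs_le.2 ⟨h, h'⟩
            _ = 1 := by norm_num
        linarith [(abs_le.1 this).1]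
  rcases hε with rfl | rfl <;> constructor <;> simp only <;> linarith

namespace BoundsRibbon

variable {ι ι' : Type} {K : ι → Set E3} {K' : ι' → Set E3} {W W' : Set E3}

lemma mono (h : BoundsRibbon K W) (hW : W ⊆ W') : BoundsRibbon K W' :=
  let ⟨D, hD, hK⟩ := h
  ⟨D, hD, fun i => ⟨(hK i).1, (hK i).2.trans hW⟩⟩

lemma subset (h : BoundsRibbon K W) (i : ι) : K i ⊆ W := by
  obtain ⟨D, -, hK⟩ := h
  rw [← (hK i).1]
  exact (image_mono sphere_subset_closedBall).trans (hK i).2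

lemma reindex (h : BoundsRibbon K W) (e : ι' ≃ ι) : BoundsRibbon (fun i => K (e i)) W :=
  let ⟨_, hD, hK⟩ := h
  ⟨_, hD.reindex e, fun i => hK (e i)⟩

lemma sum (h : BoundsRibbon K W) (h' : BoundsRibbon K' W') (hd : Disjoint W W') :
    BoundsRibbon (Sum.elim K K') (W ∪ W') := by
  obtain ⟨D, hD, hK⟩ := h
  obtain ⟨D', hD', hK'⟩ := h'
  refine ⟨_, hD.sum hD' fun i j p hp q hq he => ?_, ?_⟩
  · exact disjoint_left.1 hd ((hK i).2 ⟨p, hp, rfl⟩) (he ▸ (hK' j).2 ⟨q, hq, rfl⟩)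
  · rintro (i | i)
    · exact ⟨(hK i).1, (hK i).2.trans subset_union_left⟩
    · exact ⟨(hK' i).1, (hK' i).2.trans subset_union_right⟩

lemma perm (h : BoundsRibbon K W) {C : Set E3} {F : Equiv.Perm E3} (hF : DiffeoIn C F) :
    BoundsRibbon (fun i => F '' K i) (F '' W) := by
  obtain ⟨D, hD, hK⟩ := h
  refine ⟨_, hD.perm hF, fun i => ⟨?_, ?_⟩⟩
  · simp only [← (hK i).1, image_image]
  · rw [← image_image]; exact image_mono (hK i).2

lemma disjoint (h : BoundsRibbon K W) {i j : ι} (hij : i ≠ j) : Disjoint (K i) (K j) := by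
  obtain ⟨D, hD, hK⟩ := h
  rw [← (hK i).1, ← (hK j).1, disjoint_left]
  rintro _ ⟨p, hp, rfl⟩ ⟨q, hq, hpq⟩
  exact hij (hD.boundary_inj hp hq hpq.symm).1

/-- Fusion along one band. -/
lemma join [Finite ι] {K : Option ι → Set E3} (h : BoundsRibbon K W) {a : ι} {Φ : E3 → E3}
    (hΦ : IsBox Φ) (hmeets : bandBox ∩ Φ ⁻¹' (⋃ i, K i) = startStrand ∪ endStrand)
    (hs : Φ '' startStrand ⊆ K none) (he : Φ '' endStrand ⊆ K (some a)) (hW : Φ '' bandBox ⊆ W) :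
    BoundsRibbon (fun j => open Classical in if j = a then
      ((K (some a) ∪ K none) \ Φ '' bandBox) ∪ Φ '' sideStrands else K (some j)) W := by
  obtain ⟨D, hD, hK⟩ := h
  have hK1 : ∀ i, D i '' sphere (0 : ℂ) 1 = K i := fun i => (hK i).1
  obtain ⟨D', hD'⟩ := exists_isJoin hD (a := a) (Φ := Φ)
    { contDiff := hΦ.1
      inj := hΦ.2.1
      imm := hΦ.2.2
      meets := by simpa only [hK1] using hmeets
      start_sub := by simpa only [hK1] using hs
      end_sub := by simpa only [hK1] using he }
  refine ⟨D', hD'.ribbon, fun j => ⟨?_, (hD'.image_subset j).trans ?_⟩⟩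
  · beta_reduce
    split_ifs with h
    · rw [h, hD'.boundary, hK1, hK1]
    · rw [hD'.boundary_of_ne j h, hK1]
  · exact union_subset (iUnion_subset fun i => (hK i).2) hW

/-- Fusion of several circles with the same circle, along disjoint bands. The bands are added one at
a time: since their boxes are disjoint, a fusion does not affect the compatibility of the bands that
remain. -/
theorem multiJoin [Finite ι] {n : ℕ} (a : ι) {U : Fin n → Set E3} {Φ : Fin n → E3 → E3}
    (h : BoundsRibbon (Sum.elim K U) W) (hΦ : ∀ i, IsBox (Φ i))
    (hmeets : ∀ i, bandBox ∩ Φ i ⁻¹' ((⋃ j, K j) ∪ ⋃ j, U j) = startStrand ∪ endStrand)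
    (hs : ∀ i, Φ i '' startStrand ⊆ U i) (he : ∀ i, Φ i '' endStrand ⊆ K a)
    (hW : ∀ i, Φ i '' bandBox ⊆ W)
    (hd : Pairwise fun i j => Disjoint (Φ i '' bandBox) (Φ j '' bandBox)) :
    BoundsRibbon (fun j => open Classical in if j = a then
      ((K a ∪ ⋃ i, U i) \ ⋃ i, Φ i '' bandBox) ∪ ⋃ i, Φ i '' sideStrands else K j) W := by
  classical
  induction n generalizing K with
  | zero =>
    convert h.reindex (Equiv.sumEmpty ι (Fin 0)).symm using 2 with j
    split_ifs with hj
    · simp [hj]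
    · simp
  | succ n ih =>
    -- the first band, which joins `U 0` to `K a`
    let e : Option (ι ⊕ Fin n) ≃ ι ⊕ Fin (n + 1) :=
      { toFun := fun o => o.elim (Sum.inr 0) (Sum.map id Fin.succ)
        invFun := Sum.elim (fun i => some (Sum.inl i))
          (Fin.cases none fun i => some (Sum.inr i))
        left_inv := by rintro (_ | i | i) <;> simp
        right_inv := by
          rintro (i | i)
          · simp
          · refine Fin.cases ?_ (fun i => ?_) i <;> simp }
    have hunion : (⋃ o, Sum.elim K U (e o)) = (⋃ j, K j) ∪ ⋃ j, U j := by
      rw [e.surjective.iUnion_comp (Sum.elim K U), iUnion_sum]; rfl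
    have hst : startStrand ⊆ bandBox := fun x hx =>
      ((hmeets 0).symm.subset (Or.inl hx)).1
    have hen : endStrand ⊆ bandBox := fun x hx =>
      ((hmeets 0).symm.subset (Or.inr hx)).1
    have h1 := (h.reindex e).join (a := Sum.inl a) (hΦ 0) (by rw [hunion]; exact hmeets 0)
      (hs 0) (he 0) (hW 0)
    set K₁ : ι → Set E3 := fun j => if j = a then
      ((K a ∪ U 0) \ Φ 0 '' bandBox) ∪ Φ 0 '' sideStrands else K j with hK₁
    have hK₁a : K₁ a = ((K a ∪ U 0) \ Φ 0 '' bandBox) ∪ Φ 0 '' sideStrands := if_pos rfl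
    have hK₁j : ∀ j, j ≠ a → K₁ j = K j := fun j hj => if_neg hj
    have h2 : BoundsRibbon (Sum.elim K₁ fun i : Fin n => U i.succ) W := by
      convert h1 using 1
      funext i
      rcases i with i | i
      · by_cases hi : i = a
        · simp [hi, hK₁, e]
        · simp [hi, hK₁, e]
      · simp [e]
    have hdis : ∀ i : Fin n, ∀ x ∈ bandBox, Φ i.succ x ∉ Φ 0 '' bandBox := fun i x hx hx' =>
      disjoint_left.1 (hd (Fin.succ_ne_zero i)) ⟨x, hx, rfl⟩ hx'
    have hside : Φ 0 '' sideStrands ⊆ Φ 0 '' bandBox := image_mono sideStrands_subset_bandBox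
    have h3 := ih h2 (fun i => hΦ i.succ) (fun i => ?_) (fun i => hs i.succ) (fun i => ?_)
      (fun i => hW i.succ) (fun i j hij => hd (fun h => hij (Fin.succ_injective _ h)))
    · convert h3 using 2 with j
      by_cases hj : j = a
      · rw [if_pos hj, if_pos hj, hK₁a]
        have e1 : (⋃ i, U i) = U 0 ∪ ⋃ i : Fin n, U i.succ := by
          ext x; simp [Fin.exists_fin_succ]
        have e2 : (⋃ i, Φ i '' bandBox) = Φ 0 '' bandBox ∪ ⋃ i : Fin n, Φ i.succ '' bandBox := by
          ext x; simp only [mem_iUnion, mem_union, Fin.exists_fin_succ]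
        have e3 : (⋃ i, Φ i '' sideStrands) =
            Φ 0 '' sideStrands ∪ ⋃ i : Fin n, Φ i.succ '' sideStrands := by
          ext x; simp only [mem_iUnion, mem_union, Fin.exists_fin_succ]
        have e4 : ∀ x ∈ Φ 0 '' sideStrands, x ∉ ⋃ i : Fin n, Φ i.succ '' bandBox := by
          intro x hx hx'
          obtain ⟨i, y, hy, rfl⟩ := mem_iUnion.1 hx'
          exact hdis i y hy (hside hx)
        -- the box of the first band meets the link only in `K a` and `U 0`
        have e5 : ∀ i : Fin n, ∀ x ∈ U i.succ, x ∉ Φ 0 '' bandBox := by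
          rintro i x hx ⟨y, hy, rfl⟩
          have hy' : y ∈ startStrand ∪ endStrand := by
            rw [← hmeets 0]; exact ⟨hy, Or.inr (mem_iUnion.2 ⟨_, hx⟩)⟩
          rcases hy' with hy' | hy'
          · exact disjoint_left.1 (h.disjoint (i := Sum.inr i.succ) (j := Sum.inr 0)
              (by simp)) hx (hs 0 ⟨y, hy', rfl⟩)
          · exact disjoint_left.1 (h.disjoint (i := Sum.inr i.succ) (j := Sum.inl a)
              (by simp)) hx (he 0 ⟨y, hy', rfl⟩)
        rw [e1, e2, e3]
        ext x
        have f4 := e4 x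
        have f5 : x ∈ ⋃ i : Fin n, U i.succ → x ∉ Φ 0 '' bandBox := fun hx => by
          obtain ⟨i, hi⟩ := mem_iUnion.1 hx
          exact e5 i x hi
        simp only [mem_union, Set.mem_sdiff] at f4 f5 ⊢
        tauto
      · rw [if_neg hj, if_neg hj, hK₁j j hj]
    · rw [← hmeets i.succ]
      ext x
      simp only [mem_inter_iff, mem_preimage, mem_union, mem_iUnion]
      refine and_congr_right fun hx => ?_
      have hx0 := hdis i x hx
      constructor
      · rintro (⟨j, hj⟩ | ⟨j, hj⟩)
        · by_cases hja : j = a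
          · rw [hja, hK₁a] at hj
            rcases hj with ⟨hj | hj, -⟩ | hj
            · exact Or.inl ⟨a, hj⟩
            · exact Or.inr ⟨0, hj⟩
            · exact absurd (hside hj) hx0
          · rw [hK₁j j hja] at hj; exact Or.inl ⟨j, hj⟩
        · exact Or.inr ⟨j.succ, hj⟩
      · rintro (⟨j, hj⟩ | ⟨j, hj⟩)
        · by_cases hja : j = a
          · refine Or.inl ⟨a, ?_⟩
            rw [hK₁a]; exact Or.inl ⟨Or.inl (hja ▸ hj), hx0⟩
          · exact Or.inl ⟨j, by rwa [hK₁j j hja]⟩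
        · revert hj
          refine Fin.cases (fun hj => ?_) (fun j hj => ?_) j
          · refine Or.inl ⟨a, ?_⟩
            rw [hK₁a]; exact Or.inl ⟨Or.inr hj, hx0⟩
          · exact Or.inr ⟨j, hj⟩
    · rintro _ ⟨x, hx, rfl⟩
      rw [hK₁a]
      exact Or.inl ⟨Or.inl (he i.succ ⟨x, hx, rfl⟩), hdis i x (hen hx)⟩

end BoundsRibbon

/-! ### Stereographic projection -/

/-- The stereographic projection of `S³ ⊂ ℂ²` from the point `(1, 0)`, where it takes the junk value
`0`. This point lies on the core `w₂ = 0` of the complement of the thickened torus, and on none of the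
meridian disks in use. -/
noncomputable def stereo (w : ℂ × ℂ) : E3 :=
  (w.1.im / (1 - w.1.re), w.2.re / (1 - w.1.re), w.2.im / (1 - w.1.re))

/-- The inverse of the stereographic projection, with values in `ℂ²`. -/
noncomputable def unstereo (x : E3) : ℂ × ℂ :=
  (⟨(x.1 ^ 2 + x.2.1 ^ 2 + x.2.2 ^ 2 - 1) / (x.1 ^ 2 + x.2.1 ^ 2 + x.2.2 ^ 2 + 1),
      2 * x.1 / (x.1 ^ 2 + x.2.1 ^ 2 + x.2.2 ^ 2 + 1)⟩,
    ⟨2 * x.2.1 / (x.1 ^ 2 + x.2.1 ^ 2 + x.2.2 ^ 2 + 1),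
      2 * x.2.2 / (x.1 ^ 2 + x.2.1 ^ 2 + x.2.2 ^ 2 + 1)⟩)

lemma contDiffAt_stereo {w : ℂ × ℂ} (hw : w.1.re ≠ 1) : ContDiffAt ℝ ∞ stereo w := by
  have h1 : ContDiff ℝ ∞ fun w : ℂ × ℂ => w.1.re := Complex.reCLM.contDiff.comp contDiff_fst
  have h2 : ContDiff ℝ ∞ fun w : ℂ × ℂ => w.1.im := Complex.imCLM.contDiff.comp contDiff_fst
  have h3 : ContDiff ℝ ∞ fun w : ℂ × ℂ => w.2.re := Complex.reCLM.contDiff.comp contDiff_snd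
  have h4 : ContDiff ℝ ∞ fun w : ℂ × ℂ => w.2.im := Complex.imCLM.contDiff.comp contDiff_snd
  have h5 : ContDiffAt ℝ ∞ (fun w : ℂ × ℂ => 1 - w.1.re) w := (contDiff_const.sub h1).contDiffAt
  have h6 : 1 - w.1.re ≠ 0 := sub_ne_zero.2 hw.symm
  exact (h2.contDiffAt.div h5 h6).prodMk ((h3.contDiffAt.div h5 h6).prodMk
    (h4.contDiffAt.div h5 h6))

lemma unstereo_denom_pos (x : E3) : 0 < x.1 ^ 2 + x.2.1 ^ 2 + x.2.2 ^ 2 + 1 := by positivity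

lemma contDiff_unstereo : ContDiff ℝ ∞ unstereo := by
  have h0 : ContDiff ℝ ∞ fun x : E3 => x.1 ^ 2 + x.2.1 ^ 2 + x.2.2 ^ 2 := by fun_prop
  have h1 : ContDiff ℝ ∞ fun x : E3 => x.1 ^ 2 + x.2.1 ^ 2 + x.2.2 ^ 2 + 1 := by fun_prop
  have hne : ∀ x : E3, x.1 ^ 2 + x.2.1 ^ 2 + x.2.2 ^ 2 + 1 ≠ 0 := fun x =>
    (unstereo_denom_pos x).ne'
  have hm {f g : E3 → ℝ} (hf : ContDiff ℝ ∞ f) (hg : ContDiff ℝ ∞ g) :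
      ContDiff ℝ ∞ fun x => (⟨f x, g x⟩ : ℂ) :=
    Complex.equivRealProdCLM.symm.contDiff.comp (hf.prodMk hg)
  exact (hm ((h0.sub contDiff_const).div h1 hne) (ContDiff.div (by fun_prop) h1 hne)).prodMk
    (hm (ContDiff.div (by fun_prop) h1 hne) (ContDiff.div (by fun_prop) h1 hne))

lemma stereo_unstereo (x : E3) : stereo (unstereo x) = x := by
  have h := unstereo_denom_pos x
  obtain ⟨a, b, c⟩ := x
  simp only [stereo, unstereo, Prod.mk.injEq] at h ⊢
  have e : 1 - (a ^ 2 + b ^ 2 + c ^ 2 - 1) / (a ^ 2 + b ^ 2 + c ^ 2 + 1) =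
      2 / (a ^ 2 + b ^ 2 + c ^ 2 + 1) := by field_simp; ring
  rw [e]
  refine ⟨?_, ?_, ?_⟩ <;> field_simp

lemma normSq_unstereo (x : E3) :
    (unstereo x).1.re ^ 2 + (unstereo x).1.im ^ 2 + (unstereo x).2.re ^ 2 +
      (unstereo x).2.im ^ 2 = 1 := by
  have h := unstereo_denom_pos x
  simp only [unstereo]
  field_simp
  ring

lemma unstereo_fst_re_ne (x : E3) : (unstereo x).1.re ≠ 1 := by
  have h := unstereo_denom_pos x
  simp only [unstereo]
  rw [Ne, div_eq_one_iff_eq h.ne']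
  linarith

lemma unstereo_stereo {w : ℂ × ℂ} (hw : w.1.re ≠ 1)
    (h : w.1.re ^ 2 + w.1.im ^ 2 + w.2.re ^ 2 + w.2.im ^ 2 = 1) : unstereo (stereo w) = w := by
  have h6 : 1 - w.1.re ≠ 0 := sub_ne_zero.2 hw.symm
  obtain ⟨⟨a, b⟩, ⟨c, d⟩⟩ := w
  simp only at h h6
  have e : (b / (1 - a)) ^ 2 + (c / (1 - a)) ^ 2 + (d / (1 - a)) ^ 2 = (1 + a) / (1 - a) := by
    field_simp
    linear_combination h
  simp only [stereo, unstereo, e]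
  have e2 : (1 + a) / (1 - a) + 1 = 2 / (1 - a) := by field_simp; ring
  rw [e2]
  refine Prod.ext (Complex.ext ?_ ?_) (Complex.ext ?_ ?_) <;> simp only <;> field_simp
  ring

/-- The inverse of the stereographic projection, as an embedding of Euclidean space into the
three-sphere. -/
noncomputable def toSphere (x : E3) : S3 :=
  ⟨!₂[(unstereo x).1.re, (unstereo x).1.im, (unstereo x).2.re, (unstereo x).2.im], by
    rw [mem_sphere_zero_iff_norm, EuclideanSpace.norm_eq, Real.sqrt_eq_one]
    simp only [Real.norm_eq_abs, sq_abs, Fin.sum_univ_four]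
    simpa using normSq_unstereo x⟩

lemma toSphere_injective : Function.Injective toSphere := by
  intro x y h
  have h1 := congrArg (fun p : S3 => (p : EuclideanSpace ℝ (Fin (3 + 1)))) h
  have h2 : ∀ i, _ := fun i => congrArg (fun p : EuclideanSpace ℝ (Fin (3 + 1)) => p i) h1
  have e : unstereo x = unstereo y :=
    Prod.ext (Complex.ext (h2 0) (h2 1)) (Complex.ext (h2 2) (h2 3))
  rw [← stereo_unstereo x, e, stereo_unstereo]

lemma contDiff_coe_toSphere :
    ContDiff ℝ ∞ fun x : E3 => (toSphere x : EuclideanSpace ℝ (Fin (3 + 1))) := by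
  have h1 := (Complex.reCLM.contDiff (n := ∞)).comp (contDiff_fst.comp contDiff_unstereo)
  have h2 := (Complex.imCLM.contDiff (n := ∞)).comp (contDiff_fst.comp contDiff_unstereo)
  have h3 := (Complex.reCLM.contDiff (n := ∞)).comp (contDiff_snd.comp contDiff_unstereo)
  have h4 := (Complex.imCLM.contDiff (n := ∞)).comp (contDiff_snd.comp contDiff_unstereo)
  rw [contDiff_euclidean]
  intro i
  fin_cases i
  exacts [h1, h2, h3, h4]

lemma contMDiff_toSphere : ContMDiff 𝓘(ℝ, E3) (𝓡 3) ∞ toSphere :=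
  have : Fact (Module.finrank ℝ (EuclideanSpace ℝ (Fin (3 + 1))) = 3 + 1) :=
    ⟨finrank_euclideanSpace_fin⟩
  contDiff_coe_toSphere.contMDiff.codRestrict_sphere fun x => (toSphere x).2

lemma injective_mfderiv_toSphere (x : E3) :
    Function.Injective (mfderiv 𝓘(ℝ, E3) (𝓡 3) toSphere x) := by
  let σ : EuclideanSpace ℝ (Fin (3 + 1)) → E3 := fun v =>
    stereo (⟨v 0, v 1⟩, ⟨v 2, v 3⟩)
  have hσ : ∀ x, σ (toSphere x) = x := stereo_unstereo
  have hm {f g : EuclideanSpace ℝ (Fin (3 + 1)) → ℝ} (hf : ContDiff ℝ ∞ f) (hg : ContDiff ℝ ∞ g) :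
      ContDiff ℝ ∞ fun x => (⟨f x, g x⟩ : ℂ) :=
    Complex.equivRealProdCLM.symm.contDiff.comp (hf.prodMk hg)
  have hσd : DifferentiableAt ℝ σ (toSphere x) := by
    refine ContDiffAt.differentiableAt (n := ∞) (ContDiffAt.comp (g := stereo)
      (f := fun v : EuclideanSpace ℝ (Fin (3 + 1)) => ((⟨v 0, v 1⟩, ⟨v 2, v 3⟩) : ℂ × ℂ)) _
      (contDiffAt_stereo (unstereo_fst_re_ne x)) ?_) (by simp)
    exact ((hm (by fun_prop) (by fun_prop)).prodMk (hm (by fun_prop) (by fun_prop))).contDiffAt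
  have h1 := injective_fderiv_of_leftInverse
    ((contDiff_coe_toSphere.differentiable (by simp)) x) hσd
    (Filter.Eventually.of_forall hσ)
  have : Fact (Module.finrank ℝ (EuclideanSpace ℝ (Fin (3 + 1))) = 3 + 1) :=
    ⟨finrank_euclideanSpace_fin⟩
  have h2 : MDifferentiableAt (𝓡 3) 𝓘(ℝ, EuclideanSpace ℝ (Fin (3 + 1)))
      ((↑) : S3 → EuclideanSpace ℝ (Fin (3 + 1))) (toSphere x) :=
    (contMDiff_coe_sphere (m := 1) (n := 3) (E := EuclideanSpace ℝ (Fin (3 + 1))) _).mdifferentiableAt one_ne_zero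
  have h3 := mfderiv_comp x h2 ((contMDiff_toSphere x).mdifferentiableAt (by simp))
  have h4 : mfderiv 𝓘(ℝ, E3) 𝓘(ℝ, EuclideanSpace ℝ (Fin (3 + 1)))
      (((↑) : S3 → EuclideanSpace ℝ (Fin (3 + 1))) ∘ toSphere) x =
      fderiv ℝ (fun x : E3 => (toSphere x : EuclideanSpace ℝ (Fin (3 + 1)))) x :=
    mfderiv_eq_fderiv
  rw [h4] at h3
  rw [h3] at h1
  exact Function.Injective.of_comp (f := mfderiv (𝓡 3) 𝓘(ℝ, EuclideanSpace ℝ (Fin (3 + 1)))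
      ((↑) : S3 → EuclideanSpace ℝ (Fin (3 + 1))) (toSphere x)) h1

/-! ### The thickened torus in Euclidean space -/

lemma circle_re_sq_add_im_sq (c : Circle) : (c : ℂ).re ^ 2 + (c : ℂ).im ^ 2 = 1 := by
  have := Circle.normSq_coe c
  rw [Complex.normSq_apply] at this
  linarith

/-- The angle `hopfAngle`, as a function of a real variable. -/
noncomputable def hopfArc (z : ℝ) : ℝ := Real.pi / 8 + z * (Real.pi / 4)

lemma hopfArc_mem {z : ℝ} (hz : z ∈ Icc (0 : ℝ) 1) : hopfArc z ∈ Ioo 0 (Real.pi / 2) := by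
  have := Real.pi_pos
  have h1 := mul_le_mul_of_nonneg_right hz.2 (by positivity : 0 ≤ Real.pi / 4)
  have h2 := mul_nonneg hz.1 (by positivity : 0 ≤ Real.pi / 4)
  constructor <;> rw [hopfArc] <;> linarith

lemma sin_hopfArc_pos {z : ℝ} (hz : z ∈ Icc (0 : ℝ) 1) : 0 < Real.sin (hopfArc z) :=
  Real.sin_pos_of_pos_of_lt_pi (hopfArc_mem hz).1 (by linarith [(hopfArc_mem hz).2, Real.pi_pos])

lemma cos_hopfArc_pos {z : ℝ} (hz : z ∈ Icc (0 : ℝ) 1) : 0 < Real.cos (hopfArc z) :=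
  Real.cos_pos_of_mem_Ioo ⟨by linarith [(hopfArc_mem hz).1, Real.pi_pos], (hopfArc_mem hz).2⟩

lemma sin_hopfArc_lt {z : ℝ} (hz : z ∈ Icc (0 : ℝ) 1) : Real.sin (hopfArc z) < 1 := by
  nlinarith [Real.sin_sq_add_cos_sq (hopfArc z), cos_hopfArc_pos hz, sin_hopfArc_pos hz]

/-- The point `(sin θ · x, cos θ · y)` of `ℂ²`. -/
noncomputable def hopfPoint (q : ℂ × ℂ × ℝ) : ℂ × ℂ :=
  (Real.sin (hopfArc q.2.2) • q.1, Real.cos (hopfArc q.2.2) • q.2.1)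

lemma contDiff_hopfPoint : ContDiff ℝ ∞ hopfPoint := by
  have h : ContDiff ℝ ∞ fun q : ℂ × ℂ × ℝ => hopfArc q.2.2 := by unfold hopfArc; fun_prop
  exact ((Real.contDiff_sin.comp h).smul contDiff_fst).prodMk
    ((Real.contDiff_cos.comp h).smul (contDiff_fst.comp contDiff_snd))

/-- The coordinates of a point of the thickened torus. -/
noncomputable def torusCoords (p : ThickTorus) : ℂ × ℂ × ℝ := (p.1, p.2.1, p.2.2)

lemma hopfPoint_torusCoords_re_lt (p : ThickTorus) : (hopfPoint (torusCoords p)).1.re < 1 := by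
  have h1 := circle_re_sq_add_im_sq p.1
  have h2 := sin_hopfArc_pos p.2.2.2
  have h3 := sin_hopfArc_lt p.2.2.2
  have h4 : (p.1 : ℂ).re ≤ 1 := by nlinarith [sq_nonneg (p.1 : ℂ).im]
  simp only [hopfPoint, torusCoords, Complex.smul_re, smul_eq_mul]
  nlinarith

lemma normSq_hopfPoint (p : ThickTorus) :
    (hopfPoint (torusCoords p)).1.re ^ 2 + (hopfPoint (torusCoords p)).1.im ^ 2 +
      (hopfPoint (torusCoords p)).2.re ^ 2 + (hopfPoint (torusCoords p)).2.im ^ 2 = 1 := by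
  have h1 := circle_re_sq_add_im_sq p.1
  have h2 := circle_re_sq_add_im_sq p.2.1
  have h3 := Real.sin_sq_add_cos_sq (hopfArc p.2.2)
  simp only [hopfPoint, torusCoords, Complex.smul_re, Complex.smul_im, smul_eq_mul]
  linear_combination Real.sin (hopfArc p.2.2) ^ 2 * h1 + Real.cos (hopfArc p.2.2) ^ 2 * h2 + h3

/-- The thickened torus as a subset of Euclidean space: the composition of `dehnFilling` with the
stereographic projection. -/
noncomputable def torusEmb (p : ThickTorus) : E3 := stereo (hopfPoint (torusCoords p))

lemma unstereo_torusEmb (p : ThickTorus) : unstereo (torusEmb p) = hopfPoint (torusCoords p) :=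
  unstereo_stereo (hopfPoint_torusCoords_re_lt p).ne (normSq_hopfPoint p)

lemma toSphere_torusEmb (p : ThickTorus) : toSphere (torusEmb p) = dehnFilling p := by
  apply Subtype.ext
  simp only [toSphere, unstereo_torusEmb]
  ext i
  fin_cases i <;> 
    simp only [hopfPoint, torusCoords, Complex.smul_re, Complex.smul_im, smul_eq_mul] <;> rfl

/-! ### Smooth maps into the thickened torus -/

lemma contMDiff_circle_coe : ContMDiff (𝓡 1) 𝓘(ℝ, ℂ) ∞ (fun c : Circle => (c : ℂ)) :=
  have : Fact (Module.finrank ℝ ℂ = 1 + 1) := Complex.finrank_real_complex_fact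
  contMDiff_coe_sphere (E := ℂ)

lemma injective_mfderiv_circle_coe (c : Circle) :
    Function.Injective (mfderiv (𝓡 1) 𝓘(ℝ, ℂ) (fun c : Circle => (c : ℂ)) c) := by
  have : Fact (Module.finrank ℝ ℂ = 1 + 1) := Complex.finrank_real_complex_fact
  exact injective_mvfderiv_subtypeVal_sphere (E := ℂ) (n := 1) c

lemma injective_mfderiv_unitInterval_coe (z : unitInterval) :
    Function.Injective (mfderiv (𝓡∂ 1) 𝓘(ℝ, ℝ) (fun z : unitInterval => (z : ℝ)) z) := by
  have h1 := mfderiv_subtypeVal_Icc_one (x := (0 : ℝ)) (y := 1) z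
  have h2 : (1 : TangentSpace (𝓡∂ 1) z) ≠ 0 := by
    intro h
    rw [h, map_zero] at h1
    exact zero_ne_one (α := ℝ) h1
  rw [injective_iff_map_eq_zero]
  intro v hv
  obtain ⟨c, rfl⟩ := exists_smul_eq_of_finrank_eq_one (K := ℝ) (V := TangentSpace (𝓡∂ 1) z)
    (finrank_euclideanSpace_fin (𝕜 := ℝ) (n := 1)) h2 v
  have h3 : mfderiv (𝓡∂ 1) 𝓘(ℝ, ℝ) (fun z : unitInterval => (z : ℝ)) z
      (c • (1 : TangentSpace (𝓡∂ 1) z)) = c • (1 : ℝ) := by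
    rw [map_smul]; exact congrArg (c • ·) h1
  have h4 : c • (1 : ℝ) = 0 := h3.symm.trans hv
  have h5 : c = 0 := by simpa using h4
  rw [h5]
  exact zero_smul ℝ _

lemma contMDiff_torusCoords : ContMDiff thickTorusModel 𝓘(ℝ, ℂ × ℂ × ℝ) ∞ torusCoords := by
  have h1 : ContMDiff thickTorusModel 𝓘(ℝ, ℂ) ∞ (fun p : ThickTorus => (p.1 : ℂ)) :=
    contMDiff_circle_coe.comp contMDiff_fst
  have h2 : ContMDiff thickTorusModel 𝓘(ℝ, ℂ) ∞ (fun p : ThickTorus => (p.2.1 : ℂ)) :=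
    contMDiff_circle_coe.comp (contMDiff_fst.comp contMDiff_snd)
  have h3 : ContMDiff thickTorusModel 𝓘(ℝ, ℝ) ∞ (fun p : ThickTorus => (p.2.2 : ℝ)) :=
    contMDiff_subtypeVal_Icc.comp (contMDiff_snd.comp contMDiff_snd)
  exact h1.prodMk_space (h2.prodMk_space h3)

lemma injective_mfderiv_torusCoords (p : ThickTorus) :
    Function.Injective (mfderiv thickTorusModel 𝓘(ℝ, ℂ × ℂ × ℝ) torusCoords p) := by
  have h0 := (contMDiff_torusCoords p).mdifferentiableAt (by simp)
  -- the derivatives of the three coordinates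
  have c1 : MDifferentiableAt (𝓡 1) 𝓘(ℝ, ℂ) (fun c : Circle => (c : ℂ)) p.1 :=
    (contMDiff_circle_coe _).mdifferentiableAt (by simp)
  have c2 : MDifferentiableAt (𝓡 1) 𝓘(ℝ, ℂ) (fun c : Circle => (c : ℂ)) p.2.1 :=
    (contMDiff_circle_coe _).mdifferentiableAt (by simp)
  have c3 : MDifferentiableAt (𝓡∂ 1) 𝓘(ℝ, ℝ) (fun z : unitInterval => (z : ℝ)) p.2.2 :=
    (contMDiff_subtypeVal_Icc (n := ∞) _).mdifferentiableAt (by simp)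
  have f1 : HasMFDerivAt thickTorusModel 𝓘(ℝ, ℂ) (fun p : ThickTorus => (p.1 : ℂ)) p _ :=
    HasMFDerivAt.comp p c1.hasMFDerivAt (hasMFDerivAt_fst p)
  have f2 : HasMFDerivAt thickTorusModel 𝓘(ℝ, ℂ) (fun p : ThickTorus => (p.2.1 : ℂ)) p _ :=
    HasMFDerivAt.comp p c2.hasMFDerivAt
      (HasMFDerivAt.comp p (hasMFDerivAt_fst p.2) (hasMFDerivAt_snd p))
  have f3 : HasMFDerivAt thickTorusModel 𝓘(ℝ, ℝ) (fun p : ThickTorus => (p.2.2 : ℝ)) p _ :=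
    HasMFDerivAt.comp p c3.hasMFDerivAt
      (HasMFDerivAt.comp p (hasMFDerivAt_snd p.2) (hasMFDerivAt_snd p))
  have g1 : HasMFDerivAt thickTorusModel 𝓘(ℝ, ℂ) (fun p : ThickTorus => (p.1 : ℂ)) p _ :=
    HasMFDerivAt.comp (f := torusCoords) (g := ContinuousLinearMap.fst ℝ ℂ (ℂ × ℝ)) p
      (ContinuousLinearMap.hasMFDerivAt _) h0.hasMFDerivAt
  have g2 : HasMFDerivAt thickTorusModel 𝓘(ℝ, ℂ) (fun p : ThickTorus => (p.2.1 : ℂ)) p _ :=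
    HasMFDerivAt.comp (f := torusCoords)
      (g := (ContinuousLinearMap.fst ℝ ℂ ℝ).comp (ContinuousLinearMap.snd ℝ ℂ (ℂ × ℝ))) p
      (ContinuousLinearMap.hasMFDerivAt _) h0.hasMFDerivAt
  have g3 : HasMFDerivAt thickTorusModel 𝓘(ℝ, ℝ) (fun p : ThickTorus => (p.2.2 : ℝ)) p _ :=
    HasMFDerivAt.comp (f := torusCoords)
      (g := (ContinuousLinearMap.snd ℝ ℂ ℝ).comp (ContinuousLinearMap.snd ℝ ℂ (ℂ × ℝ))) p
      (ContinuousLinearMap.hasMFDerivAt _) h0.hasMFDerivAt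
  have e1 := hasMFDerivAt_unique f1 g1
  have e2 := hasMFDerivAt_unique f2 g2
  have e3 := hasMFDerivAt_unique f3 g3
  rw [injective_iff_map_eq_zero]
  intro v hv
  refine Prod.ext ?_ (Prod.ext ?_ ?_)
  · refine (injective_iff_map_eq_zero _).1 (injective_mfderiv_circle_coe p.1) _ ?_
    refine (DFunLike.congr_fun e1 v).trans ?_
    exact congrArg (fun x : ℂ × ℂ × ℝ => x.1) hv
  · refine (injective_iff_map_eq_zero _).1 (injective_mfderiv_circle_coe p.2.1) _ ?_
    refine (DFunLike.congr_fun e2 v).trans ?_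
    exact congrArg (fun x : ℂ × ℂ × ℝ => x.2.1) hv
  · refine (injective_iff_map_eq_zero _).1 (injective_mfderiv_unitInterval_coe p.2.2) _ ?_
    refine (DFunLike.congr_fun e3 v).trans ?_
    exact congrArg (fun x : ℂ × ℂ × ℝ => x.2.2) hv

lemma contMDiff_torusEmb : ContMDiff thickTorusModel 𝓘(ℝ, E3) ∞ torusEmb := fun p =>
  ContMDiffAt.comp (g := stereo) p (contDiffAt_stereo (hopfPoint_torusCoords_re_lt p).ne).contMDiffAt
    (contDiff_hopfPoint.contMDiff.comp contMDiff_torusCoords p)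

lemma torusCoords_injective : Function.Injective torusCoords := by
  rintro ⟨a, b, c⟩ ⟨a', b', c'⟩ h
  simp only [torusCoords, Prod.mk.injEq] at h
  exact Prod.ext (Circle.ext h.1) (Prod.ext (Circle.ext h.2.1) (Subtype.ext h.2.2))

/-- The coordinates of the thickened torus as functions on Euclidean space; they are smooth away from
the two cores of the Hopf link. -/
noncomputable def hopfCoords (x : E3) : ℂ × ℂ × ℝ :=
  (‖(unstereo x).1‖⁻¹ • (unstereo x).1, ‖(unstereo x).2‖⁻¹ • (unstereo x).2,
    (Real.arcsin ‖(unstereo x).1‖ - Real.pi / 8) / (Real.pi / 4))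

lemma norm_unstereo (x : E3) : ‖(unstereo x).1‖ ^ 2 + ‖(unstereo x).2‖ ^ 2 = 1 := by
  rw [Complex.sq_norm, Complex.sq_norm, Complex.normSq_apply, Complex.normSq_apply]
  linear_combination normSq_unstereo x

lemma norm_unstereo_torusEmb (p : ThickTorus) :
    ‖(unstereo (torusEmb p)).1‖ = Real.sin (hopfArc p.2.2) ∧
      ‖(unstereo (torusEmb p)).2‖ = Real.cos (hopfArc p.2.2) := by
  rw [unstereo_torusEmb]
  simp only [hopfPoint, torusCoords, norm_smul, Circle.norm_coe, mul_one, Real.norm_eq_abs]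
  exact ⟨abs_of_pos (sin_hopfArc_pos p.2.2.2), abs_of_pos (cos_hopfArc_pos p.2.2.2)⟩

lemma unstereo_torusEmb_ne_zero (p : ThickTorus) :
    (unstereo (torusEmb p)).1 ≠ 0 ∧ (unstereo (torusEmb p)).2 ≠ 0 := by
  rw [← norm_pos_iff, ← norm_pos_iff, (norm_unstereo_torusEmb p).1, (norm_unstereo_torusEmb p).2]
  exact ⟨sin_hopfArc_pos p.2.2.2, cos_hopfArc_pos p.2.2.2⟩

lemma hopfCoords_torusEmb (p : ThickTorus) : hopfCoords (torusEmb p) = torusCoords p := by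
  have hπ := Real.pi_pos
  have h1 := sin_hopfArc_pos p.2.2.2
  have h2 := cos_hopfArc_pos p.2.2.2
  have h3 := hopfArc_mem p.2.2.2
  simp only [hopfCoords, norm_unstereo_torusEmb]
  rw [unstereo_torusEmb, Real.arcsin_sin (by linarith [h3.1]) h3.2.le]
  simp only [hopfPoint, torusCoords]
  rw [inv_smul_smul₀ h1.ne', inv_smul_smul₀ h2.ne']
  refine Prod.ext rfl (Prod.ext rfl ?_)
  simp only [hopfArc]
  field_simp
  ring

lemma torusEmb_injective : Function.Injective torusEmb := fun p q h =>
  torusCoords_injective (by rw [← hopfCoords_torusEmb, h, hopfCoords_torusEmb])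

lemma hopfPoint_hopfCoords {x : E3} (h1 : (unstereo x).1 ≠ 0) (h2 : (unstereo x).2 ≠ 0) :
    hopfPoint (hopfCoords x) = unstereo x := by
  have hπ := Real.pi_pos
  have h := norm_unstereo x
  have h3 := norm_pos_iff.2 h1
  have h4 := norm_pos_iff.2 h2
  have e : hopfArc ((Real.arcsin ‖(unstereo x).1‖ - Real.pi / 8) / (Real.pi / 4)) =
      Real.arcsin ‖(unstereo x).1‖ := by
    rw [hopfArc]; field_simp; ring
  simp only [hopfPoint, hopfCoords, e]
  have e2 : Real.cos (Real.arcsin ‖(unstereo x).1‖) = ‖(unstereo x).2‖ := by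
    rw [Real.cos_arcsin, Real.sqrt_eq_iff_mul_self_eq_of_pos h4]
    linarith
  rw [Real.sin_arcsin (by linarith) (by nlinarith), e2, smul_inv_smul₀ h3.ne',
    smul_inv_smul₀ h4.ne']

lemma contDiffAt_norm_unstereo_fst {x : E3} (h1 : (unstereo x).1 ≠ 0) :
    ContDiffAt ℝ ∞ (fun x => ‖(unstereo x).1‖) x :=
  ContDiffAt.norm ℝ (contDiff_fst.comp contDiff_unstereo).contDiffAt h1

lemma contDiffAt_hopfCoords {x : E3} (h1 : (unstereo x).1 ≠ 0) (h2 : (unstereo x).2 ≠ 0) :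
    ContDiffAt ℝ ∞ hopfCoords x := by
  have g1 := contDiffAt_norm_unstereo_fst h1
  have g2 : ContDiffAt ℝ ∞ (fun x => ‖(unstereo x).2‖) x :=
    ContDiffAt.norm ℝ (contDiff_snd.comp contDiff_unstereo).contDiffAt h2
  have h3 := norm_pos_iff.2 h1
  have h4 := norm_pos_iff.2 h2
  have h5 := norm_unstereo x
  have h6 : ContDiffAt ℝ ∞ (fun x => Real.arcsin ‖(unstereo x).1‖) x :=
    ContDiffAt.comp (g := Real.arcsin) x
      (Real.contDiffAt_arcsin (by linarith) (by intro h; rw [h] at h5; nlinarith)) g1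
  exact ((g1.inv h3.ne').smul (contDiff_fst.comp contDiff_unstereo).contDiffAt).prodMk
    (((g2.inv h4.ne').smul (contDiff_snd.comp contDiff_unstereo).contDiffAt).prodMk
      ((h6.sub contDiffAt_const).div_const _))

lemma injective_mfderiv_torusEmb (p : ThickTorus) :
    Function.Injective (mfderiv thickTorusModel 𝓘(ℝ, E3) torusEmb p) := by
  have h0 := unstereo_torusEmb_ne_zero p
  have h1 : MDifferentiableAt 𝓘(ℝ, E3) 𝓘(ℝ, ℂ × ℂ × ℝ) hopfCoords (torusEmb p) :=
    (contDiffAt_hopfCoords h0.1 h0.2).contMDiffAt.mdifferentiableAt (by simp)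
  have h2 := mfderiv_comp p h1 ((contMDiff_torusEmb p).mdifferentiableAt (by simp))
  have h3 : hopfCoords ∘ torusEmb = torusCoords := funext hopfCoords_torusEmb
  rw [h3] at h2
  have h4 := injective_mfderiv_torusCoords p
  rw [h2] at h4
  exact Function.Injective.of_comp
    (f := mfderiv 𝓘(ℝ, E3) 𝓘(ℝ, ℂ × ℂ × ℝ) hopfCoords (torusEmb p)) h4

/-- Smooth embeddings into the thickened torus are smooth embeddings into Euclidean space. -/
lemma IsSmoothEmbeddingOn.torusEmb_comp {F : Type*} [NormedAddCommGroup F] [NormedSpace ℝ F]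
    {φ : F → ThickTorus} {s : Set F} (h : IsSmoothEmbeddingOn thickTorusModel φ s) :
    ContDiff ℝ ∞ (fun x => torusEmb (φ x)) ∧ InjOn (fun x => torusEmb (φ x)) s ∧
      ∀ x ∈ s, Function.Injective (fderiv ℝ (fun x => torusEmb (φ x)) x) := by
  obtain ⟨h1, h2, h3⟩ := h
  refine ⟨(contMDiff_torusEmb.comp h1).contDiff, fun x hx y hy hxy =>
    h2 hx hy (torusEmb_injective hxy), fun x hx => ?_⟩
  have h4 := mfderiv_comp x ((contMDiff_torusEmb (φ x)).mdifferentiableAt (by simp))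
    ((h1 x).mdifferentiableAt (by simp))
  have h5 : mfderiv 𝓘(ℝ, F) 𝓘(ℝ, E3) (torusEmb ∘ φ) x = fderiv ℝ (fun x => torusEmb (φ x)) x :=
    mfderiv_eq_fderiv
  rw [← h5, h4]
  exact (injective_mfderiv_torusEmb (φ x)).comp (h3 x hx)

/-! ### Extending isotopies of the thickened torus -/

/-- A left inverse of `torusEmb` which is smooth near the image of `p₀` if `p₀` is an interior point.
The base point only serves to choose the branches of the two angles. -/
noncomputable def torusLocalInv (p₀ : ThickTorus) (x : E3) : ThickTorus :=
  (p₀.1 * Circle.exp (((unstereo x).1 / p₀.1).arg),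
    p₀.2.1 * Circle.exp (((unstereo x).2 / p₀.2.1).arg),
    projIcc 0 1 zero_le_one ((Real.arcsin ‖(unstereo x).1‖ - Real.pi / 8) / (Real.pi / 4)))

lemma coe_mul_exp_arg (c : Circle) {w : ℂ} (hw : w ≠ 0) :
    ((c * Circle.exp ((w / c).arg) : Circle) : ℂ) = ‖w‖⁻¹ • w := by
  have hn := norm_pos_iff.2 hw
  have h := Complex.norm_mul_exp_arg_mul_I (w / c)
  rw [norm_div, Circle.norm_coe, div_one] at h
  have hc : (c : ℂ) ≠ 0 := Circle.coe_ne_zero c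
  have hn' : ((‖w‖ : ℝ) : ℂ) ≠ 0 := by exact_mod_cast hn.ne'
  rw [Circle.coe_mul, Circle.coe_exp, Complex.real_smul, Complex.ofReal_inv]
  rw [eq_div_iff hc] at h
  field_simp
  linear_combination h

lemma torusCoords_torusLocalInv (p₀ : ThickTorus) {x : E3} (h1 : (unstereo x).1 ≠ 0)
    (h2 : (unstereo x).2 ≠ 0) (h3 : (hopfCoords x).2.2 ∈ Icc (0 : ℝ) 1) :
    torusCoords (torusLocalInv p₀ x) = hopfCoords x := by
  refine Prod.ext (coe_mul_exp_arg p₀.1 h1) (Prod.ext (coe_mul_exp_arg p₀.2.1 h2) ?_)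
  exact congrArg Subtype.val (projIcc_of_mem zero_le_one h3)

lemma torusEmb_torusLocalInv {p₀ : ThickTorus} (hp : (p₀.2.2 : ℝ) ∈ Ioo (0 : ℝ) 1) :
    ∀ᶠ x in nhds (torusEmb p₀), torusEmb (torusLocalInv p₀ x) = x := by
  have h0 := unstereo_torusEmb_ne_zero p₀
  have hc := contDiff_unstereo.continuous
  have h1 : ∀ᶠ x in nhds (torusEmb p₀), (unstereo x).1 ≠ 0 :=
    hc.fst.continuousAt.eventually_ne h0.1
  have h2 : ∀ᶠ x in nhds (torusEmb p₀), (unstereo x).2 ≠ 0 :=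
    hc.snd.continuousAt.eventually_ne h0.2
  have h3 : ∀ᶠ x in nhds (torusEmb p₀), (hopfCoords x).2.2 ∈ Ioo (0 : ℝ) 1 := by
    refine (contDiffAt_hopfCoords h0.1 h0.2).continuousAt.snd.snd.eventually_mem
      (Ioo_mem_nhds ?_ ?_) <;> rw [hopfCoords_torusEmb]
    exacts [hp.1, hp.2]
  filter_upwards [h1, h2, h3] with x h1 h2 h3
  rw [torusEmb, torusCoords_torusLocalInv _ h1 h2 (Ioo_subset_Icc_self h3),
    hopfPoint_hopfCoords h1 h2, stereo_unstereo]

lemma contMDiffAt_mul_exp_arg (c : Circle) {f : E3 → ℂ} {x : E3} (hf : ContDiffAt ℝ ∞ f x)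
    {r : ℝ} (hr : 0 < r) (hx : f x = r • (c : ℂ)) :
    ContMDiffAt 𝓘(ℝ, E3) (𝓡 1) ∞ (fun x => c * Circle.exp ((f x / c).arg)) x := by
  have hc : (c : ℂ) ≠ 0 := Circle.coe_ne_zero c
  have e : f x / c = r := by rw [hx, Complex.real_smul, mul_div_cancel_right₀ _ hc]
  have h1 : ContDiffAt ℝ ∞ (fun x => f x / c) x := hf.div_const _
  have h2 : ContDiffAt ℝ ∞ (fun x => (Complex.log (f x / c)).im) x := by
    refine Complex.imCLM.contDiff.contDiffAt.comp x (ContDiffAt.comp (g := Complex.log) x ?_ h1)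
    refine (Complex.contDiffAt_log ?_).restrict_scalars ℝ
    rw [e]; exact Complex.ofReal_mem_slitPlane.2 hr
  simp only [Complex.log_im] at h2
  have h3 : ContMDiff (𝓡 1) (𝓡 1) ∞ (fun y : Circle => c * y) := contMDiff_mul_left
  exact ContMDiffAt.comp (g := fun y : Circle => c * y) x h3.contMDiffAt
    (ContMDiffAt.comp (g := Circle.exp) x contMDiff_circleExp.contMDiffAt h2.contMDiffAt)

lemma contMDiffAt_torusLocalInv {p₀ : ThickTorus} (hp : (p₀.2.2 : ℝ) ∈ Ioo (0 : ℝ) 1) :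
    ContMDiffAt 𝓘(ℝ, E3) thickTorusModel ∞ (torusLocalInv p₀) (torusEmb p₀) := by
  have h0 := unstereo_torusEmb_ne_zero p₀
  have h1 := contMDiffAt_mul_exp_arg p₀.1 (x := torusEmb p₀)
    (contDiff_fst.comp contDiff_unstereo).contDiffAt (sin_hopfArc_pos p₀.2.2.2)
    (congrArg Prod.fst (unstereo_torusEmb p₀))
  have h2 := contMDiffAt_mul_exp_arg p₀.2.1 (x := torusEmb p₀)
    (contDiff_snd.comp contDiff_unstereo).contDiffAt (cos_hopfArc_pos p₀.2.2.2)
    (congrArg Prod.snd (unstereo_torusEmb p₀))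
  have h3 : ContMDiffAt 𝓘(ℝ, E3) (𝓡∂ 1) ∞ (fun x => projIcc (0 : ℝ) 1 zero_le_one
      (hopfCoords x).2.2) (torusEmb p₀) := by
    have h4 : ContDiffAt ℝ ∞ (fun x => (hopfCoords x).2.2) (torusEmb p₀) :=
      (contDiff_snd.comp contDiff_snd).contDiffAt.comp (torusEmb p₀)
        (contDiffAt_hopfCoords h0.1 h0.2)
    refine ContMDiffAt.comp (g := projIcc (0 : ℝ) 1 zero_le_one) (I' := 𝓘(ℝ, ℝ)) _ ?_ h4.contMDiffAt
    refine contMDiffOn_projIcc.contMDiffAt (Icc_mem_nhds ?_ ?_) <;> rw [hopfCoords_torusEmb]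
    exacts [hp.1, hp.2]
  exact h1.prodMk (h2.prodMk h3)

/-- A map of Euclidean space that is a smooth map on the interior of the thickened torus and the
identity away from a compact subset of the interior is smooth. -/
lemma contDiff_of_torusEmb {φ : ThickTorus → ThickTorus}
    (hφ : ContMDiff thickTorusModel thickTorusModel ∞ φ) {C : Set ThickTorus} (hC : IsCompact C)
    (hCi : ∀ p ∈ C, (p.2.2 : ℝ) ∈ Ioo (0 : ℝ) 1) {F : E3 → E3}
    (hF : ∀ p, F (torusEmb p) = torusEmb (φ p)) (hid : ∀ x ∉ torusEmb '' C, F x = x) :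
    ContDiff ℝ ∞ F := by
  rw [contDiff_iff_contDiffAt]
  intro x
  by_cases hx : x ∈ torusEmb '' C
  · obtain ⟨p, hp, rfl⟩ := hx
    have h1 : ContMDiffAt 𝓘(ℝ, E3) 𝓘(ℝ, E3) ∞ (fun x => torusEmb (φ (torusLocalInv p x)))
        (torusEmb p) :=
      ContMDiffAt.comp (g := fun q => torusEmb (φ q)) _
        (contMDiff_torusEmb.comp hφ).contMDiffAt (contMDiffAt_torusLocalInv (hCi p hp))
    refine h1.contDiffAt.congr_of_eventuallyEq ?_
    filter_upwards [torusEmb_torusLocalInv (hCi p hp)] with y hy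
    rw [← hF, hy]
  · have h1 : IsClosed (torusEmb '' C) :=
      (hC.image contMDiff_torusEmb.continuous).isClosed
    refine contDiffAt_id.congr_of_eventuallyEq ?_
    filter_upwards [h1.isOpen_compl.mem_nhds hx] with y hy
    exact hid y hy

/-- The final diffeomorphism of an isotopy of the thickened torus with compact support in the interior
extends to Euclidean space, by the identity. -/
lemma AmbientIsotopy.exists_extension {W : Set ThickTorus}
    (hW : ∀ p ∈ W, (p.2.2 : ℝ) ∈ Ioo (0 : ℝ) 1) (A : AmbientIsotopy thickTorusModel W) :
    ∃ F : Equiv.Perm E3, DiffeoIn (torusEmb '' W) F ∧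
      ∀ p, F (torusEmb p) = torusEmb (A.toDiffeo 1 p) := by
  classical
  obtain ⟨C, hC, hCW, hid⟩ := A.supp
  let e : Equiv.Perm ThickTorus := (A.toDiffeo 1).toEquiv
  let F : Equiv.Perm E3 := e.extendDomain (Equiv.ofInjective torusEmb torusEmb_injective)
  have hF : ∀ p, F (torusEmb p) = torusEmb (e p) := fun p =>
    Equiv.Perm.extendDomain_apply_image e (Equiv.ofInjective torusEmb torusEmb_injective) p
  have hFs : ∀ p, F.symm (torusEmb p) = torusEmb (e.symm p) := fun p => by
    rw [F.symm_apply_eq, hF, e.apply_symm_apply]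
  have hFid : ∀ x ∉ torusEmb '' C, F x = x := by
    intro x hx
    by_cases h : x ∈ range torusEmb
    · obtain ⟨p, rfl⟩ := h
      rw [hF]
      exact congrArg torusEmb (hid 1 p fun hp => hx ⟨p, hp, rfl⟩)
    · exact Equiv.Perm.extendDomain_apply_not_subtype e _ h
  have hFsid : ∀ x ∉ torusEmb '' C, F.symm x = x := fun x hx => by
    rw [F.symm_apply_eq, hFid x hx]
  exact ⟨F, ⟨contDiff_of_torusEmb (A.toDiffeo 1).contMDiff hC (fun p hp => hW p (hCW hp)) hF hFid,
    contDiff_of_torusEmb (A.toDiffeo 1).symm.contMDiff hC (fun p hp => hW p (hCW hp)) hFs hFsid,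
    _, hC.image contMDiff_torusEmb.continuous, image_mono hCW, hFid⟩, hF⟩

/-! ### Sectors and meridian disks -/

/-- The union of the open half-planes, bounded by the first axis, at the angles `2 π t` with
`c < t < d`. -/
def sector (c d : ℝ) : Set E3 :=
  {x | ∃ r > 0, ∃ t ∈ Ioo c d,
    x.2 = (r * Real.cos (2 * Real.pi * t), r * Real.sin (2 * Real.pi * t))}

lemma sector_mono {c d c' d' : ℝ} (hc : c' ≤ c) (hd : d ≤ d') : sector c d ⊆ sector c' d' := by
  rintro x ⟨r, hr, t, ht, h⟩
  exact ⟨r, hr, t, Ioo_subset_Ioo hc hd ht, h⟩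

lemma disjoint_sector {a b c d : ℝ} (ha : 0 ≤ a) (hbc : b ≤ c) (hd : d ≤ 1) :
    Disjoint (sector a b) (sector c d) := by
  rw [disjoint_left]
  rintro x ⟨r, hr, t, ht, h⟩ ⟨r', hr', t', ht', h'⟩
  rw [h] at h'
  obtain ⟨h1, h2⟩ := Prod.mk.inj h'
  have hrr : r = r' := by
    have e1 := Real.sin_sq_add_cos_sq (2 * Real.pi * t)
    have e2 := Real.sin_sq_add_cos_sq (2 * Real.pi * t')
    have : r ^ 2 = r' ^ 2 := by
      calc r ^ 2 = (r * Real.cos (2 * Real.pi * t)) ^ 2 + (r * Real.sin (2 * Real.pi * t)) ^ 2 := by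
            linear_combination -(r ^ 2) * e1
        _ = r' ^ 2 := by rw [h1, h2]; linear_combination (r' ^ 2) * e2
    exact (sq_eq_sq₀ hr.le hr'.le).1 this
  subst hrr
  have h3 := mul_left_cancel₀ hr.ne' h1
  have h4 := mul_left_cancel₀ hr.ne' h2
  have h5 := Circle.exp_eq_exp.1 (Circle.ext (x := Circle.exp (2 * Real.pi * t))
    (y := Circle.exp (2 * Real.pi * t')) (by
      rw [Circle.coe_exp, Circle.coe_exp]
      apply Complex.ext
      · rw [Complex.exp_ofReal_mul_I_re, Complex.exp_ofReal_mul_I_re, h3]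
      · rw [Complex.exp_ofReal_mul_I_im, Complex.exp_ofReal_mul_I_im, h4]))
  obtain ⟨m, hm⟩ := h5
  have hπ := Real.pi_pos
  have h6 : t = t' + m := by
    have : 2 * Real.pi * (t - (t' + m)) = 0 := by linear_combination hm
    rcases mul_eq_zero.1 this with h | h
    · linarith
    · linarith
  have h7 : (-1 : ℝ) < m := by linarith [ht.1, ht'.2]
  have h8 : (m : ℝ) < 0 := by linarith [ht.2, ht'.1]
  have h9 : -1 < m := by exact_mod_cast h7
  have h10 : m < 0 := by exact_mod_cast h8
  omega

lemma torusEmb_image_subset_sector (c d : ℝ) : torusEmb '' thickAnnulus c d ⊆ sector c d := by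
  rintro _ ⟨_, ⟨⟨x, t, z⟩, ⟨-, ht, -⟩, rfl⟩, rfl⟩
  have h1 := hopfPoint_torusCoords_re_lt (torusProj (x, t, z))
  set p := torusProj (x, t, z) with hp
  have h2 := cos_hopfArc_pos z.2
  refine ⟨Real.cos (hopfArc z) / (1 - (hopfPoint (torusCoords p)).1.re),
    div_pos h2 (sub_pos.2 h1), t, ht, ?_⟩
  have e : (p.2.1 : ℂ) = Complex.exp ((2 * Real.pi * t : ℝ) * Complex.I) := Circle.coe_exp _
  simp only [torusEmb, stereo]
  have e2 : (hopfPoint (torusCoords p)).2 = Real.cos (hopfArc z) • (p.2.1 : ℂ) := rfl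
  rw [e2, Complex.smul_re, Complex.smul_im, e, Complex.exp_ofReal_mul_I_re,
    Complex.exp_ofReal_mul_I_im, smul_eq_mul, smul_eq_mul]
  refine Prod.ext ?_ ?_ <;> simp only <;> ring

lemma torusCell_subset_thickAnnulus (a b c d : ℝ) : torusCell a b c d ⊆ thickAnnulus c d :=
  image_mono (prod_mono (subset_univ _) subset_rfl)

lemma thickAnnulus_subset_interior {c d : ℝ} {p : ThickTorus} (hp : p ∈ thickAnnulus c d) :
    (p.2.2 : ℝ) ∈ Ioo (0 : ℝ) 1 := by
  obtain ⟨q, ⟨-, -, hq⟩, rfl⟩ := hp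
  exact hq

/-- The meridian disk, in the angle `2 π h`, of the solid torus in which the longitude at the height
`h` is a meridian: the stereographic image of `(ζ, exp (2 π i h)) / √(1 + |ζ|²)`. -/
noncomputable def meridianDisk (h : ℝ) (ζ : ℂ) : E3 :=
  (ζ.im / (Real.sqrt (1 + ‖ζ‖ ^ 2) - ζ.re),
    Real.cos (2 * Real.pi * h) / (Real.sqrt (1 + ‖ζ‖ ^ 2) - ζ.re),
    Real.sin (2 * Real.pi * h) / (Real.sqrt (1 + ‖ζ‖ ^ 2) - ζ.re))

lemma meridianDisk_denom_pos (ζ : ℂ) : 0 < Real.sqrt (1 + ‖ζ‖ ^ 2) - ζ.re := by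
  have h1 := Complex.re_le_norm ζ
  have h2 : ‖ζ‖ < Real.sqrt (1 + ‖ζ‖ ^ 2) := by
    rw [Real.lt_sqrt (norm_nonneg _)]; linarith
  linarith

lemma contDiff_meridianDisk (h : ℝ) : ContDiff ℝ ∞ (meridianDisk h) := by
  have h1 : ContDiff ℝ ∞ fun ζ : ℂ => Real.sqrt (1 + ‖ζ‖ ^ 2) - ζ.re := by
    refine ContDiff.sub (ContDiff.sqrt (contDiff_const.add (contDiff_norm_sq ℝ)) fun ζ => ?_)
      Complex.reCLM.contDiff
    positivity
  have hne : ∀ ζ : ℂ, Real.sqrt (1 + ‖ζ‖ ^ 2) - ζ.re ≠ 0 := fun ζ => (meridianDisk_denom_pos ζ).ne'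
  exact (Complex.imCLM.contDiff.div h1 hne).prodMk
    ((contDiff_const.div h1 hne).prodMk (contDiff_const.div h1 hne))

lemma meridianDisk_mem_sector {c d h : ℝ} (hh : h ∈ Ioo c d) (ζ : ℂ) :
    meridianDisk h ζ ∈ sector c d := by
  refine ⟨1 / (Real.sqrt (1 + ‖ζ‖ ^ 2) - ζ.re), by have := meridianDisk_denom_pos ζ; positivity,
    h, hh, ?_⟩
  simp only [meridianDisk]
  refine Prod.ext ?_ ?_ <;> simp only <;> ring

/-- A left inverse of the meridian disk. -/
noncomputable def meridianInv (h : ℝ) (x : E3) : ℂ :=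
  ⟨(x.1 ^ 2 + (x.2.1 * Real.cos (2 * Real.pi * h) + x.2.2 * Real.sin (2 * Real.pi * h)) ^ 2 - 1) /
      (2 * (x.2.1 * Real.cos (2 * Real.pi * h) + x.2.2 * Real.sin (2 * Real.pi * h))),
    x.1 / (x.2.1 * Real.cos (2 * Real.pi * h) + x.2.2 * Real.sin (2 * Real.pi * h))⟩

lemma meridianDisk_radius (h : ℝ) (ζ : ℂ) :
    (meridianDisk h ζ).2.1 * Real.cos (2 * Real.pi * h) +
      (meridianDisk h ζ).2.2 * Real.sin (2 * Real.pi * h) =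
      1 / (Real.sqrt (1 + ‖ζ‖ ^ 2) - ζ.re) := by
  have h1 := Real.sin_sq_add_cos_sq (2 * Real.pi * h)
  have h2 := (meridianDisk_denom_pos ζ).ne'
  simp only [meridianDisk]
  field_simp
  linear_combination h1

lemma meridianInv_meridianDisk (h : ℝ) (ζ : ℂ) : meridianInv h (meridianDisk h ζ) = ζ := by
  have h2 := (meridianDisk_denom_pos ζ).ne'
  have h3 : Real.sqrt (1 + ‖ζ‖ ^ 2) ^ 2 = 1 + (ζ.re ^ 2 + ζ.im ^ 2) := by
    rw [Real.sq_sqrt (by positivity), Complex.sq_norm, Complex.normSq_apply]; ring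
  rw [meridianInv, meridianDisk_radius]
  simp only [meridianDisk]
  set s := Real.sqrt (1 + ‖ζ‖ ^ 2)
  apply Complex.ext
  · simp only
    field_simp
    linear_combination -h3
  · simp only
    field_simp

lemma injective_fderiv_meridianDisk (h : ℝ) (ζ : ℂ) :
    Function.Injective (fderiv ℝ (meridianDisk h) ζ) := by
  refine injective_fderiv_of_leftInverse (g := meridianInv h)
    ((contDiff_meridianDisk h).differentiable (by simp) ζ) ?_
    (Filter.Eventually.of_forall (meridianInv_meridianDisk h))
  have hr : (meridianDisk h ζ).2.1 * Real.cos (2 * Real.pi * h) +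
      (meridianDisk h ζ).2.2 * Real.sin (2 * Real.pi * h) ≠ 0 := by
    rw [meridianDisk_radius]
    have := meridianDisk_denom_pos ζ
    positivity
  have e : meridianInv h = fun x => Complex.equivRealProdCLM.symm
      ((x.1 ^ 2 + (x.2.1 * Real.cos (2 * Real.pi * h) +
          x.2.2 * Real.sin (2 * Real.pi * h)) ^ 2 - 1) /
        (2 * (x.2.1 * Real.cos (2 * Real.pi * h) + x.2.2 * Real.sin (2 * Real.pi * h))),
      x.1 / (x.2.1 * Real.cos (2 * Real.pi * h) + x.2.2 * Real.sin (2 * Real.pi * h))) := by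
    funext x; rfl
  have q : Differentiable ℝ fun x : E3 => x.2.1 * Real.cos (2 * Real.pi * h) +
      x.2.2 * Real.sin (2 * Real.pi * h) := by fun_prop
  have q1 : Differentiable ℝ fun x : E3 => x.1 := by fun_prop
  have q2 := ((q1.pow 2).add (q.pow 2)).sub_const 1
  rw [e]
  have d1 := (q2 (meridianDisk h ζ)).mul (((q (meridianDisk h ζ)).const_mul 2).fun_inv
    (mul_ne_zero two_ne_zero hr))
  have d2 := (q1 (meridianDisk h ζ)).mul ((q (meridianDisk h ζ)).fun_inv hr)
  exact Complex.equivRealProdCLM.symm.differentiableAt.comp _ (d1.prodMk d2)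

lemma hopfArc_half : hopfArc (1 / 2) = Real.pi / 4 := by rw [hopfArc]; ring

lemma torusEmb_eq_meridianDisk {h : ℝ} {p : ThickTorus} (hp : p ∈ courseCurve h) :
    torusEmb p = meridianDisk h p.1 := by
  obtain ⟨h1, h2⟩ := hp
  have e : (p.2.1 : ℂ) = Complex.exp ((2 * Real.pi * h : ℝ) * Complex.I) := by
    rw [h1]; exact Circle.coe_exp _
  have h3 := meridianDisk_denom_pos p.1
  have e2 : (torusCoords p) = ((p.1 : ℂ), (p.2.1 : ℂ), 1 / 2) := by rw [torusCoords, h2]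
  rw [torusEmb, e2, meridianDisk]
  simp only [stereo, hopfPoint, hopfArc_half, Real.sin_pi_div_four, Real.cos_pi_div_four, e,
    Complex.smul_re, Complex.smul_im, Complex.exp_ofReal_mul_I_re, Complex.exp_ofReal_mul_I_im,
    smul_eq_mul, Circle.norm_coe]
  rw [Circle.norm_coe] at h3
  have h4 : (1 : ℝ) + 1 ^ 2 = 2 := by norm_num
  rw [h4] at h3 ⊢
  have h5 : Real.sqrt 2 ^ 2 = 2 := Real.sq_sqrt (by norm_num)
  have h6 : 1 - Real.sqrt 2 / 2 * (p.1 : ℂ).re = Real.sqrt 2 / 2 * (Real.sqrt 2 - (p.1 : ℂ).re) := by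
    linear_combination -(1 / 2) * h5
  have h7 : Real.sqrt 2 / 2 ≠ 0 := by positivity
  rw [h6, mul_div_mul_left _ _ h7, mul_div_mul_left _ _ h7, mul_div_mul_left _ _ h7]

/-- The longitude at the height `h` bounds a meridian disk. -/
lemma meridianDisk_image_sphere (h : ℝ) :
    meridianDisk h '' sphere (0 : ℂ) 1 = torusEmb '' courseCurve h := by
  ext x
  constructor
  · rintro ⟨ζ, hζ, rfl⟩
    have hp : ((⟨ζ, hζ⟩ : Circle),
      Circle.exp (2 * Real.pi * h), (⟨1 / 2, by norm_num, by norm_num⟩ : unitInterval)) ∈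
        courseCurve h := ⟨rfl, rfl⟩
    exact ⟨_, hp, torusEmb_eq_meridianDisk hp⟩
  · rintro ⟨p, hp, rfl⟩
    exact ⟨p.1, mem_sphere_zero_iff_norm.2 (Circle.norm_coe _), (torusEmb_eq_meridianDisk hp).symm⟩

lemma boundsRibbon_courseCurve {c d h : ℝ} (hh : h ∈ Ioo c d) :
    BoundsRibbon (fun _ : Unit => torusEmb '' courseCurve h) (sector c d) := by
  refine ⟨fun _ => meridianDisk h, .of_embedded (fun _ => contDiff_meridianDisk h)
    (fun _ ζ _ => injective_fderiv_meridianDisk h ζ) (fun i j p _ q _ hpq => ?_),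
    fun _ => ⟨meridianDisk_image_sphere h, ?_⟩⟩
  · rw [← meridianInv_meridianDisk h p, hpq, meridianInv_meridianDisk]
  · rintro _ ⟨ζ, -, rfl⟩
    exact meridianDisk_mem_sector hh ζ

lemma disjoint_torusCell {a b a' b' c d c' d' : ℝ} (ha : 0 ≤ a) (hb : b ≤ a') (hb' : b' ≤ 1) :
    Disjoint (torusCell a b c d) (torusCell a' b' c' d') := by
  rw [disjoint_left]
  rintro _ ⟨⟨x, t, z⟩, ⟨hx, -⟩, rfl⟩ ⟨⟨x', t', z'⟩, ⟨hx', -⟩, h⟩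
  have h1 : Circle.exp (2 * Real.pi * x') = Circle.exp (2 * Real.pi * x) := congrArg Prod.fst h
  obtain ⟨m, hm⟩ := Circle.exp_eq_exp.1 h1
  have hπ := Real.pi_pos
  have h6 : x' = x + m := by
    have : 2 * Real.pi * (x' - (x + m)) = 0 := by linear_combination hm
    rcases mul_eq_zero.1 this with h | h
    · linarith
    · linarith
  simp only [mem_Ioo] at hx hx'
  have h7 : (0 : ℝ) < m := by linarith [hx.2, hx'.1]
  have h8 : (m : ℝ) < 1 := by linarith [hx.1, hx'.2]
  have h9 : 0 < m := by exact_mod_cast h7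
  have h10 : m < 1 := by exact_mod_cast h8
  omega

lemma IsOrderedUnlink.boundsRibbon {n : ℕ} {c d : ℝ} {U : Fin n → Set ThickTorus}
    (h : IsOrderedUnlink c d U) : BoundsRibbon (fun i => torusEmb '' U i) (sector c d) := by
  obtain ⟨x, hx, hx0, hx1, hD⟩ := h
  choose D hD hDc hDs using hD
  have hT := fun i => (hD i).torusEmb_comp
  have hdis : ∀ i j : Fin n, i < j → Disjoint (torusCell (x i.castSucc) (x i.succ) c d)
      (torusCell (x j.castSucc) (x j.succ) c d) := fun i j hij =>
    disjoint_torusCell (hx0.trans (hx.monotone (Fin.zero_le _)))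
      (hx.monotone (by rw [Fin.le_def]; simpa using hij))
      ((hx.monotone (Fin.le_last _)).trans hx1)
  refine ⟨fun i z => torusEmb (D i z), .of_embedded (fun i => (hT i).1) (fun i => (hT i).2.2)
    (fun i j p hp q hq hpq => ?_), fun i => ⟨?_, ?_⟩⟩
  · rcases lt_trichotomy i j with hij | rfl | hij
    · exact absurd (hDc j ⟨q, hq, rfl⟩) (disjoint_left.1 (hdis i j hij)
        (by rw [← torusEmb_injective hpq]; exact hDc i ⟨p, hp, rfl⟩))
    · rw [(hT i).2.1 hp hq hpq]
    · exact absurd (hDc i ⟨p, hp, rfl⟩) (disjoint_left.1 (hdis j i hij)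
        (by rw [torusEmb_injective hpq]; exact hDc j ⟨q, hq, rfl⟩))
  · simp only [← hDs i, image_image]
  · rw [← image_image torusEmb (D i)]
    exact (image_mono ((hDc i).trans (torusCell_subset_thickAnnulus _ _ _ _))).trans
      (torusEmb_image_subset_sector c d)

/-! ### Swatches bound ribbon disks -/

/-- Fusion along bands in the thickened torus. -/
lemma BoundsRibbon.bandSurgery {ι : Type} [Finite ι] {n : ℕ} {K : ι → Set ThickTorus}
    {U : Fin n → Set ThickTorus} {W : Set E3} (a : ι)
    (h : BoundsRibbon (fun j => torusEmb '' Sum.elim K U j) W) {A B : Fin n → Set ThickTorus}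
    {Φ : Fin n → ℝ × ℝ × ℝ → ThickTorus} (hΦ : AreBands ((⋃ j, K j) ∪ ⋃ j, U j) A B Φ)
    (hs : ∀ i, Φ i '' startStrand ⊆ U i) (he : ∀ i, Φ i '' endStrand ⊆ K a)
    (hW : ∀ i, torusEmb '' (Φ i '' bandBox) ⊆ W) :
    BoundsRibbon (fun j => torusEmb '' (open Classical in if j = a then
      _root_.bandSurgery (K a ∪ ⋃ i, U i) Φ else K j)) W := by
  have e1 : (fun j => torusEmb '' Sum.elim K U j) =
      Sum.elim (fun j => torusEmb '' K j) (fun j => torusEmb '' U j) := by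
    funext j; cases j <;> rfl
  rw [e1] at h
  have e2 : ∀ i s, (fun x => torusEmb (Φ i x)) '' s = torusEmb '' (Φ i '' s) := fun i s =>
    (image_image _ _ _).symm
  have h1 := h.multiJoin a (Φ := fun i x => torusEmb (Φ i x))
    (fun i => (hΦ.1 i).1.torusEmb_comp) (fun i => ?_)
    (fun i => by rw [e2]; exact image_mono (hs i)) (fun i => by rw [e2]; exact image_mono (he i))
    (fun i => by rw [e2]; exact hW i)
    (fun i j hij => by
      simp only [e2]
      exact (disjoint_image_iff torusEmb_injective).2 (hΦ.2 hij))
  · convert h1 using 2 with j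
    split_ifs
    · simp only [_root_.bandSurgery, e2, image_union, image_sdiff torusEmb_injective, image_iUnion]
    · rfl
  · rw [← (hΦ.1 i).2.1, ← image_iUnion, ← image_iUnion, ← image_union]
    ext x
    simp only [mem_inter_iff, mem_preimage, torusEmb_injective.mem_set_image]

namespace SwatchData

variable {k : ℕ} {d : SwatchData k}

/-- The base and the first `m` rows, as a family. -/
noncomputable def firstRows (d : SwatchData k) (m : ℕ) (hm : m ≤ k + 1) :
    Fin (d.stitches (Fin.last k)) ⊕ Fin m → Set ThickTorus :=
  Sum.elim d.base fun i => d.row (Fin.castLE hm i)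

lemma iUnion_firstRows (m : ℕ) (hm : m < k + 1) :
    (⋃ o, d.firstRows m hm.le o) = d.below ⟨m, hm⟩ := by
  rw [iUnion_sum, below]
  congr 1
  ext x
  simp only [firstRows, Sum.elim_inr, mem_iUnion]
  constructor
  · rintro ⟨i, hi⟩
    exact ⟨_, Fin.lt_def.2 i.2, hi⟩
  · rintro ⟨i, hi, hx⟩
    exact ⟨⟨i, Fin.lt_def.1 hi⟩, hx⟩

/-- The base and the first rows bound ribbon disks. The longitude of the next row bounds a meridian
disk of the solid torus, in another sector than the disks of the knit below. The isotopy of the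
longitude, extended to Euclidean space, deforms all these disks and restores the boundary of those
of the knit below. -/
theorem IsValid.boundsRibbon_firstRows (hd : d.IsValid) (m : ℕ) (hm : m ≤ k + 1) :
    BoundsRibbon (fun o => torusEmb '' d.firstRows m hm o)
      (sector (d.cut 0) (d.cut (2 * m + 1))) := by
  have hcut : ∀ {i j : ℕ}, i ≤ j → d.cut i ≤ d.cut j := fun h => hd.cut_strictMono.monotone h
  have h0 : 0 ≤ d.cut 0 := hd.cut_zero.ge
  have htop : ∀ {i : ℕ}, i ≤ 2 * k + 3 → d.cut i ≤ 1 := fun h => (hcut h).trans hd.cut_top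
  induction m with
  | zero =>
    convert hd.base_unlink.boundsRibbon.reindex (Equiv.sumEmpty _ (Fin 0)) using 2 with o
    rcases o with i | i
    · rfl
    · exact i.elim0
  | succ m ih =>
    have hm' : m < k + 1 := hm
    set j : Fin (k + 1) := ⟨m, hm'⟩ with hj
    set K₀ := d.firstRows m hm'.le with hK₀
    have hbelow : (⋃ o, K₀ o) = d.below j := iUnion_firstRows m hm'
    -- the longitude bounds a meridian disk, in the sector above the disks of the knit below
    have h1 := ((ih hm'.le).sum (boundsRibbon_courseCurve (hd.height_mem j))
      (disjoint_sector h0 le_rfl (htop (by simp only [hj]; omega)))).mono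
      (W' := sector (d.cut 0) (d.cut (2 * (j : ℕ) + 2)))
      (union_subset (sector_mono le_rfl (hcut (by simp only [hj]; omega)))
        (sector_mono (hcut (Nat.zero_le _)) le_rfl))
    -- the isotopy moves the meridian disk and the disks of the knit below, but it fixes the boundaries
    -- of the latter
    obtain ⟨F, hF, hFemb⟩ := (d.iso j).exists_extension
      (fun p hp => thickAnnulus_subset_interior hp)
    have hF' := hF.mono (torusEmb_image_subset_sector _ _)
    have h2 : BoundsRibbon
        (fun o => torusEmb '' Sum.elim K₀ (fun _ : Unit => d.yarn j) o)
        (sector (d.cut 0) (d.cut (2 * (j : ℕ) + 2))) := by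
      have h := (h1.perm hF).mono (W' := sector (d.cut 0) (d.cut (2 * (j : ℕ) + 2))) (by
        rintro _ ⟨x, hx, rfl⟩
        exact hF'.map_mem.2 hx)
      convert h using 2 with o
      rcases o with o | o
      · simp only [Sum.elim_inl]
        rw [image_image]
        refine image_congr fun p hp => ?_
        rw [hFemb, hd.iso_fix j 1 p (hbelow.subset (mem_iUnion.2 ⟨o, hp⟩))]
      · simp only [Sum.elim_inr, yarn, image_image, hFemb]
    -- the contractible components bound disks in the sector above, which the isotopy has not entered
    have h3 : BoundsRibbon
        (fun o => torusEmb '' Sum.elim (Sum.elim K₀ (fun _ : Unit => d.yarn j)) (d.loops j) o)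
        (sector (d.cut 0) (d.cut (2 * (j : ℕ) + 3))) := by
      have h := (h2.sum (hd.loops_unlink j).boundsRibbon
        (disjoint_sector h0 le_rfl (htop (by simp only [hj]; omega)))).mono
        (W' := sector (d.cut 0) (d.cut (2 * (j : ℕ) + 3)))
        (union_subset (sector_mono le_rfl (hcut (by omega)))
          (sector_mono (hcut (Nat.zero_le _)) le_rfl))
      convert h using 2 with o
      rcases o with o | o <;> rfl
    have h4 := h3.bandSurgery (Sum.inr ()) (Φ := d.rowBand j) (A := d.loops j)
      (B := fun _ => d.yarn j) (by
        rw [iUnion_sum]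
        simp only [Sum.elim_inl, Sum.elim_inr, hbelow, iUnion_const]
        exact hd.rowBand_bands j)
      (fun i => ((hd.rowBand_bands j).1 i).2.2.1) (fun i => ((hd.rowBand_bands j).1 i).2.2.2)
      (fun i => (image_mono (hd.rowBand_mem j i)).trans (torusEmb_image_subset_sector _ _))
    let e : Fin (d.stitches (Fin.last k)) ⊕ Fin (m + 1) ≃
        (Fin (d.stitches (Fin.last k)) ⊕ Fin m) ⊕ Unit :=
      { toFun := Sum.elim (fun i => Sum.inl (Sum.inl i))
          (Fin.lastCases (Sum.inr ()) fun i => Sum.inl (Sum.inr i))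
        invFun := Sum.elim (Sum.map id Fin.castSucc) fun _ => Sum.inr (Fin.last m)
        left_inv := by
          rintro (i | i)
          · simp
          · refine Fin.lastCases ?_ (fun i => ?_) i <;> simp
        right_inv := by rintro ((i | i) | i) <;> simp }
    have h5 : BoundsRibbon _ (sector (d.cut 0) (d.cut (2 * (m + 1) + 1))) := h4.reindex e
    convert h5 using 2 with o
    rcases o with i | i
    · have : e (Sum.inl i) = Sum.inl (Sum.inl i) := rfl
      rw [this, if_neg (by simp)]
      rfl
    · refine Fin.lastCases ?_ (fun i => ?_) i
      · have : e (Sum.inr (Fin.last m)) = Sum.inr () := by simp [e]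
        rw [this, if_pos rfl]
        rfl
      · have : e (Sum.inr i.castSucc) = Sum.inl (Sum.inr i) := by simp [e]
        rw [this, if_neg (by simp)]
        rfl

/-- The components of a swatch bound ribbon disks: the disks of the base are fused with the disk of
the last row. -/
theorem IsValid.boundsRibbon_component (hd : d.IsValid) :
    BoundsRibbon (fun j => torusEmb '' d.component j) univ := by
  have hk := hd.boundsRibbon_firstRows k (Nat.le_succ k)
  have hall := (hd.boundsRibbon_firstRows (k + 1) le_rfl).mono (subset_univ _)
  -- the final bands end on loops of the last row, which meet no other row and not the base, so the
  -- ends lie on the last row itself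
  have hdis : ∀ o, ∀ i, Disjoint (d.firstRows k (Nat.le_succ k) o) (d.loops (Fin.last k) i) := by
    intro o i
    rw [← disjoint_image_iff torusEmb_injective]
    exact (disjoint_sector hd.cut_zero.ge (hd.cut_strictMono.monotone (by simp)) hd.cut_top).mono
      (hk.subset o) ((hd.loops_unlink (Fin.last k)).boundsRibbon.subset i)
  have h1 : BoundsRibbon (fun o => torusEmb '' Sum.elim d.row d.base o) univ := by
    have h := hall.reindex (Equiv.sumComm _ _)
    convert h using 2 with o
    rcases o with i | i <;> rfl
  have h2 := h1.bandSurgery (Fin.last k) (Φ := d.finalBand) (A := d.base)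
    (B := d.loops (Fin.last k)) (by rw [union_comm]; exact hd.finalBand_bands)
    (fun i => (hd.finalBand_bands.1 i).2.2.1) (fun i => ?_) (fun i => subset_univ _)
  · convert h2 using 2 with j
    simp only [component]
    split_ifs with hj
    · rw [hj]
    · rfl
  · rintro _ ⟨x, hx, rfl⟩
    have hloop : d.finalBand i x ∈ d.loops (Fin.last k) i :=
      (hd.finalBand_bands.1 i).2.2.2 ⟨x, hx, rfl⟩
    have hrow : d.finalBand i x ∈ d.allRows :=
      ((hd.finalBand_bands.1 i).2.1.symm.subset (Or.inr hx)).2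
    rcases hrow with hb | hr
    · obtain ⟨i', hb⟩ := mem_iUnion.1 hb
      exact absurd hloop (disjoint_left.1 (hdis (Sum.inl i') i) hb)
    · obtain ⟨j, hr⟩ := mem_iUnion.1 hr
      rcases eq_or_ne j (Fin.last k) with rfl | hj
      · exact hr
      · have hj' : (j : ℕ) < k := Fin.val_lt_last hj
        exact absurd hloop (disjoint_left.1 (hdis (Sum.inr ⟨j, hj'⟩) i) hr)

end SwatchData

/-! ### Ribbon links in the three-sphere -/

/-- Ribbon disks in Euclidean space are ribbon disks in the three-sphere. -/
theorem BoundsRibbon.isRibbonLink {N : ℕ} {K : Fin N → Set E3} {W : Set E3}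
    (h : BoundsRibbon K W) : IsRibbonLink fun i => toSphere '' K i := by
  obtain ⟨D, ⟨h1, h2, κ, hκ, ⟨A⟩⟩, hK⟩ := h
  have hmd : ∀ i p v, mfderiv 𝓘(ℝ, ℂ) (𝓡 3) (fun z => toSphere (D i z)) p v =
      mfderiv 𝓘(ℝ, E3) (𝓡 3) toSphere (D i p) (fderiv ℝ (D i) p v) := by
    intro i p v
    have h3 : mfderiv 𝓘(ℝ, ℂ) (𝓡 3) (toSphere ∘ D i) p = _ :=
      mfderiv_comp p ((contMDiff_toSphere (D i p)).mdifferentiableAt (by simp))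
        ((h1 i).contMDiff.mdifferentiableAt (by simp))
    have h4 : mfderiv 𝓘(ℝ, ℂ) 𝓘(ℝ, E3) (D i) p = fderiv ℝ (D i) p := mfderiv_eq_fderiv
    rw [h4] at h3
    exact DFunLike.congr_fun h3 v
  -- the differential of `toSphere` at `x`, and the tangent planes of the disks in the sphere, with
  -- values in a fixed space to avoid dependent rewriting
  let T : E3 → E3 → EuclideanSpace ℝ (Fin 3) := fun x y => mfderiv 𝓘(ℝ, E3) (𝓡 3) toSphere x y
  let R : Fin N → ℂ → Submodule ℝ (EuclideanSpace ℝ (Fin 3)) := fun i p =>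
    (mfderiv 𝓘(ℝ, ℂ) (𝓡 3) (fun z => toSphere (D i z)) p).range
  have hR : ∀ i p y, y ∈ range (fderiv ℝ (D i) p) ↔ T (D i p) y ∈ R i p := by
    intro i p y
    constructor
    · rintro ⟨v, rfl⟩
      exact ⟨v, hmd i p v⟩
    · rintro ⟨v, hv⟩
      exact ⟨v, injective_mfderiv_toSphere _ ((hmd i p v).symm.trans hv)⟩
  obtain ⟨r, ⟨e⟩⟩ := Finite.exists_equiv_fin κ
  have hI : ∀ t : unitInterval, (t : ℝ) ∈ Icc (0 : ℝ) 1 := fun t => t.2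
  refine ⟨fun i z => toSphere (D i z), fun i => contMDiff_toSphere.comp (h1 i).contMDiff,
    fun i p hp => ?_, fun i => ?_, r, fun s => A.a (e.symm s), fun s => A.b (e.symm s),
    fun s t => A.α (e.symm s) t, fun s t => A.β (e.symm s) t, fun s => ⟨?_, ?_⟩,
    fun s t => A.α_mem _ t (hI t), fun s t => ⟨A.β_mem _ t (hI t), ?_⟩, ?_, fun s t => ⟨?_, ?_⟩, ?_⟩
  · intro v w hvw
    exact h2 i p hp (injective_mfderiv_toSphere _ ((hmd i p v).symm.trans (hvw.trans (hmd i p w))))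
  · simp only [← (hK i).1, image_image]
  · exact (A.α_smooth _).continuousOn.comp_continuous continuous_subtype_val hI
  · exact (A.β_smooth _).continuousOn.comp_continuous continuous_subtype_val hI
  · rw [A.β_sphere _ t (hI t)]
    simp only [Subtype.ext_iff, Icc.coe_zero, Icc.coe_one]
  · rintro (⟨s, t⟩ | ⟨s, t⟩) (⟨s', t'⟩ | ⟨s', t'⟩) hst
    · obtain ⟨h3, h4⟩ := Prod.mk.inj hst
      obtain ⟨h5, h6⟩ := A.α_inj _ _ t (hI t) t' (hI t') h3 h4
      have h7 : s = s' := e.symm.injective h5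
      rw [h7, Subtype.ext h6]
    · obtain ⟨h3, h4⟩ := Prod.mk.inj hst
      exact absurd h4 (A.αβ_ne _ _ t (hI t) t' (hI t') h3)
    · obtain ⟨h3, h4⟩ := Prod.mk.inj hst
      exact absurd h4.symm (A.αβ_ne _ _ t' (hI t') t (hI t) h3.symm)
    · obtain ⟨h3, h4⟩ := Prod.mk.inj hst
      obtain ⟨h5, h6⟩ := A.β_inj _ _ t (hI t) t' (hI t') h3 h4
      have h7 : s = s' := e.symm.injective h5
      rw [h7, Subtype.ext h6]
  · exact congrArg toSphere (A.double _ t (hI t))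
  -- transversality, since `toSphere` is an immersion
  · intro hrange
    refine A.transverse (e.symm s) t (hI t) ?_
    have h3 : R (A.a (e.symm s)) (A.α (e.symm s) t) = R (A.b (e.symm s)) (A.β (e.symm s) t) :=
      hrange
    ext y
    rw [hR, hR, h3, A.double _ t (hI t)]
  · intro i j p hp q hq hne hpq
    obtain ⟨s, t, ht, h⟩ := A.complete i j p hp q hq hne (toSphere_injective hpq)
    exact ⟨e s, ⟨t, ht⟩, by simpa using h⟩

theorem theorem1 {k : ℕ} (S : Fin (k + 1) → Set (ℝ × ℝ × unitInterval))
    (hS : IsWeftKnittedTextile S) :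
    IsRibbonLink (fun j => dehnFilling '' textileLink S j) := by
  obtain ⟨-, n, L, ⟨d, hd, -, rfl⟩, Ψ, hΨ⟩ := hS
  obtain ⟨F, hF, hFemb⟩ := Ψ.exists_extension fun p hp => hp
  convert (hd.boundsRibbon_component.perm hF).isRibbonLink using 2 with j
  rw [← hΨ j]
  simp only [image_image, hFemb, toSphere_torusEmb]
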